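/- Let $n\ge 1$, let $\Omega\subset\mathbb R^n$ be a bounded domain (open, connected, non-empty) with Lipschitz boundary, and let $Y=\,]0,1[^n$. For $\varepsilon>0$ put $$\widehat\Omega_{\varepsilon,3}=\{x:\operatorname{dist}(x,\partial\Omega)<3\sqrt n\,\varepsilon\},\qquad \widetilde\Omega_{\varepsilon,3}=\{x:\operatorname{dist}(x,\Omega)<3\sqrt n\,\varepsilon\}.$$ For $K\in\mathbb R$, call a continuous linear map $P:H^1(\Omega)\to H^1(\widetilde\Omega_{\varepsilon,3})$ a $K$-extension operator (for $\varepsilon$) if for all $\phi\in H^1(\Omega)$: $P\phi=\phi$ a.e. on $\Omega$, $$\|\nabla P\phi\|_{L^2(\widetilde\Omega_{\varepsilon,3})}\le K\|\nabla\phi\|_{L^2(\Omega)},\qquad \|\nabla P\phi\|_{L^2(\widetilde\Omega_{\varepsilon,3}\setminus\Omega)}\le K\|\nabla\phi\|_{L^2(\Omega\cap\widehat\Omega_{\varepsilon,3})},$$ and, if $\varepsilon\le1$, $\|P\phi\|_{L^2(\widetilde\Omega_{\varepsilon,3})}\le K\{\|\phi\|_{L^2(\Omega)}+\varepsilon\|\nabla\phi\|_{L^2(\Omega\cap\widehat\Omega_{\varepsilon,3})}\}$.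 For a function $w$ on $\widetilde\Omega_{\varepsilon,3}$ let $\mathcal T_\varepsilon(w)(x,y)=w(\varepsilon[x/\varepsilon]+\varepsilon y)$ for $x\in\Omega$, $y\in Y$, where $[\cdot]$ is the coordinatewise integer part. $H^1_{per}(Y;L^2(\Omega))$ is the space of $u\in H^1(Y;L^2(\Omega))$ whose $Y$-periodic extension to $\mathbb R^n$ is weakly differentiable with weak gradient the $Y$-periodic extension of $\nabla_y u$. A function $f\in L^2(\Omega)$ is identified with the element $\psi\mapsto\int_\Omega f\psi$ of the dual $(H^1(\Omega))'$. **Theorem 2.3.** (a) There is a constant $K$, depending only on $n$ and $\Omega$, such that for every $\varepsilon>0$ there is a $K$-extension operator. (b) For every $K$ there is a constant $C$, depending only on $n$, $\Omega$ and $K$, such that for every $\varepsilon>0$, every $K$-extension operator $P$ and every $\phi\in H^1(\Omega)$ there is $\widehat\phi_\varepsilon\in H^1_{per}(Y;L^2(\Omega))$ with $$\|\widehat\phi_\varepsilon\|_{H^1(Y;L^2(\Omega))}\le C\|\nabla\phi\|_{[L^2(\Omega)]^n},$$ and such that $\mathcal T_\varepsilon(\nabla P\phi)-\nabla\phi-\nabla_y\widehat\phi_\varepsilon$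 belongs to $[L^2(Y;(H^1(\Omega))')]^n$ and satisfies $$\|\mathcal T_\varepsilon(\nabla P\phi)-\nabla\phi-\nabla_y\widehat\phi_\varepsilon\|_{[L^2(Y;(H^1(\Omega))')]^n}\le C\varepsilon\|\nabla\phi\|_{[L^2(\Omega)]^n}+C\sqrt\varepsilon\,\|\nabla P\phi\|_{[L^2(\widehat\Omega_{\varepsilon,3})]^n}.$$ -/

import Mathlib

open MeasureTheory Set
open scoped ContDiff

noncomputable section

namespace Unfolding

/-- The Euclidean space `ℝⁿ`. -/
abbrev E (n : ℕ) := EuclideanSpace ℝ (Fin n)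

/-- The space `L²(D; X)`, for Lebesgue measure on `D ⊆ ℝⁿ`. -/
abbrev L2 {n : ℕ} (D : Set (E n)) (X : Type*) [NormedAddCommGroup X] :=
  Lp X 2 ((volume : Measure (E n)).restrict D)

/-! ### Lipschitz boundaries -/

/-- `Ω` has a Lipschitz boundary: near each boundary point there are a unit vector `e` (the
"vertical" direction) and a Lipschitz function `γ` on the hyperplane orthogonal to `e` such that
`Ω` is the set of points lying strictly above the graph of `γ`. -/
def HasLipschitzBoundary {n : ℕ} (Ω : Set (E n)) : Prop :=
  ∀ x₀ ∈ frontier Ω, ∃ e : E n, ‖e‖ = 1 ∧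
    ∃ (L : NNReal) (γ : (Submodule.span ℝ {e})ᗮ → ℝ), LipschitzWith L γ ∧
      ∃ U ∈ nhds x₀, ∀ x ∈ U,
        (x ∈ Ω ↔ γ ((Submodule.span ℝ {e})ᗮ.orthogonalProjectionOnto x) < inner ℝ e x)

/-! ### Sobolev spaces -/

section Sobolev

variable {n : ℕ} {X : Type*} [NormedAddCommGroup X] [NormedSpace ℝ X]

/-- The `i`-th partial derivative of a real function. -/
def pderiv (i : Fin n) (η : E n → ℝ) (x : E n) : ℝ :=
  fderiv ℝ η x (EuclideanSpace.single i 1)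

/-- `G = (G₁, …, Gₙ)` is the weak gradient of `u` on `D`. -/
def HasWeakGrad (D : Set (E n)) (u : E n → X) (G : Fin n → E n → X) : Prop :=
  ∀ η : E n → ℝ, ContDiff ℝ ∞ η → HasCompactSupport η → tsupport η ⊆ D →
    ∀ i, ∫ x in D, pderiv i η x • u x = - ∫ x in D, η x • G i x

theorem HasWeakGrad.congr {D : Set (E n)} {u v : E n → X} {G H : Fin n → E n → X}
    (h : HasWeakGrad D u G) (huv : v =ᵐ[volume.restrict D] u)
    (hGH : ∀ i, H i =ᵐ[volume.restrict D] G i) : HasWeakGrad D v H := by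
  intro η h1 h2 h3 i
  have e1 : ∫ x in D, pderiv i η x • v x = ∫ x in D, pderiv i η x • u x :=
    integral_congr_ae (by filter_upwards [huv] with x hx; rw [hx])
  have e2 : ∫ x in D, η x • H i x = ∫ x in D, η x • G i x :=
    integral_congr_ae (by filter_upwards [hGH i] with x hx; rw [hx])
  rw [e1, e2]
  exact h η h1 h2 h3 i

theorem integrable_test_smul {D : Set (E n)} {u : E n → X} (hu : MemLp u 2 (volume.restrict D))
    {η : E n → ℝ} (h1 : ContDiff ℝ ∞ η) (h2 : HasCompactSupport η) :
    Integrable (fun x => η x • u x) (volume.restrict D) :=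
  (hu.locallyIntegrable (by norm_num)).integrable_smul_left_of_hasCompactSupport h1.continuous h2

theorem integrable_pderiv_smul {D : Set (E n)} {u : E n → X} (hu : MemLp u 2 (volume.restrict D))
    {η : E n → ℝ} (h1 : ContDiff ℝ ∞ η) (h2 : HasCompactSupport η) (i : Fin n) :
    Integrable (fun x => pderiv i η x • u x) (volume.restrict D) := by
  refine (hu.locallyIntegrable (by norm_num)).integrable_smul_left_of_hasCompactSupport ?_ ?_
  · exact (h1.continuous_fderiv (by simp)).clm_apply continuous_const
  · exact (h2.fderiv (𝕜 := ℝ)).comp_left (g := fun T : E n →L[ℝ] ℝ => T (EuclideanSpace.single i 1))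
      (by simp)

theorem HasWeakGrad.add {D : Set (E n)} {u v : E n → X} {G H : Fin n → E n → X}
    (hu : MemLp u 2 (volume.restrict D)) (hv : MemLp v 2 (volume.restrict D))
    (hG : ∀ i, MemLp (G i) 2 (volume.restrict D)) (hH : ∀ i, MemLp (H i) 2 (volume.restrict D))
    (h : HasWeakGrad D u G) (h' : HasWeakGrad D v H) :
    HasWeakGrad D (fun x => u x + v x) (fun i x => G i x + H i x) := by
  intro η h1 h2 h3 i
  simp only [smul_add]
  rw [integral_add (integrable_pderiv_smul hu h1 h2 i) (integrable_pderiv_smul hv h1 h2 i),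
    integral_add (integrable_test_smul (hG i) h1 h2) (integrable_test_smul (hH i) h1 h2),
    h η h1 h2 h3 i, h' η h1 h2 h3 i, neg_add]

theorem HasWeakGrad.smul {D : Set (E n)} {u : E n → X} {G : Fin n → E n → X} (c : ℝ)
    (h : HasWeakGrad D u G) :
    HasWeakGrad D (fun x => c • u x) (fun i x => c • G i x) := by
  intro η h1 h2 h3 i
  simp only [smul_comm _ c]
  rw [integral_smul, integral_smul, h η h1 h2 h3 i, smul_neg]

/-- The Sobolev space `H¹(D; X)`: the pairs `(u, ∇u)` with `u ∈ L²(D; X)` and weak gradient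
`∇u ∈ L²(D; X)ⁿ`, with the norm `(‖u‖² + ∑ᵢ ‖∂ᵢu‖²)^(1/2)` inherited from the ambient space. -/
def H1 (D : Set (E n)) (X : Type*) [NormedAddCommGroup X] [NormedSpace ℝ X] :
    Submodule ℝ (WithLp 2 (L2 D X × PiLp 2 (fun _ : Fin n => L2 D X))) where
  carrier := {p | HasWeakGrad D (p.fst : E n → X) (fun i => (p.snd i : E n → X))}
  zero_mem' := by
    have h : HasWeakGrad D (fun _ => (0 : X)) (fun _ : Fin n => fun _ : E n => (0 : X)) := by
      intro η _ _ _ i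
      simp
    exact h.congr (Lp.coeFn_zero _ _ _) (fun i => Lp.coeFn_zero _ _ _)
  add_mem' := by
    intro p q hp hq
    refine (HasWeakGrad.add (Lp.memLp p.fst) (Lp.memLp q.fst) (fun i => Lp.memLp (p.snd i))
      (fun i => Lp.memLp (q.snd i)) hp hq).congr ?_ ?_
    · exact Lp.coeFn_add p.fst q.fst
    · exact fun i => Lp.coeFn_add (p.snd i) (q.snd i)
  smul_mem' := by
    intro c p hp
    refine (HasWeakGrad.smul c hp).congr ?_ ?_
    · exact Lp.coeFn_smul c p.fst
    · exact fun i => Lp.coeFn_smul c (p.snd i)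

/-- The underlying `L²` function of an element of `H¹`. -/
def fn {D : Set (E n)} (u : H1 D X) : L2 D X := u.1.fst

/-- The `i`-th weak partial derivative of an element of `H¹`. -/
def grad {D : Set (E n)} (u : H1 D X) (i : Fin n) : L2 D X := u.1.snd i

/-- The inclusion `H¹(D; X) → L²(D; X)`. -/
def fnL (D : Set (E n)) (X : Type*) [NormedAddCommGroup X] [NormedSpace ℝ X] :
    H1 D X →L[ℝ] L2 D X :=
  (WithLp.fstL 2 ℝ (L2 D X) (PiLp 2 (fun _ : Fin n => L2 D X))).comp (H1 D X).subtypeL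

/-- `‖∇u‖` in `[L²(S)]ⁿ` (to be used for subsets `S` of the domain `D` of `u`). -/
def gradNorm {D : Set (E n)} (u : H1 D ℝ) (S : Set (E n)) : ℝ :=
  Real.sqrt (∑ i, ∫ x in D ∩ S, (grad u i x) ^ 2)

end Sobolev

/-! ### The reference cell and periodicity -/

/-- The reference cell `Y = ]0,1[ⁿ`. -/
def cell (n : ℕ) : Set (E n) := {y | ∀ i, 0 < y i ∧ y i < 1}

/-- The integer part `[x]`, coordinate by coordinate. -/
def floorVec {n : ℕ} (x : E n) : E n := WithLp.toLp 2 (fun i => (⌊x i⌋ : ℝ))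

/-- The fractional part `{x} = x - [x]`. -/
def fractVec {n : ℕ} (x : E n) : E n := x - floorVec x

/-- `u ∈ H¹_per(Y; X)`: the `Y`-periodic extension of `u` to `ℝⁿ` is weakly differentiable on
`ℝⁿ`, its weak gradient being the `Y`-periodic extension of `∇u` (no jump across the faces). -/
def IsPeriodic {n : ℕ} {X : Type*} [NormedAddCommGroup X] [NormedSpace ℝ X]
    (u : H1 (cell n) X) : Prop :=
  HasWeakGrad univ (fun y => fn u (fractVec y)) (fun i y => grad u i (fractVec y))

/-! ### Neighbourhoods of `∂Ω` and of `Ω`, and extension operators -/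

/-- The two-sided boundary layer `{x | dist(x, ∂Ω) < k √n ε}`. -/
def bdryLayer {n : ℕ} (Ω : Set (E n)) (ε : ℝ) (k : ℕ) : Set (E n) :=
  Metric.thickening (k * Real.sqrt n * ε) (frontier Ω)

/-- The neighbourhood `{x | dist(x, Ω) < k √n ε}` of `Ω`. -/
def nbhd {n : ℕ} (Ω : Set (E n)) (ε : ℝ) (k : ℕ) : Set (E n) :=
  Metric.thickening (k * Real.sqrt n * ε) Ω

/-- `P` extends the functions of `H¹(Ω)` to the neighbourhood of width `3√n ε` of `Ω`, with the
gradient and (for `ε ≤ 1`) `L²` estimates below, with constant `K`. -/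
structure IsExtension {n : ℕ} (Ω : Set (E n)) (ε K : ℝ)
    (P : H1 Ω ℝ →L[ℝ] H1 (nbhd Ω ε 3) ℝ) : Prop where
  eq_on : ∀ φ, fn (P φ) =ᵐ[volume.restrict Ω] fn φ
  grad_le : ∀ φ, gradNorm (P φ) (nbhd Ω ε 3) ≤ K * gradNorm φ Ω
  grad_outside_le : ∀ φ,
    gradNorm (P φ) (nbhd Ω ε 3 \ Ω) ≤ K * gradNorm φ (Ω ∩ bdryLayer Ω ε 3)
  fn_le : ε ≤ 1 → ∀ φ, ‖fn (P φ)‖ ≤ K * (‖fn φ‖ + ε * gradNorm φ (Ω ∩ bdryLayer Ω ε 3))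

/-! ### The unfolding operator -/

/-- The unfolding operator: `T_ε(w)(x, y) = w(ε[x/ε] + εy)`. -/
def unfold {n : ℕ} (ε : ℝ) (w : E n → ℝ) (x y : E n) : ℝ :=
  w (ε • floorVec (ε⁻¹ • x) + ε • y)

theorem unfold_memLp {n : ℕ} {Ω : Set (E n)} (hΩ : Bornology.IsBounded Ω) (ε : ℝ)
    (w : E n → ℝ) (y : E n) :
    MemLp (fun x => unfold ε w x y) 2 ((volume : Measure (E n)).restrict Ω) := by
  obtain ⟨R, hR⟩ := hΩ.subset_closedBall 0
  have hsub : (volume : Measure (E n)).restrict Ω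
      ≤ (volume : Measure (E n)).restrict (Metric.closedBall 0 R) := Measure.restrict_mono hR le_rfl
  refine MemLp.mono_measure hsub ?_
  let fl : E n → (Fin n → ℤ) := fun x i => ⌊(ε⁻¹ • x) i⌋
  let g : (Fin n → ℤ) → ℝ := fun k => w (ε • WithLp.toLp 2 (fun i => (k i : ℝ)) + ε • y)
  have hfl : Measurable fl := by
    refine measurable_pi_lambda _ fun i => Int.measurable_floor.comp ?_
    exact (by fun_prop : Continuous fun x : E n => (ε⁻¹ • x) i).measurable
  have hg : (fun x => unfold ε w x y) = g ∘ fl := rfl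
  have hfin : (fl '' Metric.closedBall 0 R).Finite := by
    refine (Set.Finite.pi' (t := fun _ : Fin n => Icc (-⌈|ε⁻¹| * R⌉ - 1) (⌈|ε⁻¹| * R⌉))
      (fun _ => Set.finite_Icc _ _)).subset ?_
    rintro _ ⟨x, hx, rfl⟩ i
    have h1 : |x i| ≤ R := by
      have := (PiLp.norm_apply_le x i).trans (mem_closedBall_zero_iff.1 hx)
      simpa using this
    have h2 : |(ε⁻¹ • x) i| ≤ |ε⁻¹| * R := by
      simp only [PiLp.smul_apply, smul_eq_mul, abs_mul]
      exact mul_le_mul_of_nonneg_left h1 (abs_nonneg _)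
    have h3 := abs_le.1 (h2.trans (Int.le_ceil _))
    refine ⟨?_, ?_⟩
    · refine (sub_le_self _ zero_le_one).trans (Int.le_floor.2 ?_)
      push_cast
      exact h3.1
    · exact Int.cast_le.1 ((Int.floor_le _).trans h3.2)
  obtain ⟨M, hM⟩ := (hfin.image (fun k => ‖g k‖)).bddAbove
  have : IsFiniteMeasure ((volume : Measure (E n)).restrict (Metric.closedBall 0 R)) :=
    ⟨by simpa using measure_closedBall_lt_top⟩
  rw [hg]
  refine MemLp.of_bound ((measurable_of_countable g).comp hfl).aestronglyMeasurable M ?_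
  refine ae_restrict_of_forall_mem measurableSet_closedBall fun x hx => ?_
  exact hM (mem_image_of_mem _ (mem_image_of_mem _ hx))

/-- The slice `T_ε(w)(·, y)` as an element of `L²(Ω)`. -/
def unfoldSlice {n : ℕ} {Ω : Set (E n)} (hΩ : Bornology.IsBounded Ω) (ε : ℝ) (w : E n → ℝ)
    (y : E n) : L2 Ω ℝ :=
  (unfold_memLp hΩ ε w y).toLp _

/-- The embedding of `L²(Ω)` into the dual space `(H¹(Ω))'`: `⟨f, ψ⟩ = ∫_Ω f ψ`. -/
def toDual {n : ℕ} {Ω : Set (E n)} (f : L2 Ω ℝ) : StrongDual ℝ (H1 Ω ℝ) :=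
  (innerSL ℝ f).comp (fnL Ω ℝ)

/-- The function `y ↦ T_ε(∇φ)(·, y) - ∇φ - ∇_y φ̂(·, y)`, with values in `[(H¹(Ω))']ⁿ`. Here `φ'`
is the extension of `φ` to which the unfolding operator is applied. -/
def gradDefect {n : ℕ} {Ω : Set (E n)} (hΩ : Bornology.IsBounded Ω) (ε : ℝ)
    (φ : H1 Ω ℝ) (φ' : H1 (nbhd Ω ε 3) ℝ) (φhat : H1 (cell n) (L2 Ω ℝ)) (y : E n) :
    PiLp 2 (fun _ : Fin n => StrongDual ℝ (H1 Ω ℝ)) :=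
  WithLp.toLp 2 fun i =>
    toDual (unfoldSlice hΩ ε (grad φ' i) y - grad φ i - grad φhat i y)

end Unfolding

end

noncomputable section

namespace Unfolding

/-! ### `L²` norms over subsets, squared norms and their comparison. -/

section

open Filter Topology
open scoped ENNReal

/-! Part (b). Write u = Pφ. Since ε⁻¹T_ε(u) has y-gradient T_ε(∇u), the function w(y) =
ε⁻¹(T_ε(u)(·,y) − φ) − y·∇φ has y-gradient T_ε(∇u) − ∇φ. It would be the corrector if it were
periodic. It is almost periodic: T_ε(u)(x, y − k) = T_ε(u)(x − εk, y) for k in ℤⁿ, so a lattice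
shift of y is a translation of x of length O(ε), which is small in the dual of H¹(Ω) even for
functions that are merely L². The corrector is therefore the sum over k of the translates of βw,
where β is a bump function supported in [-1,1]ⁿ whose integer translates sum to 1. Because Σβ(y − k)
= 1 and Σ∇β(y − k) = 0, the defect is a combination, with bounded coefficients, of T_ε(∇u)(y) −
T_ε(∇u)(y − k) and of w(y − k) − w(y) (`sum_correctorGrad`). The first is a translation increment.
The second is ε⁻¹ times the sum of a translation increment of T_ε(u) − u, whose L² norm is O(ε) by
the Poincaré inequality on cells, and of a first-order Taylor remainder of u, itself a mean of
translation increments of εk·∇u (`UnfoldingData.dualLe_osc`).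

Everything thus rests on one dual estimate (`exists_translate_dual_le`): for |v| < t, the pairing of
g(· + v) − g with ψ in H¹(Ω) is O(t‖g‖ + √t‖g‖_layer)‖ψ‖. The change of variables puts the
translation on an extension of ψ, where it costs O(t), and leaves integrals of gψ over the symmetric
difference of Ω and its translate. That set lies in the layer of width t around ∂Ω, where the L²
norm of ψ is O(√t)‖ψ‖ (`exists_layer_le`, a trace inequality). This is the origin of the √ε term.

Part (a). Near ∂Ω a Lipschitz domain contains cones attached to its points; averaging their axes
gives a Lipschitz field N transversal to ∂Ω, and the time σ(x) needed to reach Ω along N is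
Lipschitz and bounded by a multiple of dist(x, Ω). For x outside Ω the extension of f at x is a
weighted mean of f over a ball inside Ω, beyond the hitting point x + σN, of radius proportional to
σ. A parameter δ > 0 added to the radius makes the formula meaningful on all of a neighbourhood of
Ω, where on Ω it is a mean at scale δ; the operators are bounded uniformly in δ by a Schur test
(`exists_schur`), the gradient is controlled because both kernels in a difference of means have mass
1 and a constant may be subtracted (`exists_wavg_sub_sq_le`), and δ → 0 gives an operator that is
the identity on Ω. The balls used for points at distance less than s from Ω stay in a layer of width
s, which yields the estimate of the outer gradient.

This settles small ε. For wide neighbourhoods the local extension has to be cut off without its L²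
norm entering the gradient bound. Constants are subtracted near ∂Ω, one for each connected cluster
of a finite cover of ∂Ω by balls; the resulting function is locally constant near ∂Ω, and its
gradient restricted to Ω and continued by zero is a closed form on ℝⁿ. A primitive of this form
(`exists_potential`) coincides on the connected set Ω with the subtracted function and has zero
gradient outside, so that adding it back costs nothing there (`exists_large_extension`). -/

/-- The `L²(S)` norm of a function, as a real number. -/
def nrm {n : ℕ} {X : Type*} [NormedAddCommGroup X] (S : Set (E n)) (w : E n → X) : ℝ :=
  (eLpNorm w 2 (volume.restrict S)).toReal

/-- The square of the `L²(S)` norm of a function, as an extended real number. -/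
def sq {n : ℕ} {X : Type*} [NormedAddCommGroup X] (S : Set (E n)) (w : E n → X) : ℝ≥0∞ :=
  ∫⁻ x in S, ‖w x‖ₑ ^ 2

/-- `w ∈ L²(S)`. -/
abbrev SqInt {n : ℕ} {X : Type*} [NormedAddCommGroup X] (S : Set (E n)) (w : E n → X) : Prop :=
  MemLp w 2 (volume.restrict S)

section Norms

variable {n : ℕ} {X : Type*} [NormedAddCommGroup X] {S T : Set (E n)} {w w' : E n → X}

theorem eLpNorm_sq_eq {α : Type*} [MeasurableSpace α] (μ : Measure α) (w : α → X) :
    eLpNorm w 2 μ ^ 2 = ∫⁻ x, ‖w x‖ₑ ^ 2 ∂μ := by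
  have := eLpNorm_nnreal_pow_eq_lintegral (f := w) (μ := μ) (p := 2) (by norm_num)
  simpa using this

theorem sq_eq (S : Set (E n)) (w : E n → X) : sq S w = eLpNorm w 2 (volume.restrict S) ^ 2 :=
  (eLpNorm_sq_eq _ _).symm

theorem nrm_sq (S : Set (E n)) (w : E n → X) : nrm S w ^ 2 = (sq S w).toReal := by
  rw [sq_eq, nrm, ENNReal.toReal_pow]

theorem nrm_nonneg (S : Set (E n)) (w : E n → X) : 0 ≤ nrm S w := ENNReal.toReal_nonneg

theorem sq_lt_top (h : SqInt S w) : sq S w < ⊤ := by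
  rw [sq_eq]; exact ENNReal.pow_lt_top h.2

theorem sq_eq_ofReal (h : SqInt S w) : sq S w = ENNReal.ofReal (nrm S w ^ 2) := by
  rw [nrm_sq, ENNReal.ofReal_toReal (sq_lt_top h).ne]

theorem sqInt_of_sq_lt_top (hm : AEStronglyMeasurable w (volume.restrict S)) (h : sq S w < ⊤) :
    SqInt S w := by
  refine ⟨hm, ?_⟩
  rw [sq_eq] at h
  by_contra hc
  rw [not_lt, top_le_iff] at hc
  simp [hc] at h

theorem nrm_le_of_sq_le {c : ℝ} (hc : 0 ≤ c) (h : sq S w ≤ ENNReal.ofReal (c ^ 2)) :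
    nrm S w ≤ c := by
  refine (pow_le_pow_iff_left₀ (nrm_nonneg _ _) hc two_ne_zero).1 ?_
  rw [nrm_sq]
  exact ENNReal.toReal_le_of_le_ofReal (sq_nonneg c) h

theorem sq_mono (h : S ⊆ T) (w : E n → X) : sq S w ≤ sq T w :=
  lintegral_mono_set h

theorem SqInt.mono (h : SqInt T w) (hS : S ⊆ T) : SqInt S w :=
  h.mono_measure (Measure.restrict_mono hS le_rfl)

theorem nrm_mono (h : SqInt T w) (hS : S ⊆ T) : nrm S w ≤ nrm T w :=
  ENNReal.toReal_mono h.2.ne (eLpNorm_mono_measure _ (Measure.restrict_mono hS le_rfl))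

theorem nrm_congr (h : w =ᵐ[volume.restrict S] w') : nrm S w = nrm S w' := by
  rw [nrm, eLpNorm_congr_ae h, nrm]

theorem nrm_add_le (h : SqInt S w) (h' : SqInt S w') :
    nrm S (fun x => w x + w' x) ≤ nrm S w + nrm S w' := by
  rw [nrm, nrm, nrm, ← ENNReal.toReal_add h.2.ne h'.2.ne]
  exact ENNReal.toReal_mono (ENNReal.add_ne_top.2 ⟨h.2.ne, h'.2.ne⟩)
    (eLpNorm_add_le h.1 h'.1 (by norm_num))

theorem nrm_sub_le (h : SqInt S w) (h' : SqInt S w') :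
    nrm S (fun x => w x - w' x) ≤ nrm S w + nrm S w' := by
  rw [nrm, nrm, nrm, ← ENNReal.toReal_add h.2.ne h'.2.ne]
  exact ENNReal.toReal_mono (ENNReal.add_ne_top.2 ⟨h.2.ne, h'.2.ne⟩)
    (eLpNorm_sub_le h.1 h'.1 (by norm_num))

theorem nrm_sum_le {ι : Type*} (s : Finset ι) {w : ι → E n → X} (h : ∀ i ∈ s, SqInt S (w i)) :
    nrm S (fun x => ∑ i ∈ s, w i x) ≤ ∑ i ∈ s, nrm S (w i) := by
  classical
  induction s using Finset.induction_on with
  | empty => simp [nrm]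
  | insert a s ha ih =>
    simp only [Finset.sum_insert ha]
    refine (nrm_add_le (h a (Finset.mem_insert_self _ _))
      (memLp_finsetSum s fun i hi => h i (Finset.mem_insert_of_mem hi))).trans ?_
    gcongr
    exact ih fun i hi => h i (Finset.mem_insert_of_mem hi)

theorem nrm_le_of_bound {Z : Type*} [NormedAddCommGroup Z] {w : E n → X} {g : E n → Z}
    {c : ℝ} (hc : 0 ≤ c) (hg : SqInt S g) (h : ∀ᵐ x ∂(volume.restrict S), ‖w x‖ ≤ c * ‖g x‖) :
    nrm S w ≤ c * nrm S g := by
  have := eLpNorm_le_mul_eLpNorm_of_ae_le_mul h 2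
  rw [nrm, nrm, ← ENNReal.toReal_ofReal hc, ← ENNReal.toReal_mul]
  exact ENNReal.toReal_mono (ENNReal.mul_ne_top ENNReal.ofReal_ne_top hg.2.ne) this

theorem norm_toLp_eq (h : SqInt S w) : ‖(h.toLp w : L2 S X)‖ = nrm S w := Lp.norm_toLp _ _

theorem norm_eq_nrm (w : L2 S X) : ‖w‖ = nrm S w := rfl

theorem nrm_const_smul [NormedSpace ℝ X] (c : ℝ) (w : E n → X) :
    nrm S (fun x => c • w x) = |c| * nrm S w := by
  have : eLpNorm (fun x => c • w x) 2 (volume.restrict S)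
      = ‖c‖ₑ * eLpNorm w 2 (volume.restrict S) := eLpNorm_const_smul c w 2 _
  rw [nrm, nrm, this, ENNReal.toReal_mul, toReal_enorm, Real.norm_eq_abs]

end Norms

/-! ### Density of test functions and estimates by duality. -/

section Scalar

variable {n : ℕ} {S : Set (E n)} {f g : E n → ℝ}

theorem integral_mul_eq_inner (hf : SqInt S f) (hg : SqInt S g) :
    ∫ x in S, f x * g x = inner ℝ (hf.toLp f : L2 S ℝ) (hg.toLp g) := by
  rw [L2.inner_def]
  refine integral_congr_ae ?_
  filter_upwards [hf.coeFn_toLp, hg.coeFn_toLp] with x h1 h2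
  simp [h1, h2, mul_comm]

theorem abs_integral_mul_le (hf : SqInt S f) (hg : SqInt S g) :
    |∫ x in S, f x * g x| ≤ nrm S f * nrm S g := by
  rw [integral_mul_eq_inner hf hg, ← norm_toLp_eq hf, ← norm_toLp_eq hg]
  exact abs_real_inner_le_norm _ _

theorem integrable_mul_of_sqInt (hf : SqInt S f) (hg : SqInt S g) :
    Integrable (fun x => f x * g x) (volume.restrict S) :=
  MemLp.integrable_mul (p := 2) (q := 2) hf hg

theorem nrm_sq_eq_integral (hf : SqInt S f) : nrm S f ^ 2 = ∫ x in S, f x ^ 2 := by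
  rw [← norm_toLp_eq hf, ← real_inner_self_eq_norm_sq, ← integral_mul_eq_inner hf hf]
  simp [pow_two]

/-- A smooth function with compact support in `A`. -/
structure IsTest (A : Set (E n)) (η : E n → ℝ) : Prop where
  smooth : ContDiff ℝ ∞ η
  compact : HasCompactSupport η
  subset : tsupport η ⊆ A

theorem IsTest.mono {A B : Set (E n)} {η : E n → ℝ} (h : IsTest A η) (hAB : A ⊆ B) : IsTest B η :=
  ⟨h.1, h.2, h.3.trans hAB⟩

theorem IsTest.sqInt {A : Set (E n)} {η : E n → ℝ} (h : IsTest A η) (S : Set (E n)) :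
    SqInt S η :=
  (h.smooth.continuous.memLp_of_hasCompactSupport h.compact).mono_measure Measure.restrict_le_self

theorem IsTest.zero_of_notMem {A : Set (E n)} {η : E n → ℝ} (h : IsTest A η) {x : E n}
    (hx : x ∉ A) : η x = 0 :=
  image_eq_zero_of_notMem_tsupport fun h' => hx (h.subset h')

theorem IsTest.add {A : Set (E n)} {η ζ : E n → ℝ} (h : IsTest A η) (h' : IsTest A ζ) :
    IsTest A (η + ζ) :=
  ⟨h.1.add h'.1, h.2.add h'.2, (tsupport_add _ _).trans (union_subset h.3 h'.3)⟩

theorem IsTest.smul {A : Set (E n)} {η : E n → ℝ} (c : ℝ) (h : IsTest A η) :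
    IsTest A (c • η) :=
  ⟨h.1.const_smul c, h.2.smul_left (f := fun _ => c), (tsupport_smul_subset_right (fun _ => c) η).trans h.3⟩

/-- The space of test functions. -/
def tests (A : Set (E n)) : Submodule ℝ (E n → ℝ) where
  carrier := {η | IsTest A η}
  zero_mem' := ⟨contDiff_const, HasCompactSupport.zero, by simp [tsupport]⟩
  add_mem' h h' := h.add h'
  smul_mem' c _ h := h.smul c

/-- A test function as an element of `L²`. -/
def testsToL2 (A : Set (E n)) : tests A →ₗ[ℝ] L2 A ℝ where
  toFun η := (η.2.sqInt A).toLp η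
  map_add' _ _ := rfl
  map_smul' _ _ := rfl

/-- An `L²` function orthogonal to every test function vanishes almost everywhere on the open set,
by the fundamental lemma of the calculus of variations; so the orthogonal complement is trivial. -/
theorem dense_tests {A : Set (E n)} (hA : IsOpen A) :
    (LinearMap.range (testsToL2 A)).topologicalClosure = ⊤ := by
  rw [Submodule.topologicalClosure_eq_top_iff, Submodule.eq_bot_iff]
  intro f hf
  rw [Lp.eq_zero_iff_ae_eq_zero]
  have hloc : LocallyIntegrableOn f A volume :=
    locallyIntegrableOn_of_locallyIntegrable_restrict
      ((Lp.memLp f).locallyIntegrable (by norm_num))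
  have := hA.ae_eq_zero_of_integral_contDiff_smul_eq_zero hloc fun g h1 h2 h3 => by
    have hg : IsTest A g := ⟨h1, h2, h3⟩
    have := hf _ ⟨⟨g, hg⟩, rfl⟩
    rw [L2.inner_def] at this
    rw [← setIntegral_eq_integral_of_forall_compl_eq_zero (s := A)
      (fun x hx => by simp [hg.zero_of_notMem hx]), ← this]
    refine integral_congr_ae ?_
    filter_upwards [(hg.sqInt A).coeFn_toLp] with x hx
    change _ = inner ℝ ((hg.sqInt A).toLp g x) (f x)
    simp [hx, mul_comm]
  filter_upwards [(ae_restrict_iff' hA.measurableSet).2 this] with x hx using hx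

theorem exists_test_near {A : Set (E n)} (hA : IsOpen A) (hf : SqInt A f) {δ : ℝ} (hδ : 0 < δ) :
    ∃ η, IsTest A η ∧ nrm A (fun x => f x - η x) ≤ δ := by
  have : (hf.toLp f : L2 A ℝ) ∈ closure (LinearMap.range (testsToL2 A) : Set (L2 A ℝ)) := by
    rw [← Submodule.topologicalClosure_coe, dense_tests hA]; trivial
  obtain ⟨_, ⟨η, rfl⟩, h⟩ := Metric.mem_closure_iff.1 this δ hδ
  refine ⟨η, η.2, ?_⟩
  rw [dist_eq_norm] at h
  have h2 : (hf.toLp f : L2 A ℝ) - testsToL2 A η = (hf.sub (η.2.sqInt A)).toLp _ := rfl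
  rw [h2, norm_toLp_eq] at h
  exact h.le

/-- The bound extends by density from test functions to all of `L²`, and pairing f with itself gives
‖f‖² ≤ c‖f‖. Weak gradients are estimated in this way throughout, from integrals against derivatives
of test functions. -/
theorem nrm_le_of_test_bound {A : Set (E n)} (hA : IsOpen A) (hf : SqInt A f) {c : ℝ}
    (hc : 0 ≤ c)
    (h : ∀ η, IsTest A η → |∫ x in A, η x * f x| ≤ c * nrm A η) : nrm A f ≤ c := by
  have key : ∀ w : L2 A ℝ, |inner ℝ w (hf.toLp f)| ≤ c * ‖w‖ := by
    intro w
    have hcl : IsClosed {w : L2 A ℝ | |inner ℝ w (hf.toLp f : L2 A ℝ)| ≤ c * ‖w‖} :=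
      isClosed_le (by fun_prop) (by fun_prop)
    have hsub : (LinearMap.range (testsToL2 A) : Set (L2 A ℝ)) ⊆
        {w : L2 A ℝ | |inner ℝ w (hf.toLp f : L2 A ℝ)| ≤ c * ‖w‖} := by
      rintro _ ⟨η, rfl⟩
      have := h η η.2
      rw [integral_mul_eq_inner (η.2.sqInt A) hf, ← norm_toLp_eq (η.2.sqInt A)] at this
      exact this
    refine closure_minimal hsub hcl ?_
    rw [← Submodule.topologicalClosure_coe, dense_tests hA]; trivial
  have h1 := key (hf.toLp f)
  rw [real_inner_self_eq_norm_sq, abs_of_nonneg (sq_nonneg _), norm_toLp_eq hf] at h1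
  by_contra hlt
  push Not at hlt
  nlinarith

end Scalar

/-- The bound makes Λ vanish on the kernel of ι, so Λ descends to a bounded functional on the range
of ι; Hahn–Banach extends it to H and Riesz represents it. The form with a map ι spares identifying
test functions with their classes. -/
theorem exists_inner_eq {V H : Type*} [AddCommGroup V] [Module ℝ V] [NormedAddCommGroup H]
    [InnerProductSpace ℝ H] [CompleteSpace H] (ι : V →ₗ[ℝ] H) (Λ : V →ₗ[ℝ] ℝ) (C : ℝ)
    (h : ∀ v, |Λ v| ≤ C * ‖ι v‖) : ∃ g : H, ∀ v, Λ v = inner ℝ g (ι v) := by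
  have hker : Λ ∈ LinearMap.range ι.dualMap := by
    rw [LinearMap.range_dualMap_eq_dualAnnihilator_ker, Submodule.mem_dualAnnihilator]
    intro w hw
    have := h w
    rw [LinearMap.mem_ker.1 hw] at this
    simpa using this
  obtain ⟨f, hf⟩ := hker
  have hf' : ∀ v, f (ι v) = Λ v := fun v => by rw [← hf]; rfl
  let f₁ : StrongDual ℝ (LinearMap.range ι) :=
    (f.domRestrict (LinearMap.range ι)).mkContinuous C (by
      rintro ⟨_, v, rfl⟩
      simpa [hf'] using h v)
  obtain ⟨f₂, hf₂, -⟩ := exists_extension_norm_eq (LinearMap.range ι) f₁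
  refine ⟨(InnerProductSpace.toDual ℝ H).symm f₂, fun v => ?_⟩
  rw [InnerProductSpace.toDual_symm_apply, ← hf']
  exact (hf₂ ⟨ι v, v, rfl⟩).symm

end

/-! ### Sobolev functions, their weak gradients, and the elements of `H1`. -/

section

open Filter Topology

section SobolevFunctions

variable {n : ℕ} {X : Type*} [NormedAddCommGroup X] [NormedSpace ℝ X]

/-- `u ∈ H¹(D; X)` with weak gradient `G`, at the level of functions. -/
structure SobolevOn (D : Set (E n)) (u : E n → X) (G : Fin n → E n → X) : Prop where
  sqInt : SqInt D u
  sqInt_grad : ∀ i, SqInt D (G i)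
  weak : HasWeakGrad D u G

variable {D D' : Set (E n)} {u v : E n → X} {G H : Fin n → E n → X}

theorem IsTest.pderiv_zero_of_notMem {A : Set (E n)} {η : E n → ℝ} (h : IsTest A η) (i : Fin n)
    {x : E n} (hx : x ∉ A) : pderiv i η x = 0 := by
  have : fderiv ℝ η x = 0 :=
    image_eq_zero_of_notMem_tsupport fun h' => hx (h.subset (tsupport_fderiv_subset ℝ h'))
  simp [pderiv, this]

theorem IsTest.contDiff_pderiv {A : Set (E n)} {η : E n → ℝ} (h : IsTest A η) (i : Fin n) :
    ContDiff ℝ ∞ (pderiv i η) :=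
  (h.smooth.fderiv_right (m := ∞) (by simp)).clm_apply contDiff_const

theorem IsTest.pderiv {A : Set (E n)} {η : E n → ℝ} (h : IsTest A η) (i : Fin n) :
    IsTest A (pderiv i η) := by
  have hsub : tsupport (Unfolding.pderiv i η) ⊆ tsupport η := by
    refine closure_minimal (fun x hx => ?_) (isClosed_tsupport η)
    by_contra hc
    exact hx (IsTest.pderiv_zero_of_notMem ⟨h.1, h.2, subset_rfl⟩ i hc)
  exact ⟨h.contDiff_pderiv i, h.compact.of_isClosed_subset (isClosed_tsupport _) hsub,
    hsub.trans h.subset⟩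

theorem IsTest.setIntegral_smul {A : Set (E n)} {η : E n → ℝ} (h : IsTest A η) (w : E n → X) :
    ∫ x in A, η x • w x = ∫ x, η x • w x :=
  setIntegral_eq_integral_of_forall_compl_eq_zero fun x hx => by simp [h.zero_of_notMem hx]

theorem IsTest.setIntegral_smul_of_subset {A B : Set (E n)} {η : E n → ℝ} (h : IsTest A η)
    (hAB : A ⊆ B) (w : E n → X) : ∫ x in B, η x • w x = ∫ x in A, η x • w x := by
  rw [h.setIntegral_smul, (h.mono hAB).setIntegral_smul]

theorem HasWeakGrad.mono (h : HasWeakGrad D u G) (hD : D' ⊆ D) : HasWeakGrad D' u G := by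
  intro η h1 h2 h3 i
  have hη : IsTest D' η := ⟨h1, h2, h3⟩
  rw [← (hη.pderiv i).setIntegral_smul_of_subset hD, ← hη.setIntegral_smul_of_subset hD]
  exact h η h1 h2 (h3.trans hD) i

theorem SobolevOn.mono (h : SobolevOn D u G) (hD : D' ⊆ D) : SobolevOn D' u G :=
  ⟨h.sqInt.mono hD, fun i => (h.sqInt_grad i).mono hD, h.weak.mono hD⟩

theorem SobolevOn.congr (h : SobolevOn D u G) (hu : v =ᵐ[volume.restrict D] u)
    (hG : ∀ i, H i =ᵐ[volume.restrict D] G i) : SobolevOn D v H :=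
  ⟨(memLp_congr_ae hu).2 h.sqInt, fun i => (memLp_congr_ae (hG i)).2 (h.sqInt_grad i),
    h.weak.congr hu hG⟩

theorem SobolevOn.add (h : SobolevOn D u G) (h' : SobolevOn D v H) :
    SobolevOn D (fun x => u x + v x) (fun i x => G i x + H i x) :=
  ⟨h.sqInt.add h'.sqInt, fun i => (h.sqInt_grad i).add (h'.sqInt_grad i),
    HasWeakGrad.add h.sqInt h'.sqInt h.sqInt_grad h'.sqInt_grad h.weak h'.weak⟩

theorem SobolevOn.const_smul (c : ℝ) (h : SobolevOn D u G) :
    SobolevOn D (fun x => c • u x) (fun i x => c • G i x) :=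
  ⟨h.sqInt.const_smul c, fun i => (h.sqInt_grad i).const_smul c, HasWeakGrad.smul c h.weak⟩

theorem SobolevOn.sub (h : SobolevOn D u G) (h' : SobolevOn D v H) :
    SobolevOn D (fun x => u x - v x) (fun i x => G i x - H i x) := by
  have := h.add (h'.const_smul (-1))
  simpa [sub_eq_add_neg] using this

theorem SobolevOn.zero : SobolevOn D (fun _ => (0 : X)) (fun _ _ => 0) :=
  ⟨MemLp.zero, fun _ => MemLp.zero, fun η _ _ _ i => by simp⟩

theorem SobolevOn.sum {ι : Type*} (s : Finset ι) {u : ι → E n → X} {G : ι → Fin n → E n → X}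
    (h : ∀ j ∈ s, SobolevOn D (u j) (G j)) :
    SobolevOn D (fun x => ∑ j ∈ s, u j x) (fun i x => ∑ j ∈ s, G j i x) := by
  classical
  induction s using Finset.induction_on with
  | empty => simpa using SobolevOn.zero
  | insert a s ha ih =>
    simp only [Finset.sum_insert ha]
    exact (h a (Finset.mem_insert_self _ _)).add (ih fun j hj => h j (Finset.mem_insert_of_mem hj))

/-- The `L²(Ω)`-valued functions needed for the corrector are finite sums of such products, so their
weak differentiability reduces to that of scalar functions. -/
theorem SobolevOn.smul_vec {α : E n → ℝ} {A : Fin n → E n → ℝ} (h : SobolevOn D α A)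
    [CompleteSpace X] (x₀ : X) :
    SobolevOn D (fun x => α x • x₀) (fun i x => A i x • x₀) := by
  have key : ∀ w : E n → ℝ, SqInt D w → SqInt D (fun x => w x • x₀) := fun w hw =>
    hw.of_le_mul (c := ‖x₀‖) (hw.1.smul_const x₀) (.of_forall fun x => by
      rw [norm_smul, mul_comm])
  refine ⟨key _ h.sqInt, fun i => key _ (h.sqInt_grad i), fun η h1 h2 h3 i => ?_⟩
  have := h.weak η h1 h2 h3 i
  simp only [← smul_assoc, ← integral_neg] at this ⊢
  rw [integral_smul_const, integral_neg, integral_smul_const, ← neg_smul, this, integral_neg]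

theorem fderiv_eq_sum (η : E n → ℝ) (x v : E n) :
    fderiv ℝ η x v = ∑ i, v i * pderiv i η x := by
  conv_lhs => rw [← (EuclideanSpace.basisFun (Fin n) ℝ).sum_repr v]
  simp [pderiv]

/-- The coordinates `G₁(x), …, Gₙ(x)` as a vector. -/
def vec (G : Fin n → E n → ℝ) (x : E n) : E n := WithLp.toLp 2 fun i => G i x

theorem inner_vec (G : Fin n → E n → ℝ) (v x : E n) :
    inner ℝ v (vec G x) = ∑ i, v i * G i x := by
  simp [PiLp.inner_apply, vec, mul_comm]

theorem sqInt_vec {G : Fin n → E n → ℝ} {S : Set (E n)} :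
    SqInt S (vec G) ↔ ∀ i, SqInt S (G i) := by
  constructor
  · intro h i
    refine h.of_le (g := vec G) ?_ (.of_forall fun x => PiLp.norm_apply_le (vec G x) i)
    exact (continuous_apply i |>.comp (PiLp.continuous_ofLp 2 _)).comp_aestronglyMeasurable h.1
  · intro h
    have h1 : AEStronglyMeasurable (vec G) (volume.restrict S) :=
      (PiLp.continuous_toLp 2 _).comp_aestronglyMeasurable
        (aemeasurable_pi_iff.2 fun i => (h i).1.aemeasurable).aestronglyMeasurable
    have h2 : SqInt S (fun x => ∑ i, ‖G i x‖) := memLp_finsetSum _ fun i _ => (h i).norm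
    refine h2.of_le h1 (.of_forall fun x => ?_)
    have h3 : vec G x = ∑ i, EuclideanSpace.single i (G i x) := by
      ext j; simp [vec, Finset.sum_apply]
    rw [h3, Real.norm_of_nonneg (Finset.sum_nonneg fun i _ => norm_nonneg _)]
    exact (norm_sum_le _ _).trans (by simp)

theorem enorm_vec_sq (G : Fin n → E n → ℝ) (x : E n) :
    ‖vec G x‖ₑ ^ 2 = ∑ i, ‖G i x‖ₑ ^ 2 := by
  have h : ‖vec G x‖ ^ 2 = ∑ i, ‖G i x‖ ^ 2 := by
    rw [EuclideanSpace.norm_sq_eq]; rfl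
  simp only [← ofReal_norm]
  rw [← ENNReal.ofReal_pow (norm_nonneg _), h, ENNReal.ofReal_sum_of_nonneg fun i _ => by positivity]
  exact Finset.sum_congr rfl fun i _ => ENNReal.ofReal_pow (norm_nonneg _) 2

theorem sq_vec {G : Fin n → E n → ℝ} {S : Set (E n)} (h : ∀ i, SqInt S (G i)) :
    sq S (vec G) = ∑ i, sq S (G i) := by
  simp only [sq, enorm_vec_sq]
  rw [lintegral_finsetSum' _ fun i _ => ((h i).1.enorm.pow_const 2)]

theorem SobolevOn.vec {u : E n → ℝ} {G : Fin n → E n → ℝ} (h : SobolevOn D u G) :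
    SqInt D (vec G) := sqInt_vec.2 h.sqInt_grad

theorem nrm_grad_le {G : Fin n → E n → ℝ} {S : Set (E n)} (h : ∀ i, SqInt S (G i)) (i : Fin n) :
    nrm S (G i) ≤ nrm S (vec G) :=
  (nrm_le_of_bound (c := 1) zero_le_one (sqInt_vec.2 h)
    (.of_forall fun x => by rw [one_mul]; exact PiLp.norm_apply_le (Unfolding.vec G x) i)).trans_eq
    (one_mul _)

theorem SobolevOn.integral_fderiv {u : E n → ℝ} {G : Fin n → E n → ℝ} (h : SobolevOn D u G)
    {η : E n → ℝ} (hη : IsTest D η) (v : E n) :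
    ∫ x in D, fderiv ℝ η x v * u x = - ∫ x in D, η x * inner ℝ v (Unfolding.vec G x) := by
  simp only [fderiv_eq_sum, inner_vec, Finset.sum_mul, Finset.mul_sum]
  rw [integral_finsetSum, integral_finsetSum, ← Finset.sum_neg_distrib]
  · refine Finset.sum_congr rfl fun i _ => ?_
    have := h.weak η hη.1 hη.2 hη.3 i
    simp only [smul_eq_mul] at this
    have e1 : ∀ x, v i * pderiv i η x * u x = v i * (pderiv i η x * u x) := fun x => by ring
    have e2 : ∀ x, η x * (v i * G i x) = v i * (η x * G i x) := fun x => by ring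
    simp only [e1, e2, integral_const_mul, this, mul_neg]
  · intro i _
    simp only [mul_left_comm _ (v i)]
    exact (integrable_mul_of_sqInt (hη.sqInt D) (h.sqInt_grad i)).const_mul _
  · intro i _
    simp only [mul_assoc]
    exact (integrable_mul_of_sqInt ((hη.pderiv i).sqInt D) h.sqInt).const_mul _

/-! ### Elements of `H¹` -/

theorem sobolevOn_H1 (u : H1 D X) : SobolevOn D (fn u) (fun i => grad u i) :=
  ⟨Lp.memLp _, fun _ => Lp.memLp _, u.2⟩

theorem SobolevOn.exists_H1 (h : SobolevOn D u G) :
    ∃ w : H1 D X, fn w =ᵐ[volume.restrict D] u ∧ ∀ i, grad w i =ᵐ[volume.restrict D] G i := by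
  refine ⟨⟨WithLp.toLp 2 (h.sqInt.toLp u, WithLp.toLp 2 fun i => (h.sqInt_grad i).toLp (G i)), ?_⟩,
    h.sqInt.coeFn_toLp, fun i => (h.sqInt_grad i).coeFn_toLp⟩
  exact h.weak.congr h.sqInt.coeFn_toLp fun i => (h.sqInt_grad i).coeFn_toLp

theorem norm_sq_H1 (u : H1 D X) : ‖u‖ ^ 2 = ‖fn u‖ ^ 2 + ∑ i, ‖grad u i‖ ^ 2 := by
  have h1 : ‖u‖ ^ 2 = ‖u.1‖ ^ 2 := rfl
  rw [h1, WithLp.prod_norm_sq_eq_of_L2, PiLp.norm_sq_eq_of_L2]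
  rfl

theorem norm_fn_le (u : H1 D X) : ‖fn u‖ ≤ ‖u‖ := by
  refine abs_le_of_sq_le_sq ?_ (norm_nonneg _) |> fun h => (le_abs_self _).trans h
  rw [norm_sq_H1]
  exact le_add_of_nonneg_right (Finset.sum_nonneg fun i _ => sq_nonneg _)

theorem gradNorm_eq (u : H1 D ℝ) (S : Set (E n)) :
    gradNorm u S = nrm (D ∩ S) (Unfolding.vec fun i => grad u i) := by
  have h := (sobolevOn_H1 u).mono (inter_subset_left (t := S))
  rw [gradNorm, Real.sqrt_eq_iff_eq_sq]
  · rw [nrm_sq, sq_vec h.sqInt_grad, ENNReal.toReal_sum fun i _ => (sq_lt_top (h.sqInt_grad i)).ne]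
    refine Finset.sum_congr rfl fun i _ => ?_
    rw [← nrm_sq, nrm_sq_eq_integral (h.sqInt_grad i)]
  · exact Finset.sum_nonneg fun i _ => integral_nonneg fun x => sq_nonneg _
  · exact nrm_nonneg _ _

theorem gradNorm_self (u : H1 D ℝ) : gradNorm u D = nrm D (Unfolding.vec fun i => grad u i) := by
  rw [gradNorm_eq, inter_self]

theorem gradNorm_nonneg (u : H1 D ℝ) (S : Set (E n)) : 0 ≤ gradNorm u S := Real.sqrt_nonneg _

theorem norm_sq_H1_real (u : H1 D ℝ) : ‖u‖ ^ 2 = ‖fn u‖ ^ 2 + gradNorm u D ^ 2 := by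
  have h := sobolevOn_H1 u
  rw [norm_sq_H1, gradNorm_eq, inter_self, nrm_sq, sq_vec h.sqInt_grad,
    ENNReal.toReal_sum fun i _ => (sq_lt_top (h.sqInt_grad i)).ne]
  congr 1
  refine Finset.sum_congr rfl fun i _ => ?_
  rw [← nrm_sq]; rfl

theorem norm_H1_le (u : H1 D ℝ) : ‖u‖ ≤ ‖fn u‖ + gradNorm u D := by
  have h1 := norm_sq_H1_real u
  have h2 := gradNorm_nonneg u D
  nlinarith [norm_nonneg u, norm_nonneg (fn u), mul_nonneg (norm_nonneg (fn u)) h2]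

theorem gradNorm_le_norm (u : H1 D ℝ) : gradNorm u D ≤ ‖u‖ := by
  have h1 := norm_sq_H1_real u
  have h2 := gradNorm_nonneg u D
  nlinarith [norm_nonneg u, sq_nonneg ‖fn u‖]

/-! ### Uniqueness and existence of weak gradients -/

theorem HasWeakGrad.ae_eq {u v : E n → ℝ} {G H : Fin n → E n → ℝ} (hD : IsOpen D)
    (h : HasWeakGrad D u G) (h' : HasWeakGrad D v H) (hG : ∀ i, SqInt D (G i))
    (hH : ∀ i, SqInt D (H i)) (huv : u =ᵐ[volume.restrict D] v) (i : Fin n) :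
    G i =ᵐ[volume.restrict D] H i := by
  have hs : SqInt D (fun x => G i x - H i x) := (hG i).sub (hH i)
  have : nrm D (fun x => G i x - H i x) ≤ 0 := by
    refine nrm_le_of_test_bound hD hs le_rfl fun η hη => ?_
    have e1 := h η hη.1 hη.2 hη.3 i
    have e2 := h' η hη.1 hη.2 hη.3 i
    have e3 : ∫ x in D, Unfolding.pderiv i η x • u x = ∫ x in D, Unfolding.pderiv i η x • v x :=
      integral_congr_ae (by filter_upwards [huv] with x hx; rw [hx])
    simp only [smul_eq_mul] at e1 e2 e3
    simp only [mul_sub]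
    rw [integral_sub (integrable_mul_of_sqInt (hη.sqInt D) (hG i))
      (integrable_mul_of_sqInt (hη.sqInt D) (hH i))]
    have : ∫ x in D, η x * G i x = ∫ x in D, η x * H i x := by linarith
    simp [this]
  have h0 : nrm D (fun x => G i x - H i x) = 0 := le_antisymm this (nrm_nonneg _ _)
  rw [nrm, ENNReal.toReal_eq_zero_iff] at h0
  have h0 := h0.resolve_right hs.2.ne
  rw [eLpNorm_eq_zero_iff hs.1 (by norm_num)] at h0
  filter_upwards [h0] with x hx
  simpa [sub_eq_zero] using hx

/-- The functional η ↦ −∫ ∂ᵢη u is bounded in the `L²` norm of η, hence is represented by an `L²`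
function, which is the i-th weak derivative. -/
theorem exists_sobolevOn_of_bound {u : E n → ℝ} (hu : SqInt D u) (C : ℝ)
    (h : ∀ i η, IsTest D η → |∫ x in D, Unfolding.pderiv i η x * u x| ≤ C * nrm D η) :
    ∃ G, SobolevOn D u G := by
  have : ∀ i, ∃ g : L2 D ℝ, ∀ η : tests D,
      - ∫ x in D, Unfolding.pderiv i (η : E n → ℝ) x * u x = inner ℝ g (testsToL2 D η) := by
    intro i
    have hint : ∀ η : tests D, Integrable
        (fun x => Unfolding.pderiv i (η : E n → ℝ) x * u x) (volume.restrict D) := fun η =>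
      integrable_mul_of_sqInt ((IsTest.pderiv η.2 i).sqInt D) hu
    let Λ : tests D →ₗ[ℝ] ℝ :=
      { toFun := fun η => - ∫ x in D, Unfolding.pderiv i (η : E n → ℝ) x * u x
        map_add' := fun η ζ => by
          rw [← neg_add, ← integral_add (hint η) (hint ζ)]
          congr 2; ext x
          have h1 : DifferentiableAt ℝ (η : E n → ℝ) x := (η.2.smooth.differentiable (by simp)) x
          have h2 : DifferentiableAt ℝ (ζ : E n → ℝ) x := (ζ.2.smooth.differentiable (by simp)) x
          simp only [Unfolding.pderiv, Submodule.coe_add, fderiv_add h1 h2]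
          simp [add_mul]
        map_smul' := fun c η => by
          simp only [RingHom.id_apply, smul_eq_mul, mul_neg, ← integral_const_mul]
          congr 2; ext x
          have h1 : DifferentiableAt ℝ (η : E n → ℝ) x := (η.2.smooth.differentiable (by simp)) x
          simp only [Unfolding.pderiv, Submodule.coe_smul, fderiv_const_smul h1]
          simp [mul_assoc] }
    refine exists_inner_eq (testsToL2 D) Λ C fun η => ?_
    have := h i η η.2
    rw [← abs_neg] at this
    rwa [← norm_toLp_eq (η.2.sqInt D)] at this
  choose g hg using this
  refine ⟨fun i => g i, hu, fun i => Lp.memLp _, fun η h1 h2 h3 i => ?_⟩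
  have hη : IsTest D η := ⟨h1, h2, h3⟩
  have := hg i ⟨η, hη⟩
  have e : testsToL2 D ⟨η, hη⟩ = (hη.sqInt D).toLp η := rfl
  rw [e, real_inner_comm, ← Lp.toLp_coeFn (g i) (Lp.memLp _),
    ← integral_mul_eq_inner (hη.sqInt D) (Lp.memLp _)] at this
  simp only [smul_eq_mul]
  rw [← this, neg_neg]

/-- Tests supported in A see the gradient on A alone, so the gradient can be estimated on an outer
layer separately from the rest of D. The factor n is a crude substitute for √n. -/
theorem SobolevOn.nrm_vec_le {u : E n → ℝ} {G : Fin n → E n → ℝ} {A : Set (E n)}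
    (h : SobolevOn D u G) (hA : IsOpen A) (hAD : A ⊆ D) {C : ℝ} (hC : 0 ≤ C)
    (hb : ∀ i η, IsTest A η → |∫ x in D, Unfolding.pderiv i η x * u x| ≤ C * nrm A η) :
    nrm A (Unfolding.vec G) ≤ n * C := by
  have hG : ∀ i, SqInt A (G i) := fun i => (h.sqInt_grad i).mono hAD
  have h1 : ∀ i, nrm A (G i) ≤ C := fun i => by
    refine nrm_le_of_test_bound hA (hG i) hC fun η hη => ?_
    have e := h.weak η hη.1 hη.2 (hη.3.trans hAD) i
    simp only [smul_eq_mul] at e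
    have e2 : ∫ x in A, η x * G i x = ∫ x in D, η x * G i x :=
      (hη.setIntegral_smul_of_subset hAD (G i)).symm
    rw [e2, ← abs_neg, ← e]
    exact hb i η hη
  have h2 : nrm A (Unfolding.vec G) ^ 2 ≤ (n * C) ^ 2 := by
    rw [nrm_sq, sq_vec hG, ENNReal.toReal_sum fun i _ => (sq_lt_top (hG i)).ne]
    calc ∑ i, (sq A (G i)).toReal ≤ ∑ _i : Fin n, C ^ 2 := Finset.sum_le_sum fun i _ => by
          rw [← nrm_sq]; exact pow_le_pow_left₀ (nrm_nonneg _ _) (h1 i) 2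
      _ = n * C ^ 2 := by simp
      _ ≤ (n * C) ^ 2 := by
        rw [mul_pow]
        refine mul_le_mul_of_nonneg_right ?_ (sq_nonneg C)
        rcases Nat.eq_zero_or_pos n with rfl | hn
        · simp
        · have : (1 : ℝ) ≤ n := by exact_mod_cast hn
          nlinarith
  exact (pow_le_pow_iff_left₀ (nrm_nonneg _ _) (by positivity) two_ne_zero).1 h2

theorem H1_ext {w w' : H1 D X} (h : fn w = fn w') (h' : ∀ i, grad w i = grad w' i) : w = w' := by
  have h2 : w.1.snd = w'.1.snd := (WithLp.equiv 2 _).injective (funext h')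
  exact Subtype.ext ((WithLp.equiv 2 _).injective (Prod.ext h h2))

theorem ext_of_fn_eq (hD : IsOpen D) {w w' : H1 D ℝ} (h : fn w = fn w') : w = w' := by
  refine H1_ext h fun i => Lp.ext ?_
  have hw := sobolevOn_H1 w
  have hw' := sobolevOn_H1 w'
  exact HasWeakGrad.ae_eq hD hw.weak hw'.weak hw.sqInt_grad hw'.sqInt_grad (by rw [h]) i

/-- The element of `H1` above `A φ` is merely chosen, but it is unique because a function on an open
set has only one weak gradient; the choice is therefore linear, and the test bound makes it
continuous. -/
theorem exists_H1_clm {Ω : Set (E n)} (hD : IsOpen D) (A : H1 Ω ℝ →L[ℝ] L2 D ℝ) {C : ℝ}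
    (hC : 0 ≤ C)
    (h : ∀ φ i η, IsTest D η →
      |∫ x in D, Unfolding.pderiv i η x * A φ x| ≤ C * ‖φ‖ * nrm D η) :
    ∃ P : H1 Ω ℝ →L[ℝ] H1 D ℝ, ∀ φ, fn (P φ) = A φ := by
  have h1 : ∀ φ, ∃ w : H1 D ℝ, fn w = A φ := fun φ => by
    obtain ⟨G, hG⟩ := exists_sobolevOn_of_bound (Lp.memLp (A φ)) (C * ‖φ‖) (h φ)
    obtain ⟨w, hw, -⟩ := hG.exists_H1
    exact ⟨w, Lp.ext hw⟩
  choose P hP using h1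
  have hbound : ∀ φ, ‖P φ‖ ≤ (‖A‖ + n * C) * ‖φ‖ := by
    intro φ
    have h2 := (sobolevOn_H1 (P φ)).nrm_vec_le hD subset_rfl (C := C * ‖φ‖) (by positivity)
      (fun i η hη => by
        have := h φ i η hη
        rwa [← hP φ] at this)
    have h3 := norm_H1_le (P φ)
    rw [hP] at h3
    have h4 := A.le_opNorm φ
    calc ‖P φ‖ ≤ ‖A φ‖ + gradNorm (P φ) D := h3
      _ ≤ ‖A‖ * ‖φ‖ + n * (C * ‖φ‖) := add_le_add h4 ((gradNorm_self (P φ)).trans_le h2)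
      _ = _ := by ring
  have hadd : ∀ φ ψ, P (φ + ψ) = P φ + P ψ := fun φ ψ => ext_of_fn_eq hD <|
    (hP _).trans ((map_add A φ ψ).trans (congrArg₂ (· + ·) (hP φ) (hP ψ)).symm)
  have hsmul : ∀ (c : ℝ) φ, P (c • φ) = c • P φ := fun c φ => ext_of_fn_eq hD <|
    (hP _).trans ((map_smul A c φ).trans (congrArg (c • ·) (hP φ)).symm)
  let P' : H1 Ω ℝ →ₗ[ℝ] H1 D ℝ := { toFun := P, map_add' := hadd, map_smul' := hsmul }
  exact ⟨P'.mkContinuous (‖A‖ + n * C) hbound, hP⟩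

end SobolevFunctions

end

section

open Filter Topology
open scoped ENNReal

variable {n : ℕ}

/-! ### Translations -/

section Translation

variable {X : Type*} [NormedAddCommGroup X]

theorem sq_translate (S : Set (E n)) (w : E n → X) (z : E n) :
    sq ((fun x => x + z) ⁻¹' S) (fun x => w (x + z)) = sq S w :=
  (measurePreserving_add_right volume z).setLIntegral_comp_preimage_emb
    (MeasurableEquiv.addRight z).measurableEmbedding (fun x => ‖w x‖ₑ ^ 2) S

theorem sq_translate_le {A D : Set (E n)} (w : E n → X) {z : E n} (h : ∀ x ∈ A, x + z ∈ D) :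
    sq A (fun x => w (x + z)) ≤ sq D w :=
  (sq_mono h _).trans (sq_translate D w z).le

theorem SqInt.translate {A D : Set (E n)} {w : E n → X} (hw : SqInt D w) {z : E n}
    (h : ∀ x ∈ A, x + z ∈ D) : SqInt A (fun x => w (x + z)) :=
  SqInt.mono (hw.comp_measurePreserving
    ((measurePreserving_add_right volume z).restrict_preimage_emb
      (MeasurableEquiv.addRight z).measurableEmbedding D)) h

theorem nrm_le_nrm_of_sq_le {Z : Type*} [NormedAddCommGroup Z] {A D : Set (E n)} {w : E n → X}
    {w' : E n → Z} (hw : SqInt D w') (h : sq A w ≤ sq D w') : nrm A w ≤ nrm D w' :=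
  nrm_le_of_sq_le (nrm_nonneg _ _) (h.trans_eq (sq_eq_ofReal hw))

theorem nrm_translate_le {A D : Set (E n)} {w : E n → X} (hw : SqInt D w) {z : E n}
    (h : ∀ x ∈ A, x + z ∈ D) : nrm A (fun x => w (x + z)) ≤ nrm D w :=
  nrm_le_nrm_of_sq_le hw (sq_translate_le w h)

theorem IsTest.translate {A D : Set (E n)} {η : E n → ℝ} (hη : IsTest A η) {z : E n}
    (h : ∀ x ∈ A, x + z ∈ D) : IsTest D (fun x => η (x - z)) := by
  have hs : tsupport (fun x => η (x - z)) = (fun x => x - z) ⁻¹' tsupport η :=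
    tsupport_comp_eq_preimage η (Homeomorph.subRight z)
  refine ⟨hη.smooth.comp (contDiff_id.sub contDiff_const), ?_, ?_⟩
  · exact hη.compact.comp_homeomorph (Homeomorph.subRight z)
  · rw [hs]
    intro x hx
    simpa using h _ (hη.subset hx)

theorem IsTest.integral_translate {A D : Set (E n)} {η : E n → ℝ} (hη : IsTest A η) {z : E n}
    (h : ∀ x ∈ A, x + z ∈ D) (w : E n → ℝ) :
    ∫ x in D, η (x - z) * w x = ∫ x in A, η x * w (x + z) := by
  have h1 := (hη.translate h).setIntegral_smul w
  have h2 := hη.setIntegral_smul fun x => w (x + z)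
  simp only [smul_eq_mul] at h1 h2
  rw [h1, h2, ← integral_add_right_eq_self _ z]
  simp

end Translation

section TranslationDerivative

variable {D : Set (E n)} {u : E n → ℝ} {G : Fin n → E n → ℝ}

/-- The translation acts on the smooth factor η, so one differentiates under the integral without
any regularity of u. -/
theorem hasDerivAt_integral_translate (hu : SqInt D u) {A : Set (E n)} {η : E n → ℝ}
    (hη : IsTest A η) (v : E n) (s₀ : ℝ) :
    HasDerivAt (fun s : ℝ => ∫ x in D, η (x - s • v) * u x)
      (∫ x in D, fderiv ℝ η (x - s₀ • v) (-v) * u x) s₀ := by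
  obtain ⟨C, hC⟩ := (hη.compact.fderiv (𝕜 := ℝ)).exists_bound_of_continuous
    (hη.smooth.continuous_fderiv (by simp))
  have hC0 : 0 ≤ C := (norm_nonneg _).trans (hC 0)
  -- The compact set swept by the support of η for |s − s₀| ≤ 1; u is integrable there, which
  -- supplies the dominating function.
  let K : Set (E n) := (fun p : ℝ × E n => p.2 + p.1 • v) '' (Icc (s₀ - 1) (s₀ + 1) ×ˢ tsupport η)
  have hK : IsCompact K := (isCompact_Icc.prod hη.compact).image (by fun_prop)
  have hloc : LocallyIntegrable u (volume.restrict D) := hu.locallyIntegrable (by norm_num)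
  have hd : ∀ (x : E n) (s : ℝ), HasDerivAt (fun s : ℝ => η (x - s • v) * u x)
      (fderiv ℝ η (x - s • v) (-v) * u x) s := by
    intro x s
    have h1 : HasDerivAt (fun s : ℝ => x - s • v) (-v) s := by
      simpa using (((hasDerivAt_id s).smul_const v).const_sub x)
    have h2 := ((hη.smooth.differentiable (by simp)) (x - s • v)).hasFDerivAt
    exact (h2.comp_hasDerivAt s h1).mul_const (u x)
  refine (hasDerivAt_integral_of_dominated_loc_of_deriv_le (μ := volume.restrict D)
    (F := fun (s : ℝ) x => η (x - s • v) * u x)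
    (F' := fun s x => fderiv ℝ η (x - s • v) (-v) * u x) (x₀ := s₀)
    (s := Ioo (s₀ - 1) (s₀ + 1)) (bound := K.indicator fun x => C * ‖v‖ * ‖u x‖)
    (Ioo_mem_nhds (by linarith) (by linarith)) ?_ ?_ ?_ ?_ ?_ ?_).2
  · refine .of_forall fun s => ?_
    have : Continuous fun x => η (x - s • v) := hη.smooth.continuous.comp (by fun_prop)
    exact this.aestronglyMeasurable.mul hu.1
  · exact integrable_mul_of_sqInt (((hη.mono (subset_univ A)).translate
      (fun x _ => mem_univ (x + s₀ • v))).sqInt D) hu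
  · have : Continuous fun x => fderiv ℝ η (x - s₀ • v) (-v) :=
      ((hη.smooth.continuous_fderiv (by simp)).comp (by fun_prop)).clm_apply continuous_const
    exact this.aestronglyMeasurable.mul hu.1
  · refine .of_forall fun x s hs => ?_
    by_cases hx : x ∈ K
    · rw [indicator_of_mem hx, norm_mul]
      refine mul_le_mul_of_nonneg_right ?_ (norm_nonneg _)
      refine (ContinuousLinearMap.le_opNorm _ _).trans ?_
      rw [norm_neg]
      exact mul_le_mul_of_nonneg_right (hC _) (norm_nonneg _)
    · have : fderiv ℝ η (x - s • v) = 0 := by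
        refine image_eq_zero_of_notMem_tsupport fun hc => hx ?_
        exact ⟨(s, x - s • v), ⟨Ioo_subset_Icc_self hs, tsupport_fderiv_subset ℝ hc⟩, by simp⟩
      simp [this, indicator_of_notMem hx]
  · rw [integrable_indicator_iff hK.measurableSet]
    exact (hloc.integrableOn_isCompact hK).norm.const_mul _
  · exact .of_forall fun x s _ => hd x s

theorem SobolevOn.hasDerivAt_translate (h : SobolevOn D u G) {A : Set (E n)} {η : E n → ℝ}
    (hη : IsTest A η) (v : E n) {s₀ : ℝ} (hs : ∀ x ∈ A, x + s₀ • v ∈ D) :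
    HasDerivAt (fun s : ℝ => ∫ x in D, η (x - s • v) * u x)
      (∫ x in D, η (x - s₀ • v) * inner ℝ v (Unfolding.vec G x)) s₀ := by
  have e := h.integral_fderiv (hη.translate hs) v
  have e2 : ∀ x, fderiv ℝ (fun x => η (x - s₀ • v)) x = fderiv ℝ η (x - s₀ • v) := fun x =>
    fderiv_comp_sub (x := x) (f := η) (s₀ • v)
  have e3 : ∫ x in D, fderiv ℝ η (x - s₀ • v) (-v) * u x
      = ∫ x in D, η (x - s₀ • v) * inner ℝ v (Unfolding.vec G x) := by
    simp only [map_neg, neg_mul, integral_neg]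
    simp only [e2] at e
    rw [e, neg_neg]
  rw [← e3]
  exact hasDerivAt_integral_translate h.sqInt hη v s₀

theorem sqInt_inner {S : Set (E n)} (h : SqInt S (vec G)) (v : E n) :
    SqInt S (fun x => inner ℝ v (vec G x)) :=
  h.const_inner v

theorem nrm_inner_le {S : Set (E n)} (h : SqInt S (vec G)) (v : E n) :
    nrm S (fun x => inner ℝ v (vec G x)) ≤ ‖v‖ * nrm S (vec G) :=
  nrm_le_of_bound (norm_nonneg v) h (.of_forall fun _ => norm_inner_le_norm v _)

/-- This is the mean value inequality for s ↦ ∫ η(x − sv)u(x) dx − sc on [0,1]. The constant c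
serves two purposes: c = 0 gives the translation estimate, and c = ∫ η v·∇u gives the Taylor
remainder. -/
theorem SobolevOn.abs_integral_translate_le (h : SobolevOn D u G) {A : Set (E n)} {η : E n → ℝ}
    (hη : IsTest A η) (v : E n) (hA : ∀ s ∈ Icc (0 : ℝ) 1, ∀ x ∈ A, x + s • v ∈ D) {c B : ℝ}
    (hB : ∀ s ∈ Icc (0 : ℝ) 1,
      |(∫ x in A, η x * inner ℝ v (Unfolding.vec G (x + s • v))) - c| ≤ B) :
    |(∫ x in A, η x * (u (x + v) - u x)) - c| ≤ B := by
  have hA0 : ∀ x ∈ A, x ∈ D := fun x hx => by simpa using hA 0 (by simp) x hx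
  have hA1 : ∀ x ∈ A, x + v ∈ D := fun x hx => by simpa using hA 1 (by simp) x hx
  have := norm_image_sub_le_of_norm_deriv_le_segment_01'
    (f := fun s : ℝ => (∫ x in D, η (x - s • v) * u x) - s * c)
    (f' := fun s => (∫ x in D, η (x - s • v) * inner ℝ v (Unfolding.vec G x)) - c) (C := B)
    (fun s hs => ((h.hasDerivAt_translate hη v (hA s hs)).sub
      (by simpa using (hasDerivAt_id s).mul_const c)).hasDerivWithinAt)
    (fun s hs => by
      rw [hη.integral_translate (hA s (Ico_subset_Icc_self hs)), Real.norm_eq_abs]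
      exact hB s (Ico_subset_Icc_self hs))
  simp only [one_smul, zero_smul, sub_zero, one_mul, zero_mul, Real.norm_eq_abs] at this
  have e1 := hη.integral_translate hA1 u
  have e0 := hη.integral_translate (z := 0) (by simpa using hA0) u
  simp only [sub_zero, add_zero] at e0
  rw [e1, e0] at this
  simp only [mul_sub]
  rw [integral_sub (integrable_mul_of_sqInt (hη.sqInt A) (h.sqInt.translate hA1))
    (integrable_mul_of_sqInt (hη.sqInt A) (h.sqInt.mono hA0))]
  convert this using 2
  ring

/-- The `L²` translation estimate. -/
theorem SobolevOn.nrm_translate_sub_le (h : SobolevOn D u G) {A : Set (E n)} (hAo : IsOpen A)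
    (v : E n) (hA : ∀ s ∈ Icc (0 : ℝ) 1, ∀ x ∈ A, x + s • v ∈ D) :
    nrm A (fun x => u (x + v) - u x) ≤ ‖v‖ * nrm D (Unfolding.vec G) := by
  have hA0 : ∀ x ∈ A, x ∈ D := fun x hx => by simpa using hA 0 (by simp) x hx
  have hA1 : ∀ x ∈ A, x + v ∈ D := fun x hx => by simpa using hA 1 (by simp) x hx
  refine nrm_le_of_test_bound hAo ((h.sqInt.translate hA1).sub (h.sqInt.mono hA0))
    (mul_nonneg (norm_nonneg _) (nrm_nonneg _ _)) fun η hη => ?_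
  have := h.abs_integral_translate_le hη v hA (c := 0)
    (B := ‖v‖ * nrm D (Unfolding.vec G) * nrm A η) fun s hs => ?_
  · simpa using this
  · rw [sub_zero]
    have hi := sqInt_inner h.vec v
    refine (abs_integral_mul_le (hη.sqInt A) (hi.translate (hA s hs))).trans ?_
    rw [mul_comm]
    exact mul_le_mul_of_nonneg_right ((nrm_translate_le hi (hA s hs)).trans (nrm_inner_le h.vec v))
      (nrm_nonneg _ _)

/-- The first order Taylor estimate, in a weak sense. -/
theorem SobolevOn.abs_integral_taylor_le (h : SobolevOn D u G) {A : Set (E n)} (hAo : IsOpen A)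
    (v : E n) (hA : ∀ s ∈ Icc (0 : ℝ) 1, ∀ x ∈ A, x + s • v ∈ D) {ψ : E n → ℝ} (hψ : SqInt A ψ)
    {B : ℝ} (hB : ∀ s ∈ Icc (0 : ℝ) 1, |∫ x in A, ψ x *
      (inner ℝ v (Unfolding.vec G (x + s • v)) - inner ℝ v (Unfolding.vec G x))| ≤ B) :
    |∫ x in A, ψ x * (u (x + v) - u x - inner ℝ v (Unfolding.vec G x))| ≤ B := by
  have hA0 : ∀ x ∈ A, x ∈ D := fun x hx => by simpa using hA 0 (by simp) x hx
  have hA1 : ∀ x ∈ A, x + v ∈ D := fun x hx => by simpa using hA 1 (by simp) x hx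
  have hi := sqInt_inner h.vec v
  set M := 2 * nrm D fun x => inner ℝ v (Unfolding.vec G x) with hM
  have hM0 : 0 ≤ M := mul_nonneg zero_le_two (nrm_nonneg _ _)
  set q := fun x => u (x + v) - u x - inner ℝ v (Unfolding.vec G x) with hq
  have hqi : SqInt A q := ((h.sqInt.translate hA1).sub (h.sqInt.mono hA0)).sub (hi.mono hA0)
  set r := fun (s : ℝ) x => inner ℝ v (Unfolding.vec G (x + s • v)) - inner ℝ v (Unfolding.vec G x)
    with hr
  have hri : ∀ s ∈ Icc (0 : ℝ) 1, SqInt A (r s) := fun s hs =>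
    (hi.translate (hA s hs)).sub (hi.mono hA0)
  have hrM : ∀ s ∈ Icc (0 : ℝ) 1, nrm A (r s) ≤ M := fun s hs => by
    refine (nrm_sub_le (hi.translate (hA s hs)) (hi.mono hA0)).trans ?_
    have := nrm_translate_le hi (hA s hs)
    have := nrm_mono hi hA0
    linarith
  -- The mean value argument needs a smooth test, whereas ψ is only in `L²` and the hypothesis
  -- concerns ψ itself. Replacing ψ by a test at distance δ costs δM in the hypothesis and δ‖q‖ in
  -- the conclusion.
  have key : ∀ δ > 0, |∫ x in A, ψ x * q x| ≤ B + δ * (M + nrm A q) := by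
    intro δ hδ
    obtain ⟨η, hη, hηδ⟩ := exists_test_near hAo hψ hδ
    have hd : SqInt A (fun x => ψ x - η x) := hψ.sub (hη.sqInt A)
    have split : ∀ w, SqInt A w →
        ∫ x in A, (ψ x - η x) * w x = (∫ x in A, ψ x * w x) - ∫ x in A, η x * w x := fun w hw => by
      have e := integral_sub (integrable_mul_of_sqInt hψ hw) (integrable_mul_of_sqInt (hη.sqInt A) hw)
      rw [← e]
      exact integral_congr_ae (.of_forall fun x => sub_mul _ _ _)
    have small : ∀ w, SqInt A w →
        |(∫ x in A, ψ x * w x) - ∫ x in A, η x * w x| ≤ δ * nrm A w := fun w hw => by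
      rw [← split w hw]
      exact (abs_integral_mul_le hd hw).trans (mul_le_mul_of_nonneg_right hηδ (nrm_nonneg _ _))
    have h1 : |∫ x in A, η x * q x| ≤ B + δ * M := by
      have := h.abs_integral_translate_le hη v hA
        (c := ∫ x in A, η x * inner ℝ v (Unfolding.vec G x)) (B := B + δ * M) fun s hs => ?_
      · rw [← integral_sub] at this
        · simpa only [hq, mul_sub] using this
        · exact integrable_mul_of_sqInt (hη.sqInt A) ((h.sqInt.translate hA1).sub (h.sqInt.mono hA0))
        · exact integrable_mul_of_sqInt (hη.sqInt A) (hi.mono hA0)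
      · rw [← integral_sub]
        · have e := small _ (hri s hs)
          have e2 := hB s hs
          have e3 := mul_le_mul_of_nonneg_left (hrM s hs) hδ.le
          simp only [hr, mul_sub] at e e2 e3 ⊢
          rw [abs_sub_comm] at e
          have := abs_le.1 e; have := abs_le.1 e2
          rw [abs_le]; constructor <;> linarith
        · exact integrable_mul_of_sqInt (hη.sqInt A) (hi.translate (hA s hs))
        · exact integrable_mul_of_sqInt (hη.sqInt A) (hi.mono hA0)
    have h2 := small q hqi
    have := abs_le.1 h1; have := abs_le.1 h2
    rw [abs_le]; constructor <;> linarith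
  refine le_of_forall_pos_le_add fun δ hδ => ?_
  have hpos : 0 < M + nrm A q + 1 := by have := nrm_nonneg A q; linarith
  refine (key (δ / (M + nrm A q + 1)) (by positivity)).trans ?_
  gcongr
  rw [div_mul_eq_mul_div, div_le_iff₀ hpos]
  nlinarith

end TranslationDerivative

end

section

open Filter Topology
open scoped ENNReal

variable {n : ℕ}

/-! ### Poincaré inequalities -/

section Poincare

variable {D : Set (E n)} {u : E n → ℝ} {G : Fin n → E n → ℝ}

/-- With b = a + v and the order of integration exchanged, the integral over a for fixed v is a
translation estimate on Q ∩ (Q − v); convexity keeps the segments inside Q, and only |v| ≤ R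
contributes. -/
theorem SobolevOn.lintegral_lintegral_sub_le {Q : Set (E n)} (h : SobolevOn Q u G)
    (hu : Measurable u) (hQ : IsOpen Q) (hconv : Convex ℝ Q) {R : ℝ}
    (hR : ∀ x ∈ Q, ∀ y ∈ Q, ‖y - x‖ ≤ R) :
    ∫⁻ a in Q, ∫⁻ b in Q, ‖u b - u a‖ₑ ^ 2 ≤
      ENNReal.ofReal (R ^ 2) * volume (Metric.closedBall (0 : E n) R) * sq Q (Unfolding.vec G) := by
  let f : E n → E n → ℝ≥0∞ := fun a v =>
    Q.indicator (fun a => Q.indicator (fun b => ‖u b - u a‖ₑ ^ 2) (a + v)) a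
  have hQm := hQ.measurableSet
  have hf : Measurable (Function.uncurry f) := by
    have e : Function.uncurry f = ((Prod.fst ⁻¹' Q) ∩ (fun p : E n × E n => p.1 + p.2) ⁻¹' Q).indicator
        (fun p : E n × E n => ‖u (p.1 + p.2) - u p.1‖ₑ ^ 2) := by
      ext ⟨a, v⟩
      by_cases h1 : a ∈ Q <;> by_cases h2 : a + v ∈ Q <;> simp [f, h1, h2, indicator]
    rw [e]
    refine Measurable.indicator ?_ ((measurable_fst hQm).inter (measurable_add hQm))
    exact ((hu.comp (measurable_fst.add measurable_snd)).sub (hu.comp measurable_fst)).enorm.pow_const 2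
  have h1 : ∫⁻ a in Q, ∫⁻ b in Q, ‖u b - u a‖ₑ ^ 2 = ∫⁻ a, ∫⁻ v, f a v := by
    rw [← lintegral_indicator hQm]
    refine lintegral_congr fun a => ?_
    by_cases ha : a ∈ Q
    · simp only [f, indicator_of_mem ha]
      rw [lintegral_add_left_eq_self (fun b => Q.indicator (fun b => ‖u b - u a‖ₑ ^ 2) b) a,
        lintegral_indicator hQm]
    · simp [f, indicator_of_notMem ha]
  rw [h1, lintegral_lintegral_swap hf.aemeasurable]
  have h2 : ∀ v, ∫⁻ a, f a v ≤ (Metric.closedBall (0 : E n) R).indicator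
      (fun _ => ENNReal.ofReal (R ^ 2) * sq Q (Unfolding.vec G)) v := by
    intro v
    let A : Set (E n) := Q ∩ (fun x => x + v) ⁻¹' Q
    have hA : IsOpen A := hQ.inter (hQ.preimage (by fun_prop))
    have e : ∫⁻ a, f a v = sq A (fun x => u (x + v) - u x) := by
      rw [sq, ← lintegral_indicator hA.measurableSet]
      refine lintegral_congr fun a => ?_
      by_cases h1 : a ∈ Q <;> by_cases h2 : a + v ∈ Q <;> simp [f, A, h1, h2, indicator]
    by_cases hv : v ∈ Metric.closedBall (0 : E n) R
    · rw [indicator_of_mem hv, e]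
      have hseg : ∀ s ∈ Icc (0 : ℝ) 1, ∀ x ∈ A, x + s • v ∈ Q := fun s hs x hx => by
        have := hconv hx.1 hx.2 (sub_nonneg.2 hs.2) hs.1 (by ring)
        convert this using 1
        module
      have hs := h.nrm_translate_sub_le hA v hseg
      have hi : SqInt A (fun x => u (x + v) - u x) :=
        (h.sqInt.translate fun x hx => hx.2).sub (h.sqInt.mono inter_subset_left)
      rw [sq_eq_ofReal hi, sq_eq_ofReal h.vec, ← ENNReal.ofReal_mul (sq_nonneg R), ← mul_pow]
      refine ENNReal.ofReal_le_ofReal (pow_le_pow_left₀ (nrm_nonneg _ _) (hs.trans ?_) 2)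
      exact mul_le_mul_of_nonneg_right (by simpa using hv) (nrm_nonneg _ _)
    · rw [indicator_of_notMem hv, e, sq]
      have : A = ∅ := by
        rw [eq_empty_iff_forall_notMem]
        exact fun x hx => hv (by simpa using hR x hx.1 _ hx.2)
      simp [this]
  refine (lintegral_mono h2).trans_eq ?_
  rw [lintegral_indicator Metric.isClosed_closedBall.measurableSet, setLIntegral_const]
  ring

/-- Some point a makes the inner integral at most its mean over Q, and the constant is the value
u(a). -/
theorem SobolevOn.exists_const_sq_sub_le {Q : Set (E n)} (h : SobolevOn Q u G)
    (hu : Measurable u) (hQ : IsOpen Q) (hconv : Convex ℝ Q) (hne : Q.Nonempty) {R : ℝ}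
    (hR : ∀ x ∈ Q, ∀ y ∈ Q, ‖y - x‖ ≤ R) :
    ∃ c : ℝ, sq Q (fun x => u x - c) ≤ ENNReal.ofReal (R ^ 2) *
      (volume (Metric.closedBall (0 : E n) R) / volume Q) * sq Q (Unfolding.vec G) := by
  have hQ0 : volume Q ≠ 0 := (hQ.measure_pos _ hne).ne'
  have hQt : volume Q ≠ ⊤ := by
    obtain ⟨x, hx⟩ := hne
    refine ((measure_mono (t := Metric.closedBall x R) fun y hy => ?_).trans_lt
      measure_closedBall_lt_top).ne
    rw [mem_closedBall_iff_norm]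
    exact hR x hx y hy
  have hm : AEMeasurable (fun a => ∫⁻ b in Q, ‖u b - u a‖ₑ ^ 2) (volume.restrict Q) := by
    refine Measurable.aemeasurable ?_
    refine Measurable.lintegral_prod_right' (f := fun p : E n × E n => ‖u p.2 - u p.1‖ₑ ^ 2) ?_
    exact ((hu.comp measurable_snd).sub (hu.comp measurable_fst)).enorm.pow_const 2
  obtain ⟨a, -, ha⟩ := exists_le_setLAverage hQ0 hQt hm
  refine ⟨u a, ha.trans ?_⟩
  rw [setLAverage_eq]
  refine (ENNReal.div_le_div_right (h.lintegral_lintegral_sub_le hu hQ hconv hR) _).trans_eq ?_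
  simp only [div_eq_mul_inv]
  ring

end Poincare

/-! ### Products, smooth functions, affine changes of variables -/

section Calculus

variable {D : Set (E n)} {u : E n → ℝ} {G : Fin n → E n → ℝ}

theorem IsTest.mul_left {A : Set (E n)} {χ η : E n → ℝ} (hχ : IsTest A χ) (hη : ContDiff ℝ ∞ η) :
    IsTest A (fun x => χ x * η x) :=
  ⟨hχ.smooth.mul hη, hχ.compact.mul_right, (tsupport_mul_subset_left).trans hχ.subset⟩

theorem IsTest.sqInt_mul {χ : E n → ℝ} (hχ : IsTest D χ) (hD : IsOpen D) (hu : SqInt D u) :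
    SqInt univ (fun x => χ x * u x) := by
  obtain ⟨C, hC⟩ := hχ.compact.exists_bound_of_continuous hχ.smooth.continuous
  have h1 : SqInt D (fun x => χ x * u x) :=
    hu.of_le_mul (c := C) (hχ.smooth.continuous.aestronglyMeasurable.mul hu.1)
      (.of_forall fun x => by
        rw [norm_mul]; exact mul_le_mul_of_nonneg_right (hC x) (norm_nonneg _))
  have e : (fun x => χ x * u x) = D.indicator (fun x => χ x * u x) := by
    ext x
    by_cases hx : x ∈ D
    · rw [indicator_of_mem hx]
    · rw [indicator_of_notMem hx, hχ.zero_of_notMem hx, zero_mul]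
  rw [SqInt, Measure.restrict_univ, e, memLp_indicator_iff_restrict hD.measurableSet]
  exact h1

/-- The cutoff has compact support in D, so the product, continued by zero, creates no jump across
the boundary of D; this is the Leibniz rule tested against functions on the whole space. -/
theorem SobolevOn.mul_test (h : SobolevOn D u G) (hD : IsOpen D) {χ : E n → ℝ} (hχ : IsTest D χ) :
    SobolevOn univ (fun x => χ x * u x) (fun i x => Unfolding.pderiv i χ x * u x + χ x * G i x) := by
  have hp := fun i => (hχ.pderiv i).sqInt_mul hD h.sqInt
  have hq := fun i => hχ.sqInt_mul hD (h.sqInt_grad i)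
  refine ⟨hχ.sqInt_mul hD h.sqInt, fun i => (hp i).add (hq i), fun η h1 h2 h3 i => ?_⟩
  have hη : IsTest univ η := ⟨h1, h2, h3⟩
  have ht : IsTest D (fun x => χ x * η x) := hχ.mul_left h1
  have hw := h.weak _ ht.1 ht.2 ht.3 i
  simp only [smul_eq_mul] at hw ⊢
  rw [Measure.restrict_univ] at *
  have full : ∀ w : E n → ℝ, (∀ x, x ∉ D → w x = 0) → ∫ x, w x = ∫ x in D, w x := fun w hw =>
    (setIntegral_eq_integral_of_forall_compl_eq_zero hw).symm
  have z1 : ∀ x, x ∉ D → χ x = 0 := fun x hx => hχ.zero_of_notMem hx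
  have z2 : ∀ x, x ∉ D → Unfolding.pderiv i χ x = 0 := fun x hx => hχ.pderiv_zero_of_notMem i hx
  rw [full _ fun x hx => by simp [z1 x hx], full _ fun x hx => by simp [z1 x hx, z2 x hx]]
  have hprod : ∀ x, Unfolding.pderiv i (fun x => χ x * η x) x
      = Unfolding.pderiv i χ x * η x + χ x * Unfolding.pderiv i η x := fun x => by
    have d1 : DifferentiableAt ℝ χ x := (hχ.smooth.differentiable (by simp)) x
    have d2 : DifferentiableAt ℝ η x := (h1.differentiable (by simp)) x
    simp only [Unfolding.pderiv, fderiv_fun_mul d1 d2]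
    simp; ring
  simp only [hprod] at hw
  have i1 : Integrable (fun x => Unfolding.pderiv i χ x * η x * u x) (volume.restrict D) :=
    integrable_mul_of_sqInt (((hχ.pderiv i).mul_left h1).sqInt D) h.sqInt
  have i2 : Integrable (fun x => χ x * Unfolding.pderiv i η x * u x) (volume.restrict D) :=
    integrable_mul_of_sqInt ((hχ.mul_left (hη.pderiv i).smooth).sqInt D) h.sqInt
  have i3 : Integrable (fun x => χ x * η x * G i x) (volume.restrict D) :=
    integrable_mul_of_sqInt (ht.sqInt D) (h.sqInt_grad i)
  simp only [add_mul] at hw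
  rw [integral_add i1 i2] at hw
  have e1 : ∫ x in D, Unfolding.pderiv i η x * (χ x * u x)
      = ∫ x in D, χ x * Unfolding.pderiv i η x * u x := by congr 1; ext x; ring
  have e2 : ∫ x in D, η x * (Unfolding.pderiv i χ x * u x + χ x * G i x)
      = (∫ x in D, Unfolding.pderiv i χ x * η x * u x) + ∫ x in D, χ x * η x * G i x := by
    rw [← integral_add i1 i3]; congr 1; ext x; ring
  rw [e1, e2]
  linarith

theorem sqInt_of_continuous {f : E n → ℝ} (hf : Continuous f) (hD : Bornology.IsBounded D) :
    SqInt D f := by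
  obtain ⟨R, hR⟩ := hD.subset_closedBall 0
  refine SqInt.mono ?_ hR
  have : IsFiniteMeasure ((volume : Measure (E n)).restrict (Metric.closedBall 0 R)) :=
    ⟨by simpa using measure_closedBall_lt_top⟩
  obtain ⟨C, hC⟩ := (isCompact_closedBall (0 : E n) R).exists_bound_of_continuousOn hf.continuousOn
  exact MemLp.of_bound hf.aestronglyMeasurable C
    (ae_restrict_of_forall_mem Metric.isClosed_closedBall.measurableSet hC)

theorem sobolevOn_of_contDiff {f : E n → ℝ} (hf : ContDiff ℝ 1 f) (hD : Bornology.IsBounded D) :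
    SobolevOn D f (fun i => pderiv i f) := by
  have hc : ∀ i, Continuous (pderiv i f) := fun i =>
    (hf.continuous_fderiv (by simp)).clm_apply continuous_const
  refine ⟨sqInt_of_continuous hf.continuous hD, fun i => sqInt_of_continuous (hc i) hD,
    fun η h1 h2 h3 i => ?_⟩
  have hη : IsTest D η := ⟨h1, h2, h3⟩
  have hcs : HasCompactSupport (pderiv i η) := (hη.pderiv i).compact
  rw [(hη.pderiv i).setIntegral_smul, hη.setIntegral_smul]
  have := integral_mul_fderiv_eq_neg_fderiv_mul_of_integrable (μ := volume) (f := η) (g := f)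
    (v := EuclideanSpace.single i 1)
    (((hη.pderiv i).smooth.continuous.mul hf.continuous).integrable_of_hasCompactSupport
      hcs.mul_right)
    ((h1.continuous.mul (hc i)).integrable_of_hasCompactSupport h2.mul_right)
    ((h1.continuous.mul hf.continuous).integrable_of_hasCompactSupport h2.mul_right)
    (fun x _ => (h1.differentiable (by simp)) x) (fun x _ => (hf.differentiable (by simp)) x)
  simp only [smul_eq_mul]
  have e : ∫ x, η x * pderiv i f x = - ∫ x, pderiv i η x * f x := this
  rw [e, neg_neg]

/-- The affine map `y ↦ a + εy`. -/
theorem map_affine (a : E n) {ε : ℝ} (hε : 0 < ε) :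
    (volume : Measure (E n)).map (fun y => a + ε • y)
      = ENNReal.ofReal ((ε ^ n)⁻¹) • volume := by
  have h1 : (fun y : E n => a + ε • y) = (fun y => a + y) ∘ (fun y => ε • y) := rfl
  rw [h1, ← Measure.map_map (by fun_prop) (by fun_prop), Measure.map_addHaar_smul _ hε.ne',
    Measure.map_smul, map_add_left_eq_self]
  simp [abs_of_pos (pow_pos hε n)]

theorem measurableEmbedding_affine (a : E n) {ε : ℝ} (hε : 0 < ε) :
    MeasurableEmbedding (fun y : E n => a + ε • y) :=
  ((Homeomorph.smulOfNeZero ε hε.ne').trans (Homeomorph.addLeft a)).measurableEmbedding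

theorem setLIntegral_affine (a : E n) {ε : ℝ} (hε : 0 < ε) (S : Set (E n)) (f : E n → ℝ≥0∞) :
    ∫⁻ y in (fun y => a + ε • y) ⁻¹' S, f (a + ε • y)
      = ENNReal.ofReal ((ε ^ n)⁻¹) * ∫⁻ x in S, f x := by
  have hm := measurableEmbedding_affine a hε
  rw [← hm.lintegral_map, ← hm.restrict_map, map_affine a hε, Measure.restrict_smul,
    lintegral_smul_measure]
  rfl

theorem integral_affine (a : E n) {ε : ℝ} (hε : 0 < ε) (f : E n → ℝ) :
    ∫ y, f (a + ε • y) = (ε ^ n)⁻¹ * ∫ x, f x := by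
  have hm := measurableEmbedding_affine a hε
  rw [← hm.integral_map, map_affine a hε, integral_smul_measure,
    ENNReal.toReal_ofReal (by positivity)]
  rfl

theorem SqInt.comp_affine {X : Type*} [NormedAddCommGroup X] {w : E n → X} (h : SqInt D w)
    (a : E n) {ε : ℝ} (hε : 0 < ε) :
    SqInt ((fun y => a + ε • y) ⁻¹' D) (fun y => w (a + ε • y)) := by
  have hm := measurableEmbedding_affine a hε
  refine (hm.memLp_map_measure_iff (g := w)).1 ?_
  rw [← hm.restrict_map, map_affine a hε, Measure.restrict_smul]
  exact h.smul_measure ENNReal.ofReal_ne_top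

theorem SobolevOn.comp_affine (h : SobolevOn D u G) (a : E n) {ε : ℝ} (hε : 0 < ε) :
    SobolevOn ((fun y => a + ε • y) ⁻¹' D) (fun y => u (a + ε • y))
      (fun i y => ε * G i (a + ε • y)) := by
  refine ⟨h.sqInt.comp_affine a hε, fun i => ((h.sqInt_grad i).comp_affine a hε).const_mul ε,
    fun η h1 h2 h3 i => ?_⟩
  set D' := (fun y => a + ε • y) ⁻¹' D with hD'
  have hη : IsTest D' η := ⟨h1, h2, h3⟩
  let e : E n ≃ₜ E n := (Homeomorph.addRight (-a)).trans (Homeomorph.smulOfNeZero ε⁻¹ (inv_ne_zero hε.ne'))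
  have he : ∀ x, e x = ε⁻¹ • (x - a) := fun x => by simp [e, sub_eq_add_neg]
  have he2 : ∀ y, e (a + ε • y) = y := fun y => by
    rw [he, add_sub_cancel_left, smul_smul, inv_mul_cancel₀ hε.ne', one_smul]
  let ζ : E n → ℝ := fun x => η (e x)
  have hζ : IsTest D ζ := by
    refine ⟨?_, h2.comp_homeomorph e, ?_⟩
    · have : ζ = fun x => η (ε⁻¹ • (x - a)) := by ext x; simp [ζ, he]
      rw [this]
      exact h1.comp ((contDiff_id.sub contDiff_const).const_smul ε⁻¹)
    · have hs : tsupport ζ = e ⁻¹' tsupport η := tsupport_comp_eq_preimage η e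
      rw [hs]
      intro x hx
      have : a + ε • e x ∈ D := h3 hx
      rwa [he, smul_smul, mul_inv_cancel₀ hε.ne', one_smul, add_sub_cancel] at this
  have hpd : ∀ y, Unfolding.pderiv i ζ (a + ε • y) = ε⁻¹ * Unfolding.pderiv i η y := by
    intro y
    have d1 : HasFDerivAt η (fderiv ℝ η (e (a + ε • y))) (e (a + ε • y)) :=
      ((h1.differentiable (by simp)) _).hasFDerivAt
    have d2 : HasFDerivAt (fun x => e x) (ε⁻¹ • ContinuousLinearMap.id ℝ (E n)) (a + ε • y) := by
      have : (fun x => e x) = fun x => ε⁻¹ • (x - a) := by ext1 x; exact he x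
      rw [this]
      exact ((hasFDerivAt_id _).sub_const a).const_smul ε⁻¹
    have d3 : HasFDerivAt ζ _ (a + ε • y) := d1.comp (a + ε • y) d2
    simp only [Unfolding.pderiv, d3.fderiv]
    rw [he2]
    simp
  have hw := h.weak ζ hζ.1 hζ.2 hζ.3 i
  rw [(hζ.pderiv i).setIntegral_smul, hζ.setIntegral_smul] at hw
  rw [(hη.pderiv i).setIntegral_smul, hη.setIntegral_smul]
  simp only [smul_eq_mul] at hw ⊢
  have i1 := integral_affine a hε fun x => Unfolding.pderiv i ζ x * u x
  have i2 := integral_affine a hε fun x => ζ x * G i x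
  simp only [hpd] at i1
  have hζη : ∀ y, ζ (a + ε • y) = η y := fun y => by simp only [ζ, he2]
  simp only [hζη] at i2
  rw [hw] at i1
  have e1 : ∫ y, ε⁻¹ * Unfolding.pderiv i η y * u (a + ε • y)
      = ε⁻¹ * ∫ y, Unfolding.pderiv i η y * u (a + ε • y) := by
    rw [← integral_const_mul]; congr 1; ext y; ring
  have e2 : ∫ y, η y * (ε * G i (a + ε • y)) = ε * ∫ y, η y * G i (a + ε • y) := by
    rw [← integral_const_mul]; congr 1; ext y; ring
  rw [e2, i2]
  rw [e1] at i1
  field_simp at i1 ⊢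
  linarith

end Calculus

end

section

open Filter Topology
open scoped ENNReal NNReal

variable {n : ℕ}

/-! ### The cone property of Lipschitz domains -/

/-- Near `x₀`, the set `Ω` contains the cones of axis `e` and opening `ρ` attached to its points. -/
def ConeAt (Ω : Set (E n)) (x₀ e : E n) (r ρ : ℝ) : Prop :=
  ∀ y ∈ Ω, ‖y - x₀‖ ≤ 2 * r → ∀ t : ℝ, 0 ≤ t → t ≤ r → ∀ z : E n, ‖z‖ ≤ ρ → y + t • (e + z) ∈ Ω

/-- At a boundary point, a step t(e + z) raises the height by at least t(1 − ‖z‖) while the graph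
rises by at most Lt‖z‖, so openings up to 1/(L + 1) are admissible. At an interior point a small
ball does the job, with axis 0 and opening 1. -/
theorem HasLipschitzBoundary.exists_coneAt {Ω : Set (E n)} (hopen : IsOpen Ω)
    (h : HasLipschitzBoundary Ω) {x₀ : E n} (hx₀ : x₀ ∈ closure Ω) :
    ∃ (e : E n) (r ρ : ℝ), ‖e‖ ≤ 1 ∧ 0 < r ∧ 0 < ρ ∧ ρ ≤ 1 ∧ ConeAt Ω x₀ e r ρ := by
  by_cases hin : x₀ ∈ Ω
  · obtain ⟨d, hd, hball⟩ := Metric.isOpen_iff.1 hopen x₀ hin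
    refine ⟨0, d / 4, 1, by simp, by positivity, one_pos, le_rfl, fun y _ hyx t ht htr z hz => ?_⟩
    refine hball ?_
    rw [mem_ball_iff_norm, zero_add]
    have h1 : y + t • z - x₀ = (y - x₀) + t • z := by abel
    have h2 : ‖t • z‖ ≤ d / 4 := by
      rw [norm_smul, Real.norm_of_nonneg ht]
      nlinarith [norm_nonneg z]
    rw [h1]
    linarith [norm_add_le (y - x₀) (t • z)]
  · obtain ⟨e, he, hrest⟩ := h x₀ (by rw [hopen.frontier_eq]; exact ⟨hx₀, hin⟩)
    set S := (Submodule.span ℝ {e})ᗮ with hS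
    obtain ⟨L, γ, hγ, U, hU, hΩ⟩ := hrest
    obtain ⟨d, hd, hball⟩ := Metric.mem_nhds_iff.1 hU
    have hL : (0 : ℝ) ≤ L := L.2
    have hρ1 : 1 / ((L : ℝ) + 1) ≤ 1 := by
      rw [div_le_one (by positivity)]; linarith
    refine ⟨e, d / 5, 1 / (L + 1), he.le, by positivity, by positivity, hρ1,
      fun y hy hyx t ht htr z hz => ?_⟩
    have hz1 : ‖z‖ ≤ 1 := hz.trans hρ1
    have hyU : y ∈ U := hball (by rw [mem_ball_iff_norm]; linarith)
    have hxU : y + t • (e + z) ∈ U := hball (by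
      rw [mem_ball_iff_norm]
      have h1 : y + t • (e + z) - x₀ = (y - x₀) + t • (e + z) := by abel
      have h2 : ‖t • (e + z)‖ ≤ d / 5 * 2 := by
        rw [norm_smul, Real.norm_of_nonneg ht]
        have := norm_add_le e z
        exact mul_le_mul htr (by linarith) (norm_nonneg _) (by positivity)
      rw [h1]
      linarith [norm_add_le (y - x₀) (t • (e + z))])
    rw [hΩ _ hxU]
    have h0 := (hΩ _ hyU).1 hy
    have hpe : S.orthogonalProjectionOnto e = 0 := by
      rw [Submodule.orthogonalProjectionOnto_eq_zero_iff]
      exact Submodule.le_orthogonal_orthogonal _ (Submodule.mem_span_singleton_self e)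
    have hproj : S.orthogonalProjectionOnto (y + t • (e + z))
        = S.orthogonalProjectionOnto y + t • S.orthogonalProjectionOnto z := by
      simp [hpe]
    have h1 : γ (S.orthogonalProjectionOnto (y + t • (e + z)))
        ≤ γ (S.orthogonalProjectionOnto y) + L * (t * ‖z‖) := by
      have := hγ.dist_le_mul (S.orthogonalProjectionOnto (y + t • (e + z)))
        (S.orthogonalProjectionOnto y)
      rw [hproj, dist_eq_norm, dist_eq_norm, add_sub_cancel_left, norm_smul,
        Real.norm_of_nonneg ht] at this
      have h2 : ‖S.orthogonalProjectionOnto z‖ ≤ ‖z‖ :=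
        (S.orthogonalProjectionOnto).le_of_opNorm_le
          S.orthogonalProjectionOnto_norm_le z |>.trans_eq (one_mul _)
      have h3 : (L : ℝ) * (t * ‖S.orthogonalProjectionOnto z‖) ≤ L * (t * ‖z‖) := by gcongr
      rw [hproj]
      have := (abs_le.1 ((Real.norm_eq_abs _).symm.trans_le this)).2
      linarith
    have h2 : inner ℝ e (y + t • (e + z)) = inner ℝ e y + t * (1 + inner ℝ e z) := by
      rw [inner_add_right, inner_smul_right, inner_add_right, real_inner_self_eq_norm_sq, he]
      norm_num
    have h3 : -‖z‖ ≤ inner ℝ e z := by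
      have := abs_le.1 (abs_real_inner_le_norm e z)
      rw [he, one_mul] at this
      exact this.1
    have h4 : (L + 1) * ‖z‖ ≤ 1 := by
      rw [le_div_iff₀ (by positivity)] at hz
      linarith
    rw [h2]
    nlinarith [mul_nonneg ht (norm_nonneg z)]

/-- A Lipschitz vector field `N` such that `Ω` contains the cones of axis `N` attached to its
points. -/
structure ConeField (Ω : Set (E n)) (N : E n → E n) (K : ℝ≥0) (m r ρ : ℝ) : Prop where
  lip : LipschitzWith K N
  le : ∀ x, ‖N x‖ ≤ m
  one_le : 1 ≤ m
  r_pos : 0 < r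
  ρ_pos : 0 < ρ
  ρ_le : ρ ≤ 1
  cone : ∀ x, ∀ y ∈ Ω, ‖y - x‖ ≤ r → ∀ t : ℝ, 0 ≤ t → t ≤ r → ∀ z : E n, ‖z‖ ≤ ρ →
    y + t • (N x + z) ∈ Ω

theorem exists_coneCover {Ω : Set (E n)} (hopen : IsOpen Ω)
    (hb : Bornology.IsBounded Ω) (h : HasLipschitzBoundary Ω) :
    ∃ (J : Finset (E n)) (e : E n → E n) (r : E n → ℝ) (ρ r₀ : ℝ), 0 < ρ ∧ ρ ≤ 1 ∧ 0 < r₀ ∧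
      (∀ j ∈ J, ‖e j‖ ≤ 1 ∧ r₀ ≤ r j ∧ ConeAt Ω j (e j) (r j) ρ) ∧
      ∀ x ∈ closure Ω, ∃ j ∈ J, ‖x - j‖ < r j / 4 := by
  have hc : IsCompact (closure Ω) := hb.isCompact_closure
  have h1 : ∀ x : E n, ∃ (e : E n) (r ρ : ℝ), x ∈ closure Ω →
      ‖e‖ ≤ 1 ∧ 0 < r ∧ 0 < ρ ∧ ρ ≤ 1 ∧ ConeAt Ω x e r ρ := fun x => by
    by_cases hx : x ∈ closure Ω
    · obtain ⟨e, r, ρ, h⟩ := h.exists_coneAt hopen hx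
      exact ⟨e, r, ρ, fun _ => h⟩
    · exact ⟨0, 0, 0, fun h => absurd h hx⟩
  choose e r ρ her using h1
  obtain ⟨J, hJ, hcov⟩ := hc.elim_nhds_subcover (fun x => Metric.ball x (r x / 4))
    fun x hx => Metric.ball_mem_nhds _ (by have := (her x hx).2.1; positivity)
  obtain ⟨ρ₀, hρ₀, hρ₁⟩ : ∃ ρ₀ > 0, ∀ j ∈ J, ρ₀ ≤ ρ j := by
    rcases J.eq_empty_or_nonempty with rfl | hne
    · exact ⟨1, one_pos, by simp⟩
    · obtain ⟨j, hj, hmin⟩ := J.exists_min_image ρ hne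
      exact ⟨ρ j, (her j (hJ j hj)).2.2.1, hmin⟩
  obtain ⟨r₀, hr₀, hr₁⟩ : ∃ r₀ > 0, ∀ j ∈ J, r₀ ≤ r j := by
    rcases J.eq_empty_or_nonempty with rfl | hne
    · exact ⟨1, one_pos, by simp⟩
    · obtain ⟨j, hj, hmin⟩ := J.exists_min_image r hne
      exact ⟨r j, (her j (hJ j hj)).2.1, hmin⟩
  refine ⟨J, e, r, min ρ₀ 1, r₀, lt_min hρ₀ one_pos, min_le_right _ _, hr₀, fun j hj => ?_, ?_⟩
  · have := her j (hJ j hj)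
    exact ⟨this.1, hr₁ j hj, fun y hy hyj t ht htr z hz => this.2.2.2.2 y hy hyj t ht htr z
      (hz.trans ((min_le_left _ _).trans (hρ₁ j hj)))⟩
  · intro x hx
    obtain ⟨j, hj, hxj⟩ := mem_iUnion₂.1 (hcov hx)
    exact ⟨j, hj, by rw [← dist_eq_norm]; simpa using hxj⟩

/-- The field is N = Σ bⱼeⱼ with hat weights bⱼ living in the charts of a finite cone cover. A step
along N is not in any single cone, but it decomposes into steps along the axes eⱼ, each taken inside
the cone of its own chart. -/
theorem exists_coneField {Ω : Set (E n)} (hopen : IsOpen Ω)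
    (hb : Bornology.IsBounded Ω) (h : HasLipschitzBoundary Ω) :
    ∃ N K m r ρ, ConeField Ω N K m r ρ := by
  obtain ⟨J, e, r, ρ, r₀, hρ, hρ1, hr₀, hJ, hcov⟩ := exists_coneCover hopen hb h
  let b : E n → E n → ℝ := fun j x => max 0 (2 - (2 / r j) * ‖x - j‖)
  have hb0 : ∀ j x, 0 ≤ b j x := fun j x => le_max_left _ _
  have hb2 : ∀ j ∈ J, ∀ x, b j x ≤ 2 := fun j hj x => by
    have := hr₀.trans_le (hJ j hj).2.1
    have : 0 ≤ 2 / r j * ‖x - j‖ := by positivity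
    exact max_le zero_le_two (by linarith)
  have hblip : ∀ j ∈ J, LipschitzWith (Real.toNNReal (2 / r j)) (b j) := fun j hj => by
    have hr := hr₀.trans_le (hJ j hj).2.1
    refine LipschitzWith.of_dist_le_mul fun x y => ?_
    rw [Real.coe_toNNReal _ (by positivity), dist_eq_norm, Real.norm_eq_abs]
    refine (abs_max_sub_max_le_max _ _ _ _).trans ?_
    rw [sub_self, abs_zero, max_eq_right (abs_nonneg _)]
    have : 2 - 2 / r j * ‖x - j‖ - (2 - 2 / r j * ‖y - j‖) = 2 / r j * (‖y - j‖ - ‖x - j‖) := by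
      ring
    rw [this, abs_mul, abs_of_pos (by positivity)]
    gcongr
    refine (abs_norm_sub_norm_le _ _).trans_eq ?_
    rw [sub_sub_sub_cancel_right, dist_comm, dist_eq_norm]
  let N : E n → E n := fun x => ∑ j ∈ J, b j x • e j
  have hNlip : ∃ K, LipschitzWith K N := by
    refine ⟨∑ j ∈ J, Real.toNNReal (2 / r j), LipschitzWith.of_dist_le_mul fun x y => ?_⟩
    rw [dist_eq_norm, ← Finset.sum_sub_distrib, NNReal.coe_sum, Finset.sum_mul]
    refine (norm_sum_le _ _).trans (Finset.sum_le_sum fun j hj => ?_)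
    rw [← sub_smul, norm_smul]
    have := (hblip j hj).dist_le_mul x y
    rw [Real.dist_eq] at this
    calc ‖b j x - b j y‖ * ‖e j‖ ≤ ‖b j x - b j y‖ * 1 :=
          mul_le_mul_of_nonneg_left (hJ j hj).1 (norm_nonneg _)
      _ ≤ _ := by rw [mul_one]; exact this
  obtain ⟨K, hK⟩ := hNlip
  have hNle : ∀ x, ‖N x‖ ≤ 2 * J.card + 1 := fun x => by
    refine (norm_sum_le _ _).trans ?_
    have : ∀ j ∈ J, ‖b j x • e j‖ ≤ 2 := fun j hj => by
      rw [norm_smul, Real.norm_of_nonneg (hb0 j x)]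
      have := (hJ j hj).1
      nlinarith [hb0 j x, hb2 j hj x, norm_nonneg (e j)]
    refine (Finset.sum_le_card_nsmul _ _ _ this).trans ?_
    rw [nsmul_eq_mul]; linarith
  -- Each partial step has length at most 4t ≤ 4q, so all the intermediate points stay within q +
  -- 4q|J| ≤ r₀ of x, and hence within 2rⱼ of the centre of every chart whose weight at x is
  -- nonzero.
  set q := r₀ / (4 * J.card + 4) with hq
  have hq0 : 0 < q := by positivity
  have hqr : q * (4 * J.card + 4) = r₀ := by rw [hq]; field_simp
  have hq4 : 4 * q ≤ r₀ := by nlinarith [mul_nonneg hq0.le (Nat.cast_nonneg (α := ℝ) J.card)]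
  refine ⟨N, K, 2 * J.card + 1, q, ρ, hK, hNle, by
    have : (0 : ℝ) ≤ J.card := Nat.cast_nonneg _
    linarith, hq0, hρ, hρ1, ?_⟩
  intro x y hy hyx t ht htq z hz
  obtain ⟨j₀, hj₀, hxj₀⟩ := hcov y (subset_closure hy)
  set B := ∑ j ∈ J, b j x with hB
  have hB1 : 1 ≤ B := by
    have h1 : 1 ≤ b j₀ x := by
      refine le_max_of_le_right ?_
      have hr := hr₀.trans_le (hJ j₀ hj₀).2.1
      have : ‖x - j₀‖ ≤ r j₀ / 2 := by
        have h2 : x - j₀ = (y - j₀) - (y - x) := by abel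
        rw [h2]
        have := norm_sub_le (y - j₀) (y - x)
        have := (hJ j₀ hj₀).2.1
        linarith
      have : 2 / r j₀ * ‖x - j₀‖ ≤ 2 / r j₀ * (r j₀ / 2) := by gcongr
      have h3 : 2 / r j₀ * (r j₀ / 2) = 1 := by field_simp
      linarith
    exact h1.trans (Finset.single_le_sum (f := fun j => b j x) (fun j _ => hb0 j x) hj₀)
  have hBz : ‖B⁻¹ • z‖ ≤ ρ := by
    rw [norm_smul, Real.norm_of_nonneg (by positivity)]
    exact (mul_le_of_le_one_left (norm_nonneg _) (inv_le_one_of_one_le₀ hB1)).trans hz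
  -- The perturbation z is shared out in proportion to the weights: since B = Σ bⱼ ≥ 1, the steps
  -- tbⱼ(eⱼ + z/B) add up to t(N + z), and z/B is no longer than z.
  have key : ∀ I ⊆ J, y + ∑ j ∈ I, (t * b j x) • (e j + B⁻¹ • z) ∈ Ω ∧
      ‖∑ j ∈ I, (t * b j x) • (e j + B⁻¹ • z)‖ ≤ I.card * (4 * t) := by
    classical
    intro I
    induction I using Finset.induction_on with
    | empty => intro _; simpa using hy
    | insert a I ha ih =>
      intro hI
      have haJ : a ∈ J := hI (Finset.mem_insert_self _ _)
      obtain ⟨h1, h2⟩ := ih fun j hj => hI (Finset.mem_insert_of_mem hj)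
      have hcard : ((I.card : ℝ)) ≤ J.card := by
        exact_mod_cast Finset.card_le_card fun j hj => hI (Finset.mem_insert_of_mem hj)
      have hJa := hJ a haJ
      rw [Finset.sum_insert ha, Finset.card_insert_of_notMem ha]
      have hterm : ‖(t * b a x) • (e a + B⁻¹ • z)‖ ≤ 4 * t := by
        rw [norm_smul, Real.norm_of_nonneg (mul_nonneg ht (hb0 a x))]
        have h3 : ‖e a + B⁻¹ • z‖ ≤ 2 := (norm_add_le _ _).trans (by linarith [hJa.1])
        have h4 : t * b a x ≤ t * 2 := mul_le_mul_of_nonneg_left (hb2 a haJ x) ht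
        calc t * b a x * ‖e a + B⁻¹ • z‖ ≤ t * 2 * 2 :=
              mul_le_mul h4 h3 (norm_nonneg _) (by positivity)
          _ = 4 * t := by ring
      constructor
      · by_cases hba : b a x = 0
        · simpa [hba] using h1
        have hxa : ‖x - a‖ < r a := by
          by_contra hc
          push Not at hc
          refine hba (max_eq_left ?_)
          have hr := hr₀.trans_le hJa.2.1
          have : 2 / r a * r a ≤ 2 / r a * ‖x - a‖ := by gcongr
          have h3 : 2 / r a * r a = 2 := by field_simp
          linarith
        have h5 : y + ((t * b a x) • (e a + B⁻¹ • z) + ∑ j ∈ I, (t * b j x) • (e j + B⁻¹ • z))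
            = (y + ∑ j ∈ I, (t * b j x) • (e j + B⁻¹ • z)) + (t * b a x) • (e a + B⁻¹ • z) := by
          abel
        rw [h5]
        refine hJa.2.2 _ h1 ?_ _ (mul_nonneg ht (hb0 a x)) ?_ _ hBz
        · have h6 : y + ∑ j ∈ I, (t * b j x) • (e j + B⁻¹ • z) - a
              = (y - x) + (x - a) + ∑ j ∈ I, (t * b j x) • (e j + B⁻¹ • z) := by abel
          rw [h6]
          have h7 : (I.card : ℝ) * (4 * t) ≤ J.card * (4 * q) := by gcongr
          have := norm_add₃_le (a := y - x) (b := x - a)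
            (c := ∑ j ∈ I, (t * b j x) • (e j + B⁻¹ • z))
          nlinarith [hJa.2.1]
        · have := hb2 a haJ x
          have := hJa.2.1
          nlinarith
      · refine (norm_add_le _ _).trans ?_
        push_cast
        linarith
  have hfin := (key J subset_rfl).1
  have hsum : ∑ j ∈ J, (t * b j x) • (e j + B⁻¹ • z) = t • (N x + z) := by
    simp only [mul_smul, smul_add, Finset.sum_add_distrib, ← Finset.smul_sum]
    congr 1
    rw [← Finset.sum_smul, ← hB, smul_smul B, mul_inv_cancel₀ (by positivity), one_smul]
  rwa [hsum] at hfin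

end

section

open Filter Topology
open scoped ENNReal NNReal

variable {n : ℕ}

/-! ### The hitting time of a Lipschitz domain along a transversal field -/

/-- Replacing y by a nearby w in Ω changes the direction by (y − w)/t, which is absorbed by giving
up half of the opening; this is why t must be positive. -/
theorem ConeField.cone_closure {Ω : Set (E n)} {N : E n → E n} {K : ℝ≥0} {m r ρ : ℝ}
    (h : ConeField Ω N K m r ρ) {x y : E n} (hy : y ∈ closure Ω) (hyx : ‖y - x‖ ≤ 3 * r / 4)
    {t : ℝ} (ht : 0 < t) (htr : t ≤ r) {z : E n} (hz : ‖z‖ ≤ ρ / 2) : y + t • (N x + z) ∈ Ω := by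
  have hr := h.r_pos
  have hρ := h.ρ_pos
  obtain ⟨w, hw, hwy⟩ := Metric.mem_closure_iff.1 hy (min (t * (ρ / 2)) (r / 4)) (by positivity)
  rw [lt_min_iff, dist_eq_norm] at hwy
  have h1 : y + t • (N x + z) = w + t • (N x + (z + t⁻¹ • (y - w))) := by
    simp only [smul_add, smul_smul, mul_inv_cancel₀ ht.ne', one_smul]
    abel
  rw [h1]
  refine h.cone x w hw ?_ t ht.le htr _ ?_
  · have : w - x = (y - x) - (y - w) := by abel
    rw [this]
    linarith [norm_sub_le (y - x) (y - w)]
  · refine (norm_add_le _ _).trans ?_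
    rw [norm_smul, norm_inv, Real.norm_of_nonneg ht.le]
    have : t⁻¹ * ‖y - w‖ ≤ ρ / 2 := by
      rw [inv_mul_le_iff₀ ht]; exact hwy.1.le
    linarith

/-- A Lipschitz vector field `N` transversal to the boundary of `Ω`, together with the (Lipschitz)
time `σ` that a point of a neighbourhood of `Ω` needs to reach `Ω` in the direction of `N`. -/
structure TransversalField (Ω : Set (E n)) (N : E n → E n) (σ : E n → ℝ) (K : ℝ≥0)
    (m r ρ : ℝ) : Prop where
  N_lip : LipschitzWith K N
  σ_lip : LipschitzWith K σ
  N_le : ∀ x, ‖N x‖ ≤ m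
  one_le : 1 ≤ m
  r_pos : 0 < r
  ρ_pos : 0 < ρ
  ρ_le : ρ ≤ 1
  σ_nonneg : ∀ x ∈ Metric.thickening r Ω, 0 ≤ σ x
  σ_le : ∀ x ∈ Metric.thickening r Ω, ρ * σ x ≤ Metric.infDist x Ω
  σ_zero : ∀ x ∈ Ω, σ x = 0
  frontier : ∀ x ∈ Metric.thickening r Ω, x ∉ Ω → x + σ x • N x ∈ frontier Ω
  cone : ∀ x ∈ Metric.thickening r Ω, ∀ t : ℝ, 0 < t → t ≤ r → ∀ z : E n, ‖z‖ ≤ ρ →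
    x + σ x • N x + t • (N x + z) ∈ Ω

/-- The time σ is the first s ≥ 0 with x + sN(x) in Ω. It is Lipschitz because, from the hitting
point of x, a further time proportional to |x' − x| along N(x') leads into Ω. Off the neighbourhood
where hitting is guaranteed, σ is an arbitrary Lipschitz extension. -/
theorem ConeField.exists_transversalField {Ω : Set (E n)} (hopen : IsOpen Ω) (hne : Ω.Nonempty)
    {N : E n → E n} {K : ℝ≥0} {m r ρ : ℝ} (h : ConeField Ω N K m r ρ) :
    ∃ σ K' r' ρ', TransversalField Ω N σ K' m r' ρ' := by
  have hr := h.r_pos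
  have hρ := h.ρ_pos
  have hm : 0 < m := one_pos.trans_le h.one_le
  -- Small enough that the hitting time s satisfies sm ≤ r/4: the hitting point then remains where
  -- the cones of axis N(x) are available.
  set r' := ρ * r / (8 * m) with hr'
  have hr'0 : 0 < r' := by positivity
  have hr'm : r' * (8 * m) = ρ * r := by rw [hr']; field_simp
  have hr'8 : 8 * r' ≤ ρ * r := by nlinarith [h.one_le]
  have hρr : ρ * r ≤ r := mul_le_of_le_one_left hr.le h.ρ_le
  let S : E n → Set ℝ := fun x => {s | 0 ≤ s ∧ x + s • N x ∈ Ω}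
  let s : E n → ℝ := fun x => sInf (S x)
  have hbdd : ∀ x, BddBelow (S x) := fun x => ⟨0, fun t ht => ht.1⟩
  have hs0 : ∀ x, 0 ≤ s x := fun x => Real.sInf_nonneg fun t ht => ht.1
  -- If y in Ω is closer than d, then x + (d/ρ)N(x) is y plus a step of length parameter d/ρ in the
  -- direction N(x) + (ρ/d)(x − y), whose perturbation is at most ρ. So the hitting time is at most
  -- dist(x, Ω)/ρ.
  have hit : ∀ x d, 0 < d → d ≤ ρ * r → (∃ y ∈ Ω, dist x y < d) → d / ρ ∈ S x := by
    rintro x d hd hdr ⟨y, hy, hxy⟩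
    refine ⟨by positivity, ?_⟩
    have e : x + (d / ρ) • N x = y + (d / ρ) • (N x + (d / ρ)⁻¹ • (x - y)) := by
      rw [smul_add, smul_smul, mul_inv_cancel₀ (by positivity), one_smul]
      abel
    rw [e]
    rw [dist_eq_norm] at hxy
    refine h.cone x y hy (by rw [norm_sub_rev]; linarith) _ (by positivity) ?_ _ ?_
    · rw [div_le_iff₀ hρ]; linarith
    · rw [norm_smul, norm_inv, Real.norm_of_nonneg (by positivity), inv_mul_le_iff₀ (by positivity),
        div_mul_cancel₀ _ hρ.ne']
      exact hxy.le
  have hSne : ∀ x ∈ Metric.thickening r' Ω, (S x).Nonempty := fun x hx =>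
    ⟨_, hit x r' hr'0 (by linarith) (Metric.mem_thickening_iff.1 hx)⟩
  have hsle : ∀ x ∈ Metric.thickening r' Ω, ρ * s x ≤ Metric.infDist x Ω := by
    intro x hx
    rw [← le_div_iff₀' hρ]
    have hlt := (Metric.mem_thickening_iff_infDist_lt hne).1 hx
    refine le_of_forall_gt_imp_ge_of_dense fun a ha => ?_
    rw [div_lt_iff₀ hρ] at ha
    have hd0 : 0 ≤ Metric.infDist x Ω := Metric.infDist_nonneg
    rcases le_total (a * ρ) r' with h1 | h1
    · have := csInf_le (hbdd x) (hit x (a * ρ) (hd0.trans_lt ha) (by linarith)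
        ((Metric.infDist_lt_iff hne).1 ha))
      rwa [mul_div_assoc, div_self hρ.ne', mul_one] at this
    · refine (csInf_le (hbdd x) (hit x r' hr'0 (by linarith)
        (Metric.mem_thickening_iff.1 hx))).trans ?_
      rw [div_le_iff₀ hρ]; exact h1
  have hsm : ∀ x ∈ Metric.thickening r' Ω, s x * m ≤ r / 4 ∧ s x ≤ r := by
    intro x hx
    have h1 := hsle x hx
    have hlt := (Metric.mem_thickening_iff_infDist_lt hne).1 hx
    have h2 : ρ * (s x * (8 * m)) ≤ ρ * r := by
      nlinarith
    have h3 := le_of_mul_le_mul_left h2 hρ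
    constructor
    · linarith [hs0 x, mul_nonneg (hs0 x) hm.le]
    · nlinarith [hs0 x, h.one_le]
  have hscl : ∀ x ∈ Metric.thickening r' Ω, x + s x • N x ∈ closure Ω := by
    intro x hx
    have h1 : s x ∈ closure (S x) := csInf_mem_closure (hSne x hx) (hbdd x)
    have h2 : Continuous fun t : ℝ => x + t • N x := by fun_prop
    exact map_mem_closure (f := fun t : ℝ => x + t • N x) h2 h1 fun t ht => ht.2
  have hsnorm : ∀ x ∈ Metric.thickening r' Ω, ‖s x • N x‖ ≤ r / 4 := fun x hx => by
    rw [norm_smul, Real.norm_of_nonneg (hs0 x)]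
    exact (mul_le_mul_of_nonneg_left (h.le x) (hs0 x)).trans (hsm x hx).1
  have hszero : ∀ x ∈ Ω, s x = 0 := fun x hx =>
    le_antisymm (csInf_le (hbdd x) ⟨le_rfl, by simpa using hx⟩) (hs0 x)
  -- Starting from the hitting point of x, the perturbation of the direction N(x') is at most (1 +
  -- rK)|x' − x|/t, which equals ρ/2 for t = C|x' − x|. When this t exceeds r, the Lipschitz bound
  -- follows from s ≤ r.
  set C := 2 * (1 + r * K) / ρ with hC
  have hC2 : 2 ≤ C := by
    rw [hC, le_div_iff₀ hρ]
    nlinarith [h.ρ_le, mul_nonneg hr.le K.2]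
  have hlip : LipschitzOnWith (Real.toNNReal C) s (Metric.thickening r' Ω) := by
    refine LipschitzOnWith.of_le_add_mul _ fun x' hx' x hx => ?_
    rw [Real.coe_toNNReal _ (by linarith)]
    rcases eq_or_ne x' x with rfl | hxx
    · simp
    have hd : 0 < dist x' x := dist_pos.2 hxx
    rcases le_or_gt (C * dist x' x) r with h1 | h1
    · set t := C * dist x' x with ht
      have ht0 : 0 < t := by positivity
      refine csInf_le (hbdd x') ⟨by linarith [hs0 x], ?_⟩
      have e : x' + (s x + t) • N x' = (x + s x • N x) +
          t • (N x' + t⁻¹ • ((x' - x) + s x • (N x' - N x))) := by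
        rw [smul_add t (N x'), smul_inv_smul₀ ht0.ne']
        module
      rw [e]
      refine h.cone_closure (hscl x hx) ?_ ht0 h1 ?_
      · have e2 : x + s x • N x - x' = s x • N x - (x' - x) := by abel
        rw [e2]
        have := norm_sub_le (s x • N x) (x' - x)
        have := hsnorm x hx
        rw [dist_eq_norm] at ht
        nlinarith [norm_nonneg (x' - x)]
      · rw [norm_smul, norm_inv, Real.norm_of_nonneg ht0.le, inv_mul_le_iff₀ ht0]
        refine (norm_add_le _ _).trans ?_
        rw [norm_smul, Real.norm_of_nonneg (hs0 x), ← dist_eq_norm, ← dist_eq_norm]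
        have h2 := h.lip.dist_le_mul x' x
        have h3 : s x * dist (N x') (N x) ≤ r * (K * dist x' x) :=
          mul_le_mul (hsm x hx).2 h2 dist_nonneg hr.le
        have h4 : t * (ρ / 2) = (1 + r * K) * dist x' x := by
          rw [ht, hC]; field_simp
        rw [h4]; linarith
    · linarith [(hsm x' hx').2, hs0 x]
  obtain ⟨σ, hσ, hσs⟩ := hlip.extend_real
  have hmem : ∀ x ∈ Ω, x ∈ Metric.thickening r' Ω := fun x hx =>
    Metric.self_subset_thickening hr'0 Ω hx
  refine ⟨σ, max K (Real.toNNReal C), r', ρ / 2, h.lip.weaken (le_max_left _ _),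
    hσ.weaken (le_max_right _ _), h.le, h.one_le, hr'0, by positivity, by linarith [h.ρ_le], ?_, ?_,
    ?_, ?_, ?_⟩
  · intro x hx; rw [← hσs hx]; exact hs0 x
  · intro x hx; rw [← hσs hx]
    nlinarith [hsle x hx, hs0 x]
  · intro x hx; rw [← hσs (hmem x hx)]; exact hszero x hx
  · intro x hx hxΩ
    rw [← hσs hx, hopen.frontier_eq]
    refine ⟨hscl x hx, fun hin => ?_⟩
    have hpos : 0 < s x := by
      refine lt_of_le_of_ne (hs0 x) fun h0 => hxΩ ?_
      rwa [← h0, zero_smul, add_zero] at hin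
    have hc : Continuous fun t : ℝ => x + t • N x := by fun_prop
    have hnh : ∀ᶠ t in 𝓝 (s x), x + t • N x ∈ Ω :=
      hc.continuousAt.eventually (hopen.mem_nhds hin)
    obtain ⟨δ, hδ, hball⟩ := Metric.eventually_nhds_iff.1 hnh
    have hlt : s x - min δ (s x) / 2 ∈ S x := by
      have h1 : 0 < min δ (s x) := lt_min hδ hpos
      have h2 := min_le_left δ (s x)
      have h3 := min_le_right δ (s x)
      refine ⟨by linarith, hball ?_⟩
      rw [Real.dist_eq, sub_sub_cancel_left, abs_neg, abs_of_pos (by linarith)]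
      linarith
    have := csInf_le (hbdd x) hlt
    have h1 : 0 < min δ (s x) := lt_min hδ hpos
    change s x ≤ _ at this
    linarith
  · intro x hx t ht htr z hz
    rw [← hσs hx]
    refine h.cone_closure (hscl x hx) ?_ ht (by linarith) hz
    rw [add_sub_cancel_left]
    linarith [hsnorm x hx]

end

section

open Filter Topology
open scoped ENNReal NNReal

variable {n : ℕ}

/-! ### Averaging kernels -/

/-- The hat function supported in the ball of radius `a`. -/
def hat (a : ℝ) (z : E n) : ℝ := max 0 (a - ‖z‖)

theorem continuous_hat (a : ℝ) : Continuous (hat a : E n → ℝ) := by unfold hat; fun_prop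

theorem hat_nonneg (a : ℝ) (z : E n) : 0 ≤ hat a z := le_max_left _ _

theorem hat_le {a : ℝ} (ha : 0 < a) (z : E n) : hat a z ≤ a :=
  max_le ha.le (by linarith [norm_nonneg z])

theorem hat_eq_zero {a : ℝ} {z : E n} (hz : a ≤ ‖z‖) : hat a z = 0 := max_eq_left (by linarith)

theorem hasCompactSupport_hat (a : ℝ) : HasCompactSupport (hat a : E n → ℝ) := by
  refine HasCompactSupport.intro (isCompact_closedBall 0 a) fun z hz => hat_eq_zero ?_
  simp only [mem_closedBall_iff_norm, sub_zero, not_le] at hz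
  exact hz.le

theorem hat_sub_le (a b : ℝ) (z w : E n) : |hat a z - hat b w| ≤ |a - b| + ‖z - w‖ := by
  refine (abs_max_sub_max_le_max _ _ _ _).trans ?_
  rw [sub_self, abs_zero, max_eq_right (abs_nonneg _)]
  have : a - ‖z‖ - (b - ‖w‖) = (a - b) - (‖z‖ - ‖w‖) := by ring
  rw [this]
  exact (abs_sub _ _).trans (add_le_add le_rfl (abs_norm_sub_norm_le _ _))

/-- The mass of the hat function. -/
def hatMass (n : ℕ) (a : ℝ) : ℝ := ∫ z : E n, hat a z

theorem integrable_hat (a : ℝ) : Integrable (hat a : E n → ℝ) :=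
  (continuous_hat a).integrable_of_hasCompactSupport (hasCompactSupport_hat a)

theorem hatMass_pos {a : ℝ} (ha : 0 < a) : 0 < hatMass n a := by
  refine (continuous_hat a).integral_pos_of_hasCompactSupport_nonneg_nonzero
    (hasCompactSupport_hat a) (hat_nonneg a) (x := 0) ?_
  simp [hat, max_eq_right ha.le, ha.ne']

/-- The averaging kernel of centre `c` and radius `a t`. -/
def kern (a : ℝ) (c : E n) (t : ℝ) (w : E n) : ℝ :=
  (hatMass n a)⁻¹ * (t ^ (n + 1))⁻¹ * hat (a * t) (w - c)

theorem hat_scale {a t : ℝ} (ht : 0 < t) (z : E n) : hat (a * t) (t • z) = t * hat a z := by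
  simp only [hat, norm_smul, Real.norm_of_nonneg ht.le]
  rw [mul_max_of_nonneg _ _ ht.le]
  ring_nf

theorem kern_affine {a t : ℝ} (ht : 0 < t) (c z : E n) :
    kern a c t (c + t • z) = (t ^ n)⁻¹ * ((hatMass n a)⁻¹ * hat a z) := by
  rw [kern, add_sub_cancel_left, hat_scale ht]
  field_simp
  ring

theorem kern_nonneg {a t : ℝ} (ha : 0 < a) (ht : 0 < t) (c w : E n) : 0 ≤ kern a c t w := by
  have := hatMass_pos (n := n) ha
  have := hat_nonneg (a * t) (w - c)
  unfold kern; positivity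

theorem kern_eq_zero {a t : ℝ} {c w : E n} (h : a * t ≤ ‖w - c‖) : kern a c t w = 0 := by
  rw [kern, hat_eq_zero h, mul_zero]

theorem kern_le {a t : ℝ} (ha : 0 < a) (ht : 0 < t) (c w : E n) :
    kern a c t w ≤ (hatMass n a)⁻¹ * a * (t ^ n)⁻¹ := by
  have h1 := hatMass_pos (n := n) ha
  have h2 := hat_le (mul_pos ha ht) (w - c)
  unfold kern
  calc (hatMass n a)⁻¹ * (t ^ (n + 1))⁻¹ * hat (a * t) (w - c)
      ≤ (hatMass n a)⁻¹ * (t ^ (n + 1))⁻¹ * (a * t) := by gcongr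
    _ = _ := by field_simp; ring

theorem continuous_kern (a : ℝ) (c : E n) (t : ℝ) : Continuous (kern a c t) := by
  unfold kern
  exact continuous_const.mul ((continuous_hat _).comp (by fun_prop))

/-- The weighted average of `f` around `c`. -/
def wavg (a : ℝ) (c : E n) (t : ℝ) (f : E n → ℝ) : ℝ := ∫ w, kern a c t w * f w

theorem wavg_eq {a t : ℝ} (ht : 0 < t) (c : E n) (f : E n → ℝ) :
    wavg a c t f = (hatMass n a)⁻¹ * ∫ z, hat a z * f (c + t • z) := by
  have := integral_affine c ht fun w => kern a c t w * f w
  simp only [kern_affine ht] at this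
  rw [wavg]
  have e : ∫ z : E n, (t ^ n)⁻¹ * ((hatMass n a)⁻¹ * hat a z) * f (c + t • z)
      = (t ^ n)⁻¹ * ((hatMass n a)⁻¹ * ∫ z : E n, hat a z * f (c + t • z)) := by
    rw [← integral_const_mul, ← integral_const_mul]; congr 1; ext z; ring
  rw [e] at this
  exact (mul_left_cancel₀ (inv_ne_zero (pow_pos ht n).ne') this).symm

theorem integral_kern {a t : ℝ} (ha : 0 < a) (ht : 0 < t) (c : E n) : ∫ w, kern a c t w = 1 := by
  have := wavg_eq (a := a) ht c fun _ => 1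
  simp only [wavg, mul_one] at this
  rw [this]
  exact inv_mul_cancel₀ (hatMass_pos ha).ne'

theorem sqInt_of_le_of_support {S : Set (E n)} {k : E n → ℝ} (hk : Continuous k) {M : ℝ}
    (hM : ∀ w, |k w| ≤ M) (hS : volume S ≠ ⊤) : SqInt S k := by
  have : IsFiniteMeasure ((volume : Measure (E n)).restrict S) :=
    ⟨by rw [Measure.restrict_apply_univ]; exact hS.lt_top⟩
  exact MemLp.of_bound hk.aestronglyMeasurable M (.of_forall hM)

theorem sq_le_of_bound {S : Set (E n)} {k : E n → ℝ} {M : ℝ} (hM : ∀ w, |k w| ≤ M) :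
    sq S k ≤ ENNReal.ofReal (M ^ 2) * volume S := by
  rw [sq, ← setLIntegral_const]
  refine lintegral_mono fun w => ?_
  have h0 : 0 ≤ M := (abs_nonneg _).trans (hM w)
  rw [← ofReal_norm, ← ENNReal.ofReal_pow (norm_nonneg _)]
  exact ENNReal.ofReal_le_ofReal (pow_le_pow_left₀ (norm_nonneg _) (hM w) 2)

theorem sq_setIntegral_mul_le {S : Set (E n)} {k g : E n → ℝ} (hk : Continuous k) {M : ℝ}
    (hM : ∀ w, |k w| ≤ M) (hS : volume S ≠ ⊤) (hg : SqInt S g) :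
    ENNReal.ofReal ((∫ w in S, k w * g w) ^ 2) ≤ ENNReal.ofReal (M ^ 2) * volume S * sq S g := by
  have hki := sqInt_of_le_of_support hk hM hS
  have h1 := abs_integral_mul_le hki hg
  have h2 : (∫ w in S, k w * g w) ^ 2 ≤ nrm S k ^ 2 * nrm S g ^ 2 := by
    rw [← mul_pow, ← sq_abs]
    exact pow_le_pow_left₀ (abs_nonneg _) h1 2
  refine (ENNReal.ofReal_le_ofReal h2).trans ?_
  rw [ENNReal.ofReal_mul (sq_nonneg _), ← sq_eq_ofReal hki, ← sq_eq_ofReal hg]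
  gcongr
  exact sq_le_of_bound hM

theorem volume_ball_scale (c : E n) {s : ℝ} (hs : 0 < s) :
    volume (Metric.ball c s) = ENNReal.ofReal (s ^ n) * volume (Metric.ball (0 : E n) 1) := by
  rw [Measure.addHaar_ball_of_pos _ _ hs]
  simp

theorem wavg_eq_setIntegral {a t b : ℝ} {c : E n} (hb : a * t ≤ b) (f : E n → ℝ) :
    wavg a c t f = ∫ w in Metric.ball c b, kern a c t w * f w := by
  rw [wavg, setIntegral_eq_integral_of_forall_compl_eq_zero]
  intro w hw
  rw [mem_ball_iff_norm, not_lt] at hw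
  rw [kern_eq_zero (hb.trans hw), zero_mul]

theorem abs_kern_le {a t : ℝ} (ha : 0 < a) (ht : 0 < t) (c w : E n) :
    |kern a c t w| ≤ (hatMass n a)⁻¹ * a * (t ^ n)⁻¹ := by
  rw [abs_of_nonneg (kern_nonneg ha ht c w)]; exact kern_le ha ht c w

/-- Cauchy–Schwarz with a kernel of size t⁻ⁿ on a ball of volume of order tⁿ. The ball has twice the
radius of the support of the kernel, so that the same ball also serves for kernels with slightly
different parameters. -/
theorem exists_wavg_sq_le {a : ℝ} (ha : 0 < a) : ∃ C : ℝ, 0 ≤ C ∧ ∀ (c : E n) (t : ℝ) (f : E n → ℝ),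
    0 < t → SqInt (Metric.ball c (2 * a * t)) f →
    ENNReal.ofReal (wavg a c t f ^ 2) ≤
      ENNReal.ofReal (C * (t ^ n)⁻¹) * sq (Metric.ball c (2 * a * t)) f := by
  have hv : volume (Metric.ball (0 : E n) 1) ≠ ⊤ := measure_ball_lt_top.ne
  set V := (volume (Metric.ball (0 : E n) 1)).toReal with hV
  refine ⟨((hatMass n a)⁻¹ * a) ^ 2 * ((2 * a) ^ n * V), by positivity, fun c t f ht hf => ?_⟩
  rw [wavg_eq_setIntegral (b := 2 * a * t) (by nlinarith [mul_pos ha ht])]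
  refine (sq_setIntegral_mul_le (continuous_kern a c t) (abs_kern_le ha ht c)
    measure_ball_lt_top.ne hf).trans ?_
  gcongr
  rw [volume_ball_scale c (by positivity), ← ENNReal.ofReal_toReal hv, ← hV,
    ← ENNReal.ofReal_mul (by positivity), ← ENNReal.ofReal_mul (by positivity)]
  refine ENNReal.ofReal_le_ofReal (le_of_eq ?_)
  rw [mul_pow _ t n]
  field_simp

/-- The kernel is Lipschitz in its centre and its scale, with constant of order t⁻ⁿ⁻¹; the condition
4h ≤ at keeps t and t' comparable. -/
theorem exists_kern_sub_le {a : ℝ} (ha : 0 < a) (ha1 : a ≤ 1) : ∃ C : ℝ, 0 ≤ C ∧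
    ∀ (c c' : E n) (t t' h : ℝ), 0 < t → |t - t'| ≤ h → ‖c - c'‖ ≤ h → 4 * h ≤ a * t →
      ∀ w, |kern a c t w - kern a c' t' w| ≤ C * h * (t ^ (n + 1))⁻¹ := by
  have hQ := hatMass_pos (n := n) ha
  refine ⟨(hatMass n a)⁻¹ * (((n + 1 : ℕ) : ℝ) * 2 ^ n * 2 ^ (n + 1) + 2 ^ (n + 1) * 2),
    by positivity, fun c c' t t' h ht htt hcc hht w => ?_⟩
  have h0 : 0 ≤ h := (abs_nonneg _).trans htt
  have hat1 : a * t ≤ t := mul_le_of_le_one_left ht.le ha1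
  have ht1 : t / 2 ≤ t' := by have := abs_le.1 htt; linarith
  have ht2 : t' ≤ 2 * t := by have := abs_le.1 htt; linarith
  have ht' : 0 < t' := by linarith
  have e : kern a c t w - kern a c' t' w = (hatMass n a)⁻¹ *
      (((t ^ (n + 1))⁻¹ - (t' ^ (n + 1))⁻¹) * hat (a * t) (w - c) +
        (t' ^ (n + 1))⁻¹ * (hat (a * t) (w - c) - hat (a * t') (w - c'))) := by
    unfold kern; ring
  have hinv : (t' ^ (n + 1))⁻¹ ≤ 2 ^ (n + 1) * (t ^ (n + 1))⁻¹ := by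
    have : (t / 2) ^ (n + 1) ≤ t' ^ (n + 1) := pow_le_pow_left₀ (by positivity) ht1 _
    calc (t' ^ (n + 1))⁻¹ ≤ ((t / 2) ^ (n + 1))⁻¹ := by gcongr
      _ = _ := by rw [div_pow]; field_simp
  have hpow : |t' ^ (n + 1) - t ^ (n + 1)| ≤ h * ((n + 1 : ℕ) : ℝ) * (2 * t) ^ n := by
    have := abs_pow_sub_pow_le t' t (n + 1)
    refine this.trans ?_
    rw [abs_of_pos ht, abs_of_pos ht', abs_sub_comm, Nat.add_sub_cancel]
    have : max t' t ≤ 2 * t := max_le ht2 (by linarith)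
    gcongr
  have h1 : |(t ^ (n + 1))⁻¹ - (t' ^ (n + 1))⁻¹| * hat (a * t) (w - c)
      ≤ ((n + 1 : ℕ) : ℝ) * 2 ^ n * 2 ^ (n + 1) * h * (t ^ (n + 1))⁻¹ := by
    have e2 : (t ^ (n + 1))⁻¹ - (t' ^ (n + 1))⁻¹
        = (t' ^ (n + 1) - t ^ (n + 1)) * ((t ^ (n + 1))⁻¹ * (t' ^ (n + 1))⁻¹) := by
      field_simp
    rw [e2, abs_mul, abs_of_pos (a := (t ^ (n + 1))⁻¹ * (t' ^ (n + 1))⁻¹) (by positivity)]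
    have h3 := (hat_le (mul_pos ha ht) (w - c)).trans hat1
    calc |t' ^ (n + 1) - t ^ (n + 1)| * ((t ^ (n + 1))⁻¹ * (t' ^ (n + 1))⁻¹) * hat (a * t) (w - c)
        ≤ h * ((n + 1 : ℕ) : ℝ) * (2 * t) ^ n *
          ((t ^ (n + 1))⁻¹ * (2 ^ (n + 1) * (t ^ (n + 1))⁻¹)) * t := by
          gcongr
          exact hat_nonneg _ _
      _ = _ := by rw [mul_pow]; field_simp; ring
  have h2 : (t' ^ (n + 1))⁻¹ * |hat (a * t) (w - c) - hat (a * t') (w - c')|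
      ≤ 2 ^ (n + 1) * 2 * h * (t ^ (n + 1))⁻¹ := by
    have h3 : |hat (a * t) (w - c) - hat (a * t') (w - c')| ≤ 2 * h := by
      refine (hat_sub_le _ _ _ _).trans ?_
      rw [← mul_sub, abs_mul, abs_of_pos ha]
      have e3 : w - c - (w - c') = -(c - c') := by abel
      rw [e3, norm_neg]
      have : a * |t - t'| ≤ 1 * |t - t'| := by gcongr
      linarith
    calc (t' ^ (n + 1))⁻¹ * |hat (a * t) (w - c) - hat (a * t') (w - c')|
        ≤ 2 ^ (n + 1) * (t ^ (n + 1))⁻¹ * (2 * h) := by gcongr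
      _ = _ := by ring
  rw [e, abs_mul, abs_of_pos (inv_pos.2 hQ)]
  have h4 := abs_add_le (((t ^ (n + 1))⁻¹ - (t' ^ (n + 1))⁻¹) * hat (a * t) (w - c))
    ((t' ^ (n + 1))⁻¹ * (hat (a * t) (w - c) - hat (a * t') (w - c')))
  rw [abs_mul, abs_mul, abs_of_nonneg (hat_nonneg _ _),
    abs_of_pos (a := (t' ^ (n + 1))⁻¹) (by positivity)] at h4
  calc (hatMass n a)⁻¹ * _ ≤ (hatMass n a)⁻¹ * (((n + 1 : ℕ) : ℝ) * 2 ^ n * 2 ^ (n + 1) * h *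
        (t ^ (n + 1))⁻¹ + 2 ^ (n + 1) * 2 * h * (t ^ (n + 1))⁻¹) := by
        gcongr
        exact h4.trans (add_le_add h1 h2)
    _ = _ := by ring

/-- The variation of weighted averages is controlled by the gradient. -/
theorem exists_wavg_sub_sq_le {a : ℝ} (ha : 0 < a) (ha1 : a ≤ 1) : ∃ C : ℝ, 0 ≤ C ∧
    ∀ (c c' : E n) (t t' h : ℝ) (f : E n → ℝ) (G : Fin n → E n → ℝ), 0 < t → |t - t'| ≤ h →
      ‖c - c'‖ ≤ h → 4 * h ≤ a * t → Measurable f → SobolevOn (Metric.ball c (2 * a * t)) f G →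
      ENNReal.ofReal ((wavg a c t f - wavg a c' t' f) ^ 2) ≤
        ENNReal.ofReal (C * h ^ 2 * (t ^ n)⁻¹) * sq (Metric.ball c (2 * a * t)) (vec G) := by
  obtain ⟨M, hM0, hM⟩ := exists_kern_sub_le (n := n) ha ha1
  have hv : volume (Metric.ball (0 : E n) 1) ≠ ⊤ := measure_ball_lt_top.ne
  have hv0 : volume (Metric.ball (0 : E n) 1) ≠ 0 := (Metric.measure_ball_pos _ _ one_pos).ne'
  set V := (volume (Metric.ball (0 : E n) 1)).toReal with hV
  refine ⟨M ^ 2 * (2 * a) ^ n * V * ((4 * a) ^ 2 * 2 ^ n), by positivity,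
    fun c c' t t' h f G ht htt hcc hht hf hG => ?_⟩
  have h0 : 0 ≤ h := (abs_nonneg _).trans htt
  have hat1 : a * t ≤ t := mul_le_of_le_one_left ht.le ha1
  have hat0 : 0 < a * t := mul_pos ha ht
  have ht' : 0 < t' := by have := abs_le.1 htt; linarith
  set B := Metric.ball c (2 * a * t) with hB
  have hBpos : 0 < 2 * a * t := by positivity
  have hBf : volume B ≠ ⊤ := measure_ball_lt_top.ne
  have hdiam : ∀ x ∈ B, ∀ y ∈ B, ‖y - x‖ ≤ 4 * a * t := fun x hx y hy => by
    rw [hB, mem_ball_iff_norm] at hx hy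
    have : y - x = (y - c) - (x - c) := by abel
    rw [this]
    linarith [norm_sub_le (y - c) (x - c)]
  obtain ⟨b, hb⟩ := hG.exists_const_sq_sub_le hf Metric.isOpen_ball (convex_ball c _)
    ⟨c, Metric.mem_ball_self hBpos⟩ hdiam
  have hratio : volume (Metric.closedBall (0 : E n) (4 * a * t)) / volume B
      = ENNReal.ofReal (2 ^ n) := by
    rw [hB, Measure.addHaar_closedBall _ _ (by positivity), finrank_euclideanSpace_fin,
      volume_ball_scale _ hBpos, ENNReal.mul_div_mul_right _ _ hv0 hv,
      ← ENNReal.ofReal_div_of_pos (by positivity)]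
    congr 1
    rw [← div_pow]; congr 1; field_simp; norm_num
  rw [hratio] at hb
  have hc' : ∀ w, w ∉ B → kern a c t w = 0 ∧ kern a c' t' w = 0 := by
    intro w hw
    rw [hB, mem_ball_iff_norm, not_lt] at hw
    refine ⟨kern_eq_zero (by linarith), kern_eq_zero ?_⟩
    have e : w - c = (w - c') - (c - c') := by abel
    have h1 : ‖w - c‖ ≤ ‖w - c'‖ + ‖c - c'‖ := by rw [e]; exact norm_sub_le _ _
    have h2 : a * t' ≤ a * t + h := by
      have h3 := (abs_le.1 htt).1
      have : a * (t' - t) ≤ h := by nlinarith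
      linarith
    linarith
  have hk1 := continuous_kern a c t
  have hk2 := continuous_kern a c' t'
  have hfi : SqInt B (fun x => f x - b) := by
    have : IsFiniteMeasure ((volume : Measure (E n)).restrict B) :=
      ⟨by rw [Measure.restrict_apply_univ]; exact hBf.lt_top⟩
    exact hG.sqInt.sub (memLp_const b)
  have hi1 : SqInt B (kern a c t) := sqInt_of_le_of_support hk1 (abs_kern_le ha ht c) hBf
  have hi2 : SqInt B (kern a c' t') := sqInt_of_le_of_support hk2 (abs_kern_le ha ht' c') hBf
  have full : ∀ g : E n → ℝ, (∫ w, kern a c t w * g w) = ∫ w in B, kern a c t w * g w := fun g =>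
    (setIntegral_eq_integral_of_forall_compl_eq_zero fun w hw => by
      rw [(hc' w hw).1, zero_mul]).symm
  have full' : ∀ g : E n → ℝ, (∫ w, kern a c' t' w * g w) = ∫ w in B, kern a c' t' w * g w :=
    fun g => (setIntegral_eq_integral_of_forall_compl_eq_zero fun w hw => by
      rw [(hc' w hw).2, zero_mul]).symm
  -- Both kernels have mass 1, so the Poincaré constant b of the ball may be subtracted from f at no
  -- cost. The factor h/t from the kernels then meets the factor t from Poincaré, leaving h times
  -- the gradient.
  have key : wavg a c t f - wavg a c' t' f
      = ∫ w in B, (kern a c t w - kern a c' t' w) * (f w - b) := by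
    have e1 : ∫ w in B, kern a c t w = 1 := by
      rw [← integral_kern ha ht c]
      simpa using (full fun _ => 1).symm
    have e2 : ∫ w in B, kern a c' t' w = 1 := by
      rw [← integral_kern ha ht' c']
      simpa using (full' fun _ => 1).symm
    have i1 := integrable_mul_of_sqInt hi1 hG.sqInt
    have i2 := integrable_mul_of_sqInt hi2 hG.sqInt
    have j1 : Integrable (kern a c t) (volume.restrict B) := by
      refine (hk1.integrable_of_hasCompactSupport ?_).restrict
      exact HasCompactSupport.intro (isCompact_closedBall c (2 * a * t)) fun w hw =>
        (hc' w fun hw' => hw (Metric.ball_subset_closedBall hw')).1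
    have j2 : Integrable (kern a c' t') (volume.restrict B) := by
      refine (hk2.integrable_of_hasCompactSupport ?_).restrict
      exact HasCompactSupport.intro (isCompact_closedBall c (2 * a * t)) fun w hw =>
        (hc' w fun hw' => hw (Metric.ball_subset_closedBall hw')).2
    have e3 : ∀ w, (kern a c t w - kern a c' t' w) * (f w - b)
        = (kern a c t w * f w - kern a c' t' w * f w) - (kern a c t w - kern a c' t' w) * b :=
      fun w => by ring
    have i12 : Integrable (fun w => kern a c t w * f w - kern a c' t' w * f w)
        (volume.restrict B) := i1.sub i2
    have j12 : Integrable (fun w => (kern a c t w - kern a c' t' w) * b) (volume.restrict B) :=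
      (j1.sub j2).mul_const b
    simp only [e3]
    rw [integral_sub i12 j12, integral_sub i1 i2,
      integral_mul_const, integral_sub j1 j2, e1, e2, sub_self, zero_mul, sub_zero, wavg, wavg,
      full, full']
  rw [key]
  have hst := sq_setIntegral_mul_le (hk1.sub hk2) (hM c c' t t' h ht htt hcc hht) hBf hfi
  refine hst.trans ?_
  calc _ ≤ ENNReal.ofReal ((M * h * (t ^ (n + 1))⁻¹) ^ 2) * volume B *
        (ENNReal.ofReal ((4 * a * t) ^ 2) * ENNReal.ofReal (2 ^ n) * sq B (vec G)) := by gcongr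
    _ = _ := by
      rw [hB, volume_ball_scale c hBpos, ← ENNReal.ofReal_toReal hv, ← hV,
        ← ENNReal.ofReal_mul (by positivity), ← ENNReal.ofReal_mul (by positivity),
        ← ENNReal.ofReal_mul (by positivity), ← mul_assoc, ← ENNReal.ofReal_mul (by positivity)]
      congr 2
      rw [mul_pow _ t n]
      field_simp
      ring

end

section

open Filter Topology
open scoped ENNReal NNReal

variable {n : ℕ}

/-! ### The extension obtained by averaging over interior balls -/

/-- The radius parameter of the averaging ball attached to `x`. -/
def radius (l δ : ℝ) (σ : E n → ℝ) (x : E n) : ℝ := l * σ x + δ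

/-- The centre of the averaging ball attached to `x`. -/
def centre (l δ : ℝ) (N : E n → E n) (σ : E n → ℝ) (x : E n) : E n :=
  x + (σ x + radius l δ σ x) • N x

/-- The ratio of the radius of the averaging ball to the hitting time. -/
def slope (m ρ : ℝ) : ℝ := ρ / (4 * (m + 1))

/-- The averaging ball attached to `x`. -/
def avgBall (m ρ δ : ℝ) (N : E n → E n) (σ : E n → ℝ) (x : E n) : Set (E n) :=
  Metric.ball (centre (slope m ρ) δ N σ x) (2 * (ρ / 4) * radius (slope m ρ) δ σ x)

/-- The function obtained from `f` by averaging over the interior balls. -/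
def ballAvg (m ρ δ : ℝ) (N : E n → E n) (σ : E n → ℝ) (f : E n → ℝ) (x : E n) : ℝ :=
  wavg (ρ / 4) (centre (slope m ρ) δ N σ x) (radius (slope m ρ) δ σ x) f

section

variable {Ω : Set (E n)} {N : E n → E n} {σ : E n → ℝ} {K : ℝ≥0} {m r ρ : ℝ}

theorem TransversalField.slope_pos (h : TransversalField Ω N σ K m r ρ) : 0 < slope m ρ := by
  have := h.one_le; have := h.ρ_pos
  unfold slope; positivity

theorem TransversalField.slope_mul (h : TransversalField Ω N σ K m r ρ) :
    slope m ρ * (4 * (m + 1)) = ρ := by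
  have := h.one_le
  unfold slope; field_simp

theorem TransversalField.slope_le (h : TransversalField Ω N σ K m r ρ) : 8 * slope m ρ ≤ ρ := by
  have := h.one_le; have := h.slope_mul; have := h.slope_pos
  nlinarith

theorem TransversalField.mem (h : TransversalField Ω N σ K m r ρ) {x : E n} (hx : x ∈ Ω) :
    x ∈ Metric.thickening r Ω := Metric.self_subset_thickening h.r_pos Ω hx

theorem TransversalField.infDist_lt (_h : TransversalField Ω N σ K m r ρ) {x : E n}
    (hx : x ∈ Metric.thickening r Ω) : Metric.infDist x Ω < r := by
  obtain ⟨y, hy, hxy⟩ := Metric.mem_thickening_iff.1 hx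
  exact (Metric.infDist_le_dist_of_mem hy).trans_lt hxy

/-- This inequality dictates the value of `slope`: the part of the averaging radius due to σ moves
the ball away from the hitting point by at most a quarter of the distance of x to Ω. -/
theorem TransversalField.slope_σ_le (h : TransversalField Ω N σ K m r ρ) {x : E n}
    (hx : x ∈ Metric.thickening r Ω) :
    slope m ρ * σ x * (m + 1) ≤ Metric.infDist x Ω / 4 := by
  have h1 := h.σ_le x hx
  rw [← h.slope_mul] at h1
  linarith

theorem TransversalField.radius_pos (h : TransversalField Ω N σ K m r ρ) {δ : ℝ} (_hδ : 0 < δ)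
    {x : E n} (hx : x ∈ Metric.thickening r Ω) : δ ≤ radius (slope m ρ) δ σ x := by
  have := mul_nonneg h.slope_pos.le (h.σ_nonneg x hx)
  unfold radius; linarith

theorem TransversalField.radius_le (h : TransversalField Ω N σ K m r ρ) {δ : ℝ} (hδ : δ ≤ r / 2)
    {x : E n} (hx : x ∈ Metric.thickening r Ω) : radius (slope m ρ) δ σ x ≤ r := by
  have h1 := h.slope_σ_le hx
  have h2 := h.infDist_lt hx
  have h3 := mul_nonneg h.slope_pos.le (h.σ_nonneg x hx)
  have := h.one_le
  unfold radius; nlinarith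

theorem TransversalField.σ_lt (h : TransversalField Ω N σ K m r ρ)
    {x : E n} (hx : x ∈ Metric.thickening r Ω) : σ x ≤ r / ρ := by
  rw [le_div_iff₀ h.ρ_pos]
  linarith [h.σ_le x hx, h.infDist_lt hx]

theorem TransversalField.centre_add_mem (h : TransversalField Ω N σ K m r ρ) {δ : ℝ} (hδ : 0 < δ)
    (hδr : δ ≤ r / 2) {x : E n} (hx : x ∈ Metric.thickening r Ω) {w : E n}
    (hw : ‖w - centre (slope m ρ) δ N σ x‖ ≤ ρ * radius (slope m ρ) δ σ x) : w ∈ Ω := by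
  set t := radius (slope m ρ) δ σ x with ht
  have ht0 : 0 < t := hδ.trans_le (h.radius_pos hδ hx)
  have e : w = x + σ x • N x + t • (N x + t⁻¹ • (w - centre (slope m ρ) δ N σ x)) := by
    rw [smul_add t (N x), smul_inv_smul₀ ht0.ne', centre, ← ht]
    module
  rw [e]
  refine h.cone x hx t ht0 (h.radius_le hδr hx) _ ?_
  rw [norm_smul, norm_inv, Real.norm_of_nonneg ht0.le, inv_mul_le_iff₀ ht0]
  linarith

/-- The cone leaves room ρt around the centre and the averaging ball uses half of it. The other half
keeps the ball at a distance from the complement of Ω comparable to its radius, as the Schur test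
outside Ω requires. -/
theorem TransversalField.ball_subset (h : TransversalField Ω N σ K m r ρ) {δ : ℝ} (hδ : 0 < δ)
    (hδr : δ ≤ r / 2) {x : E n} (hx : x ∈ Metric.thickening r Ω) {w : E n}
    (hw : w ∈ avgBall m ρ δ N σ x) :
    Metric.ball w (ρ / 2 * radius (slope m ρ) δ σ x) ⊆ Ω := by
  intro y hy
  rw [avgBall, mem_ball_iff_norm] at hw
  rw [mem_ball_iff_norm] at hy
  refine h.centre_add_mem hδ hδr hx ?_
  have e : y - centre (slope m ρ) δ N σ x = (y - w) + (w - centre (slope m ρ) δ N σ x) := by abel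
  rw [e]
  have := norm_add_le (y - w) (w - centre (slope m ρ) δ N σ x)
  linarith

theorem TransversalField.avgBall_subset (h : TransversalField Ω N σ K m r ρ) {δ : ℝ} (hδ : 0 < δ)
    (hδr : δ ≤ r / 2) {x : E n} (hx : x ∈ Metric.thickening r Ω) :
    avgBall m ρ δ N σ x ⊆ Ω := fun w hw => by
  have h1 := hδ.trans_le (h.radius_pos hδ hx)
  have := h.ρ_pos
  exact h.ball_subset hδ hδr hx hw (Metric.mem_ball_self (by positivity))

theorem TransversalField.norm_sub_lt (h : TransversalField Ω N σ K m r ρ) {δ : ℝ}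
    (hδ : 0 < δ) {x : E n} (hx : x ∈ Metric.thickening r Ω) {w : E n}
    (hw : w ∈ avgBall m ρ δ N σ x) :
    ‖w - (x + σ x • N x)‖ < (m + 1) * radius (slope m ρ) δ σ x := by
  rw [avgBall, mem_ball_iff_norm] at hw
  set t := radius (slope m ρ) δ σ x with ht
  have ht0 : 0 < t := hδ.trans_le (h.radius_pos hδ hx)
  have e : w - (x + σ x • N x) = (w - centre (slope m ρ) δ N σ x) + t • N x := by
    rw [centre, ← ht]; module
  rw [e]
  have h1 := norm_add_le (w - centre (slope m ρ) δ N σ x) (t • N x)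
  rw [norm_smul, Real.norm_of_nonneg ht0.le] at h1
  have := h.ρ_le
  nlinarith [h.N_le x]

/-- The frontier point is the hitting point x + σ(x)N(x). The term (m + 1)δ disappears in the limit
δ → 0. -/
theorem TransversalField.exists_frontier_near (h : TransversalField Ω N σ K m r ρ) {δ : ℝ}
    (hδ : 0 < δ) {x : E n} (hx : x ∈ Metric.thickening r Ω) (hxΩ : x ∉ Ω) {w : E n}
    (hw : w ∈ avgBall m ρ δ N σ x) :
    ∃ p ∈ _root_.frontier Ω, ‖w - p‖ < Metric.infDist x Ω / 4 + (m + 1) * δ := by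
  refine ⟨_, h.frontier x hx hxΩ, (h.norm_sub_lt hδ hx hw).trans_le ?_⟩
  have := h.slope_σ_le hx
  unfold radius; linarith

theorem TransversalField.continuous_radius (h : TransversalField Ω N σ K m r ρ) (δ : ℝ) :
    Continuous (radius (slope m ρ) δ σ) := by
  have := h.σ_lip.continuous
  unfold radius; fun_prop

theorem TransversalField.continuous_centre (h : TransversalField Ω N σ K m r ρ) (δ : ℝ) :
    Continuous (centre (slope m ρ) δ N σ) := by
  have h1 := h.σ_lip.continuous
  have h2 := h.N_lip.continuous
  have h3 := h.continuous_radius δ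
  unfold centre; fun_prop

theorem TransversalField.exists_lip (h : TransversalField Ω N σ K m r ρ) :
    ∃ Λ : ℝ, 1 ≤ Λ ∧ ∀ δ, 0 < δ → δ ≤ r / 2 → ∀ x ∈ Metric.thickening r Ω,
      ∀ y ∈ Metric.thickening r Ω,
      |radius (slope m ρ) δ σ x - radius (slope m ρ) δ σ y| ≤ Λ * ‖x - y‖ ∧
      ‖centre (slope m ρ) δ N σ x - centre (slope m ρ) δ N σ y‖ ≤ Λ * ‖x - y‖ := by
  have hm := h.one_le
  have hr := h.r_pos
  have hρ := h.ρ_pos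
  have hK : (0 : ℝ) ≤ K := K.2
  refine ⟨1 + 2 * K * m + (r / ρ + r) * K, by
    have : 0 ≤ 2 * K * m + (r / ρ + r) * K := by positivity
    linarith, fun δ hδ hδr x hx y hy => ?_⟩
  have h1 : |σ x - σ y| ≤ K * ‖x - y‖ := by
    have := h.σ_lip.dist_le_mul x y
    rwa [Real.dist_eq, dist_eq_norm] at this
  have h2 : ‖N x - N y‖ ≤ K * ‖x - y‖ := by
    have := h.N_lip.dist_le_mul x y
    rwa [dist_eq_norm, dist_eq_norm] at this
  have hl0 := h.slope_pos
  have hl1 : slope m ρ ≤ 1 := by linarith [h.slope_le, h.ρ_le]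
  have h3 : |radius (slope m ρ) δ σ x - radius (slope m ρ) δ σ y| ≤ K * ‖x - y‖ := by
    have : radius (slope m ρ) δ σ x - radius (slope m ρ) δ σ y = slope m ρ * (σ x - σ y) := by
      unfold radius; ring
    rw [this, abs_mul, abs_of_pos hl0]
    exact (mul_le_of_le_one_left (abs_nonneg _) hl1).trans h1
  have hxy := norm_nonneg (x - y)
  have hKm : (K : ℝ) * ‖x - y‖ ≤ K * m * ‖x - y‖ := by
    have : (K : ℝ) * 1 ≤ K * m := by gcongr
    nlinarith
  constructor
  · have : 0 ≤ (r / ρ + r) * K * ‖x - y‖ := by positivity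
    have : 0 ≤ K * m * ‖x - y‖ := by positivity
    nlinarith
  · have e : centre (slope m ρ) δ N σ x - centre (slope m ρ) δ N σ y = (x - y) +
        (((σ x - σ y) + (radius (slope m ρ) δ σ x - radius (slope m ρ) δ σ y)) • N y +
        (σ x + radius (slope m ρ) δ σ x) • (N x - N y)) := by
      unfold centre; module
    rw [e]
    refine (norm_add_le _ _).trans ?_
    have h4 := norm_add_le (((σ x - σ y) + (radius (slope m ρ) δ σ x - radius (slope m ρ) δ σ y)) • N y)
      ((σ x + radius (slope m ρ) δ σ x) • (N x - N y))
    have h5 : ‖((σ x - σ y) + (radius (slope m ρ) δ σ x - radius (slope m ρ) δ σ y)) • N y‖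
        ≤ (2 * (K * ‖x - y‖)) * m := by
      rw [norm_smul]
      have := abs_add_le (σ x - σ y) (radius (slope m ρ) δ σ x - radius (slope m ρ) δ σ y)
      refine mul_le_mul ?_ (h.N_le y) (norm_nonneg _) (by positivity)
      rw [Real.norm_eq_abs]; linarith
    have h6 : ‖(σ x + radius (slope m ρ) δ σ x) • (N x - N y)‖ ≤ (r / ρ + r) * (K * ‖x - y‖) := by
      have := h.σ_nonneg x hx
      have := h.radius_pos hδ hx
      rw [norm_smul, Real.norm_of_nonneg (by linarith)]
      exact mul_le_mul (add_le_add (h.σ_lt hx) (h.radius_le hδr hx)) h2 (norm_nonneg _)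
        (by positivity)
    linarith

/-- On Ω the hitting time vanishes, so every radius parameter is exactly δ and the points whose ball
contains w lie within (m + 1)δ of w: a set of volume of order δⁿ, weighted by δ⁻ⁿ. -/
theorem TransversalField.lintegral_radius_inside (h : TransversalField Ω N σ K m r ρ) {δ : ℝ}
    (hδ : 0 < δ) {A : Set (E n)} (hA : MeasurableSet A) (hAΩ : A ⊆ Ω) (w : E n) :
    ∫⁻ x in A, {x | w ∈ avgBall m ρ δ N σ x}.indicator
        (fun x => ENNReal.ofReal ((radius (slope m ρ) δ σ x ^ n)⁻¹)) x ≤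
      ENNReal.ofReal ((m + 1) ^ n) * volume (Metric.ball (0 : E n) 1) := by
  have hm := h.one_le
  calc _ ≤ ∫⁻ x, (Metric.ball w ((m + 1) * δ)).indicator
        (fun _ => ENNReal.ofReal ((δ ^ n)⁻¹)) x := by
        rw [← lintegral_indicator hA]
        refine lintegral_mono fun x => ?_
        by_cases hx : x ∈ A ∧ w ∈ avgBall m ρ δ N σ x
        · have hxΩ := hAΩ hx.1
          have hσ := h.σ_zero x hxΩ
          have ht : radius (slope m ρ) δ σ x = δ := by rw [radius, hσ]; ring
          have h1 := h.norm_sub_lt hδ (h.mem hxΩ) hx.2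
          rw [hσ, zero_smul, add_zero, ht, norm_sub_rev] at h1
          rw [indicator_of_mem hx.1, indicator_of_mem (by exact hx.2),
            indicator_of_mem (by rw [mem_ball_iff_norm]; exact h1), ht]
        · have : A.indicator (fun x => {x | w ∈ avgBall m ρ δ N σ x}.indicator
              (fun x => ENNReal.ofReal ((radius (slope m ρ) δ σ x ^ n)⁻¹)) x) x = 0 := by
            by_cases hxA : x ∈ A
            · rw [indicator_of_mem hxA]
              exact indicator_of_notMem (s := {x | w ∈ avgBall m ρ δ N σ x}) (fun hc => hx ⟨hxA, hc⟩) _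
            · exact indicator_of_notMem hxA _
          rw [this]; exact zero_le
    _ = _ := by
      rw [lintegral_indicator Metric.isOpen_ball.measurableSet, setLIntegral_const,
        volume_ball_scale _ (by positivity), ← mul_assoc, ← ENNReal.ofReal_mul (by positivity)]
      congr 2
      rw [mul_pow]; field_simp

/-- If the ball of an outside point x contains w, then t(x), |x − w| and the distance d of w to the
complement of Ω are controlled by one another: ρt/2 ≤ d ≤ |x − w| ≤ Ht. So the admissible x fill at
most a ball of radius of order d, with weight of order d⁻ⁿ; neither constant involves δ. -/
theorem TransversalField.lintegral_radius_outside (h : TransversalField Ω N σ K m r ρ) {δ : ℝ}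
    (hδ : 0 < δ) (hδr : δ ≤ r / 2) {A : Set (E n)} (hA : MeasurableSet A)
    (hAD : A ⊆ Metric.thickening r Ω) (hAΩ : ∀ x ∈ A, x ∉ Ω) (w : E n) :
    ∫⁻ x in A, {x | w ∈ avgBall m ρ δ N σ x}.indicator
        (fun x => ENNReal.ofReal ((radius (slope m ρ) δ σ x ^ n)⁻¹)) x ≤
      ENNReal.ofReal ((3 * (3 * m / slope m ρ) ^ 2 / ρ) ^ n) *
        volume (Metric.ball (0 : E n) 1) := by
  have hm := h.one_le
  have hρ := h.ρ_pos
  have hl := h.slope_pos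
  have hl1 : slope m ρ ≤ 1 := by linarith [h.slope_le, h.ρ_le]
  set H := 3 * m / slope m ρ with hH
  have hH0 : 0 < H := by positivity
  set d := Metric.infDist w Ωᶜ with hd
  have key : ∀ x ∈ A, w ∈ avgBall m ρ δ N σ x →
      0 < d ∧ d ≤ H * radius (slope m ρ) δ σ x ∧ ‖x - w‖ < 3 * d * H / ρ := by
    intro x hxA hw
    have hx := hAD hxA
    set t := radius (slope m ρ) δ σ x with ht
    have ht0 : 0 < t := hδ.trans_le (h.radius_pos hδ hx)
    have h1 : ρ / 2 * t ≤ d := by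
      rw [hd, Metric.le_infDist ⟨x, hAΩ x hxA⟩]
      intro y hy
      by_contra hc
      push Not at hc
      refine hy (h.ball_subset hδ hδr hx hw ?_)
      rw [Metric.mem_ball, dist_comm]; exact hc
    have h2 : ‖x - w‖ ≤ H * t := by
      have e : x - w = -(w - (x + σ x • N x)) - σ x • N x := by abel
      have h3 := h.norm_sub_lt hδ hx hw
      have h4 := norm_sub_le (-(w - (x + σ x • N x))) (σ x • N x)
      rw [← e, norm_neg, norm_smul, Real.norm_of_nonneg (h.σ_nonneg x hx)] at h4
      have h5 : σ x * ‖N x‖ ≤ σ x * m :=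
        mul_le_mul_of_nonneg_left (h.N_le x) (h.σ_nonneg x hx)
      have h6 : slope m ρ * σ x ≤ t := by rw [ht, radius]; linarith
      have h7 : slope m ρ * (H * t) = 3 * m * t := by rw [hH]; field_simp
      have h8 : slope m ρ * ‖x - w‖ ≤ slope m ρ * (H * t) := by
        rw [h7]
        have h9 : slope m ρ * ((m + 1) * t) ≤ (m + 1) * t :=
          mul_le_of_le_one_left (by positivity) hl1
        have h10 : slope m ρ * ‖x - w‖ ≤ slope m ρ * ((m + 1) * t) + slope m ρ * σ x * m := by
          nlinarith
        nlinarith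
      exact le_of_mul_le_mul_left h8 hl
    have h3 : d ≤ ‖x - w‖ := by
      rw [hd, norm_sub_rev, ← dist_eq_norm]
      exact Metric.infDist_le_dist_of_mem (hAΩ x hxA)
    have hd0 : 0 < d := lt_of_lt_of_le (by positivity) h1
    refine ⟨hd0, h3.trans h2, ?_⟩
    rw [lt_div_iff₀ hρ]
    have : ‖x - w‖ * ρ ≤ H * t * ρ := by gcongr
    have : H * (ρ / 2 * t) ≤ H * d := by gcongr
    nlinarith [mul_pos hH0 hd0]
  by_cases hd0 : 0 < d
  · calc _ ≤ ∫⁻ x, (Metric.ball w (3 * d * H / ρ)).indicator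
          (fun _ => ENNReal.ofReal ((H / d) ^ n)) x := by
          rw [← lintegral_indicator hA]
          refine lintegral_mono fun x => ?_
          by_cases hx : x ∈ A ∧ w ∈ avgBall m ρ δ N σ x
          · obtain ⟨-, h1, h2⟩ := key x hx.1 hx.2
            have ht0 : 0 < radius (slope m ρ) δ σ x := hδ.trans_le (h.radius_pos hδ (hAD hx.1))
            rw [indicator_of_mem hx.1, indicator_of_mem (by exact hx.2),
              indicator_of_mem (by rw [mem_ball_iff_norm]; exact h2), ← inv_pow]
            refine ENNReal.ofReal_le_ofReal (pow_le_pow_left₀ (by positivity) ?_ n)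
            rw [inv_le_iff_one_le_mul₀ ht0, div_mul_eq_mul_div, le_div_iff₀ hd0]
            linarith
          · have : A.indicator (fun x => {x | w ∈ avgBall m ρ δ N σ x}.indicator
                (fun x => ENNReal.ofReal ((radius (slope m ρ) δ σ x ^ n)⁻¹)) x) x = 0 := by
              by_cases hxA : x ∈ A
              · rw [indicator_of_mem hxA]
                exact indicator_of_notMem (s := {x | w ∈ avgBall m ρ δ N σ x}) (fun hc => hx ⟨hxA, hc⟩) _
              · exact indicator_of_notMem hxA _
            rw [this]; exact zero_le
      _ = _ := by
        rw [lintegral_indicator Metric.isOpen_ball.measurableSet, setLIntegral_const,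
          volume_ball_scale _ (by positivity), ← mul_assoc, ← ENNReal.ofReal_mul (by positivity),
          ← mul_pow]
        congr 3
        field_simp
  · have hz : ∫⁻ x in A, {x | w ∈ avgBall m ρ δ N σ x}.indicator
        (fun x => ENNReal.ofReal ((radius (slope m ρ) δ σ x ^ n)⁻¹)) x = 0 := by
      refine (setLIntegral_congr_fun hA fun x hx => ?_).trans lintegral_zero
      exact indicator_of_notMem (s := {x | w ∈ avgBall m ρ δ N σ x}) (fun hc => hd0 (key x hx hc).1) _
    rw [hz]; exact zero_le

/-- Averages over the interior balls are bounded in `L¹`, uniformly in `δ`. -/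
theorem TransversalField.exists_schur (h : TransversalField Ω N σ K m r ρ) (hΩ : IsOpen Ω) :
    ∃ C : ℝ, 0 ≤ C ∧ ∀ (δ : ℝ) (A W : Set (E n)) (g : E n → ℝ≥0∞), 0 < δ → δ ≤ r / 2 →
      MeasurableSet A → MeasurableSet W → A ⊆ Metric.thickening r Ω →
      (∀ x ∈ A, avgBall m ρ δ N σ x ⊆ W) → Measurable g →
      ∫⁻ x in A, ENNReal.ofReal ((radius (slope m ρ) δ σ x ^ n)⁻¹) *
        ∫⁻ w in avgBall m ρ δ N σ x, g w ≤ ENNReal.ofReal C * ∫⁻ w in W, g w := by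
  have hm := h.one_le
  have hρ := h.ρ_pos
  have hl := h.slope_pos
  have hv : volume (Metric.ball (0 : E n) 1) ≠ ⊤ := measure_ball_lt_top.ne
  set V := (volume (Metric.ball (0 : E n) 1)).toReal with hV
  refine ⟨(m + 1) ^ n * V + (3 * (3 * m / slope m ρ) ^ 2 / ρ) ^ n * V, by positivity, ?_⟩
  intro δ A W g hδ hδr hA hW hAD hAW hg
  have hrc := h.continuous_radius δ
  have hcc := h.continuous_centre δ
  have hset : IsOpen {p : E n × E n | p.2 ∈ avgBall m ρ δ N σ p.1} := by
    simp only [avgBall, Metric.mem_ball]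
    exact isOpen_lt (continuous_snd.dist (hcc.comp continuous_fst))
      (continuous_const.mul (hrc.comp continuous_fst))
  obtain ⟨I, hIdef, hI⟩ : ∃ I : E n → E n → ℝ≥0∞,
      (∀ x w, I x w = {x | w ∈ avgBall m ρ δ N σ x}.indicator
        (fun x => ENNReal.ofReal ((radius (slope m ρ) δ σ x ^ n)⁻¹)) x) ∧
      Measurable (Function.uncurry I) := by
    refine ⟨fun x w => {p : E n × E n | p.2 ∈ avgBall m ρ δ N σ p.1}.indicator
      (fun p => ENNReal.ofReal ((radius (slope m ρ) δ σ p.1 ^ n)⁻¹)) (x, w), fun x w => rfl, ?_⟩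
    refine Measurable.indicator ?_ hset.measurableSet
    exact (((hrc.measurable.comp measurable_fst).pow_const n).inv).ennreal_ofReal
  have hIw : ∀ w, Measurable fun x => I x w := fun w => hI.of_uncurry_right
  have h1 : ∀ x ∈ A, ENNReal.ofReal ((radius (slope m ρ) δ σ x ^ n)⁻¹) *
      ∫⁻ w in avgBall m ρ δ N σ x, g w = ∫⁻ w in W, I x w * g w := by
    intro x hx
    have hb : MeasurableSet (avgBall m ρ δ N σ x) := Metric.isOpen_ball.measurableSet
    rw [← lintegral_const_mul _ hg, ← lintegral_indicator hb, ← lintegral_indicator hW]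
    refine lintegral_congr fun w => ?_
    by_cases hw : w ∈ avgBall m ρ δ N σ x
    · rw [indicator_of_mem hw, indicator_of_mem (hAW x hx hw)]
      rw [hIdef, indicator_of_mem (by exact hw)]
    · rw [indicator_of_notMem hw]
      have : I x w = 0 := (hIdef x w).trans (indicator_of_notMem (by exact hw) _)
      by_cases hwW : w ∈ W
      · rw [indicator_of_mem hwW, this, zero_mul]
      · rw [indicator_of_notMem hwW]
  rw [setLIntegral_congr_fun hA h1, lintegral_lintegral_swap]
  · rw [← lintegral_const_mul _ hg]
    refine lintegral_mono fun w => ?_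
    rw [lintegral_mul_const _ (hIw w)]
    gcongr
    have hsplit : ∫⁻ x in A, I x w = (∫⁻ x in A ∩ Ω, I x w) + ∫⁻ x in A \ Ω, I x w :=
      (lintegral_inter_add_sdiff _ A hΩ.measurableSet).symm
    rw [hsplit, ENNReal.ofReal_add (by positivity) (by positivity), ENNReal.ofReal_mul (by positivity),
      ENNReal.ofReal_mul (by positivity), hV, ENNReal.ofReal_toReal hv]
    simp only [hIdef]
    exact add_le_add (h.lintegral_radius_inside hδ (hA.inter hΩ.measurableSet) inter_subset_right w)
      (h.lintegral_radius_outside hδ hδr (hA.diff hΩ.measurableSet)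
        (sdiff_subset.trans hAD) (fun x hx => hx.2) w)
  · exact (hI.mul (hg.comp measurable_snd)).aemeasurable

end

end

/-! ### Boundedness of the averaging operators in `L²` and of their gradients. -/

section

open Filter Topology
open scoped ENNReal NNReal

variable {n : ℕ}

section

variable {Ω : Set (E n)} {N : E n → E n} {σ : E n → ℝ} {K : ℝ≥0} {m r ρ : ℝ}

theorem TransversalField.measurable_ballAvg (h : TransversalField Ω N σ K m r ρ) (δ : ℝ)
    {f : E n → ℝ} (hf : Measurable f) : Measurable (ballAvg m ρ δ N σ f) := by
  have hr := (h.continuous_radius δ).measurable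
  have hc := (h.continuous_centre δ).measurable
  have : Measurable (Function.uncurry fun x w =>
      kern (ρ / 4) (centre (slope m ρ) δ N σ x) (radius (slope m ρ) δ σ x) w * f w) := by
    unfold Function.uncurry kern hat
    fun_prop
  exact this.stronglyMeasurable.integral_prod_right.measurable

/-- The pointwise Cauchy–Schwarz bound is integrated with the Schur estimate. The set W records
where the averaging balls of the points of A lie, and so localizes the estimate. -/
theorem TransversalField.exists_ballAvg_le (h : TransversalField Ω N σ K m r ρ) (hΩ : IsOpen Ω) :
    ∃ C : ℝ, 0 ≤ C ∧ ∀ (δ : ℝ) (A W : Set (E n)) (f : E n → ℝ), 0 < δ → δ ≤ r / 2 →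
      MeasurableSet A → MeasurableSet W → A ⊆ Metric.thickening r Ω →
      (∀ x ∈ A, avgBall m ρ δ N σ x ⊆ W) → Measurable f → SqInt W f →
      sq A (ballAvg m ρ δ N σ f) ≤ ENNReal.ofReal C * sq W f := by
  obtain ⟨C₁, hC₁, H₁⟩ := h.exists_schur hΩ
  obtain ⟨C₂, hC₂, H₂⟩ := exists_wavg_sq_le (n := n) (a := ρ / 4) (by linarith [h.ρ_pos])
  refine ⟨C₂ * C₁, by positivity, fun δ A W f hδ hδr hA hW hAD hAW hf hfW => ?_⟩
  have hg : Measurable fun w => ‖f w‖ₑ ^ 2 := hf.enorm.pow_const 2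
  calc sq A (ballAvg m ρ δ N σ f)
      ≤ ∫⁻ x in A, ENNReal.ofReal C₂ * (ENNReal.ofReal ((radius (slope m ρ) δ σ x ^ n)⁻¹) *
        ∫⁻ w in avgBall m ρ δ N σ x, ‖f w‖ₑ ^ 2) := by
        refine setLIntegral_mono' hA fun x hx => ?_
        have ht := hδ.trans_le (h.radius_pos hδ (hAD hx))
        have := H₂ (centre (slope m ρ) δ N σ x) (radius (slope m ρ) δ σ x) f ht
          (hfW.mono (hAW x hx))
        rw [ENNReal.ofReal_mul hC₂, mul_assoc] at this
        rwa [Real.enorm_eq_ofReal_abs, ← ENNReal.ofReal_pow (abs_nonneg _), sq_abs]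
    _ = ENNReal.ofReal C₂ * ∫⁻ x in A, ENNReal.ofReal ((radius (slope m ρ) δ σ x ^ n)⁻¹) *
        ∫⁻ w in avgBall m ρ δ N σ x, ‖f w‖ₑ ^ 2 := lintegral_const_mul' _ _ ENNReal.ofReal_ne_top
    _ ≤ ENNReal.ofReal C₂ * (ENNReal.ofReal C₁ * sq W f) := by
        gcongr
        exact H₁ δ A W _ hδ hδr hA hW hAD hAW hg
    _ = _ := by rw [ENNReal.ofReal_mul hC₂, mul_assoc]

/-- The averaged function b is not differentiated. The integral is the derivative at s = 0 of s ↦ ∫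
η(x − sv)b with v = −eᵢ, and a bound on the increments, ‖b(· + sv) − b‖ ≤ C|s|‖∇f‖_W on the support
of η, bounds this derivative. -/
theorem TransversalField.exists_ballAvg_deriv_le (h : TransversalField Ω N σ K m r ρ)
    (hΩ : IsOpen Ω) :
    ∃ C : ℝ, 0 ≤ C ∧ ∀ (δ : ℝ) (A W : Set (E n)) (f : E n → ℝ) (G : Fin n → E n → ℝ), 0 < δ →
      δ ≤ r / 2 → IsOpen A → MeasurableSet W → W ⊆ Ω → A ⊆ Metric.thickening r Ω →
      (∀ x ∈ A, avgBall m ρ δ N σ x ⊆ W) → Measurable f → (∀ i, Measurable (G i)) →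
      SobolevOn Ω f G → ∀ i η, IsTest A η →
      |∫ x in Metric.thickening r Ω, pderiv i η x * ballAvg m ρ δ N σ f x| ≤
        C * nrm W (vec G) * nrm A η := by
  obtain ⟨C₁, hC₁, H₁⟩ := h.exists_schur hΩ
  obtain ⟨C₂, hC₂, H₂⟩ := exists_wavg_sub_sq_le (n := n) (a := ρ / 4) (by linarith [h.ρ_pos])
    (by linarith [h.ρ_le])
  obtain ⟨C₃, hC₃, H₃⟩ := h.exists_ballAvg_le hΩ
  obtain ⟨Λ, hΛ, HΛ⟩ := h.exists_lip
  refine ⟨√(C₂ * Λ ^ 2 * C₁), by positivity, ?_⟩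
  intro δ A W f G hδ hδr hA hW hWΩ hAD hAW hf hG hfG i η hη
  set D := Metric.thickening r Ω with hD
  have hDo : IsOpen D := Metric.isOpen_thickening
  set b := ballAvg m ρ δ N σ f with hb
  have hbm : Measurable b := h.measurable_ballAvg δ hf
  have hbD : SqInt D b := by
    refine sqInt_of_sq_lt_top hbm.aestronglyMeasurable ?_
    refine (H₃ δ D Ω f hδ hδr hDo.measurableSet hΩ.measurableSet subset_rfl
      (fun x hx => h.avgBall_subset hδ hδr hx) hf hfG.sqInt).trans_lt ?_
    exact ENNReal.mul_lt_top ENNReal.ofReal_lt_top (sq_lt_top hfG.sqInt)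
  set v : E n := -EuclideanSpace.single i 1 with hv
  have hvn : ‖v‖ = 1 := by simp [hv]
  have hder := hasDerivAt_integral_translate hbD hη v 0
  simp only [zero_smul, sub_zero] at hder
  have hval : (∫ x in D, pderiv i η x * b x) = ∫ x in D, fderiv ℝ η x (-v) * b x := by
    simp [hv, pderiv]
  rw [hval, ← Real.norm_eq_abs]
  refine hder.le_of_lip' (by have := nrm_nonneg W (vec G); have := nrm_nonneg A η; positivity) ?_
  obtain ⟨κ, hκ, hκA⟩ := hη.compact.isCompact.exists_thickening_subset_open hA hη.subset
  have hS : MeasurableSet (tsupport η) := (isClosed_tsupport η).measurableSet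
  have hs1 : ∀ᶠ s : ℝ in 𝓝 0, |s| < κ := by
    have : ContinuousAt (fun s : ℝ => |s|) 0 := continuous_abs.continuousAt
    exact this.eventually_lt continuousAt_const (by simpa using hκ)
  -- The comparison of two means requires the shift to be small relative to the radius, which is at
  -- least of order δ. How small s must be depends on δ, but the resulting constant does not.
  have hs2 : ∀ᶠ s : ℝ in 𝓝 0, 4 * (Λ * |s|) < ρ / 4 * δ := by
    have : ContinuousAt (fun s : ℝ => 4 * (Λ * |s|)) 0 := by fun_prop
    exact this.eventually_lt continuousAt_const (by
      have := h.ρ_pos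
      simp only [abs_zero, mul_zero]; positivity)
  filter_upwards [hs1, hs2] with s h1 h2
  have hmem : ∀ x ∈ tsupport η, x + s • v ∈ A := fun x hx => by
    refine hκA (Metric.mem_thickening_iff.2 ⟨x, hx, ?_⟩)
    rw [dist_eq_norm, add_sub_cancel_left, norm_smul, hvn, mul_one]
    exact h1
  have hint : ∀ w : E n → ℝ, ∫ x in D, η x * w x = ∫ x in tsupport η, η x * w x := by
    intro w
    refine (setIntegral_eq_of_subset_of_forall_sdiff_eq_zero hDo.measurableSet
      (hη.subset.trans hAD) fun x hx => ?_)
    rw [image_eq_zero_of_notMem_tsupport hx.2, zero_mul]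
  have htest : IsTest (D ∩ (fun x => x + s • v) ⁻¹' D) η :=
    ⟨hη.smooth, hη.compact, fun x hx => ⟨hAD (hη.subset hx), hAD (hmem x hx)⟩⟩
  have e1 : ∫ x in D, η (x - s • v) * b x = ∫ x in D, η x * b (x + s • v) := by
    refine (htest.integral_translate (D := D) (z := s • v) (fun x hx => hx.2) b).trans ?_
    exact (htest.setIntegral_smul_of_subset inter_subset_left fun x => b (x + s • v)).symm
  have hT : SqInt (tsupport η) b := hbD.mono (hη.subset.trans hAD)
  have hT' : SqInt (tsupport η) (fun x => b (x + s • v)) :=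
    hbD.translate fun x hx => hAD (hmem x hx)
  have e2 : (∫ x in D, η (x - s • v) * b x) - ∫ x in D, η x * b x =
      ∫ x in tsupport η, η x * (b (x + s • v) - b x) := by
    rw [e1, hint, hint, ← integral_sub (integrable_mul_of_sqInt (hη.sqInt _) hT')
      (integrable_mul_of_sqInt (hη.sqInt _) hT)]
    simp only [mul_sub]
  rw [zero_smul]
  simp only [sub_zero]
  rw [e2, Real.norm_eq_abs, Real.norm_eq_abs]
  refine (abs_integral_mul_le (hη.sqInt _) (hT'.sub hT)).trans ?_
  have h3 : nrm (tsupport η) (fun x => b (x + s • v) - b x) ≤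
      √(C₂ * Λ ^ 2 * C₁) * nrm W (vec G) * |s| := by
    have hGW : SqInt W (vec G) := (hfG.mono hWΩ).vec
    refine nrm_le_of_sq_le (by have := nrm_nonneg W (vec G); positivity) ?_
    have hpt : ∀ x ∈ tsupport η, ‖b (x + s • v) - b x‖ₑ ^ 2 ≤
        ENNReal.ofReal (C₂ * (Λ * |s|) ^ 2) *
          (ENNReal.ofReal ((radius (slope m ρ) δ σ x ^ n)⁻¹) *
            ∫⁻ w in avgBall m ρ δ N σ x, ‖vec G w‖ₑ ^ 2) := by
      intro x hx
      have hxA := hη.subset hx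
      have hxD := hAD hxA
      obtain ⟨hl1, hl2⟩ := HΛ δ hδ hδr x hxD _ (hAD (hmem x hx))
      have e3 : ‖x - (x + s • v)‖ = |s| := by
        rw [sub_add_cancel_left, norm_neg, norm_smul, hvn, mul_one, Real.norm_eq_abs]
      rw [e3] at hl1 hl2
      have ht := h.radius_pos hδ hxD
      have := H₂ _ _ _ _ (Λ * |s|) f G (hδ.trans_le ht) hl1 hl2
        (h2.le.trans (by have := h.ρ_pos; gcongr)) hf
        (hfG.mono ((hAW x hxA).trans hWΩ))
      rw [← mul_assoc, ← ENNReal.ofReal_mul (by positivity)]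
      rw [Real.enorm_eq_ofReal_abs, ← ENNReal.ofReal_pow (abs_nonneg _), sq_abs, ← neg_sq, neg_sub]
      exact this
    have hgm : Measurable fun w => ‖vec G w‖ₑ ^ 2 := by
      simp only [enorm_vec_sq]
      exact Finset.measurable_sum _ fun i _ => (hG i).enorm.pow_const 2
    calc _ ≤ _ := setLIntegral_mono' hS hpt
      _ = _ := lintegral_const_mul' _ _ ENNReal.ofReal_ne_top
      _ ≤ ENNReal.ofReal (C₂ * (Λ * |s|) ^ 2) * (ENNReal.ofReal C₁ * sq W (vec G)) := by
        gcongr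
        exact H₁ δ _ W _ hδ hδr hS hW (hη.subset.trans hAD) (fun x hx => hAW x (hη.subset hx)) hgm
      _ = _ := by
        rw [sq_eq_ofReal hGW, ← ENNReal.ofReal_mul hC₁, ← ENNReal.ofReal_mul (by positivity)]
        congr 1
        rw [mul_pow, mul_pow, mul_pow, sq_abs, Real.sq_sqrt (by positivity)]
        ring
  calc _ ≤ nrm A η * (√(C₂ * Λ ^ 2 * C₁) * nrm W (vec G) * |s|) := by
        exact mul_le_mul (nrm_mono (hη.sqInt _) hη.subset) h3 (nrm_nonneg _ _) (nrm_nonneg _ _)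
    _ = _ := by ring

end

end

/-! ### Averaging operators on `L²` and their dependence on δ. -/

section

open Filter Topology
open scoped ENNReal NNReal

variable {n : ℕ}

/-- Written on the reference ball, a mean of f is an integral of f(c + tz) against a fixed
probability density on |z| ≤ a ≤ 1, so Lipschitz continuity of f passes to (c, t). -/
theorem abs_hat_integral_sub_le {a : ℝ} (ha : 0 < a) (ha1 : a ≤ 1) {f : E n → ℝ} {L : ℝ≥0}
    (hf : LipschitzWith L f) (c c' : E n) (t t' : ℝ) :
    |(hatMass n a)⁻¹ * (∫ z, hat a z * f (c + t • z)) -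
      (hatMass n a)⁻¹ * ∫ z, hat a z * f (c' + t' • z)| ≤ L * (‖c - c'‖ + |t - t'|) := by
  have hM := hatMass_pos (n := n) ha
  have hfc := hf.continuous
  have hi : ∀ (c : E n) (t : ℝ), Integrable fun z => hat a z * f (c + t • z) := fun c t =>
    ((continuous_hat a).mul (by fun_prop)).integrable_of_hasCompactSupport
      (hasCompactSupport_hat a).mul_right
  rw [← mul_sub, ← integral_sub (hi c t) (hi c' t'), abs_mul, abs_of_pos (inv_pos.2 hM),
    inv_mul_le_iff₀ hM]
  have hb : ∀ z : E n, ‖hat a z * f (c + t • z) - hat a z * f (c' + t' • z)‖ ≤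
      hat a z * (L * (‖c - c'‖ + |t - t'|)) := by
    intro z
    rw [← mul_sub, norm_mul, Real.norm_of_nonneg (hat_nonneg a z)]
    by_cases hz : a ≤ ‖z‖
    · rw [hat_eq_zero hz]; simp
    · refine mul_le_mul_of_nonneg_left ?_ (hat_nonneg a z)
      have h1 := hf.dist_le_mul (c + t • z) (c' + t' • z)
      rw [dist_eq_norm, dist_eq_norm] at h1
      refine h1.trans (mul_le_mul_of_nonneg_left ?_ L.2)
      have e : c + t • z - (c' + t' • z) = (c - c') + (t - t') • z := by module
      rw [e]
      refine (norm_add_le _ _).trans (add_le_add le_rfl ?_)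
      rw [norm_smul, Real.norm_eq_abs]
      exact mul_le_of_le_one_right (abs_nonneg _) (by linarith)
  calc _ ≤ ∫ z, hat a z * (L * (‖c - c'‖ + |t - t'|)) :=
        norm_integral_le_of_norm_le ((integrable_hat a).mul_const _) (ae_of_all _ hb)
    _ = _ := by rw [integral_mul_const, hatMass]

theorem wavg_congr {a c t} {S : Set (E n)} {f g : E n → ℝ} (ha : 0 < a) (ht : 0 < t)
    (hS : Metric.ball c (2 * a * t) ⊆ S) (h : f =ᵐ[volume.restrict S] g) :
    wavg a c t f = wavg a c t g := by
  have hb : a * t ≤ 2 * a * t := by nlinarith [mul_pos ha ht]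
  rw [wavg_eq_setIntegral hb, wavg_eq_setIntegral hb]
  refine integral_congr_ae ?_
  filter_upwards [ae_mono (Measure.restrict_mono hS le_rfl) h] with w hw
  rw [hw]

theorem integrable_kern_mul {a t : ℝ} {c : E n} {f : E n → ℝ} (ha : 0 < a) (ht : 0 < t)
    (hf : SqInt (Metric.ball c (2 * a * t)) f) :
    Integrable (fun w => kern a c t w * f w) := by
  have h1 : IntegrableOn (fun w => kern a c t w * f w) (Metric.ball c (2 * a * t)) :=
    integrable_mul_of_sqInt (sqInt_of_le_of_support (continuous_kern a c t)
      (abs_kern_le ha ht c) measure_ball_lt_top.ne) hf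
  refine (integrableOn_iff_integrable_of_support_subset fun w hw => ?_).1 h1
  by_contra hc
  rw [mem_ball_iff_norm, not_lt] at hc
  refine hw ?_
  change kern a c t w * f w = 0
  rw [kern_eq_zero (le_trans (by nlinarith [mul_pos ha ht]) hc), zero_mul]

theorem nrm_le_of_abs_le {S : Set (E n)} (hS : volume S ≠ ⊤) (hSm : MeasurableSet S) {w : E n → ℝ}
    {M : ℝ} (hM : 0 ≤ M) (hw : ∀ x ∈ S, |w x| ≤ M) :
    nrm S w ≤ M * √(volume S).toReal := by
  refine nrm_le_of_sq_le (by positivity) ?_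
  rw [mul_pow, Real.sq_sqrt ENNReal.toReal_nonneg, ENNReal.ofReal_mul (by positivity),
    ENNReal.ofReal_toReal hS, ← setLIntegral_const]
  refine setLIntegral_mono' hSm fun x hx => ?_
  rw [Real.enorm_eq_ofReal_abs, ← ENNReal.ofReal_pow (abs_nonneg _)]
  exact ENNReal.ofReal_le_ofReal (pow_le_pow_left₀ (abs_nonneg _) (hw x hx) 2)

section

variable {Ω : Set (E n)} {N : E n → E n} {σ : E n → ℝ} {K : ℝ≥0} {m r ρ : ℝ}

theorem TransversalField.ballAvg_congr (h : TransversalField Ω N σ K m r ρ) {δ : ℝ} (hδ : 0 < δ)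
    (hδr : δ ≤ r / 2) {f g : E n → ℝ} (hfg : f =ᵐ[volume.restrict Ω] g) {x : E n}
    (hx : x ∈ Metric.thickening r Ω) : ballAvg m ρ δ N σ f x = ballAvg m ρ δ N σ g x :=
  wavg_congr (by linarith [h.ρ_pos]) (hδ.trans_le (h.radius_pos hδ hx))
    (h.avgBall_subset hδ hδr hx) hfg

theorem TransversalField.exists_avgCLM (h : TransversalField Ω N σ K m r ρ) (hΩ : IsOpen Ω) :
    ∃ C : ℝ, 0 ≤ C ∧ ∀ δ, 0 < δ → δ ≤ r / 2 →
      ∃ S : L2 Ω ℝ →L[ℝ] L2 (Metric.thickening r Ω) ℝ, (∀ f, ‖S f‖ ≤ C * ‖f‖) ∧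
        ∀ (f : L2 Ω ℝ) (g : E n → ℝ), f =ᵐ[volume.restrict Ω] g →
          ∀ᵐ x ∂(volume.restrict (Metric.thickening r Ω)), S f x = ballAvg m ρ δ N σ g x := by
  obtain ⟨C, hC, H⟩ := h.exists_ballAvg_le hΩ
  refine ⟨√C, by positivity, fun δ hδ hδr => ?_⟩
  set D := Metric.thickening r Ω with hD
  have hDm : MeasurableSet D := Metric.isOpen_thickening.measurableSet
  have hfm : ∀ f : L2 Ω ℝ, Measurable (f : E n → ℝ) := fun f => (Lp.stronglyMeasurable f).measurable
  have hle : ∀ f : L2 Ω ℝ, sq D (ballAvg m ρ δ N σ f) ≤ ENNReal.ofReal C * sq Ω f := fun f =>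
    H δ D Ω f hδ hδr hDm hΩ.measurableSet subset_rfl
      (fun x hx => h.avgBall_subset hδ hδr hx) (hfm f) (Lp.memLp f)
  have hS : ∀ f : L2 Ω ℝ, SqInt D (ballAvg m ρ δ N σ f) := fun f => by
    refine sqInt_of_sq_lt_top (h.measurable_ballAvg δ (hfm f)).aestronglyMeasurable ?_
    exact (hle f).trans_lt (ENNReal.mul_lt_top ENNReal.ofReal_lt_top (sq_lt_top (Lp.memLp f)))
  have hint : ∀ (f : L2 Ω ℝ), ∀ x ∈ D, Integrable fun w =>
      kern (ρ / 4) (centre (slope m ρ) δ N σ x) (radius (slope m ρ) δ σ x) w * f w :=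
    fun f x hx => integrable_kern_mul (by linarith [h.ρ_pos]) (hδ.trans_le (h.radius_pos hδ hx))
      ((show SqInt Ω f from Lp.memLp f).mono (h.avgBall_subset hδ hδr hx))
  let T : L2 Ω ℝ →ₗ[ℝ] L2 D ℝ :=
    { toFun := fun f => (hS f).toLp _
      map_add' := fun f g => by
        rw [← MemLp.toLp_add, MemLp.toLp_eq_toLp_iff]
        refine (ae_restrict_mem hDm).mono fun x hx => ?_
        rw [h.ballAvg_congr hδ hδr (Lp.coeFn_add f g) hx]
        simp only [ballAvg, wavg, Pi.add_apply]
        rw [← integral_add (hint f x hx) (hint g x hx)]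
        refine integral_congr_ae (ae_of_all _ fun w => ?_)
        ring
      map_smul' := fun c f => by
        rw [RingHom.id_apply, ← MemLp.toLp_const_smul, MemLp.toLp_eq_toLp_iff]
        refine (ae_restrict_mem hDm).mono fun x hx => ?_
        rw [h.ballAvg_congr hδ hδr (Lp.coeFn_smul c f) hx]
        simp only [ballAvg, wavg, Pi.smul_apply, smul_eq_mul]
        rw [← integral_const_mul]
        refine integral_congr_ae (ae_of_all _ fun w => ?_)
        ring }
  have hT : ∀ f, ‖T f‖ ≤ √C * ‖f‖ := fun f => by
    change ‖(hS f).toLp _‖ ≤ _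
    rw [norm_toLp_eq (hS f), norm_eq_nrm f]
    refine nrm_le_of_sq_le (by have := nrm_nonneg Ω f; positivity) ((hle f).trans ?_)
    rw [mul_pow, Real.sq_sqrt hC, ENNReal.ofReal_mul hC, sq_eq_ofReal (Lp.memLp f)]
  refine ⟨T.mkContinuous (√C) hT, hT, fun f g hfg => ?_⟩
  filter_upwards [(hS f).coeFn_toLp, ae_restrict_mem hDm] with x hx hxD
  refine Eq.trans hx ?_
  exact h.ballAvg_congr hδ hδr hfg hxD

theorem TransversalField.abs_ballAvg_sub_le (h : TransversalField Ω N σ K m r ρ) {η : E n → ℝ}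
    {L : ℝ≥0} (hη : LipschitzWith L η) {δ δ' : ℝ} (hδ : 0 < δ) (hδ' : 0 < δ') {x : E n}
    (hx : x ∈ Metric.thickening r Ω) :
    |ballAvg m ρ δ N σ η x - ballAvg m ρ δ' N σ η x| ≤ L * (m + 1) * |δ - δ'| := by
  have hρ := h.ρ_pos
  rw [ballAvg, ballAvg, wavg_eq (hδ.trans_le (h.radius_pos hδ hx)),
    wavg_eq (hδ'.trans_le (h.radius_pos hδ' hx))]
  refine (abs_hat_integral_sub_le (by linarith) (by linarith [h.ρ_le]) hη _ _ _ _).trans ?_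
  have e1 : radius (slope m ρ) δ σ x - radius (slope m ρ) δ' σ x = δ - δ' := by
    unfold radius; ring
  have e2 : centre (slope m ρ) δ N σ x - centre (slope m ρ) δ' N σ x = (δ - δ') • N x := by
    unfold centre radius; module
  rw [e1, e2, norm_smul, Real.norm_eq_abs, mul_assoc]
  refine mul_le_mul_of_nonneg_left ?_ L.2
  nlinarith [mul_le_mul_of_nonneg_left (h.N_le x) (abs_nonneg (δ - δ'))]

theorem TransversalField.abs_ballAvg_sub_self_le (h : TransversalField Ω N σ K m r ρ)
    {η : E n → ℝ} {L : ℝ≥0} (hη : LipschitzWith L η) {δ : ℝ} (hδ : 0 < δ) {x : E n}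
    (hx : x ∈ Ω) : |ballAvg m ρ δ N σ η x - η x| ≤ L * (m + 1) * δ := by
  have hρ := h.ρ_pos
  have ha : 0 < ρ / 4 := by linarith
  have e0 : radius (slope m ρ) δ σ x = δ := by rw [radius, h.σ_zero x hx]; ring
  have e1 : η x = (hatMass n (ρ / 4))⁻¹ * ∫ z, hat (ρ / 4) z * η (x + (0 : ℝ) • z) := by
    simp only [zero_smul, add_zero]
    rw [integral_mul_const, ← hatMass, inv_mul_cancel_left₀ (hatMass_pos ha).ne']
  rw [ballAvg, wavg_eq (hδ.trans_le (h.radius_pos hδ (h.mem hx))), e1]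
  refine (abs_hat_integral_sub_le ha (by linarith [h.ρ_le]) hη _ _ _ _).trans ?_
  have e2 : centre (slope m ρ) δ N σ x - x = δ • N x := by
    rw [centre, e0, h.σ_zero x hx]; module
  rw [e0, e2, norm_smul, Real.norm_eq_abs, mul_assoc, sub_zero, abs_of_pos hδ]
  refine mul_le_mul_of_nonneg_left ?_ L.2
  nlinarith [mul_le_mul_of_nonneg_left (h.N_le x) hδ.le]

end

end

/-! ### The limit of the averaging operators as δ tends to zero. -/

section

open Filter Topology
open scoped ENNReal NNReal

variable {n : ℕ}

section

variable {Ω : Set (E n)} {N : E n → E n} {σ : E n → ℝ} {K : ℝ≥0} {m r ρ : ℝ}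

theorem IsTest.exists_lipschitz {A : Set (E n)} {η : E n → ℝ} (hη : IsTest A η) :
    ∃ L : ℝ≥0, LipschitzWith L η :=
  ContDiff.lipschitzWith_of_hasCompactSupport hη.compact hη.smooth (by simp)

/-- On a Lipschitz function the means vary by O(|δ − δ'|) and, on Ω, differ from the function by
O(δ). The uniform bound in δ transfers this to every f, up to an arbitrary κ, by density of test
functions. -/
theorem TransversalField.exists_avgCLM_family (h : TransversalField Ω N σ K m r ρ) (hΩ : IsOpen Ω)
    (hb : Bornology.IsBounded Ω) :
    ∃ (C : ℝ) (S : ℝ → L2 Ω ℝ →L[ℝ] L2 (Metric.thickening r Ω) ℝ), 0 ≤ C ∧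
      (∀ δ, 0 < δ → δ ≤ r / 2 → (∀ f, ‖S δ f‖ ≤ C * ‖f‖) ∧
        ∀ (f : L2 Ω ℝ), ∀ᵐ x ∂(volume.restrict (Metric.thickening r Ω)),
          S δ f x = ballAvg m ρ δ N σ f x) ∧
      ∀ (f : L2 Ω ℝ) (κ : ℝ), 0 < κ → ∃ B : ℝ, 0 ≤ B ∧ ∀ δ δ', 0 < δ → δ ≤ r / 2 → 0 < δ' →
        δ' ≤ r / 2 → ‖S δ f - S δ' f‖ ≤ κ + B * |δ - δ'| ∧
          nrm Ω (fun x => S δ f x - f x) ≤ κ + B * δ := by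
  set D := Metric.thickening r Ω with hD
  obtain ⟨C, hC, H⟩ := h.exists_avgCLM hΩ
  rw [← hD] at H
  choose S hS1 hS2 using H
  have hDm : MeasurableSet D := Metric.isOpen_thickening.measurableSet
  have hΩD : Ω ⊆ D := Metric.self_subset_thickening h.r_pos Ω
  have hDv : volume D ≠ ⊤ := hb.thickening.measure_lt_top.ne
  have hm := h.one_le
  classical
  -- The value 0 outside the admissible range of δ only makes the family total; all the assertions
  -- are restricted to that range.
  refine ⟨C, fun δ => if hδ : 0 < δ ∧ δ ≤ r / 2 then S δ hδ.1 hδ.2 else 0, hC, ?_, ?_⟩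
  · intro δ hδ hδr
    beta_reduce
    rw [dif_pos ⟨hδ, hδr⟩]
    exact ⟨hS1 δ hδ hδr, fun f => hS2 δ hδ hδr f f (ae_eq_refl _)⟩
  intro f κ hκ
  -- The error f − η is seen by two operators of norm at most C in the first estimate, and by one
  -- operator and the identity in the second; 2C + 1 covers both.
  obtain ⟨η, hη, hfη⟩ := exists_test_near hΩ (Lp.memLp f) (δ := κ / (2 * C + 1)) (by positivity)
  have hκC : (2 * C + 1) * (κ / (2 * C + 1)) = κ := by field_simp
  obtain ⟨L, hL⟩ := hη.exists_lipschitz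
  set V := √(volume D).toReal with hV
  refine ⟨L * (m + 1) * V, by positivity, fun δ δ' hδ hδr hδ' hδr' => ?_⟩
  beta_reduce
  rw [dif_pos ⟨hδ, hδr⟩, dif_pos ⟨hδ', hδr'⟩]
  set g : L2 Ω ℝ := (hη.sqInt Ω).toLp η with hg
  have hgη : g =ᵐ[volume.restrict Ω] η := (hη.sqInt Ω).coeFn_toLp
  have hfg : ‖f - g‖ ≤ κ / (2 * C + 1) := by
    rw [norm_eq_nrm]
    refine le_trans (le_of_eq (nrm_congr ?_)) hfη
    filter_upwards [Lp.coeFn_sub f g, hgη] with x h1 h2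
    rw [h1, Pi.sub_apply, h2]
  have hCf : ∀ δ hδ hδr, ‖S δ hδ hδr (f - g)‖ ≤ C * (κ / (2 * C + 1)) := fun δ hδ hδr =>
    (hS1 δ hδ hδr _).trans (mul_le_mul_of_nonneg_left hfg hC)
  constructor
  · have e : S δ hδ hδr f - S δ' hδ' hδr' f = S δ hδ hδr (f - g) - S δ' hδ' hδr' (f - g) +
        (S δ hδ hδr g - S δ' hδ' hδr' g) := by simp only [map_sub]; abel
    have h1 : ‖S δ hδ hδr g - S δ' hδ' hδr' g‖ ≤ L * (m + 1) * |δ - δ'| * V := by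
      rw [norm_eq_nrm]
      have : (S δ hδ hδr g - S δ' hδ' hδr' g : L2 D ℝ) =ᵐ[volume.restrict D]
          fun x => ballAvg m ρ δ N σ η x - ballAvg m ρ δ' N σ η x := by
        filter_upwards [Lp.coeFn_sub (S δ hδ hδr g) (S δ' hδ' hδr' g), hS2 δ hδ hδr g η hgη,
          hS2 δ' hδ' hδr' g η hgη] with x h1 h2 h3
        rw [h1, Pi.sub_apply, h2, h3]
      rw [nrm_congr this]
      exact nrm_le_of_abs_le hDv hDm (by positivity)
        fun x hx => h.abs_ballAvg_sub_le hL hδ hδ' hx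
    rw [e]
    have h2 := norm_add_le (S δ hδ hδr (f - g) - S δ' hδ' hδr' (f - g))
      (S δ hδ hδr g - S δ' hδ' hδr' g)
    have h3 := norm_sub_le (S δ hδ hδr (f - g)) (S δ' hδ' hδr' (f - g))
    have h4 := hCf δ hδ hδr
    have h5 := hCf δ' hδ' hδr'
    have h6 : 0 < κ / (2 * C + 1) := by positivity
    nlinarith
  · have hS : ∀ f, SqInt Ω (S δ hδ hδr f) := fun f =>
      (show SqInt D (S δ hδ hδr f) from Lp.memLp _).mono hΩD
    have hfs : SqInt Ω f := Lp.memLp f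
    have h1 : nrm Ω (fun x => ballAvg m ρ δ N σ η x - η x) ≤ L * (m + 1) * δ * V := by
      refine (nrm_le_of_abs_le ((measure_mono hΩD).trans_lt hDv.lt_top).ne hΩ.measurableSet
        (by positivity) fun x hx => h.abs_ballAvg_sub_self_le hL hδ hx).trans ?_
      gcongr
      exact Real.sqrt_le_sqrt (ENNReal.toReal_mono hDv (measure_mono hΩD))
    have hres : ∀ {p : E n → Prop}, (∀ᵐ x ∂(volume.restrict D), p x) →
        ∀ᵐ x ∂(volume.restrict Ω), p x := fun hp => ae_mono (Measure.restrict_mono hΩD le_rfl) hp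
    have e : (fun x => S δ hδ hδr f x - f x) =ᵐ[volume.restrict Ω]
        fun x => (S δ hδ hδr (f - g) x + (ballAvg m ρ δ N σ η x - η x)) - (f - g : L2 Ω ℝ) x := by
      have h2 : S δ hδ hδr (f - g) = S δ hδ hδr f - S δ hδ hδr g := map_sub _ _ _
      filter_upwards [hres (Lp.coeFn_sub (S δ hδ hδr f) (S δ hδ hδr g)), Lp.coeFn_sub f g,
        hres (hS2 δ hδ hδr g η hgη), hgη] with x h3 h4 h5 h6
      rw [h2, h3, h4, Pi.sub_apply, Pi.sub_apply, h5, h6]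
      ring
    have hba : SqInt Ω (fun x => ballAvg m ρ δ N σ η x - η x) := by
      refine MemLp.sub (MemLp.ae_eq (f := S δ hδ hδr g) ?_ (hS g)) (hη.sqInt Ω)
      exact hres (hS2 δ hδ hδr g η hgη)
    rw [nrm_congr e]
    refine (nrm_sub_le ((hS (f - g)).add hba) (Lp.memLp (f - g))).trans ?_
    refine (add_le_add (nrm_add_le (hS (f - g)) hba) le_rfl).trans ?_
    have h3 : nrm Ω (S δ hδ hδr (f - g)) ≤ C * (κ / (2 * C + 1)) := by
      refine le_trans (nrm_mono (show SqInt D _ from Lp.memLp _) hΩD) ?_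
      rw [← norm_eq_nrm]; exact hCf δ hδ hδr
    rw [norm_eq_nrm] at hfg
    refine (add_le_add (add_le_add h3 h1) hfg).trans ?_
    have h6 : 0 < κ / (2 * C + 1) := by positivity
    have h7 := mul_nonneg hC h6.le
    linarith

theorem tendsto_zero_of_eventually_le {u : ℕ → ℝ} (hu : ∀ k, 0 ≤ u k)
    (h : ∀ κ > 0, ∀ᶠ k in atTop, u k ≤ κ) : Tendsto u atTop (𝓝 0) := by
  refine Metric.tendsto_nhds.2 fun κ hκ => ?_
  filter_upwards [h (κ / 2) (half_pos hκ)] with k hk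
  rw [Real.dist_eq, sub_zero, abs_of_nonneg (hu k)]
  linarith

theorem nrm_eq_zero {S : Set (E n)} {w : E n → ℝ} (hw : SqInt S w) (h : nrm S w = 0) :
    w =ᵐ[volume.restrict S] 0 := by
  rw [← norm_toLp_eq hw, norm_eq_zero] at h
  have h1 := hw.coeFn_toLp
  rw [h] at h1
  exact h1.symm.trans (Lp.coeFn_zero ℝ 2 (volume.restrict S))

theorem norm_sub_eq_nrm {D : Set (E n)} (f g : L2 D ℝ) : ‖f - g‖ = nrm D (fun x => f x - g x) := by
  rw [norm_eq_nrm, nrm_congr (Lp.coeFn_sub _ _)]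
  rfl

theorem ae_eq_of_tendsto {D : Set (E n)} (hΩD : Ω ⊆ D) {w : ℕ → L2 D ℝ} {w₀ : L2 D ℝ}
    (hw : Tendsto w atTop (𝓝 w₀)) {f : E n → ℝ} (hf : SqInt Ω f)
    (h : Tendsto (fun k => nrm Ω (fun x => w k x - f x)) atTop (𝓝 0)) :
    w₀ =ᵐ[volume.restrict Ω] f := by
  have hm : ∀ w : L2 D ℝ, SqInt Ω w := fun w => (show SqInt D w from Lp.memLp w).mono hΩD
  have h1 : ∀ k, nrm Ω (fun x => w₀ x - f x) ≤ ‖w₀ - w k‖ + nrm Ω (fun x => w k x - f x) := by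
    intro k
    have h2 := nrm_add_le ((hm w₀).sub (hm (w k))) ((hm (w k)).sub hf)
    simp only [Pi.sub_apply, sub_add_sub_cancel] at h2
    refine h2.trans (add_le_add ?_ le_rfl)
    rw [norm_sub_eq_nrm]
    exact nrm_mono (MemLp.sub (Lp.memLp w₀) (Lp.memLp (w k))) hΩD
  have h2 : Tendsto (fun k => ‖w₀ - w k‖ + nrm Ω (fun x => w k x - f x)) atTop (𝓝 (0 + 0)) := by
    refine Tendsto.add ?_ h
    have := (tendsto_const_nhds (x := w₀)).sub hw
    simpa using this.norm
  rw [add_zero] at h2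
  have h3 := le_antisymm (ge_of_tendsto' h2 h1) (nrm_nonneg _ _)
  filter_upwards [nrm_eq_zero ((hm w₀).sub hf) h3] with x hx
  simp only [Pi.sub_apply, Pi.zero_apply] at hx
  linarith

-- Along δₖ = r/(2(k + 1)) the operators form a Cauchy sequence at each f, by the preceding family
-- estimate, so they converge strongly. The limit inherits the bound and is the identity on Ω, where
-- the means converge to f.
set_option maxHeartbeats 1000000 in
theorem TransversalField.exists_limit (h : TransversalField Ω N σ K m r ρ) (hΩ : IsOpen Ω)
    (hb : Bornology.IsBounded Ω) :
    ∃ (C : ℝ) (S : ℕ → L2 Ω ℝ →L[ℝ] L2 (Metric.thickening r Ω) ℝ) (δ : ℕ → ℝ)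
      (T : L2 Ω ℝ →L[ℝ] L2 (Metric.thickening r Ω) ℝ), 0 ≤ C ∧
      (∀ k, 0 < δ k ∧ δ k ≤ r / 2) ∧ Tendsto δ atTop (𝓝 0) ∧
      (∀ k (f : L2 Ω ℝ), ∀ᵐ x ∂(volume.restrict (Metric.thickening r Ω)),
          S k f x = ballAvg m ρ (δ k) N σ f x) ∧
      (∀ f, Tendsto (fun k => S k f) atTop (𝓝 (T f))) ∧
      (∀ f, ‖T f‖ ≤ C * ‖f‖) ∧ ∀ f, T f =ᵐ[volume.restrict Ω] f := by
  have hex := h.exists_avgCLM_family hΩ hb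
  have hΩD : Ω ⊆ Metric.thickening r Ω := Metric.self_subset_thickening h.r_pos Ω
  generalize Metric.thickening r Ω = D at *
  obtain ⟨C, S, hC, H1, H2⟩ := hex
  have hr := h.r_pos
  set δ : ℕ → ℝ := fun k => r / 2 * (1 / ((k : ℝ) + 1)) with hδ
  have hδ0 : ∀ k, 0 < δ k ∧ δ k ≤ r / 2 := fun k => by
    have h1 : 1 / ((k : ℝ) + 1) ≤ 1 := by
      rw [div_le_one (by positivity)]; linarith [(k.cast_nonneg : (0 : ℝ) ≤ k)]
    exact ⟨by positivity, mul_le_of_le_one_right (by positivity) h1⟩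
  have hδt : Tendsto δ atTop (𝓝 0) := by
    have := (tendsto_one_div_add_atTop_nhds_zero_nat (𝕜 := ℝ)).const_mul (r / 2)
    rwa [mul_zero] at this
  have hcau : ∀ f, CauchySeq fun k => S (δ k) f := by
    intro f
    refine Metric.cauchySeq_iff'.2 fun κ hκ => ?_
    obtain ⟨B, hB, HB⟩ := H2 f (κ / 2) (by positivity)
    have hev : ∀ᶠ k in atTop, B * δ k < κ / 4 := by
      have := hδt.const_mul B
      rw [mul_zero] at this
      exact this.eventually_lt_const (by positivity)
    obtain ⟨k₀, hk₀⟩ := eventually_atTop.1 hev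
    refine ⟨k₀, fun k hk => ?_⟩
    rw [dist_eq_norm]
    have h1 := (HB (δ k) (δ k₀) (hδ0 k).1 (hδ0 k).2 (hδ0 k₀).1 (hδ0 k₀).2).1
    have h2 : |δ k - δ k₀| ≤ δ k + δ k₀ := by
      rw [abs_le]; constructor <;> linarith [(hδ0 k).1, (hδ0 k₀).1]
    have h3 := hk₀ k hk
    have h4 := hk₀ k₀ le_rfl
    nlinarith [mul_le_mul_of_nonneg_left h2 hB]
  choose t ht using fun f => cauchySeq_tendsto_of_complete (hcau f)
  let T : L2 Ω ℝ →L[ℝ] L2 D ℝ :=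
    continuousLinearMapOfTendsto (fun k => S (δ k)) (tendsto_pi_nhds.2 ht)
  have hT : ∀ f, Tendsto (fun k => S (δ k) f) atTop (𝓝 (T f)) := ht
  refine ⟨C, fun k => S (δ k), δ, T, hC, hδ0, hδt,
    fun k f => (H1 (δ k) (hδ0 k).1 (hδ0 k).2).2 f, hT, fun f => ?_, fun f => ?_⟩
  · exact le_of_tendsto (hT f).norm
      (Eventually.of_forall fun k => (H1 (δ k) (hδ0 k).1 (hδ0 k).2).1 f)
  · refine ae_eq_of_tendsto hΩD (hT f) (Lp.memLp f) ?_
    refine tendsto_zero_of_eventually_le (fun _ => nrm_nonneg _ _) fun κ hκ => ?_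
    obtain ⟨B, hB, HB⟩ := H2 f (κ / 4) (by positivity)
    have hev : ∀ᶠ k in atTop, B * δ k < κ / 4 := by
      have := hδt.const_mul B
      rw [mul_zero] at this
      exact this.eventually_lt_const (by positivity)
    filter_upwards [hev] with k hk
    have h1 := (HB (δ k) (δ k) (hδ0 k).1 (hδ0 k).2 (hδ0 k).1 (hδ0 k).2).2
    linarith

theorem tendsto_integral_mul {D : Set (E n)} {g : E n → ℝ} (hg : SqInt D g) {w : ℕ → L2 D ℝ}
    {w₀ : L2 D ℝ} (hw : Tendsto w atTop (𝓝 w₀)) :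
    Tendsto (fun k => ∫ x in D, g x * w k x) atTop (𝓝 (∫ x in D, g x * w₀ x)) := by
  have e : ∀ w : L2 D ℝ, ∫ x in D, g x * w x = inner ℝ (hg.toLp g : L2 D ℝ) w := by
    intro w
    rw [integral_mul_eq_inner hg (Lp.memLp w), Lp.toLp_coeFn]
  simp only [e]
  exact tendsto_const_nhds.inner hw

/-- Bounds tested against ∂ᵢη survive convergence in `L²`. The averaging balls need to lie in W only
for large k, so the part of their displacement that is proportional to δ plays no role in the choice
of W. -/
theorem TransversalField.exists_limit_deriv (h : TransversalField Ω N σ K m r ρ) (hΩ : IsOpen Ω)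
    (hb : Bornology.IsBounded Ω) :
    ∃ (C : ℝ) (δ : ℕ → ℝ) (T : L2 Ω ℝ →L[ℝ] L2 (Metric.thickening r Ω) ℝ), 0 ≤ C ∧
      (∀ k, 0 < δ k ∧ δ k ≤ r / 2) ∧ Tendsto δ atTop (𝓝 0) ∧
      (∀ f, ‖T f‖ ≤ C * ‖f‖) ∧ (∀ f, T f =ᵐ[volume.restrict Ω] f) ∧
      ∀ (A W : Set (E n)) (φ : H1 Ω ℝ), IsOpen A → MeasurableSet W → W ⊆ Ω →
        A ⊆ Metric.thickening r Ω → (∀ᶠ k in atTop, ∀ x ∈ A, avgBall m ρ (δ k) N σ x ⊆ W) →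
        ∀ i η, IsTest A η → |∫ x in Metric.thickening r Ω, pderiv i η x * T (fn φ) x| ≤
          C * nrm W (vec fun i => grad φ i) * nrm A η := by
  obtain ⟨C₁, S, δ, T, hC₁, hδ, hδt, hS, hT, hTle, hTeq⟩ := h.exists_limit hΩ hb
  obtain ⟨C₂, hC₂, H⟩ := h.exists_ballAvg_deriv_le hΩ
  refine ⟨max C₁ C₂, δ, T, hC₁.trans (le_max_left _ _), hδ, hδt, fun f => (hTle f).trans
    (mul_le_mul_of_nonneg_right (le_max_left _ _) (norm_nonneg _)), hTeq, ?_⟩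
  intro A W φ hA hW hWΩ hAD hAW i η hη
  have hlim := tendsto_integral_mul ((hη.pderiv i).sqInt (Metric.thickening r Ω)) (hT (fn φ))
  refine le_trans (le_of_tendsto hlim.abs (b := C₂ * nrm W (vec fun i => grad φ i) * nrm A η) ?_)
    (mul_le_mul_of_nonneg_right (mul_le_mul_of_nonneg_right (le_max_right _ _) (nrm_nonneg _ _))
      (nrm_nonneg _ _))
  filter_upwards [hAW] with k hk
  have e : ∫ x in Metric.thickening r Ω, pderiv i η x * S k (fn φ) x =
      ∫ x in Metric.thickening r Ω, pderiv i η x * ballAvg m ρ (δ k) N σ (fn φ) x := by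
    refine integral_congr_ae ?_
    filter_upwards [hS k (fn φ)] with x hx
    rw [hx]
  rw [e]
  exact H (δ k) A W (fn φ) (fun i => grad φ i) (hδ k).1 (hδ k).2 hA hW hWΩ hAD hk
    (Lp.stronglyMeasurable _).measurable (fun i => (Lp.stronglyMeasurable _).measurable)
    (sobolevOn_H1 φ) i η hη

end

end

/-! ### The extension operator to a small neighbourhood of the domain. -/

section

open Filter Topology
open scoped ENNReal NNReal

variable {n : ℕ}

section

variable {Ω : Set (E n)} {N : E n → E n} {σ : E n → ℝ} {K : ℝ≥0} {m r ρ : ℝ}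

/-- `P` extends functions from `Ω` to the `r`-neighbourhood of `Ω`; the gradient outside `Ω` is
controlled by the gradient in a layer of the same width inside `Ω`. -/
def IsLocalExtension (Ω : Set (E n)) (r C : ℝ)
    (P : H1 Ω ℝ →L[ℝ] H1 (Metric.thickening r Ω) ℝ) : Prop :=
  ∀ φ, fn (P φ) =ᵐ[volume.restrict Ω] fn φ ∧ ‖fn (P φ)‖ ≤ C * ‖fn φ‖ ∧
    nrm (Metric.thickening r Ω) (vec fun i => grad (P φ) i) ≤
      C * nrm Ω (vec fun i => grad φ i) ∧
    ∀ s, 0 < s → s ≤ r → nrm (Metric.thickening s Ω \ closure Ω) (vec fun i => grad (P φ) i) ≤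
      C * nrm (Ω ∩ Metric.thickening s (frontier Ω)) (vec fun i => grad φ i)

/-- The limiting test bound is used with two pairs (A, W): the whole neighbourhood with Ω, for the
global gradient, and the outer layer with the inner layer of the same width. The closure of Ω is
removed, and not Ω, so that the outer layer is open. -/
theorem TransversalField.exists_local_extension (h : TransversalField Ω N σ K m r ρ)
    (hopen : IsOpen Ω) (hb : Bornology.IsBounded Ω) :
    ∃ (C : ℝ) (P : H1 Ω ℝ →L[ℝ] H1 (Metric.thickening r Ω) ℝ), 0 ≤ C ∧
      IsLocalExtension Ω r C P := by
  obtain ⟨C, δ, T, hC, hδ, hδt, hTle, hTeq, key⟩ := h.exists_limit_deriv hopen hb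
  have hDo : IsOpen (Metric.thickening r Ω) := Metric.isOpen_thickening
  have hall : ∀ᶠ k in atTop, ∀ x ∈ Metric.thickening r Ω, avgBall m ρ (δ k) N σ x ⊆ Ω :=
    Eventually.of_forall fun k x hx => h.avgBall_subset (hδ k).1 (hδ k).2 hx
  have hgn : ∀ φ : H1 Ω ℝ, nrm Ω (vec fun i => grad φ i) ≤ ‖φ‖ := fun φ =>
    (gradNorm_self φ).symm.trans_le (gradNorm_le_norm φ)
  have hbound : ∀ (φ : H1 Ω ℝ) (i : Fin n) (η : E n → ℝ), IsTest (Metric.thickening r Ω) η →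
      |∫ x in Metric.thickening r Ω, pderiv i η x * T (fn φ) x| ≤
        C * ‖φ‖ * nrm (Metric.thickening r Ω) η := fun φ i η hη =>
    (key _ Ω φ hDo hopen.measurableSet subset_rfl subset_rfl hall i η hη).trans
      (mul_le_mul_of_nonneg_right (mul_le_mul_of_nonneg_left (hgn φ) hC) (nrm_nonneg _ _))
  obtain ⟨P, hP⟩ := exists_H1_clm hDo (T.comp (fnL Ω ℝ)) hC hbound
  have hPT : ∀ φ, fn (P φ) = T (fn φ) := hP
  have hgrad : ∀ (A W : Set (E n)) (φ : H1 Ω ℝ), IsOpen A → MeasurableSet W → W ⊆ Ω →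
      A ⊆ Metric.thickening r Ω →
      (∀ᶠ k in atTop, ∀ x ∈ A, avgBall m ρ (δ k) N σ x ⊆ W) →
      nrm A (vec fun i => grad (P φ) i) ≤ n * (C * nrm W (vec fun i => grad φ i)) := by
    intro A W φ hA hW hWΩ hAD hAW
    refine (sobolevOn_H1 (P φ)).nrm_vec_le hA hAD
      (mul_nonneg hC (nrm_nonneg _ _)) fun i η hη => ?_
    have := key A W φ hA hW hWΩ hAD hAW i η hη
    rwa [← hPT] at this
  have hle : ∀ (W : Set (E n)) (φ : H1 Ω ℝ), n * (C * nrm W (vec fun i => grad φ i)) ≤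
      (C + n * C) * nrm W (vec fun i => grad φ i) := fun W φ => by
    have := mul_nonneg hC (nrm_nonneg W (vec fun i => grad φ i))
    linarith
  refine ⟨C + n * C, P, by positivity, fun φ => ⟨?_, ?_, ?_, fun s hs hsr => ?_⟩⟩
  · rw [hPT]; exact hTeq _
  · rw [hPT]
    refine (hTle _).trans (mul_le_mul_of_nonneg_right ?_ (norm_nonneg _))
    have : 0 ≤ n * C := by positivity
    linarith
  · exact (hgrad _ Ω φ hDo hopen.measurableSet subset_rfl subset_rfl hall).trans (hle Ω φ)
  · have hsD : Metric.thickening s Ω ⊆ Metric.thickening r Ω := Metric.thickening_mono hsr Ω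
    refine (hgrad _ (Ω ∩ Metric.thickening s (_root_.frontier Ω)) φ
      (Metric.isOpen_thickening.sdiff isClosed_closure)
      (hopen.measurableSet.inter Metric.isOpen_thickening.measurableSet) inter_subset_left
      (sdiff_subset.trans hsD) ?_).trans (hle _ φ)
    have hm := h.one_le
    -- A ball attached to x at distance less than s from Ω is then within s/4 + s/4 of a frontier
    -- point, hence in the inner layer of width s.
    have hev : ∀ᶠ k in atTop, (m + 1) * δ k < s / 4 := by
      have := hδt.const_mul (m + 1)
      rw [mul_zero] at this
      exact this.eventually_lt_const (by positivity)
    filter_upwards [hev] with k hk x hx w hw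
    have hxD := hsD hx.1
    refine ⟨h.avgBall_subset (hδ k).1 (hδ k).2 hxD hw, ?_⟩
    obtain ⟨p, hp, hwp⟩ := h.exists_frontier_near (hδ k).1 hxD
      (fun hc => hx.2 (subset_closure hc)) hw
    refine Metric.mem_thickening_iff.2 ⟨p, hp, ?_⟩
    have h1 : Metric.infDist x Ω < s := by
      obtain ⟨y, hy, hxy⟩ := Metric.mem_thickening_iff.1 hx.1
      exact (Metric.infDist_le_dist_of_mem hy).trans_lt hxy
    rw [dist_eq_norm]
    linarith

theorem exists_local_extension (hopen : IsOpen Ω) (hne : Ω.Nonempty) (hb : Bornology.IsBounded Ω)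
    (hL : HasLipschitzBoundary Ω) :
    ∃ (r C : ℝ) (P : H1 Ω ℝ →L[ℝ] H1 (Metric.thickening r Ω) ℝ), 0 < r ∧ 0 ≤ C ∧
      IsLocalExtension Ω r C P := by
  obtain ⟨N, K₀, m, r₀, ρ₀, hc⟩ := exists_coneField hopen hb hL
  obtain ⟨σ, K, r, ρ, h⟩ := hc.exists_transversalField hopen hne
  obtain ⟨C, P, hC, hP⟩ := h.exists_local_extension hopen hb
  exact ⟨r, C, P, h.r_pos, hC, hP⟩

end

end

section

open Filter Topology
open scoped ENNReal NNReal

variable {n : ℕ}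

/-! ### The boundary layer -/

/-- Consecutive sets may overlap, but those of even index are pairwise disjoint and so are those of
odd index; hence the factor 2. -/
theorem sum_sq_le_of_disjoint {X : Type*} [NormedAddCommGroup X] {D : Set (E n)}
    {S : ℕ → Set (E n)} {J : ℕ} (hm : ∀ k, MeasurableSet (S k)) (hS : ∀ k < J, S k ⊆ D)
    (hdis : ∀ i j, i + 2 ≤ j → j < J → Disjoint (S i) (S j)) (w : E n → X) :
    ∑ k ∈ Finset.range J, sq (S k) w ≤ 2 * sq D w := by
  have key : ∀ p : ℕ → Prop, ∀ _ : DecidablePred p,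
      (∀ i j, p i → p j → i < j → i + 2 ≤ j) →
      ∑ k ∈ (Finset.range J).filter p, sq (S k) w ≤ sq D w := by
    intro p _ hp
    have hd : Set.PairwiseDisjoint (↑((Finset.range J).filter p)) S := by
      intro i hi j hj hij
      simp only [Finset.coe_filter, Finset.mem_range, mem_ofPred_eq] at hi hj
      rcases lt_or_gt_of_ne hij with h | h
      · exact hdis i j (hp i j hi.2 hj.2 h) hj.1
      · exact (hdis j i (hp j i hj.2 hi.2 h) hi.1).symm
    unfold sq
    rw [← lintegral_biUnion_finset hd fun k _ => hm k]
    refine lintegral_mono_set (iUnion₂_subset fun k hk => hS k ?_)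
    exact Finset.mem_range.1 (Finset.mem_filter.1 hk).1
  rw [← Finset.sum_filter_add_sum_filter_not _ (fun k => k % 2 = 0), two_mul]
  exact add_le_add (key _ _ fun i j h1 h2 h3 => by omega) (key _ _ fun i j h1 h2 h3 => by omega)

theorem sq_biUnion_le {ι X : Type*} [NormedAddCommGroup X] (J : Finset ι) (A : ι → Set (E n))
    (w : E n → X) : sq (⋃ j ∈ J, A j) w ≤ ∑ j ∈ J, sq (A j) w := by
  classical
  induction J using Finset.induction_on with
  | empty => simp [sq]
  | insert j J hj ih =>
    rw [Finset.sum_insert hj, Finset.set_biUnion_insert]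
    exact (lintegral_union_le _ _ _).trans (add_le_add le_rfl ih)

theorem sum_nrm_sq_le_of_disjoint {X : Type*} [NormedAddCommGroup X] {D : Set (E n)}
    {S : ℕ → Set (E n)} {J : ℕ} (hm : ∀ k, MeasurableSet (S k)) (hS : ∀ k < J, S k ⊆ D)
    (hdis : ∀ i j, i + 2 ≤ j → j < J → Disjoint (S i) (S j)) {w : E n → X} (hw : SqInt D w) :
    ∑ k ∈ Finset.range J, nrm (S k) w ^ 2 ≤ 2 * nrm D w ^ 2 := by
  have h := sum_sq_le_of_disjoint hm hS hdis w
  have h1 : ∑ k ∈ Finset.range J, sq (S k) w =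
      ENNReal.ofReal (∑ k ∈ Finset.range J, nrm (S k) w ^ 2) := by
    rw [ENNReal.ofReal_sum_of_nonneg fun _ _ => sq_nonneg _]
    exact Finset.sum_congr rfl fun k hk =>
      sq_eq_ofReal (hw.mono (hS k (Finset.mem_range.1 hk)))
  rw [h1, sq_eq_ofReal hw, ← ENNReal.ofReal_ofNat 2, ← ENNReal.ofReal_mul zero_le_two] at h
  exact (ENNReal.ofReal_le_ofReal_iff (by positivity)).1 h

/-- Telescoping gives a₀ ≤ aₖ + Σbᵢ for every k; squaring, bounding the sum by Cauchy–Schwarz and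
adding over the J values of k produces the factor J in front of a₀². -/
theorem mul_sq_le_of_telescope {J : ℕ} {a b : ℕ → ℝ} (ha : ∀ k, 0 ≤ a k) (hb : ∀ k, 0 ≤ b k)
    (hab : ∀ k < J, a k ≤ a (k + 1) + b k) {S T : ℝ} (hS : ∑ k ∈ Finset.range J, a k ^ 2 ≤ S)
    (hT : ∑ k ∈ Finset.range J, b k ^ 2 ≤ T) : J * a 0 ^ 2 ≤ 2 * S + 2 * (J : ℝ) ^ 2 * T := by
  have h1 : ∀ k ≤ J, a 0 ≤ a k + ∑ i ∈ Finset.range k, b i := by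
    intro k
    induction k with
    | zero => intro _; simp
    | succ k ih =>
      intro hk
      rw [Finset.sum_range_succ]
      linarith [ih (by omega), hab k (by omega)]
  have h2 : (∑ i ∈ Finset.range J, b i) ^ 2 ≤ J * T := by
    have := sq_sum_le_card_mul_sum_sq (s := Finset.range J) (f := b)
    rw [Finset.card_range] at this
    exact this.trans (mul_le_mul_of_nonneg_left hT (by positivity))
  have h3 : ∀ k ∈ Finset.range J, a 0 ^ 2 ≤ 2 * a k ^ 2 + 2 * (J * T) := by
    intro k hk
    have hk' := (Finset.mem_range.1 hk).le
    have h4 : ∑ i ∈ Finset.range k, b i ≤ ∑ i ∈ Finset.range J, b i :=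
      Finset.sum_le_sum_of_subset_of_nonneg (Finset.range_mono hk') fun i _ _ => hb i
    have h5 := h1 k hk'
    have h6 : a 0 ^ 2 ≤ (a k + ∑ i ∈ Finset.range J, b i) ^ 2 :=
      pow_le_pow_left₀ (ha 0) (by linarith) 2
    nlinarith [sq_nonneg (a k - ∑ i ∈ Finset.range J, b i)]
  have h4 := Finset.sum_le_sum h3
  rw [Finset.sum_const, Finset.card_range, nsmul_eq_mul, Finset.sum_add_distrib,
    ← Finset.mul_sum, Finset.sum_const, Finset.card_range, nsmul_eq_mul] at h4
  nlinarith

/-- A discrete trace inequality. The set A is pushed J times by τe; u on A is compared with u on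
each copy, the cost being the gradient on the slabs crossed. As the copies are essentially disjoint,
averaging over them gains a factor 1/J. -/
theorem SobolevOn.mul_nrm_sq_le {D A : Set (E n)} {u : E n → ℝ} {G : Fin n → E n → ℝ}
    (h : SobolevOn D u G) (hA : IsOpen A) {e : E n} (he : ‖e‖ ≤ 1) {τ : ℝ} (hτ : 0 < τ) {J : ℕ}
    (hseg : ∀ x ∈ A, ∀ s, 0 ≤ s → s ≤ J * τ → x + s • e ∈ D)
    (hdis : ∀ x ∈ A, ∀ x' ∈ A, ∀ s s', 0 ≤ s → s + τ ≤ s' → s' ≤ J * τ →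
      x + s • e ≠ x' + s' • e) :
    J * nrm A u ^ 2 ≤ 4 * nrm D u ^ 2 + 4 * (J * τ) ^ 2 * nrm D (Unfolding.vec G) ^ 2 := by
  -- The slab swept by A between the times kτ and (k + 1)τ. Slabs whose indices differ by at least 2
  -- are separated by a time τ, hence disjoint.
  set S : ℕ → Set (E n) := fun k =>
    ⋃ s ∈ Icc (k * τ) ((k + 1) * τ), (fun x => x - s • e) ⁻¹' A with hS
  have hSo : ∀ k, IsOpen (S k) := fun k =>
    isOpen_biUnion fun s _ => hA.preimage (continuous_id.sub continuous_const)
  have hmem : ∀ (k : ℕ) (s : ℝ), k * τ ≤ s → s ≤ (k + 1) * τ → ∀ x ∈ A, x + s • e ∈ S k :=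
    fun k s h1 h2 x hx => mem_iUnion₂.2 ⟨s, ⟨h1, h2⟩, by simpa using hx⟩
  have hkJ : ∀ k < J, ((k : ℝ) + 1) * τ ≤ J * τ := fun k hk => by
    have : (k : ℝ) + 1 ≤ J := by exact_mod_cast hk
    gcongr
  have hSD : ∀ k < J, S k ⊆ D := fun k hk y hy => by
    obtain ⟨s, ⟨h1, h2⟩, hy⟩ := mem_iUnion₂.1 hy
    have := hseg _ hy s (le_trans (by positivity) h1) (h2.trans (hkJ k hk))
    simpa using this
  have hSdis : ∀ i j, i + 2 ≤ j → j < J → Disjoint (S i) (S j) := fun i j hij hj => by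
    refine Set.disjoint_left.2 fun y hy hy' => ?_
    obtain ⟨s, ⟨h1, h2⟩, hx⟩ := mem_iUnion₂.1 hy
    obtain ⟨s', ⟨h1', h2'⟩, hx'⟩ := mem_iUnion₂.1 hy'
    have h3 : ((i : ℝ) + 1) * τ + τ ≤ j * τ := by
      have : (i : ℝ) + 2 ≤ j := by exact_mod_cast hij
      nlinarith
    exact hdis _ hx _ hx' s s' (le_trans (by positivity) h1) (by linarith)
      (h2'.trans (hkJ j hj)) (by simp)
  have hSm : ∀ k, MeasurableSet (S k) := fun k => (hSo k).measurableSet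
  set a : ℕ → ℝ := fun k => nrm A (fun x => u (x + (k * τ) • e)) with ha
  set b : ℕ → ℝ := fun k => τ * nrm (S k) (Unfolding.vec G) with hb
  have hA0 : nrm A u = a 0 := by simp [ha]
  have key := mul_sq_le_of_telescope (J := J) (a := a) (b := b) (fun k => nrm_nonneg _ _)
    (fun k => mul_nonneg hτ.le (nrm_nonneg _ _)) (S := 2 * nrm D u ^ 2)
    (T := τ ^ 2 * (2 * nrm D (Unfolding.vec G) ^ 2)) ?_ ?_ ?_
  · rw [hA0]
    refine key.trans (le_of_eq ?_)
    ring
  · intro k hk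
    set z : E n := (k * τ) • e with hz
    have hAk : IsOpen ((fun x => x - z) ⁻¹' A) := hA.preimage (continuous_id.sub continuous_const)
    have hseg' : ∀ s ∈ Icc (0 : ℝ) 1, ∀ x ∈ (fun x => x - z) ⁻¹' A, x + s • (τ • e) ∈ S k := by
      intro s hs x hx
      have e1 : x + s • (τ • e) = (x - z) + (k * τ + s * τ) • e := by
        rw [hz]; module
      rw [e1]
      have h1 : 0 ≤ s * τ := mul_nonneg hs.1 hτ.le
      have h2 : s * τ ≤ τ := mul_le_of_le_one_left hτ.le hs.2
      exact hmem k _ (by linarith) (by linarith) _ hx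
    have h1 := (h.mono (hSD k hk)).nrm_translate_sub_le hAk (τ • e) hseg'
    rw [norm_smul, Real.norm_of_nonneg hτ.le] at h1
    have h2 : τ * ‖e‖ * nrm (S k) (Unfolding.vec G) ≤ b k :=
      mul_le_mul_of_nonneg_right (mul_le_of_le_one_right hτ.le he) (nrm_nonneg _ _)
    have hu1 : SqInt ((fun x => x - z) ⁻¹' A) (fun x => u (x + τ • e)) :=
      h.sqInt.translate fun x hx => by
        have := hSD k hk (hseg' 1 ⟨zero_le_one, le_rfl⟩ x hx)
        rwa [one_smul] at this
    have hu2 : SqInt ((fun x => x - z) ⁻¹' A) u := h.sqInt.mono fun x hx => by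
        have := hSD k hk (hseg' 0 ⟨le_rfl, zero_le_one⟩ x hx)
        rwa [zero_smul, add_zero] at this
    have hxz : ∀ x ∈ A, x + z ∈ (fun x => x - z) ⁻¹' A := fun x hx => by simpa using hx
    have h3 := nrm_translate_le (hu1.sub hu2) hxz
    have h4 : ∀ x, u (x + z) = u (x + z + τ • e) - (u (x + z + τ • e) - u (x + z)) := fun x => by
      ring
    have h5 : a k ≤ nrm A (fun x => u (x + z + τ • e)) +
        nrm A (fun x => u (x + z + τ • e) - u (x + z)) := by
      have := nrm_sub_le (hu1.translate hxz) ((show SqInt _ _ from hu1.sub hu2).translate hxz)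
      refine le_trans (le_of_eq ?_) this
      exact congrArg (nrm A) (funext h4)
    have h6 : a (k + 1) = nrm A (fun x => u (x + z + τ • e)) := by
      rw [ha]
      refine congrArg (nrm A) (funext fun x => congrArg u ?_)
      rw [hz]; push_cast; module
    rw [h6]
    exact h5.trans (add_le_add le_rfl (h3.trans (h1.trans h2)))
  · refine le_trans (Finset.sum_le_sum fun k hk => ?_)
      (sum_nrm_sq_le_of_disjoint hSm hSD hSdis h.sqInt)
    have hk' := Finset.mem_range.1 hk
    refine pow_le_pow_left₀ (nrm_nonneg _ _) ?_ 2
    exact nrm_translate_le (h.sqInt.mono (hSD k hk')) fun x hx =>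
      hmem k _ le_rfl (by nlinarith) x hx
  · have := sum_nrm_sq_le_of_disjoint hSm hSD hSdis h.vec
    simp only [hb, mul_pow, ← Finset.mul_sum]
    exact mul_le_mul_of_nonneg_left this (by positivity)

theorem ConeAt.ball_subset {Ω : Set (E n)} {j e : E n} {r ρ : ℝ} (h : ConeAt Ω j e r ρ)
    {p : E n} (hp : p ∈ closure Ω) (hpj : ‖p - j‖ < 2 * r) {t : ℝ} (ht : 0 < t) (htr : t ≤ r) :
    Metric.ball (p + t • e) (t * ρ) ⊆ Ω := by
  intro w hw
  rw [mem_ball_iff_norm] at hw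
  obtain ⟨q, hq, hqp⟩ := Metric.mem_closure_iff.1 hp
    (min (t * ρ - ‖w - (p + t • e)‖) (2 * r - ‖p - j‖)) (lt_min (by linarith) (by linarith))
  rw [dist_eq_norm, lt_min_iff] at hqp
  have e1 : w = q + t • (e + t⁻¹ • ((w - (p + t • e)) + (p - q))) := by
    rw [smul_add, smul_inv_smul₀ ht.ne']; module
  rw [e1]
  refine h q hq ?_ t ht.le htr _ ?_
  · have e2 : q - j = (p - j) - (p - q) := by abel
    rw [e2]
    linarith [norm_sub_le (p - j) (p - q), hqp.2]
  · rw [norm_smul, norm_inv, Real.norm_of_nonneg ht.le, inv_mul_le_iff₀ ht]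
    linarith [norm_add_le (w - (p + t • e)) (p - q), hqp.1]

/-- The trace-type estimate in a thin layer near the boundary. -/
theorem exists_layer_le {Ω : Set (E n)} (hopen : IsOpen Ω) (hb : Bornology.IsBounded Ω)
    (hL : HasLipschitzBoundary Ω) {d : ℝ} (hd : 0 < d) :
    ∃ C : ℝ, 0 ≤ C ∧ ∀ (h : ℝ) (u : E n → ℝ) (G : Fin n → E n → ℝ), 0 < h → h ≤ d →
      SobolevOn (Metric.thickening d Ω) u G →
      nrm (Metric.thickening h (frontier Ω)) u ≤
        C * √h * (nrm (Metric.thickening d Ω) u + nrm (Metric.thickening d Ω) (vec G)) := by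
  obtain ⟨J, e, r, ρ, r₀, hρ, hρ1, hr₀, hJ, hcov⟩ := exists_coneCover hopen hb hL
  have hsub : ∀ h, h ≤ d → Metric.thickening h (frontier Ω) ⊆ Metric.thickening d Ω := by
    intro h hh
    rw [← Metric.thickening_closure (s := Ω)]
    exact (Metric.thickening_mono hh _).trans
      (Metric.thickening_subset_of_subset d frontier_subset_closure)
  set D := Metric.thickening d Ω with hD
  set h₀ := min d (min (r₀ / 4) (r₀ * ρ / 2)) with hh₀
  have hh₀p : 0 < h₀ := by positivity
  set C₁ : ℝ := J.card * √(16 / (ρ * r₀) + 16 * r₀ / ρ) with hC₁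
  have hC₁0 : 0 ≤ C₁ := by positivity
  -- The second entry disposes of the widths h ≥ h₀, for which √h is bounded below and the estimate
  -- is trivial.
  refine ⟨max C₁ (√h₀)⁻¹, hC₁0.trans (le_max_left _ _), fun h u G hh hhd hu => ?_⟩
  set X := nrm D u + nrm D (vec G) with hX
  have hu0 := nrm_nonneg D u
  have hG0 := nrm_nonneg D (vec G)
  have hX0 : 0 ≤ X := by positivity
  by_cases hcase : h₀ ≤ h
  · have h1 : 1 ≤ (√h₀)⁻¹ * √h := by
      rw [← div_eq_inv_mul, le_div_iff₀ (by positivity), one_mul]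
      exact Real.sqrt_le_sqrt hcase
    have h2 : nrm (Metric.thickening h (frontier Ω)) u ≤ nrm D u := nrm_mono hu.sqInt (hsub h hhd)
    calc _ ≤ 1 * X := by linarith
      _ ≤ (√h₀)⁻¹ * √h * X := by gcongr
      _ ≤ _ := by gcongr; exact le_max_right _ _
  push Not at hcase
  obtain ⟨hh1, hh2⟩ := lt_min_iff.1 hcase
  obtain ⟨hh2, hh3⟩ := lt_min_iff.1 hh2
  set A : E n → Set (E n) := fun j => Metric.thickening h (frontier Ω) ∩ Metric.ball j (r j / 2)
  have hpatch : ∀ j ∈ J, nrm (A j) u ≤ √(16 / (ρ * r₀) + 16 * r₀ / ρ) * √h * X := by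
    intro j hj
    obtain ⟨hej, hrj, hcone⟩ := hJ j hj
    have hnear : ∀ x ∈ A j, ∃ p ∈ frontier Ω, ‖x - p‖ < h ∧ ‖p - j‖ < 2 * r j := by
      intro x hx
      obtain ⟨p, hp, hxp⟩ := Metric.mem_thickening_iff.1 hx.1
      have h1 := hx.2
      rw [mem_ball_iff_norm] at h1
      rw [dist_eq_norm] at hxp
      refine ⟨p, hp, hxp, ?_⟩
      have e1 : p - j = (x - j) - (x - p) := by abel
      rw [e1]
      linarith [norm_sub_le (x - j) (x - p)]
    -- A shift by τ along the cone axis lifts the layer of width h off itself, the cone at height τ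
    -- having width τρ = 2h. About r₀/τ shifts fit in the chart, which turns 1/J into a constant
    -- times h, and so into √h after extraction of the root.
    set τ := 2 * h / ρ with hτ
    have hτ0 : 0 < τ := by positivity
    have hτρ : τ * ρ = 2 * h := by rw [hτ]; field_simp
    have hτr : τ ≤ r₀ := by
      rw [hτ, div_le_iff₀ hρ]; linarith
    set M := ⌊r₀ / τ⌋₊ with hM
    have hM1 : (M : ℝ) * τ ≤ r₀ := by
      have := Nat.floor_le (a := r₀ / τ) (by positivity)
      rwa [le_div_iff₀ hτ0] at this
    have hM2 : r₀ ≤ 2 * (M * τ) := by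
      have h1 := Nat.lt_floor_add_one (r₀ / τ)
      rw [div_lt_iff₀ hτ0] at h1
      have h2 : (1 : ℝ) ≤ M := by
        have : 1 ≤ M := Nat.le_floor (by rw [Nat.cast_one, le_div_iff₀ hτ0]; linarith)
        exact_mod_cast this
      nlinarith
    have hMt := hu.mul_nrm_sq_le (A := A j) (Metric.isOpen_thickening.inter Metric.isOpen_ball)
      hej hτ0 (J := M) ?_ ?_
    · have hMτ : (M : ℝ) * τ * nrm (A j) u ^ 2 ≤
          τ * (4 * nrm D u ^ 2 + 4 * r₀ ^ 2 * nrm D (vec G) ^ 2) := by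
        have h1 : ((M : ℝ) * τ) ^ 2 ≤ r₀ ^ 2 := pow_le_pow_left₀ (by positivity) hM1 2
        have h2 : 4 * (M * τ) ^ 2 * nrm D (vec G) ^ 2 ≤ 4 * r₀ ^ 2 * nrm D (vec G) ^ 2 := by
          gcongr
        nlinarith
      have h1 : r₀ * nrm (A j) u ^ 2 ≤
          2 * (τ * (4 * nrm D u ^ 2 + 4 * r₀ ^ 2 * nrm D (vec G) ^ 2)) := by
        nlinarith [mul_le_mul_of_nonneg_right hM2 (sq_nonneg (nrm (A j) u))]
      refine abs_le_of_sq_le_sq' ?_ (by positivity) |>.2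
      rw [mul_pow, mul_pow, Real.sq_sqrt (by positivity), Real.sq_sqrt hh.le]
      have h2 : nrm (A j) u ^ 2 ≤ (16 / (ρ * r₀) * nrm D u ^ 2 +
          16 * r₀ / ρ * nrm D (vec G) ^ 2) * h := by
        have h3 : r₀ * ((16 / (ρ * r₀) * nrm D u ^ 2 + 16 * r₀ / ρ * nrm D (vec G) ^ 2) * h) =
            2 * (τ * (4 * nrm D u ^ 2 + 4 * r₀ ^ 2 * nrm D (vec G) ^ 2)) := by
          rw [hτ]; field_simp; ring
        rw [← h3] at h1
        exact le_of_mul_le_mul_left h1 hr₀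
      refine h2.trans ?_
      have h3 : nrm D u ^ 2 ≤ X ^ 2 := pow_le_pow_left₀ hu0 (by linarith) 2
      have h4 : nrm D (vec G) ^ 2 ≤ X ^ 2 := pow_le_pow_left₀ hG0 (by linarith) 2
      calc _ ≤ (16 / (ρ * r₀) * X ^ 2 + 16 * r₀ / ρ * X ^ 2) * h := by gcongr
        _ = _ := by ring
    · intro x hx s hs hsM
      rcases hs.eq_or_lt with hs0 | hs0
      · rw [← hs0, zero_smul, add_zero]; exact hsub h hhd hx.1
      · obtain ⟨p, hp, hxp, hpj⟩ := hnear x hx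
        have h1 := hcone.ball_subset (frontier_subset_closure hp) hpj hs0
          (hsM.trans (hM1.trans hrj)) (Metric.mem_ball_self (mul_pos hs0 hρ))
        refine Metric.mem_thickening_iff.2 ⟨_, h1, ?_⟩
        rw [dist_eq_norm, add_sub_add_right_eq_sub]
        linarith
    -- If the two shifted points agreed, then x = x' + (s' − s)e; the frontier point q near x would
    -- lie less than 2h ≤ (s' − s)ρ from p + (s' − s)e, that is in the cone at p, which is contained
    -- in the open set Ω.
    · intro x hx x' hx' s s' hs hss hsM heq
      obtain ⟨p, hp, hxp, hpj⟩ := hnear x' hx'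
      obtain ⟨q, hq, hxq, -⟩ := hnear x hx
      have h1 := hcone.ball_subset (frontier_subset_closure hp) hpj (t := s' - s) (by linarith)
        (by linarith)
      have h2 : q ∈ Metric.ball (p + (s' - s) • e j) ((s' - s) * ρ) := by
        rw [mem_ball_iff_norm]
        have e1 : q - (p + (s' - s) • e j) = (x' - p) - (x - q) := by
          have : x = x' + (s' - s) • e j := by
            rw [sub_smul, ← add_sub_assoc, ← heq, add_sub_cancel_right]
          rw [this]; abel
        rw [e1]
        have h3 := norm_sub_le (x' - p) (x - q)
        have h4 : τ * ρ ≤ (s' - s) * ρ := mul_le_mul_of_nonneg_right (by linarith) hρ.le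
        linarith
      exact hopen.inter_frontier_eq.subset ⟨h1 h2, hq⟩
  have hcover : Metric.thickening h (frontier Ω) ⊆ ⋃ j ∈ J, A j := by
    intro x hx
    obtain ⟨p, hp, hxp⟩ := Metric.mem_thickening_iff.1 hx
    obtain ⟨j, hj, hpj⟩ := hcov p (frontier_subset_closure hp)
    refine mem_iUnion₂.2 ⟨j, hj, hx, ?_⟩
    rw [mem_ball_iff_norm]
    rw [dist_eq_norm] at hxp
    have e1 : x - j = (x - p) + (p - j) := by abel
    rw [e1]
    linarith [norm_add_le (x - p) (p - j), (hJ j hj).2.1]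
  have hfin : nrm (Metric.thickening h (frontier Ω)) u ≤ ∑ j ∈ J, nrm (A j) u := by
    refine nrm_le_of_sq_le (Finset.sum_nonneg fun _ _ => nrm_nonneg _ _) ?_
    have hAu : ∀ j, SqInt (A j) u := fun j => hu.sqInt.mono (inter_subset_left.trans (hsub h hhd))
    calc _ ≤ sq (⋃ j ∈ J, A j) u := sq_mono hcover u
      _ ≤ ∑ j ∈ J, sq (A j) u := sq_biUnion_le J A u
      _ = ENNReal.ofReal (∑ j ∈ J, nrm (A j) u ^ 2) := by
        rw [ENNReal.ofReal_sum_of_nonneg fun _ _ => sq_nonneg _]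
        exact Finset.sum_congr rfl fun j _ => sq_eq_ofReal (hAu j)
      _ ≤ _ := ENNReal.ofReal_le_ofReal
        (Finset.sum_sq_le_sq_sum_of_nonneg fun j _ => nrm_nonneg _ _)
  refine hfin.trans ((Finset.sum_le_sum hpatch).trans ?_)
  rw [Finset.sum_const, nsmul_eq_mul]
  calc _ = C₁ * √h * X := by rw [hC₁]; ring
    _ ≤ _ := by gcongr; exact le_max_left _ _

/-- The layer estimate for the constant function 1 says that the layer of width h has volume O(h).
-/
theorem volume_frontier_eq_zero {Ω : Set (E n)} (hopen : IsOpen Ω) (hb : Bornology.IsBounded Ω)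
    (hL : HasLipschitzBoundary Ω) : volume (frontier Ω) = 0 := by
  obtain ⟨C, hC, H⟩ := exists_layer_le hopen hb hL one_pos
  have hu : SobolevOn (Metric.thickening 1 Ω) (fun _ => (1 : ℝ)) (fun i => pderiv i fun _ => 1) :=
    sobolevOn_of_contDiff contDiff_const hb.thickening
  set X := nrm (Metric.thickening 1 Ω) (fun _ => (1 : ℝ)) +
    nrm (Metric.thickening 1 Ω) (vec fun i => pderiv i fun _ => 1) with hX
  have hX0 : 0 ≤ X := add_nonneg (nrm_nonneg _ _) (nrm_nonneg _ _)
  have h1 : ∀ h, 0 < h → h ≤ 1 → volume (frontier Ω) ≤ ENNReal.ofReal (C ^ 2 * X ^ 2 * h) := by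
    intro h hh hh1
    have h2 := H h _ _ hh hh1 hu
    have hS : SqInt (frontier Ω) (fun _ => (1 : ℝ)) :=
      sqInt_of_continuous continuous_const
        (hb.closure.subset frontier_subset_closure)
    have hT : SqInt (Metric.thickening h (frontier Ω)) (fun _ => (1 : ℝ)) :=
      sqInt_of_continuous continuous_const
        (hb.closure.subset frontier_subset_closure).thickening
    have h3 : volume (frontier Ω) = sq (frontier Ω) (fun _ => (1 : ℝ)) := by simp [sq]
    rw [h3]
    refine (sq_mono (Metric.self_subset_thickening hh _) _).trans ?_
    rw [sq_eq_ofReal hT]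
    refine ENNReal.ofReal_le_ofReal
      ((pow_le_pow_left₀ (nrm_nonneg _ _) h2 2).trans (le_of_eq ?_))
    rw [mul_pow, mul_pow, Real.sq_sqrt hh.le]; ring
  have h2 : Tendsto (fun h : ℝ => ENNReal.ofReal (C ^ 2 * X ^ 2 * h)) (𝓝[>] 0) (𝓝 0) := by
    have : Tendsto (fun h : ℝ => C ^ 2 * X ^ 2 * h) (𝓝 0) (𝓝 (C ^ 2 * X ^ 2 * 0)) :=
      tendsto_id.const_mul _
    rw [mul_zero] at this
    simpa using (ENNReal.tendsto_ofReal this).mono_left nhdsWithin_le_nhds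
  refine le_antisymm (ge_of_tendsto h2 ?_) zero_le
  filter_upwards [self_mem_nhdsWithin, Ioc_mem_nhdsGT (zero_lt_one' ℝ)] with h _ hh
  exact h1 h hh.1 hh.2

end

/-! ### Primitives of cut-off gradients, partitions of unity, and averages over balls. -/

section

open Filter Topology
open scoped ENNReal NNReal Manifold

variable {n : ℕ}

theorem fn_add_ae {D : Set (E n)} (u v : H1 D ℝ) :
    fn (u + v) =ᵐ[volume.restrict D] fun x => fn u x + fn v x :=
  Lp.coeFn_add (fn u) (fn v)

theorem fn_smul_ae {D : Set (E n)} (c : ℝ) (u : H1 D ℝ) :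
    fn (c • u) =ᵐ[volume.restrict D] fun x => c * fn u x :=
  Lp.coeFn_smul c (fn u)

theorem exists_H1_clm_of {Ω D : Set (E n)} (hD : IsOpen D) (F : H1 Ω ℝ → E n → ℝ)
    (G : H1 Ω ℝ → Fin n → E n → ℝ) (hFG : ∀ φ, SobolevOn D (F φ) (G φ))
    (hadd : ∀ φ ψ, F (φ + ψ) =ᵐ[volume.restrict D] fun x => F φ x + F ψ x)
    (hsmul : ∀ (c : ℝ) φ, F (c • φ) =ᵐ[volume.restrict D] fun x => c * F φ x) (C : ℝ)
    (hC : ∀ φ, nrm D (F φ) + nrm D (vec (G φ)) ≤ C * ‖φ‖) :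
    ∃ P : H1 Ω ℝ →L[ℝ] H1 D ℝ, ∀ φ, fn (P φ) =ᵐ[volume.restrict D] F φ ∧
      ∀ i, grad (P φ) i =ᵐ[volume.restrict D] G φ i := by
  choose p hp hpG using fun φ => (hFG φ).exists_H1
  have hext : ∀ u v : H1 D ℝ, fn u =ᵐ[volume.restrict D] fn v → u = v := fun u v h =>
    ext_of_fn_eq hD (Lp.ext h)
  have hvec : ∀ φ, vec (fun i => grad (p φ) i) =ᵐ[volume.restrict D] vec (G φ) := fun φ => by
    filter_upwards [ae_all_iff.2 (hpG φ)] with x hx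
    simp only [vec, hx]
  have hpadd : ∀ φ ψ, p (φ + ψ) = p φ + p ψ := fun φ ψ => hext _ _ <| by
    filter_upwards [hp (φ + ψ), hp φ, hp ψ, hadd φ ψ, fn_add_ae (p φ) (p ψ)] with x h2 h3 h4 h5 h6
    exact h2.trans (h5.trans ((congrArg₂ (· + ·) h3 h4).symm.trans h6.symm))
  have hpsmul : ∀ (c : ℝ) φ, p (c • φ) = c • p φ := fun c φ => hext _ _ <| by
    filter_upwards [hp (c • φ), hp φ, hsmul c φ, fn_smul_ae c (p φ)] with x h2 h3 h4 h5
    exact h2.trans (h4.trans ((congrArg (c * ·) h3).symm.trans h5.symm))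
  have hnorm : ∀ φ, ‖p φ‖ ≤ C * ‖φ‖ := fun φ => by
    refine (norm_H1_le (p φ)).trans (le_trans (add_le_add (le_of_eq ?_) (le_of_eq ?_)) (hC φ))
    · exact (norm_eq_nrm _).trans (nrm_congr (hp φ))
    · exact (gradNorm_self _).trans (nrm_congr (hvec φ))
  exact ⟨(IsLinearMap.mk' p ⟨hpadd, hpsmul⟩).mkContinuous C hnorm, fun φ => ⟨hp φ, hpG φ⟩⟩

/-- A function which is locally constant near the boundary of a connected open set has an
extension which is locally constant outside of the set. -/
theorem exists_potential {Ω : Set (E n)} (hopen : IsOpen Ω) (hconn : IsConnected Ω) {f : E n → ℝ}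
    (hf : ContDiff ℝ ∞ f) (hloc : ∀ x ∈ frontier Ω, ∃ c : ℝ, ∀ᶠ y in 𝓝 x, f y = c) :
    ∃ g : E n → ℝ, ContDiff ℝ 1 g ∧ (∀ x ∈ Ω, g x = f x) ∧ ∀ x ∉ Ω, fderiv ℝ g x = 0 := by
  classical
  -- Continuation by zero is of class C¹ because f is locally constant near the frontier. Its
  -- derivative is symmetric at every point, so the form is closed and has a primitive on the whole
  -- space, which is convex.
  let ψ : E n → (E n →L[ℝ] ℝ) := fun x => if x ∈ Ω then fderiv ℝ f x else 0
  have hin : ∀ x ∈ Ω, ψ =ᶠ[𝓝 x] fderiv ℝ f := fun x hx => by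
    filter_upwards [hopen.mem_nhds hx] with y hy
    exact if_pos hy
  have hout : ∀ x ∉ Ω, ψ =ᶠ[𝓝 x] fun _ => 0 := fun x hx => by
    by_cases hxc : x ∈ closure Ω
    · obtain ⟨c, hc⟩ := hloc x (by rw [hopen.frontier_eq]; exact ⟨hxc, hx⟩)
      filter_upwards [hc.eventually_nhds] with y hy
      have : fderiv ℝ f y = 0 := by
        rw [Filter.EventuallyEq.fderiv_eq (f := fun _ => c) hy]
        simp
      simp only [ψ, this, ite_self]
    · filter_upwards [isClosed_closure.isOpen_compl.mem_nhds hxc] with y hy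
      exact if_neg fun h => hy (subset_closure h)
  have hf2 : ContDiff ℝ 2 f := contDiff_infty.1 hf 2
  have hfd : ContDiff ℝ 1 (fderiv ℝ f) := hf2.fderiv_right (by norm_num)
  have hψ : ContDiff ℝ 1 ψ := contDiff_iff_contDiffAt.2 fun x => by
    by_cases hx : x ∈ Ω
    · exact hfd.contDiffAt.congr_of_eventuallyEq (hin x hx)
    · exact contDiffAt_const.congr_of_eventuallyEq (hout x hx)
  obtain ⟨g, hg⟩ := convex_univ.exists_forall_hasFDerivAt_of_fderiv_symmetric isOpen_univ
    (hψ.differentiable (by norm_num)).differentiableOn (fun a _ x y => by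
      by_cases ha : a ∈ Ω
      · rw [(hin a ha).fderiv_eq]
        exact (hf2.contDiffAt.isSymmSndFDerivAt (by simp)) x y
      · rw [(hout a ha).fderiv_eq]; simp)
  have hg' : ∀ x, HasFDerivAt g (ψ x) x := fun x => hg x (mem_univ x)
  have hfg : fderiv ℝ g = ψ := funext fun x => (hg' x).fderiv
  have hgd : Differentiable ℝ g := fun x => (hg' x).differentiableAt
  -- Connectedness of Ω makes the difference between f and the primitive a single constant.
  obtain ⟨c, hc⟩ := hopen.exists_eq_add_of_fderiv_eq (f := f) (g := g) hconn.isPreconnected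
    (hf.differentiable (by simp)).differentiableOn hgd.differentiableOn (fun x hx => by
      rw [hfg]; exact (if_pos hx).symm)
  refine ⟨fun x => g x + c, ?_, fun x hx => (hc hx).symm, fun x hx => ?_⟩
  · refine ContDiff.add ?_ contDiff_const
    rw [contDiff_one_iff_fderiv, hfg]
    exact ⟨hgd, hψ.continuous⟩
  · rw [fderiv_add_const, hfg]
    exact if_neg hx

theorem exists_cutoff {K U : Set (E n)} (hK : IsCompact K) (hU : IsOpen U) (hKU : K ⊆ U) :
    ∃ χ : E n → ℝ, IsTest U χ ∧ ∀ x ∈ K, χ x = 1 := by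
  obtain ⟨κ, hκ, hκU⟩ := hK.exists_cthickening_subset_open hU hKU
  obtain ⟨f, hf0, hf1, -⟩ := exists_contMDiffMap_zero_one_of_isClosed (n := (⊤ : ℕ∞)) 𝓘(ℝ, E n)
    (s := (Metric.thickening κ K)ᶜ) (t := K) Metric.isOpen_thickening.isClosed_compl hK.isClosed
    (disjoint_compl_left_iff_subset.2 (Metric.self_subset_thickening hκ K))
  have hsupp : Function.support f ⊆ Metric.thickening κ K := fun x hx => by
    by_contra hc
    exact hx (hf0 hc)
  have hts : tsupport f ⊆ Metric.cthickening κ K :=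
    closure_minimal (hsupp.trans (Metric.thickening_subset_cthickening κ K))
      Metric.isClosed_cthickening
  refine ⟨f, ⟨f.contMDiff.contDiff, ?_, hts.trans hκU⟩, fun x hx => hf1 hx⟩
  exact hK.cthickening.of_isClosed_subset (isClosed_tsupport _) hts

theorem exists_partition {F : Set (E n)} (hF : IsCompact F) {q : ℝ} (hq : 0 < q) :
    ∃ (J : Finset (E n)) (χ : E n → E n → ℝ) (κ : ℝ), 0 < κ ∧ κ ≤ q ∧ (∀ j ∈ J, j ∈ F) ∧
      (∀ j ∈ J, IsTest (Metric.ball j q) (χ j)) ∧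
      ∀ x ∈ Metric.thickening κ F, ∑ j ∈ J, χ j x = 1 := by
  classical
  obtain ⟨J, hJ, hJF⟩ := hF.elim_nhds_subcover (fun x => Metric.ball x q)
    fun x _ => Metric.ball_mem_nhds x hq
  have hUo : IsOpen (⋃ j ∈ J, Metric.ball j q) := isOpen_biUnion fun _ _ => Metric.isOpen_ball
  obtain ⟨κ, hκ, hκU⟩ := hF.exists_cthickening_subset_open hUo hJF
  obtain ⟨f, hf⟩ := SmoothPartitionOfUnity.exists_isSubordinate 𝓘(ℝ, E n)
    (s := Metric.cthickening κ F) Metric.isClosed_cthickening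
    (fun j : J => Metric.ball (j : E n) q) (fun _ => Metric.isOpen_ball)
    (by simpa [iUnion_subtype] using hκU)
  refine ⟨J, fun j => if hj : j ∈ J then f ⟨j, hj⟩ else 0, min κ q, lt_min hκ hq, min_le_right _ _,
    hJ, fun j hj => ?_, fun x hx => ?_⟩
  · beta_reduce
    rw [dif_pos hj]
    have hts : tsupport (f ⟨j, hj⟩) ⊆ Metric.ball j q := hf ⟨j, hj⟩
    refine ⟨(f ⟨j, hj⟩).contMDiff.contDiff, ?_, hts⟩
    exact (ProperSpace.isCompact_closedBall j q).of_isClosed_subset (isClosed_tsupport _)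
      (hts.trans Metric.ball_subset_closedBall)
  · have h1 := f.sum_eq_one (Metric.thickening_subset_cthickening κ F
      (Metric.thickening_mono (min_le_left κ q) F hx))
    rw [finsum_eq_sum_of_fintype] at h1
    rw [← h1, ← Finset.sum_coe_sort]
    exact Finset.sum_congr rfl fun j _ => by
      beta_reduce
      rw [dif_pos j.2]

/-- The average of a function over a set. -/
def avg (B : Set (E n)) (u : E n → ℝ) : ℝ := (volume B).toReal⁻¹ * ∫ x in B, u x

theorem nrm_const (S : Set (E n)) (c : ℝ) :
    nrm S (fun _ => c) = |c| * √(volume S).toReal := by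
  have h : nrm S (fun _ => c) ^ 2 = (|c| * √(volume S).toReal) ^ 2 := by
    rw [nrm_sq, mul_pow, Real.sq_sqrt ENNReal.toReal_nonneg, sq, setLIntegral_const,
      ENNReal.toReal_mul]
    simp
  exact (pow_left_inj₀ (nrm_nonneg _ _) (by positivity) two_ne_zero).1 h

theorem sqInt_const {S : Set (E n)} (hS : volume S ≠ ⊤) (c : ℝ) : SqInt S (fun _ => c) := by
  have : IsFiniteMeasure (volume.restrict S) := ⟨by simpa using hS.lt_top⟩
  exact memLp_const c

theorem abs_avg_le {B : Set (E n)} (hB : volume B ≠ ⊤) {u : E n → ℝ} (hu : SqInt B u) :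
    √(volume B).toReal * |avg B u| ≤ nrm B u := by
  rcases eq_or_ne (volume B).toReal 0 with h0 | h0
  · rw [h0]; simp [nrm_nonneg]
  have hpos : 0 < (volume B).toReal := lt_of_le_of_ne ENNReal.toReal_nonneg h0.symm
  have h1 := abs_integral_mul_le (sqInt_const hB 1) hu
  simp only [one_mul] at h1
  rw [nrm_const, abs_one, one_mul] at h1
  rw [avg, abs_mul, abs_inv, abs_of_pos hpos]
  have h2 := Real.mul_self_sqrt hpos.le
  have h3 : 0 < √(volume B).toReal := Real.sqrt_pos.2 hpos
  calc _ ≤ √(volume B).toReal * ((volume B).toReal⁻¹ * (√(volume B).toReal * nrm B u)) := by gcongr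
    _ = (√(volume B).toReal * √(volume B).toReal) * (volume B).toReal⁻¹ * nrm B u := by ring
    _ = _ := by rw [h2, mul_inv_cancel₀ h0, one_mul]

theorem avg_sub_const {B : Set (E n)} (hB : volume B ≠ ⊤) (hB0 : volume B ≠ 0) {u : E n → ℝ}
    (hu : SqInt B u) (c : ℝ) : avg B (fun x => u x - c) = avg B u - c := by
  have : IsFiniteMeasure (volume.restrict B) := ⟨by simpa using hB.lt_top⟩
  have h0 : (volume B).toReal ≠ 0 := (ENNReal.toReal_pos hB0 hB).ne'
  rw [avg, integral_sub (hu.integrable (by norm_num)) (integrable_const c), avg]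
  simp only [integral_const, smul_eq_mul, measureReal_def, Measure.restrict_apply_univ]
  field_simp

/-- Any constant for which the Poincaré inequality holds may be exchanged for the mean over a
smaller ball, at the cost of the square root of the ratio of the volumes. The radius 3q makes room
for every ball of radius q overlapping the central one. -/
theorem exists_ball_poincare {q : ℝ} (hq : 0 < q) :
    ∃ C : ℝ, 0 ≤ C ∧ ∀ (p p' : E n) (u : E n → ℝ) (G : Fin n → E n → ℝ), Measurable u →
      Metric.ball p' q ⊆ Metric.ball p (3 * q) → SobolevOn (Metric.ball p (3 * q)) u G →
      nrm (Metric.ball p (3 * q)) (fun x => u x - avg (Metric.ball p' q) u) ≤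
        C * nrm (Metric.ball p (3 * q)) (vec G) := by
  set V₁ := volume (Metric.ball (0 : E n) q) with hV₁
  set V₃ := volume (Metric.ball (0 : E n) (3 * q)) with hV₃
  set V₆ := volume (Metric.closedBall (0 : E n) (6 * q)) with hV₆
  have hV₁0 : V₁ ≠ 0 := (Metric.measure_ball_pos _ _ hq).ne'
  have hV₁t : V₁ ≠ ⊤ := measure_ball_lt_top.ne
  have hV₃0 : V₃ ≠ 0 := (Metric.measure_ball_pos _ _ (by positivity)).ne'
  have hV₃t : V₃ ≠ ⊤ := measure_ball_lt_top.ne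
  have hV₆t : V₆ ≠ ⊤ := measure_closedBall_lt_top.ne
  have hb1 : ∀ p : E n, volume (Metric.ball p q) = V₁ := fun p => Measure.addHaar_ball_center _ p q
  have hb3 : ∀ p : E n, volume (Metric.ball p (3 * q)) = V₃ := fun p =>
    Measure.addHaar_ball_center _ p _
  set c₁ := √V₁.toReal with hc₁
  have hc₁0 : 0 < c₁ := Real.sqrt_pos.2 (ENNReal.toReal_pos hV₁0 hV₁t)
  set c₃ := √V₃.toReal with hc₃
  set L := √((6 * q) ^ 2 * (V₆ / V₃).toReal) with hL
  refine ⟨(1 + c₃ / c₁) * L, by positivity, fun p p' u G hum hsub hu => ?_⟩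
  obtain ⟨c, hc⟩ := hu.exists_const_sq_sub_le hum Metric.isOpen_ball (convex_ball p _)
    (Metric.nonempty_ball.2 (by positivity)) (R := 6 * q) (fun x hx y hy => by
      rw [mem_ball_iff_norm] at hx hy
      have e : y - x = (y - p) - (x - p) := by abel
      rw [e]; linarith [norm_sub_le (y - p) (x - p)])
  rw [hb3, ← hV₆] at hc
  have hQt : volume (Metric.ball p (3 * q)) ≠ ⊤ := by rw [hb3]; exact hV₃t
  have hBt : volume (Metric.ball p' q) ≠ ⊤ := by rw [hb1]; exact hV₁t
  have h1 : nrm (Metric.ball p (3 * q)) (fun x => u x - c) ≤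
      L * nrm (Metric.ball p (3 * q)) (vec G) := by
    refine nrm_le_of_sq_le (mul_nonneg (Real.sqrt_nonneg _) (nrm_nonneg _ _)) (hc.trans (le_of_eq ?_))
    rw [sq_eq_ofReal hu.vec, mul_pow L, hL, Real.sq_sqrt (by positivity),
      ENNReal.ofReal_mul (by positivity), ENNReal.ofReal_mul (by positivity),
      ENNReal.ofReal_toReal (ENNReal.div_ne_top hV₆t hV₃0)]
  have hsq : SqInt (Metric.ball p (3 * q)) (fun x => u x - c) :=
    MemLp.sub hu.sqInt (sqInt_const hQt c)
  have hBu : SqInt (Metric.ball p' q) u := hu.sqInt.mono hsub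
  have h2 := abs_avg_le hBt (hsq.mono hsub)
  rw [avg_sub_const hBt (by rw [hb1]; exact hV₁0) hBu, hb1] at h2
  have h3 := nrm_mono hsq hsub
  set a := avg (Metric.ball p' q) u with ha
  have e : (fun x => u x - a) = fun x => (u x - c) - (a - c) := by funext x; ring
  rw [e]
  have h4 : |a - c| ≤ nrm (Metric.ball p (3 * q)) (fun x => u x - c) / c₁ := by
    rw [le_div_iff₀ hc₁0]; linarith
  refine (nrm_sub_le hsq (sqInt_const hQt (a - c))).trans ?_
  rw [nrm_const, hb3]
  set X := nrm (Metric.ball p (3 * q)) (fun x => u x - c) with hX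
  calc X + |a - c| * c₃ ≤ X + X / c₁ * c₃ := by gcongr
    _ = (1 + c₃ / c₁) * X := by ring
    _ ≤ (1 + c₃ / c₁) * (L * nrm (Metric.ball p (3 * q)) (vec G)) := by gcongr
    _ = _ := by ring

end

/-! ### Subtracting one constant for each connected cluster of balls. -/

section

open Filter Topology
open scoped ENNReal NNReal

variable {n : ℕ}

/-- In a class of the equivalence relation generated by R, two indices are joined by a finite chain
along which the differences add up; finiteness of ι makes the constant uniform. The representatives
depend on R only, so the constants chosen through them later remain linear in the function. -/
theorem exists_representatives {ι : Type*} [Fintype ι] (R : ι → ι → Prop) :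
    ∃ (rep : ι → ι) (C : ℝ), 0 ≤ C ∧ (∀ i j, R i j → rep i = rep j) ∧
      ∀ (c : ι → ℝ) (s : ℝ), 0 ≤ s → (∀ i j, R i j → |c i - c j| ≤ s) →
        ∀ i, |c i - c (rep i)| ≤ C * s := by
  have key : ∀ i j, Relation.EqvGen R i j → ∃ C : ℝ, 0 ≤ C ∧ ∀ (c : ι → ℝ) (s : ℝ), 0 ≤ s →
      (∀ i j, R i j → |c i - c j| ≤ s) → |c i - c j| ≤ C * s := by
    intro i j h
    induction h with
    | rel i j h => exact ⟨1, zero_le_one, fun c s _ H => by rw [one_mul]; exact H i j h⟩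
    | refl i => exact ⟨0, le_rfl, fun c s _ _ => by simp⟩
    | symm i j _ ih =>
      obtain ⟨C, hC, H⟩ := ih
      exact ⟨C, hC, fun c s hs h => by rw [abs_sub_comm]; exact H c s hs h⟩
    | trans i j k _ _ ih ih' =>
      obtain ⟨C, hC, H⟩ := ih
      obtain ⟨C', hC', H'⟩ := ih'
      refine ⟨C + C', by positivity, fun c s hs h => ?_⟩
      have := abs_sub_le (c i) (c j) (c k)
      linarith [H c s hs h, H' c s hs h]
  let S := Relation.EqvGen.setoid R
  let rep : ι → ι := fun i => (Quotient.mk S i).out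
  have hrep : ∀ i, Relation.EqvGen R i (rep i) := fun i =>
    Relation.EqvGen.symm _ _ (Quotient.mk_out (s := S) i)
  choose C hC H using fun i => key i (rep i) (hrep i)
  refine ⟨rep, ∑ i, C i, Finset.sum_nonneg fun i _ => hC i, fun i j h => ?_, fun c s hs h i => ?_⟩
  · exact congrArg Quotient.out (Quotient.sound (s := S) (Relation.EqvGen.rel i j h))
  · exact (H i c s hs h).trans (mul_le_mul_of_nonneg_right
      (Finset.single_le_sum (fun j _ => hC j) (Finset.mem_univ i)) hs)

theorem IsTest.exists_bound {A : Set (E n)} {η : E n → ℝ} (h : IsTest A η) :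
    ∃ M : ℝ, 0 ≤ M ∧ ∀ x, |η x| ≤ M := by
  obtain ⟨M, hM⟩ := h.smooth.continuous.bounded_above_of_compact_support h.compact
  exact ⟨M, (norm_nonneg _).trans (hM 0), hM⟩

section

variable {X : Type*} [NormedAddCommGroup X]

theorem nrm_union_le {A B : Set (E n)} {w : E n → X} (hA : SqInt A w) (hB : SqInt B w) :
    nrm (A ∪ B) w ≤ nrm A w + nrm B w := by
  refine nrm_le_of_sq_le (add_nonneg (nrm_nonneg _ _) (nrm_nonneg _ _)) ?_
  refine (lintegral_union_le _ _ _).trans ?_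
  change sq A w + sq B w ≤ _
  rw [sq_eq_ofReal hA, sq_eq_ofReal hB, ← ENNReal.ofReal_add (by positivity) (by positivity)]
  refine ENNReal.ofReal_le_ofReal ?_
  nlinarith [nrm_nonneg A w, nrm_nonneg B w]

theorem nrm_le_of_zero_outside {S T : Set (E n)} {w : E n → X} (hw : SqInt T w)
    (hS : MeasurableSet S) (hT : MeasurableSet T) (h : ∀ x ∈ S, x ∉ T → w x = 0) :
    nrm S w ≤ nrm (S ∩ T) w := by
  refine nrm_le_nrm_of_sq_le (hw.mono inter_subset_right) ?_
  have h0 : ∫⁻ x in S \ T, ‖w x‖ₑ ^ 2 = 0 := by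
    refine (setLIntegral_congr_fun (hS.diff hT) fun x hx => ?_).trans lintegral_zero
    simp [h x hx.1 hx.2]
  unfold sq
  rw [← lintegral_inter_add_sdiff _ S hT, h0, add_zero]

end

/-- Subtracting constants on a family of balls: the constants are chosen to agree on balls which
overlap. -/
theorem exists_sub_sum_le {ι : Type*} [Fintype ι] (p : ι → E n) {q : ℝ} (hq : 0 < q)
    {χ : ι → E n → ℝ} (hχ : ∀ i, IsTest (Metric.ball (p i) q) (χ i)) :
    ∃ (rep : ι → ι) (C : ℝ), 0 ≤ C ∧
      (∀ i j, (Metric.ball (p i) q ∩ Metric.ball (p j) q).Nonempty → rep i = rep j) ∧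
      ∀ (u : E n → ℝ) (G : Fin n → E n → ℝ) (V T : Set (E n)), Measurable u →
        (∀ i, Metric.ball (p i) (3 * q) ⊆ V) → SobolevOn V u G → MeasurableSet T → T ⊆ V →
        (∀ x ∈ T, ∑ i, χ i x = 1) →
        nrm T (fun x => u x - ∑ i, avg (Metric.ball (p (rep i)) q) u * χ i x) ≤
          C * nrm V (vec G) := by
  obtain ⟨rep, C₁, hC₁, hrep, H₁⟩ := exists_representatives fun i j : ι =>
    (Metric.ball (p i) q ∩ Metric.ball (p j) q).Nonempty
  obtain ⟨C₂, hC₂, H₂⟩ := exists_ball_poincare (n := n) hq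
  choose M hM0 hM using fun i => (hχ i).exists_bound
  set v := √(volume (Metric.ball (0 : E n) q)).toReal with hv
  have hv0 : 0 < v := Real.sqrt_pos.2 (ENNReal.toReal_pos (Metric.measure_ball_pos _ _ hq).ne'
    measure_ball_lt_top.ne)
  refine ⟨rep, ∑ i, (M i * C₂ + C₁ * (2 * C₂ / v) * nrm univ (χ i)), Finset.sum_nonneg fun i _ => by
    have := hM0 i; have := nrm_nonneg univ (χ i); positivity, hrep, ?_⟩
  intro u G V T hum hV hu hT hTV hsum
  set Y := nrm V (vec G) with hY
  have hY0 : 0 ≤ Y := nrm_nonneg _ _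
  set c : ι → ℝ := fun i => avg (Metric.ball (p i) q) u with hc
  have hpoin : ∀ i j, Metric.ball (p j) q ⊆ Metric.ball (p i) (3 * q) →
      nrm (Metric.ball (p i) (3 * q)) (fun x => u x - c j) ≤ C₂ * Y := fun i j hij =>
    (H₂ (p i) (p j) u G hum hij (hu.mono (hV i))).trans
      (mul_le_mul_of_nonneg_left (nrm_mono hu.vec (hV i)) hC₂)
  have hself : ∀ i, Metric.ball (p i) q ⊆ Metric.ball (p i) (3 * q) := fun i =>
    Metric.ball_subset_ball (by linarith)
  have hsq : ∀ i j, SqInt (Metric.ball (p i) (3 * q)) (fun x => u x - c j) := fun i j =>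
    MemLp.sub (hu.mono (hV i)).sqInt (sqInt_const measure_ball_lt_top.ne _)
  have hcc : ∀ i j, (Metric.ball (p i) q ∩ Metric.ball (p j) q).Nonempty →
      |c i - c j| ≤ 2 * C₂ / v * Y := by
    rintro i j ⟨y, hyi, hyj⟩
    have hsub : Metric.ball (p j) q ⊆ Metric.ball (p i) (3 * q) := fun x hx => by
      have h1 := dist_triangle x (p j) (p i)
      have h2 := dist_triangle (p j) y (p i)
      rw [Metric.mem_ball] at *
      rw [dist_comm y (p j)] at hyj
      linarith
    have h1 := nrm_sub_le ((hsq i j).mono (hself i)) ((hsq i i).mono (hself i))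
    have e : (fun x => u x - c j - (u x - c i)) = fun _ => c i - c j := by funext x; ring
    rw [e, nrm_const, Measure.addHaar_ball_center] at h1
    have h2 := (nrm_mono (hsq i j) (hself i)).trans (hpoin i j hsub)
    have h3 := (nrm_mono (hsq i i) (hself i)).trans (hpoin i i (hself i))
    rw [div_mul_eq_mul_div, le_div_iff₀ hv0]
    linarith
  have hcr := H₁ c (2 * C₂ / v * Y) (by positivity) hcc
  -- Since Σχᵢ = 1 on T, the difference splits into local Poincaré terms χᵢ(u − cᵢ) and into changes
  -- of constants within a cluster, (cᵢ − c_rep)χᵢ; both are bounded by the gradient.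
  have hdec : ∀ x ∈ T, u x - ∑ i, c (rep i) * χ i x =
      ∑ i, (χ i x * (u x - c i) + (c i - c (rep i)) * χ i x) := by
    intro x hx
    have : u x = ∑ i, χ i x * u x := by rw [← Finset.sum_mul, hsum x hx, one_mul]
    rw [this, ← Finset.sum_sub_distrib]
    refine Finset.sum_congr rfl fun i _ => ?_
    rw [← Finset.sum_mul, hsum x hx]; ring
  have hqT : ∀ i, SqInt univ (fun x => χ i x * (u x - c i)) := fun i =>
    (hχ i).sqInt_mul Metric.isOpen_ball ((hsq i i).mono (hself i))
  have hb1 : ∀ i, nrm T (fun x => χ i x * (u x - c i)) ≤ M i * (C₂ * Y) := fun i => by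
    refine (nrm_le_of_zero_outside ((hqT i).mono (subset_univ (Metric.ball (p i) q))) hT
      Metric.isOpen_ball.measurableSet fun x _ hx => by
        rw [(hχ i).zero_of_notMem hx, zero_mul]).trans ?_
    refine (nrm_le_of_bound (hM0 i) ((hsq i i).mono (inter_subset_right.trans (hself i)))
      (ae_of_all _ fun x => ?_)).trans (mul_le_mul_of_nonneg_left
        ((nrm_mono (hsq i i) (inter_subset_right.trans (hself i))).trans (hpoin i i (hself i)))
        (hM0 i))
    rw [norm_mul]
    exact mul_le_mul_of_nonneg_right (hM i x) (norm_nonneg _)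
  have hb2 : ∀ i, nrm T (fun x => (c i - c (rep i)) * χ i x) ≤
      C₁ * (2 * C₂ / v * Y) * nrm univ (χ i) := fun i => by
    have h1 := nrm_const_smul (S := T) (c i - c (rep i)) (χ i)
    simp only [smul_eq_mul] at h1
    rw [h1]
    exact mul_le_mul (hcr i) (nrm_mono ((hχ i).sqInt univ) (subset_univ T)) (nrm_nonneg _ _)
      (by positivity)
  have hs2 : ∀ i, SqInt T (fun x => (c i - c (rep i)) * χ i x) := fun i =>
    ((hχ i).sqInt T).const_mul _
  have hs1 : ∀ i, SqInt T (fun x => χ i x * (u x - c i)) := fun i => (hqT i).mono (subset_univ T)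
  rw [nrm_congr ((ae_restrict_mem hT).mono hdec)]
  refine (nrm_sum_le _ fun i _ => (hs1 i).add (hs2 i)).trans ?_
  rw [Finset.sum_mul]
  refine Finset.sum_le_sum fun i _ => (nrm_add_le (hs1 i) (hs2 i)).trans ?_
  refine (add_le_add (hb1 i) (hb2 i)).trans (le_of_eq ?_)
  ring

/-- Indicator functions of the boundary components, as combinations of a partition of unity, and
primitives of their gradients restricted to the domain. -/
theorem exists_component_functions {Ω : Set (E n)} (hopen : IsOpen Ω) (hconn : IsConnected Ω)
    {ι : Type*} [Fintype ι] [DecidableEq ι] (p : ι → E n) {q κ : ℝ} (hκ : 0 < κ)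
    {χ : ι → E n → ℝ} (hχ : ∀ i, IsTest (Metric.ball (p i) q) (χ i))
    (hsum : ∀ x ∈ Metric.thickening κ (frontier Ω), ∑ i, χ i x = 1) {rep : ι → ι}
    (hrep : ∀ i j, (Metric.ball (p i) q ∩ Metric.ball (p j) q).Nonempty → rep i = rep j) :
    ∃ f g : ι → E n → ℝ, (∀ k, ContDiff ℝ ∞ (f k)) ∧ (∀ k, ContDiff ℝ 1 (g k)) ∧
      (∀ k, ∀ x ∈ Ω, g k x = f k x) ∧ (∀ k, ∀ x ∉ Ω, fderiv ℝ (g k) x = 0) ∧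
      (∀ k, ∀ x ∈ Metric.thickening κ (frontier Ω), fderiv ℝ (f k) x = 0) ∧
      ∀ (c : ι → ℝ) x, ∑ k, c k * f k x = ∑ i, c (rep i) * χ i x := by
  -- The sum of the χᵢ over one cluster. All the balls containing a given point overlap and so
  -- belong to one cluster; near the frontier, where the χᵢ sum to 1, this function is therefore
  -- locally equal to 0 or 1.
  set f : ι → E n → ℝ := fun k x => ∑ i, if rep i = k then χ i x else 0 with hf
  have hfs : ∀ k, ContDiff ℝ ∞ (f k) := fun k => by
    refine ContDiff.sum fun i _ => ?_
    by_cases h : rep i = k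
    · simp only [h, if_true]; exact (hχ i).smooth
    · simp only [h, if_false]; exact contDiff_const
  have hloc : ∀ k, ∀ x ∈ Metric.thickening κ (frontier Ω), ∃ c : ℝ, ∀ᶠ y in 𝓝 x, f k y = c := by
    intro k x hx
    obtain ⟨i₀, hi₀⟩ : ∃ i₀, χ i₀ x ≠ 0 := by
      by_contra hc
      push Not at hc
      have := hsum x hx
      simp [hc] at this
    have hxi : x ∈ Metric.ball (p i₀) q := by
      by_contra hc
      exact hi₀ ((hχ i₀).zero_of_notMem hc)
    refine ⟨if rep i₀ = k then 1 else 0, ?_⟩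
    filter_upwards [Metric.isOpen_ball.mem_nhds hxi, Metric.isOpen_thickening.mem_nhds hx]
      with y hy hyκ
    have h1 : ∀ i, (if rep i = k then χ i y else 0) = if rep i₀ = k then χ i y else 0 := by
      intro i
      by_cases hi : y ∈ Metric.ball (p i) q
      · rw [hrep i i₀ ⟨y, hi, hy⟩]
      · rw [(hχ i).zero_of_notMem hi]; simp
    rw [hf]
    simp only [h1]
    by_cases h : rep i₀ = k
    · simp only [h, if_true]; exact hsum y hyκ
    · simp [h]
  choose g hg1 hg2 hg3 using fun k => exists_potential hopen hconn (hfs k) fun x hx =>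
    hloc k x (Metric.self_subset_thickening hκ _ hx)
  refine ⟨f, g, hfs, hg1, hg2, hg3, fun k x hx => ?_, fun c x => ?_⟩
  · obtain ⟨c, hc⟩ := hloc k x hx
    rw [Filter.EventuallyEq.fderiv_eq (f := fun _ => c) hc]
    simp
  · simp only [hf, Finset.mul_sum]
    rw [Finset.sum_comm]
    refine Finset.sum_congr rfl fun i _ => ?_
    simp

end

/-! ### Gluing the local extension to functions that are locally constant outside. -/

section

open Filter Topology
open scoped ENNReal NNReal

variable {n : ℕ}

theorem SobolevOn.grad_ae_eq {Ω D : Set (E n)} {F : E n → ℝ} {G : Fin n → E n → ℝ}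
    (h : SobolevOn D F G) (hΩ : IsOpen Ω) (hΩD : Ω ⊆ D) {φ : H1 Ω ℝ}
    (hF : F =ᵐ[volume.restrict Ω] fn φ) :
    Unfolding.vec G =ᵐ[volume.restrict Ω] Unfolding.vec fun i => grad φ i := by
  have h1 := h.mono hΩD
  have h2 := sobolevOn_H1 φ
  have h3 := fun i => HasWeakGrad.ae_eq hΩ h1.weak h2.weak h1.sqInt_grad h2.sqInt_grad hF i
  filter_upwards [ae_all_iff.2 h3] with x hx
  simp only [Unfolding.vec, hx]

/-- `P` extends functions from `Ω` to the `s`-neighbourhood of `Ω`; the gradient outside `Ω` is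
controlled by the gradient in a layer of width `r` inside `Ω`. -/
structure IsLargeExtension (Ω : Set (E n)) (s r C C' : ℝ)
    (P : H1 Ω ℝ →L[ℝ] H1 (Metric.thickening s Ω) ℝ) : Prop where
  eq_on : ∀ φ, fn (P φ) =ᵐ[volume.restrict Ω] fn φ
  grad_outside_le : ∀ φ, nrm (Metric.thickening s Ω \ Ω) (vec fun i => grad (P φ) i) ≤
    C * nrm (Ω ∩ Metric.thickening r (frontier Ω)) (vec fun i => grad φ i)
  fn_le : ∀ φ, ‖fn (P φ)‖ ≤ C' * ‖fn φ‖

/-- The segment from x, outside Ω, to a nearby point of Ω is connected, so it meets the frontier. -/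
theorem sub_frontier_thickening {Ω : Set (E n)} {κ : ℝ} {x : E n}
    (hx : x ∈ Metric.thickening κ Ω) (hxΩ : x ∉ Ω) : x ∈ Metric.thickening κ (frontier Ω) := by
  obtain ⟨y, hy, hxy⟩ := Metric.mem_thickening_iff.1 hx
  obtain ⟨z, hz, hzf⟩ : ∃ z ∈ segment ℝ x y, z ∈ frontier Ω := by
    by_contra! hc
    by_cases hxc : x ∈ closure Ω
    · exact hc x (left_mem_segment ℝ x y) ⟨hxc, fun h => hxΩ (interior_subset h)⟩
    have hsub : segment ℝ x y ⊆ interior Ω ∪ (closure Ω)ᶜ := fun z hz => by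
      by_cases hzc : z ∈ closure Ω
      · by_contra hcon
        exact hc z hz ⟨hzc, fun h => hcon (Or.inl h)⟩
      · exact Or.inr hzc
    obtain ⟨z, -, hz1, hz2⟩ := (convex_segment (𝕜 := ℝ) x y).isPreconnected _ _ isOpen_interior
      isClosed_closure.isOpen_compl hsub ⟨y, right_mem_segment ℝ x y, by
        by_contra hcon
        exact hc y (right_mem_segment ℝ x y) ⟨subset_closure hy, hcon⟩⟩
      ⟨x, left_mem_segment ℝ x y, hxc⟩
    exact hz2 (subset_closure (interior_subset hz1))
  refine Metric.mem_thickening_iff.2 ⟨z, hzf, lt_of_le_of_lt ?_ hxy⟩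
  rw [← dist_add_dist_of_mem_segment hz]
  linarith [dist_nonneg (x := z) (y := y)]

/-- The data out of which extensions to large neighbourhoods are built. -/
structure GluingData (Ω : Set (E n)) (r κ : ℝ) {ι : Type*} [Fintype ι] (χ : E n → ℝ)
    (f g : ι → E n → ℝ) : Prop where
  κ_le : κ ≤ r
  χ_test : IsTest (Metric.thickening κ Ω) χ
  χ_one : ∀ x ∈ Ω, χ x = 1
  f_smooth : ∀ k, ContDiff ℝ ∞ (f k)
  g_smooth : ∀ k, ContDiff ℝ 1 (g k)
  eq_on : ∀ k, ∀ x ∈ Ω, g k x = f k x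
  g_grad : ∀ k, ∀ x ∉ Ω, fderiv ℝ (g k) x = 0
  f_grad : ∀ k, ∀ x ∈ Metric.thickening κ (frontier Ω), fderiv ℝ (f k) x = 0

section

variable {Ω : Set (E n)} {r κ : ℝ} {ι : Type*} [Fintype ι] {χ : E n → ℝ} {f g : ι → E n → ℝ}

/-- The glued function. -/
def glue (χ : E n → ℝ) (f g : ι → E n → ℝ) (c : ι → ℝ) (u : E n → ℝ) (x : E n) : ℝ :=
  χ x * (u x - ∑ k, c k * f k x) + ∑ k, c k * g k x

/-- The weak gradient of the glued function. -/
def glueGrad (χ : E n → ℝ) (f g : ι → E n → ℝ) (c : ι → ℝ) (u : E n → ℝ)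
    (U : Fin n → E n → ℝ) (i : Fin n) (x : E n) : ℝ :=
  (pderiv i χ x * (u x - ∑ k, c k * f k x) + χ x * (U i x - ∑ k, c k * pderiv i (f k) x)) +
    ∑ k, c k * pderiv i (g k) x

theorem GluingData.sobolevOn (h : GluingData Ω r κ χ f g) (hb : Bornology.IsBounded Ω)
    {u : E n → ℝ} {U : Fin n → E n → ℝ} (hu : SobolevOn (Metric.thickening r Ω) u U) (c : ι → ℝ)
    (s : ℝ) : SobolevOn (Metric.thickening s Ω) (glue χ f g c u) (glueGrad χ f g c u U) := by
  have hf : SobolevOn (Metric.thickening r Ω) (fun x => ∑ k, c k * f k x)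
      (fun i x => ∑ k, c k * pderiv i (f k) x) :=
    SobolevOn.sum Finset.univ fun k _ => SobolevOn.const_smul (c k)
      (sobolevOn_of_contDiff ((h.f_smooth k).of_le (by simp)) hb.thickening)
  have hg : SobolevOn (Metric.thickening s Ω) (fun x => ∑ k, c k * g k x)
      (fun i x => ∑ k, c k * pderiv i (g k) x) :=
    SobolevOn.sum Finset.univ fun k _ => SobolevOn.const_smul (c k)
      (sobolevOn_of_contDiff (h.g_smooth k) hb.thickening)
  exact (((hu.sub hf).mul_test Metric.isOpen_thickening
    (h.χ_test.mono (Metric.thickening_mono h.κ_le Ω))).mono (subset_univ _)).add hg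

theorem GluingData.glue_eq (h : GluingData Ω r κ χ f g) {x : E n} (hx : x ∈ Ω) (c : ι → ℝ)
    (u : E n → ℝ) : glue χ f g c u x = u x := by
  simp only [glue, h.χ_one x hx, h.eq_on _ x hx]
  ring

/-- Outside Ω the functions gₖ have zero gradient, and so have the fₖ wherever the cutoff is
nonzero. The constants therefore enter the outer gradient only through u − Σcₖfₖ, which Poincaré
controls. -/
theorem GluingData.glueGrad_outside (h : GluingData Ω r κ χ f g) {x : E n} (hx : x ∉ Ω) (c : ι → ℝ)
    (u : E n → ℝ) (U : Fin n → E n → ℝ) :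
    vec (glueGrad χ f g c u U) x =
      (u x - ∑ k, c k * f k x) • vec (fun i => pderiv i χ) x + χ x • vec U x := by
  have hg : ∀ k i, pderiv i (g k) x = 0 := fun k i => by simp [pderiv, h.g_grad k x hx]
  ext i
  simp only [vec, glueGrad, hg, mul_zero, Finset.sum_const_zero, add_zero, PiLp.add_apply,
    PiLp.smul_apply, smul_eq_mul]
  by_cases hxκ : x ∈ Metric.thickening κ Ω
  · have hf : ∀ k, pderiv i (f k) x = 0 := fun k => by
      simp [pderiv, h.f_grad k x (sub_frontier_thickening hxκ hx)]
    simp only [hf, mul_zero, Finset.sum_const_zero, sub_zero]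
    ring
  · rw [h.χ_test.zero_of_notMem hxκ, h.χ_test.pderiv_zero_of_notMem i hxκ]
    ring

theorem norm_vec_le {A : Fin n → E n → ℝ} {M : Fin n → ℝ} {x : E n} (h : ∀ i, |A i x| ≤ M i) :
    ‖vec A x‖ ≤ √(∑ i, M i ^ 2) := by
  rw [EuclideanSpace.norm_eq]
  refine Real.sqrt_le_sqrt (Finset.sum_le_sum fun i _ => ?_)
  exact pow_le_pow_left₀ (norm_nonneg _) (h i) 2

theorem nrm_norm {X : Type*} [NormedAddCommGroup X] (S : Set (E n)) (w : E n → X) :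
    nrm S (fun x => ‖w x‖) = nrm S w := by
  unfold nrm
  rw [eLpNorm_norm]

/-- The outer gradient vanishes beyond the κ-neighbourhood, where the cutoff is zero, so the
constant can be chosen before the width s. -/
theorem GluingData.exists_grad_le (h : GluingData Ω r κ χ f g) (hopen : IsOpen Ω)
    (hb : Bornology.IsBounded Ω) :
    ∃ C : ℝ, 0 ≤ C ∧ ∀ (s : ℝ) (c : ι → ℝ) (u : E n → ℝ) (U : Fin n → E n → ℝ),
      SobolevOn (Metric.thickening r Ω) u U →
      nrm (Metric.thickening s Ω \ Ω) (vec (glueGrad χ f g c u U)) ≤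
        C * (nrm (Metric.thickening κ Ω \ Ω) (fun x => u x - ∑ k, c k * f k x) +
          nrm (Metric.thickening κ Ω \ Ω) (vec U)) := by
  obtain ⟨M, hM0, hM⟩ := h.χ_test.exists_bound
  choose M' hM'0 hM' using fun i => (h.χ_test.pderiv i).exists_bound
  set C := max M (√(∑ i, M' i ^ 2)) with hC
  have hC0 : 0 ≤ C := hM0.trans (le_max_left _ _)
  refine ⟨C, hC0, fun s c u U hu => ?_⟩
  set T := Metric.thickening κ Ω \ Ω with hT
  have hTm : MeasurableSet T := Metric.isOpen_thickening.measurableSet.diff hopen.measurableSet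
  have hSm : MeasurableSet (Metric.thickening s Ω \ Ω) :=
    Metric.isOpen_thickening.measurableSet.diff hopen.measurableSet
  have hTD : T ⊆ Metric.thickening r Ω := sdiff_subset.trans (Metric.thickening_mono h.κ_le Ω)
  have hG : SqInt T (vec (glueGrad χ f g c u U)) :=
    ((h.sobolevOn hb hu c κ).mono sdiff_subset).vec
  have hw : SqInt T (fun x => u x - ∑ k, c k * f k x) := by
    refine MemLp.sub (hu.sqInt.mono hTD) (sqInt_of_continuous ?_ (hb.thickening.subset hTD))
    exact continuous_finsetSum _ fun k _ => continuous_const.mul (h.f_smooth k).continuous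
  have hUT : SqInt T (vec U) := hu.vec.mono hTD
  refine (nrm_le_of_zero_outside hG hSm hTm fun x hx hxT => ?_).trans ?_
  · have hxκ : x ∉ Metric.thickening κ Ω := fun hc => hxT ⟨hc, hx.2⟩
    rw [h.glueGrad_outside hx.2, h.χ_test.zero_of_notMem hxκ]
    have : vec (fun i => pderiv i χ) x = 0 := by
      ext i
      exact h.χ_test.pderiv_zero_of_notMem i hxκ
    rw [this]; simp
  refine (nrm_mono hG inter_subset_right).trans ?_
  refine (nrm_le_of_bound (g := fun x => ‖u x - ∑ k, c k * f k x‖ + ‖vec U x‖) hC0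
    (hw.norm.add hUT.norm) ((ae_restrict_mem hTm).mono fun x hx => ?_)).trans
    (mul_le_mul_of_nonneg_left ?_ hC0)
  · rw [h.glueGrad_outside hx.2, Real.norm_of_nonneg (by positivity), mul_add]
    refine (norm_add_le _ _).trans (add_le_add ?_ ?_)
    · rw [norm_smul, mul_comm]
      exact mul_le_mul_of_nonneg_right ((norm_vec_le fun i => hM' i x).trans (le_max_right _ _))
        (norm_nonneg _)
    · rw [norm_smul]
      exact mul_le_mul_of_nonneg_right ((hM x).trans (le_max_left _ _)) (norm_nonneg _)
  · refine (nrm_add_le hw.norm hUT.norm).trans (le_of_eq ?_)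
    exact congrArg₂ (· + ·) (nrm_norm _ _) (nrm_norm _ _)

/-- Here the constant does depend on s: far from Ω the glued function is a combination of the gₖ,
which need not decay, and its `L²` norm grows with the neighbourhood. -/
theorem GluingData.exists_fn_le (h : GluingData Ω r κ χ f g)
    (hb : Bornology.IsBounded Ω) (s : ℝ) :
    ∃ C : ℝ, 0 ≤ C ∧ ∀ (c : ι → ℝ) (u : E n → ℝ) (Z : ℝ), SqInt (Metric.thickening r Ω) u →
      0 ≤ Z → (∀ k, |c k| ≤ Z) →
      nrm (Metric.thickening s Ω) (glue χ f g c u) ≤ C * (nrm (Metric.thickening r Ω) u + Z) := by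
  obtain ⟨M, hM0, hM⟩ := h.χ_test.exists_bound
  set S := Metric.thickening s Ω with hS
  set D := Metric.thickening r Ω with hD
  have hv : ∀ k, SqInt S (fun x => g k x - χ x * f k x) := fun k =>
    sqInt_of_continuous ((h.g_smooth k).continuous.sub
      (h.χ_test.smooth.continuous.mul (h.f_smooth k).continuous)) hb.thickening
  refine ⟨M + ∑ k, nrm S (fun x => g k x - χ x * f k x),
    add_nonneg hM0 (Finset.sum_nonneg fun k _ => nrm_nonneg _ _), fun c u Z hu hZ hcZ => ?_⟩
  have e : glue χ f g c u = fun x => χ x * u x + ∑ k, c k * (g k x - χ x * f k x) := by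
    funext x
    simp only [glue, mul_sub, Finset.mul_sum, Finset.sum_sub_distrib]
    have : ∀ k, χ x * (c k * f k x) = c k * (χ x * f k x) := fun k => by ring
    simp only [this]
    ring
  have hχD : IsTest D χ := h.χ_test.mono (Metric.thickening_mono h.κ_le Ω)
  have h1 : SqInt univ (fun x => χ x * u x) := hχD.sqInt_mul Metric.isOpen_thickening hu
  have h2 : nrm S (fun x => χ x * u x) ≤ M * nrm D u := by
    refine (nrm_le_of_zero_outside (h1.mono (subset_univ D)) Metric.isOpen_thickening.measurableSet
      Metric.isOpen_thickening.measurableSet fun x _ hx => by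
        rw [hχD.zero_of_notMem hx, zero_mul]).trans ?_
    refine (nrm_le_of_bound hM0 (hu.mono inter_subset_right) (ae_of_all _ fun x => ?_)).trans
      (mul_le_mul_of_nonneg_left (nrm_mono hu inter_subset_right) hM0)
    rw [norm_mul]
    exact mul_le_mul_of_nonneg_right (hM x) (norm_nonneg _)
  have h3 : ∀ k, SqInt S (fun x => c k * (g k x - χ x * f k x)) := fun k => (hv k).const_mul _
  have h4 : ∀ k, nrm S (fun x => c k * (g k x - χ x * f k x)) ≤
      nrm S (fun x => g k x - χ x * f k x) * Z := fun k => by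
    have := nrm_const_smul (S := S) (c k) (fun x => g k x - χ x * f k x)
    simp only [smul_eq_mul] at this
    rw [this, mul_comm]
    exact mul_le_mul_of_nonneg_left (hcZ k) (nrm_nonneg _ _)
  rw [e]
  refine (nrm_add_le (h1.mono (subset_univ S)) (memLp_finsetSum _ fun k _ => h3 k)).trans ?_
  refine (add_le_add h2 ((nrm_sum_le _ fun k _ => h3 k).trans
    (Finset.sum_le_sum fun k _ => h4 k))).trans ?_
  rw [← Finset.sum_mul]
  have h5 := nrm_nonneg D u
  have h6 : 0 ≤ ∑ k, nrm S (fun x => g k x - χ x * f k x) :=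
    Finset.sum_nonneg fun k _ => nrm_nonneg _ _
  nlinarith [mul_nonneg hM0 hZ, mul_nonneg h6 h5]

end

end

/-! ### Extension operators to neighbourhoods of arbitrary width. -/

section

open Filter Topology
open scoped ENNReal NNReal

variable {n : ℕ}

theorem avg_add {B : Set (E n)} (hB : volume B ≠ ⊤) {u v w : E n → ℝ} (hu : SqInt B u)
    (hv : SqInt B v) (h : w =ᵐ[volume.restrict B] fun x => u x + v x) :
    avg B w = avg B u + avg B v := by
  have : IsFiniteMeasure (volume.restrict B) := ⟨by simpa using hB.lt_top⟩
  rw [avg, integral_congr_ae h, integral_add (hu.integrable (by norm_num))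
    (hv.integrable (by norm_num)), avg, avg]
  ring

theorem avg_smul {B : Set (E n)} {u w : E n → ℝ} (c : ℝ)
    (h : w =ᵐ[volume.restrict B] fun x => c * u x) : avg B w = c * avg B u := by
  rw [avg, integral_congr_ae h, integral_const_mul, avg]
  ring

section

variable {Ω : Set (E n)} {r C₀ : ℝ} {P₀ : H1 Ω ℝ →L[ℝ] H1 (Metric.thickening r Ω) ℝ}

theorem nrm_sdiff_closure (hopen : IsOpen Ω) (h0 : volume (frontier Ω) = 0) {X : Type*}
    [NormedAddCommGroup X] (S : Set (E n)) (w : E n → X) :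
    nrm (S \ Ω) w = nrm (S \ closure Ω) w := by
  have h : volume.restrict (S \ Ω) = volume.restrict (S \ closure Ω) := by
    refine Measure.restrict_congr_set ((?_ : ∀ᵐ x, (x ∈ S \ Ω) = (x ∈ S \ closure Ω)))
    filter_upwards [measure_eq_zero_iff_ae_notMem.1 h0] with x hx
    rw [hopen.frontier_eq] at hx
    refine propext ⟨fun h => ⟨h.1, fun hc => hx ⟨hc, h.2⟩⟩, fun h => ⟨h.1, fun hc =>
      h.2 (subset_closure hc)⟩⟩
  unfold nrm
  rw [h]

theorem nrm_le_of_eq_on {D V : Set (E n)} {w w₀ : E n → E n} (hw : SqInt D w) (hVD : V ⊆ D)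
    (h : w =ᵐ[volume.restrict Ω] w₀) {C : ℝ} (hC : nrm (D \ Ω) w ≤ C * nrm (Ω ∩ V) w₀) :
    nrm V w ≤ (1 + C) * nrm (Ω ∩ V) w₀ := by
  have e : (Ω ∩ V) ∪ (V \ Ω) = V := by
    rw [inter_comm]; exact inter_union_sdiff V Ω
  have h1 := nrm_union_le (hw.mono (inter_subset_right.trans hVD : Ω ∩ V ⊆ D))
    (hw.mono (sdiff_subset.trans hVD : V \ Ω ⊆ D))
  rw [e] at h1
  have h2 : nrm (Ω ∩ V) w = nrm (Ω ∩ V) w₀ :=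
    nrm_congr (ae_mono (Measure.restrict_mono inter_subset_left le_rfl) h)
  have h3 := nrm_mono (hw.mono sdiff_subset) (sdiff_subset_sdiff_left hVD : V \ Ω ⊆ D \ Ω)
  linarith

theorem IsLocalExtension.grad_outside_le (h : IsLocalExtension Ω r C₀ P₀) (hopen : IsOpen Ω)
    (h0 : volume (frontier Ω) = 0) {s : ℝ} (hs : 0 < s) (hsr : s ≤ r) (φ : H1 Ω ℝ) :
    nrm (Metric.thickening s Ω \ Ω) (vec fun i => grad (P₀ φ) i) ≤
      C₀ * nrm (Ω ∩ Metric.thickening s (frontier Ω)) (vec fun i => grad φ i) :=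
  (nrm_sdiff_closure hopen h0 _ _).trans_le ((h φ).2.2.2 s hs hsr)

theorem IsLocalExtension.grad_layer_le (h : IsLocalExtension Ω r C₀ P₀) (hopen : IsOpen Ω)
    (h0 : volume (frontier Ω) = 0) (hr : 0 < r) (φ : H1 Ω ℝ) :
    nrm (Metric.thickening r (frontier Ω)) (vec fun i => grad (P₀ φ) i) ≤
      (1 + C₀) * nrm (Ω ∩ Metric.thickening r (frontier Ω)) (vec fun i => grad φ i) := by
  have hVD : Metric.thickening r (frontier Ω) ⊆ Metric.thickening r Ω := by
    rw [← Metric.thickening_closure (s := Ω)]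
    exact Metric.thickening_subset_of_subset r frontier_subset_closure
  exact nrm_le_of_eq_on (sobolevOn_H1 (P₀ φ)).vec hVD
    ((sobolevOn_H1 (P₀ φ)).grad_ae_eq hopen (Metric.self_subset_thickening hr Ω) (h φ).1)
    (h.grad_outside_le hopen h0 hr le_rfl φ)

theorem exists_gluingData (hopen : IsOpen Ω) (hconn : IsConnected Ω) (hb : Bornology.IsBounded Ω)
    (hr : 0 < r) :
    ∃ (J : Finset (E n)) (κ q C : ℝ) (χ : E n → ℝ) (f g : J → E n → ℝ), 0 < q ∧ 0 ≤ C ∧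
      GluingData Ω r κ χ f g ∧
      (∀ j : J, Metric.ball (j : E n) q ⊆ Metric.thickening r (frontier Ω)) ∧
      ∀ (u : E n → ℝ) (U : Fin n → E n → ℝ), Measurable u → SobolevOn (Metric.thickening r Ω) u U →
        nrm (Metric.thickening κ Ω \ Ω)
          (fun x => u x - ∑ k : J, avg (Metric.ball (k : E n) q) u * f k x) ≤
          C * nrm (Metric.thickening r (frontier Ω)) (vec U) := by
  classical
  have hF : IsCompact (frontier Ω) := Metric.isCompact_of_isClosed_isBounded isClosed_frontier
    (hb.closure.subset frontier_subset_closure)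
  -- The balls of triple radius 3r/4, on which Poincaré is applied, still lie in the layer of width
  -- r around the frontier.
  have hq : 0 < r / 4 := by positivity
  obtain ⟨J, χJ, κ, hκ, hκq, hJF, hχJ, hsum⟩ := exists_partition hF hq
  obtain ⟨χ, hχ, hχ1⟩ := exists_cutoff hb.isCompact_closure Metric.isOpen_thickening
    (Metric.closure_subset_thickening hκ Ω)
  have hχJ' : ∀ j : J, IsTest (Metric.ball (j : E n) (r / 4)) (χJ j) := fun j => hχJ j j.2
  have hsum' : ∀ x ∈ Metric.thickening κ (frontier Ω), ∑ j : J, χJ j x = 1 := fun x hx => by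
    rw [← hsum x hx]; exact Finset.sum_coe_sort J fun j => χJ j x
  obtain ⟨rep, C, hC, hrep, H⟩ := exists_sub_sum_le (fun j : J => (j : E n)) hq hχJ'
  obtain ⟨f, g, hf, hg, hfg, hg0, hf0, hsumf⟩ :=
    exists_component_functions hopen hconn (fun j : J => (j : E n)) hκ hχJ' hsum' hrep
  have hball : ∀ (t : ℝ), t ≤ r → ∀ j : J, Metric.ball (j : E n) t ⊆
      Metric.thickening r (frontier Ω) := fun t ht j x hx =>
    Metric.mem_thickening_iff.2 ⟨j, hJF j j.2, (Metric.mem_ball.1 hx).trans_le ht⟩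
  have hVD : Metric.thickening r (frontier Ω) ⊆ Metric.thickening r Ω := by
    rw [← Metric.thickening_closure (s := Ω)]
    exact Metric.thickening_subset_of_subset r frontier_subset_closure
  refine ⟨J, κ, r / 4, C, χ, f, g, hq, hC, ⟨by linarith, hχ, fun x hx => hχ1 x (subset_closure hx),
    hf, hg, hfg, hg0, hf0⟩, hball _ (by linarith), fun u U hum hu => ?_⟩
  have hTκ : Metric.thickening κ Ω \ Ω ⊆ Metric.thickening κ (frontier Ω) := fun x hx =>
    sub_frontier_thickening hx.1 hx.2
  have h1 := H u U (Metric.thickening r (frontier Ω)) (Metric.thickening κ Ω \ Ω) hum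
    (hball _ (by linarith)) (hu.mono hVD)
    (Metric.isOpen_thickening.measurableSet.diff hopen.measurableSet)
    (hTκ.trans (Metric.thickening_mono (by linarith) _)) fun x hx => hsum' x (hTκ hx)
  refine le_trans (le_of_eq ?_) h1
  refine congrArg (nrm _) (funext fun x => ?_)
  rw [hsumf (fun k : J => avg (Metric.ball (k : E n) (r / 4)) u) x]

-- The constants subtracted are means of the local extension over fixed balls, hence linear in φ,
-- and the glued function is linear too. The gradient constant C is fixed before s; only the
-- constant C' of the `L²` estimate depends on the width.
set_option maxHeartbeats 4000000 in
theorem exists_large_extension (hopen : IsOpen Ω) (hconn : IsConnected Ω)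
    (hb : Bornology.IsBounded Ω) (hL : HasLipschitzBoundary Ω) (hr : 0 < r) (hC₀ : 0 ≤ C₀)
    (hP₀ : IsLocalExtension Ω r C₀ P₀) :
    ∃ C : ℝ, 0 ≤ C ∧ ∀ s, 0 < s → ∃ (C' : ℝ) (P : H1 Ω ℝ →L[ℝ] H1 (Metric.thickening s Ω) ℝ),
      0 ≤ C' ∧ IsLargeExtension Ω s r C C' P := by
  have h0 := volume_frontier_eq_zero hopen hb hL
  obtain ⟨J, κ, q, C₁, χ, f, g, hq, hC₁, hglue, hball, H₁⟩ :=
    exists_gluingData hopen hconn hb hr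
  obtain ⟨C₂, hC₂, H₂⟩ := hglue.exists_grad_le hopen hb
  set V := Metric.thickening r (frontier Ω) with hV
  have hVD : V ⊆ Metric.thickening r Ω := by
    rw [← Metric.thickening_closure (s := Ω)]
    exact Metric.thickening_subset_of_subset r frontier_subset_closure
  let u : H1 Ω ℝ → E n → ℝ := fun φ => fn (P₀ φ)
  let U : H1 Ω ℝ → Fin n → E n → ℝ := fun φ i => grad (P₀ φ) i
  have hu : ∀ φ, SobolevOn (Metric.thickening r Ω) (u φ) (U φ) := fun φ => sobolevOn_H1 (P₀ φ)
  have hum : ∀ φ, Measurable (u φ) := fun φ => (Lp.stronglyMeasurable _).measurable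
  let c : H1 Ω ℝ → J → ℝ := fun φ k => avg (Metric.ball (k : E n) q) (u φ)
  let F : H1 Ω ℝ → E n → ℝ := fun φ => glue χ f g (c φ) (u φ)
  let G : H1 Ω ℝ → Fin n → E n → ℝ := fun φ => glueGrad χ f g (c φ) (u φ) (U φ)
  have hballD : ∀ k : J, Metric.ball (k : E n) q ⊆ Metric.thickening r Ω := fun k =>
    (hball k).trans hVD
  have hout : ∀ s φ, nrm (Metric.thickening s Ω \ Ω) (vec (G φ)) ≤
      C₂ * (C₁ * (1 + C₀) + C₀) * nrm (Ω ∩ V) (vec fun i => grad φ i) := by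
    intro s φ
    have h1 := H₂ s (c φ) (u φ) (U φ) (hu φ)
    have h2 := (H₁ (u φ) (U φ) (hum φ) (hu φ)).trans (mul_le_mul_of_nonneg_left
      (hP₀.grad_layer_le hopen h0 hr φ) hC₁)
    have h3 : nrm (Metric.thickening κ Ω \ Ω) (vec (U φ)) ≤
        C₀ * nrm (Ω ∩ V) (vec fun i => grad φ i) :=
      (nrm_mono ((hu φ).vec.mono sdiff_subset)
        (sdiff_subset_sdiff_left (Metric.thickening_mono hglue.κ_le Ω))).trans
        (hP₀.grad_outside_le hopen h0 hr le_rfl φ)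
    refine h1.trans ((mul_le_mul_of_nonneg_left (add_le_add h2 h3) hC₂).trans (le_of_eq ?_))
    ring
  have hFΩ : ∀ φ, F φ =ᵐ[volume.restrict Ω] fn φ := fun φ => by
    filter_upwards [(hP₀ φ).1, ae_restrict_mem hopen.measurableSet] with x hx hxΩ
    exact (hglue.glue_eq hxΩ (c φ) (u φ)).trans hx
  refine ⟨C₂ * (C₁ * (1 + C₀) + C₀), by positivity, fun s hs => ?_⟩
  obtain ⟨C₃, hC₃, H₃⟩ := hglue.exists_fn_le hb s
  have hΩS : Ω ⊆ Metric.thickening s Ω := Metric.self_subset_thickening hs Ω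
  have hFG : ∀ φ, SobolevOn (Metric.thickening s Ω) (F φ) (G φ) := fun φ =>
    hglue.sobolevOn hb (hu φ) (c φ) s
  set v := √(volume (Metric.ball (0 : E n) q)).toReal with hv
  have hv0 : 0 < v := Real.sqrt_pos.2 (ENNReal.toReal_pos (Metric.measure_ball_pos _ _ hq).ne'
    measure_ball_lt_top.ne)
  have hcle : ∀ φ k, |c φ k| ≤ C₀ * ‖fn φ‖ / v := fun φ k => by
    have h1 := abs_avg_le measure_ball_lt_top.ne ((hu φ).sqInt.mono (hballD k))
    rw [Measure.addHaar_ball_center] at h1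
    rw [le_div_iff₀ hv0, mul_comm]
    refine h1.trans ((nrm_mono (hu φ).sqInt (hballD k)).trans ?_)
    exact (norm_eq_nrm (fn (P₀ φ))).symm.trans_le (hP₀ φ).2.1
  have hFle : ∀ φ, nrm (Metric.thickening s Ω) (F φ) ≤ C₃ * (C₀ + C₀ / v) * ‖fn φ‖ := fun φ => by
    have h1 := H₃ (c φ) (u φ) (C₀ * ‖fn φ‖ / v) (hu φ).sqInt (by positivity) (hcle φ)
    have h2 : nrm (Metric.thickening r Ω) (u φ) ≤ C₀ * ‖fn φ‖ :=
      (norm_eq_nrm (fn (P₀ φ))).symm.trans_le (hP₀ φ).2.1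
    refine h1.trans ((mul_le_mul_of_nonneg_left (add_le_add h2 le_rfl) hC₃).trans (le_of_eq ?_))
    ring
  have hYle : ∀ φ : H1 Ω ℝ, nrm Ω (vec fun i => grad φ i) ≤ ‖φ‖ := fun φ =>
    (gradNorm_self φ).symm.trans_le (gradNorm_le_norm φ)
  have hGle : ∀ φ, nrm (Metric.thickening s Ω) (vec (G φ)) ≤
      (1 + C₂ * (C₁ * (1 + C₀) + C₀)) * ‖φ‖ := fun φ => by
    have e : Metric.thickening s Ω = Ω ∪ (Metric.thickening s Ω \ Ω) :=
      (union_sdiff_cancel hΩS).symm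
    have h1 := nrm_union_le ((hFG φ).vec.mono hΩS)
      ((hFG φ).vec.mono (sdiff_subset : Metric.thickening s Ω \ Ω ⊆ _))
    rw [← e] at h1
    have h2 : nrm Ω (vec (G φ)) ≤ ‖φ‖ :=
      (nrm_congr ((hFG φ).grad_ae_eq hopen hΩS (hFΩ φ))).trans_le (hYle φ)
    have h3 : nrm (Ω ∩ V) (vec fun i => grad φ i) ≤ ‖φ‖ :=
      (nrm_mono (sobolevOn_H1 φ).vec inter_subset_left).trans (hYle φ)
    have h4 := (hout s φ).trans (mul_le_mul_of_nonneg_left h3 (by positivity))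
    linarith
  have hfinite : ∀ k : J, volume (Metric.ball (k : E n) q) ≠ ⊤ := fun k => measure_ball_lt_top.ne
  have hres : ∀ {p : E n → Prop} (k : J), (∀ᵐ x ∂(volume.restrict (Metric.thickening r Ω)), p x) →
      ∀ᵐ x ∂(volume.restrict (Metric.ball (k : E n) q)), p x := fun k hp =>
    ae_mono (Measure.restrict_mono (hballD k) le_rfl) hp
  have hDm : MeasurableSet (Metric.thickening r Ω) := Metric.isOpen_thickening.measurableSet
  have hχ0 : ∀ x, x ∉ Metric.thickening r Ω → χ x = 0 := fun x hx =>
    (hglue.χ_test.mono (Metric.thickening_mono hglue.κ_le Ω)).zero_of_notMem hx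
  have hadd : ∀ φ ψ, F (φ + ψ) =ᵐ[volume.restrict (Metric.thickening s Ω)]
      fun x => F φ x + F ψ x := by
    intro φ ψ
    have h1 : u (φ + ψ) =ᵐ[volume.restrict (Metric.thickening r Ω)] fun x => u φ x + u ψ x :=
      Filter.EventuallyEq.trans (Filter.EventuallyEq.of_eq
        (congrArg (fun w : H1 (Metric.thickening r Ω) ℝ => (fn w : E n → ℝ)) (map_add P₀ φ ψ)))
        (fn_add_ae (P₀ φ) (P₀ ψ))
    have h2 : ∀ k, c (φ + ψ) k = c φ k + c ψ k := fun k =>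
      avg_add (hfinite k) ((hu φ).sqInt.mono (hballD k)) ((hu ψ).sqInt.mono (hballD k)) (hres k h1)
    refine ae_restrict_of_ae ?_
    filter_upwards [(ae_restrict_iff' hDm).1 h1] with x hx
    simp only [F, glue, h2, add_mul, Finset.sum_add_distrib]
    by_cases hxD : x ∈ Metric.thickening r Ω
    · rw [hx hxD]; ring
    · rw [hχ0 x hxD]; ring
  have hsmul : ∀ (a : ℝ) φ, F (a • φ) =ᵐ[volume.restrict (Metric.thickening s Ω)]
      fun x => a * F φ x := by
    intro a φ
    have h1 : u (a • φ) =ᵐ[volume.restrict (Metric.thickening r Ω)] fun x => a * u φ x :=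
      Filter.EventuallyEq.trans (Filter.EventuallyEq.of_eq
        (congrArg (fun w : H1 (Metric.thickening r Ω) ℝ => (fn w : E n → ℝ)) (map_smul P₀ a φ)))
        (fn_smul_ae a (P₀ φ))
    have h2 : ∀ k, c (a • φ) k = a * c φ k := fun k => avg_smul a (hres k h1)
    refine ae_restrict_of_ae ?_
    filter_upwards [(ae_restrict_iff' hDm).1 h1] with x hx
    simp only [F, glue, h2, mul_assoc, ← Finset.mul_sum]
    by_cases hxD : x ∈ Metric.thickening r Ω
    · rw [hx hxD]; ring
    · rw [hχ0 x hxD]; ring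
  obtain ⟨P, hP⟩ := exists_H1_clm_of Metric.isOpen_thickening F G hFG hadd hsmul
    (C₃ * (C₀ + C₀ / v) + (1 + C₂ * (C₁ * (1 + C₀) + C₀))) (fun φ => by
      have h1 := mul_le_mul_of_nonneg_left (norm_fn_le φ)
        (by positivity : 0 ≤ C₃ * (C₀ + C₀ / v))
      rw [add_mul]
      exact add_le_add ((hFle φ).trans h1) (hGle φ))
  refine ⟨C₃ * (C₀ + C₀ / v), P, by positivity, fun φ => ?_, fun φ => ?_, fun φ => ?_⟩
  · exact Filter.EventuallyEq.trans (ae_mono (Measure.restrict_mono hΩS le_rfl) (hP φ).1) (hFΩ φ)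
  · refine le_trans (le_of_eq (nrm_congr ?_)) (hout s φ)
    have : vec (fun i => grad (P φ) i) =ᵐ[volume.restrict (Metric.thickening s Ω)] vec (G φ) := by
      filter_upwards [ae_all_iff.2 (hP φ).2] with x hx
      simp only [vec, hx]
    exact ae_mono (Measure.restrict_mono sdiff_subset le_rfl) this
  · exact ((norm_eq_nrm _).trans (nrm_congr (hP φ).1)).trans_le (hFle φ)

end

end

/-! ### Restriction to the prescribed neighbourhoods; existence of extension operators. -/

section

open Filter Topology
open scoped ENNReal NNReal

variable {n : ℕ}

theorem norm_fn_eq_nrm {D : Set (E n)} (φ : H1 D ℝ) : ‖fn φ‖ = nrm D (fn φ) := norm_eq_nrm _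

theorem exists_restrict {Ω D D' : Set (E n)} (hD : IsOpen D) (hDD : D ⊆ D')
    (P : H1 Ω ℝ →L[ℝ] H1 D' ℝ) :
    ∃ Q : H1 Ω ℝ →L[ℝ] H1 D ℝ, ∀ φ, fn (Q φ) =ᵐ[volume.restrict D] fn (P φ) ∧
      ∀ i, grad (Q φ) i =ᵐ[volume.restrict D] grad (P φ) i := by
  refine exists_H1_clm_of hD (fun φ => fn (P φ)) (fun φ i => grad (P φ) i)
    (fun φ => (sobolevOn_H1 (P φ)).mono hDD) (fun φ ψ => ?_) (fun c φ => ?_) (2 * ‖P‖)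
    fun φ => ?_
  · refine ae_mono (Measure.restrict_mono hDD le_rfl) ?_
    exact Filter.EventuallyEq.trans (Filter.EventuallyEq.of_eq
        (congrArg (fun w : H1 D' ℝ => (fn w : E n → ℝ)) (map_add P φ ψ)))
        (fn_add_ae (P φ) (P ψ))
  · refine ae_mono (Measure.restrict_mono hDD le_rfl) ?_
    exact Filter.EventuallyEq.trans (Filter.EventuallyEq.of_eq
        (congrArg (fun w : H1 D' ℝ => (fn w : E n → ℝ)) (map_smul P c φ)))
        (fn_smul_ae c (P φ))
  · have h1 : nrm D (fn (P φ)) ≤ ‖P φ‖ :=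
      (nrm_mono (sobolevOn_H1 (P φ)).sqInt hDD).trans
        ((norm_fn_eq_nrm (P φ)).symm.trans_le (norm_fn_le (P φ)))
    have h2 : nrm D (vec fun i => grad (P φ) i) ≤ ‖P φ‖ :=
      (nrm_mono (sobolevOn_H1 (P φ)).vec hDD).trans
        ((gradNorm_self (P φ)).symm.trans_le (gradNorm_le_norm (P φ)))
    linarith [P.le_opNorm φ]

theorem vec_grad_ae {D : Set (E n)} {u : H1 D ℝ} {G : Fin n → E n → ℝ}
    (h : ∀ i, grad u i =ᵐ[volume.restrict D] G i) :
    vec (fun i => grad u i) =ᵐ[volume.restrict D] vec G := by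
  filter_upwards [ae_all_iff.2 h] with x hx
  simp only [vec, hx]

/-- An extension whose gradient outside `Ω` is controlled by the gradient in the boundary layer. -/
structure IsLayerExtension (Ω D V : Set (E n)) (C : ℝ) (P : H1 Ω ℝ →L[ℝ] H1 D ℝ) : Prop where
  eq_on : ∀ φ, fn (P φ) =ᵐ[volume.restrict Ω] fn φ
  grad_outside_le : ∀ φ, nrm (D \ Ω) (vec fun i => grad (P φ) i) ≤
    C * nrm (Ω ∩ V) (vec fun i => grad φ i)

theorem IsLayerExtension.restrict {Ω D D' V : Set (E n)} {C : ℝ} {P : H1 Ω ℝ →L[ℝ] H1 D' ℝ}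
    {Q : H1 Ω ℝ →L[ℝ] H1 D ℝ} (hΩ : Ω ⊆ D)
    (hQ : ∀ φ, fn (Q φ) =ᵐ[volume.restrict D] fn (P φ) ∧
      ∀ i, grad (Q φ) i =ᵐ[volume.restrict D] grad (P φ) i)
    (heq : ∀ φ, fn (P φ) =ᵐ[volume.restrict Ω] fn φ)
    (hout : ∀ φ, nrm (D \ Ω) (vec fun i => grad (P φ) i) ≤
      C * nrm (Ω ∩ V) (vec fun i => grad φ i)) : IsLayerExtension Ω D V C Q := by
  refine ⟨fun φ => ?_, fun φ => ?_⟩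
  · exact Filter.EventuallyEq.trans (ae_mono (Measure.restrict_mono hΩ le_rfl) (hQ φ).1) (heq φ)
  · refine le_trans (le_of_eq (nrm_congr ?_)) (hout φ)
    exact ae_mono (Measure.restrict_mono sdiff_subset le_rfl) (vec_grad_ae (hQ φ).2)

theorem nbhd_three (Ω : Set (E n)) (ε : ℝ) :
    nbhd Ω ε 3 = Metric.thickening (3 * Real.sqrt n * ε) Ω := by
  simp [nbhd]

theorem bdryLayer_three (Ω : Set (E n)) (ε : ℝ) :
    bdryLayer Ω ε 3 = Metric.thickening (3 * Real.sqrt n * ε) (frontier Ω) := by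
  simp [bdryLayer]

-- The global gradient is the gradient of φ on Ω plus the outer one, whence 1 + C. The `L²` bound
-- supplied is stronger than the one required, as it has no gradient term.
set_option maxHeartbeats 4000000 in
theorem IsLayerExtension.isExtension {Ω : Set (E n)} {ε C C' : ℝ} (hopen : IsOpen Ω)
    (hΩ : Ω ⊆ nbhd Ω ε 3) (hε : 0 ≤ ε) (hC : 0 ≤ C)
    {P : H1 Ω ℝ →L[ℝ] H1 (nbhd Ω ε 3) ℝ}
    (hP : IsLayerExtension Ω (nbhd Ω ε 3) (bdryLayer Ω ε 3) C P)
    (hfn : ε ≤ 1 → ∀ φ, ‖fn (P φ)‖ ≤ C' * ‖fn φ‖) {K : ℝ} (hK : 1 + C ≤ K) (hK' : C' ≤ K) :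
    IsExtension Ω ε K P := by
  have hsub : Ω ∩ (Ω ∩ bdryLayer Ω ε 3) = Ω ∩ bdryLayer Ω ε 3 :=
    inter_eq_right.2 inter_subset_left
  have hsub' : nbhd Ω ε 3 ∩ (nbhd Ω ε 3 \ Ω) = nbhd Ω ε 3 \ Ω := inter_eq_right.2 sdiff_subset
  have hlayer : ∀ φ : H1 Ω ℝ, nrm (Ω ∩ bdryLayer Ω ε 3) (vec fun i => grad φ i) ≤ gradNorm φ Ω :=
    fun φ => (nrm_mono (sobolevOn_H1 φ).vec inter_subset_left).trans_eq (gradNorm_self φ).symm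
  refine ⟨hP.eq_on, fun φ => ?_, fun φ => ?_, fun h1 φ => ?_⟩
  · have hs := (sobolevOn_H1 (P φ)).vec
    have h1 := nrm_union_le (hs.mono hΩ) (hs.mono (sdiff_subset : nbhd Ω ε 3 \ Ω ⊆ _))
    rw [union_sdiff_cancel hΩ] at h1
    have h2 : nrm Ω (vec fun i => grad (P φ) i) = gradNorm φ Ω :=
      (nrm_congr ((sobolevOn_H1 (P φ)).grad_ae_eq hopen hΩ (hP.eq_on φ))).trans
        (gradNorm_self φ).symm
    have h3 := (hP.grad_outside_le φ).trans (mul_le_mul_of_nonneg_left (hlayer φ) hC)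
    have h4 := mul_le_mul_of_nonneg_right hK (gradNorm_nonneg φ Ω)
    refine (gradNorm_self (P φ)).trans_le ?_
    linarith
  · refine (gradNorm_eq (P φ) _).trans_le ?_
    rw [hsub', gradNorm_eq, hsub]
    exact (hP.grad_outside_le φ).trans (mul_le_mul_of_nonneg_right (by linarith) (nrm_nonneg _ _))
  · have h2 := mul_le_mul_of_nonneg_right hK' (norm_nonneg (fn φ))
    have h3 : 0 ≤ K * (ε * gradNorm φ (Ω ∩ bdryLayer Ω ε 3)) :=
      mul_nonneg (by linarith) (mul_nonneg hε (gradNorm_nonneg _ _))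
    rw [mul_add]
    linarith [hfn h1 φ]

set_option maxHeartbeats 4000000 in
theorem IsLocalExtension.exists_isExtension {Ω : Set (E n)} {r C₀ ε : ℝ}
    {P₀ : H1 Ω ℝ →L[ℝ] H1 (Metric.thickening r Ω) ℝ} (hP₀ : IsLocalExtension Ω r C₀ P₀)
    (hopen : IsOpen Ω) (h0 : volume (frontier Ω) = 0) (hC₀ : 0 ≤ C₀) (hε : 0 ≤ ε)
    (hs : 0 < 3 * Real.sqrt n * ε) (hsr : 3 * Real.sqrt n * ε ≤ r) {K : ℝ} (hK : 1 + C₀ ≤ K) :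
    ∃ P : H1 Ω ℝ →L[ℝ] H1 (nbhd Ω ε 3) ℝ, IsExtension Ω ε K P := by
  have hDD : nbhd Ω ε 3 ⊆ Metric.thickening r Ω := by
    rw [nbhd_three]; exact Metric.thickening_mono hsr Ω
  have hΩ : Ω ⊆ nbhd Ω ε 3 := by
    rw [nbhd_three]; exact Metric.self_subset_thickening hs Ω
  obtain ⟨Q, hQ⟩ := exists_restrict Metric.isOpen_thickening hDD P₀
  refine ⟨Q, (IsLayerExtension.restrict hΩ hQ (fun φ => (hP₀ φ).1) fun φ => ?_).isExtension (C' := C₀)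
    hopen hΩ hε hC₀ (fun _ φ => ?_) hK (by linarith)⟩
  · rw [nbhd_three, bdryLayer_three]
    exact hP₀.grad_outside_le hopen h0 hs hsr φ
  · refine le_trans ?_ (hP₀ φ).2.1
    rw [norm_fn_eq_nrm, norm_fn_eq_nrm]
    exact (nrm_congr (hQ φ).1).trans_le (nrm_mono (sobolevOn_H1 (P₀ φ)).sqInt hDD)

set_option maxHeartbeats 4000000 in
theorem IsLargeExtension.exists_isExtension {Ω : Set (E n)} {r s C C' ε : ℝ}
    {P₀ : H1 Ω ℝ →L[ℝ] H1 (Metric.thickening s Ω) ℝ} (hP₀ : IsLargeExtension Ω s r C C' P₀)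
    (hopen : IsOpen Ω) (hC : 0 ≤ C) (hε : 0 ≤ ε)
    (hs : 0 < 3 * Real.sqrt n * ε) (hr : r ≤ 3 * Real.sqrt n * ε) (hse : 3 * Real.sqrt n * ε ≤ s)
    {K : ℝ} (hK : 1 + C ≤ K) (hK' : ε ≤ 1 → C' ≤ K) :
    ∃ P : H1 Ω ℝ →L[ℝ] H1 (nbhd Ω ε 3) ℝ, IsExtension Ω ε K P := by
  have hDD : nbhd Ω ε 3 ⊆ Metric.thickening s Ω := by
    rw [nbhd_three]; exact Metric.thickening_mono hse Ω
  have hΩ : Ω ⊆ nbhd Ω ε 3 := by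
    rw [nbhd_three]; exact Metric.self_subset_thickening hs Ω
  obtain ⟨Q, hQ⟩ := exists_restrict Metric.isOpen_thickening hDD P₀
  have hlay : IsLayerExtension Ω (nbhd Ω ε 3) (bdryLayer Ω ε 3) C Q := by
    refine IsLayerExtension.restrict hΩ hQ hP₀.eq_on fun φ => ?_
    refine (nrm_mono ((sobolevOn_H1 (P₀ φ)).vec.mono sdiff_subset)
      (sdiff_subset_sdiff_left hDD)).trans ((hP₀.grad_outside_le φ).trans
      (mul_le_mul_of_nonneg_left (nrm_mono ((sobolevOn_H1 φ).vec.mono inter_subset_left) ?_) hC))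
    rw [bdryLayer_three]
    exact inter_subset_inter_right _ (Metric.thickening_mono hr _)
  have hfn : ∀ φ, ‖fn (Q φ)‖ ≤ C' * ‖fn φ‖ := fun φ => by
    refine le_trans ?_ (hP₀.fn_le φ)
    rw [norm_fn_eq_nrm, norm_fn_eq_nrm]
    exact (nrm_congr (hQ φ).1).trans_le (nrm_mono (sobolevOn_H1 (P₀ φ)).sqInt hDD)
  by_cases h1 : ε ≤ 1
  · exact ⟨Q, hlay.isExtension hopen hΩ hε hC (fun _ => hfn) hK (hK' h1)⟩
  · exact ⟨Q, hlay.isExtension (C' := 0) hopen hΩ hε hC (fun h => absurd h h1) hK (by linarith)⟩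

set_option maxHeartbeats 4000000 in
/-- Extension operators exist, with a constant that does not depend on `ε`. -/
theorem exists_isExtension {Ω : Set (E n)} (hn : 0 < n) (hopen : IsOpen Ω) (hconn : IsConnected Ω)
    (hb : Bornology.IsBounded Ω) (hL : HasLipschitzBoundary Ω) :
    ∃ K : ℝ, ∀ ε : ℝ, 0 < ε →
      ∃ P : H1 Ω ℝ →L[ℝ] H1 (nbhd Ω ε 3) ℝ, IsExtension Ω ε K P := by
  obtain ⟨r, C₀, P₀, hr, hC₀, hP₀⟩ := exists_local_extension hopen hconn.nonempty hb hL
  have h0 := volume_frontier_eq_zero hopen hb hL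
  obtain ⟨C, hC, hlarge⟩ := exists_large_extension hopen hconn hb hL hr hC₀ hP₀
  have hn' : 0 < 3 * Real.sqrt n := by positivity
  obtain ⟨C₁, P₁, hC₁, hP₁⟩ := hlarge (3 * Real.sqrt n) hn'
  refine ⟨1 + C₀ + C + C₁, fun ε hε => ?_⟩
  have hs : 0 < 3 * Real.sqrt n * ε := mul_pos hn' hε
  -- Three regimes. Narrow neighbourhoods receive a restriction of the local extension. For
  -- intermediate ones with ε ≤ 1, a single operator of width 3√n is restricted, so its `L²`
  -- constant is independent of ε. For ε > 1 no `L²` bound is asked for, and the constant that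
  -- depends on the width never enters K.
  rcases le_or_gt (3 * Real.sqrt n * ε) r with h | h
  · exact hP₀.exists_isExtension hopen h0 hC₀ hε.le hs h (by linarith)
  rcases le_or_gt ε 1 with h1 | h1
  · exact hP₁.exists_isExtension hopen hC hε.le hs h.le (by nlinarith) (by linarith)
      fun _ => by linarith
  · obtain ⟨C₂, P₂, hC₂, hP₂⟩ := hlarge (3 * Real.sqrt n * ε) hs
    exact hP₂.exists_isExtension hopen hC hε.le hs h.le le_rfl (by linarith)
      fun h => absurd h1 h.not_gt

end

section

open Filter Topology
open scoped ENNReal NNReal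

variable {n : ℕ}

/-! ### Translations, tested against functions of `H¹(Ω)` -/

theorem sub_frontier_thickening' {Ω : Set (E n)} {κ : ℝ} {x : E n} (hx : x ∈ Ω)
    (hx' : x ∈ Metric.thickening κ Ωᶜ) : x ∈ Metric.thickening κ (frontier Ω) := by
  rw [← frontier_compl]
  exact sub_frontier_thickening hx' fun h => h hx

/-- The change of variables transfers the translation from g to Ψ and replaces Ω by its translate
Ω'. The increment of Ψ is controlled by its gradient, and the parts of Ω and Ω' not in common lie in
the layer of width t. -/
theorem abs_integral_translate_mul_le {Ω : Set (E n)} (hopen : IsOpen Ω) {r t : ℝ} (htr : t ≤ r)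
    {v : E n} (hv : ‖v‖ < t) {g Ψ : E n → ℝ} {G : Fin n → E n → ℝ}
    (hg : SqInt (Metric.thickening t Ω) g) (hΨ : SobolevOn (Metric.thickening r Ω) Ψ G) :
    |∫ x in Ω, (g (x + v) - g x) * Ψ x| ≤
      nrm (Metric.thickening t Ω) g * (t * nrm (Metric.thickening r Ω) (vec G)) +
      2 * (nrm (Metric.thickening t (frontier Ω)) g * nrm (Metric.thickening t (frontier Ω)) Ψ) := by
  have ht : 0 < t := (norm_nonneg v).trans_lt hv
  set S := Metric.thickening t Ω with hS
  set L := Metric.thickening t (frontier Ω) with hL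
  set D := Metric.thickening r Ω with hD
  set Ω' := (fun x => x + -v) ⁻¹' Ω with hΩ'
  have hSD : S ⊆ D := Metric.thickening_mono htr Ω
  have hΩS : Ω ⊆ S := Metric.self_subset_thickening ht Ω
  have hΩ'o : IsOpen Ω' := hopen.preimage (by fun_prop)
  have hΩ'S : Ω' ⊆ S := fun x hx => Metric.mem_thickening_iff.2 ⟨_, hx, by
    rw [dist_eq_norm]; simpa using hv⟩
  have hLS : L ⊆ S := by
    rw [hS, ← Metric.thickening_closure (s := Ω)]
    exact Metric.thickening_subset_of_subset t frontier_subset_closure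
  have hΨS := hΨ.sqInt.mono hSD
  have h1 : Ω' \ Ω ⊆ L := fun x hx => sub_frontier_thickening (hΩ'S hx.1) hx.2
  have h2 : Ω \ Ω' ⊆ L := fun x hx => sub_frontier_thickening' hx.1
    (Metric.mem_thickening_iff.2 ⟨_, hx.2, by rw [dist_eq_norm]; simpa using hv⟩)
  have hgv : SqInt Ω fun x => g (x + v) := hg.translate fun x hx => hΩ'S (by simpa [hΩ'] using hx)
  have hΨv : SqInt Ω' fun x => Ψ (x + -v) := hΨS.translate fun x hx => hΩS hx
  have hdiff : SqInt Ω' fun x => Ψ (x + -v) - Ψ x := hΨv.sub (hΨS.mono hΩ'S)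
  have e1 : ∫ x in Ω, g (x + v) * Ψ x = ∫ x in Ω', g x * Ψ (x + -v) := by
    have := (measurePreserving_add_right (volume : Measure (E n)) v).setIntegral_preimage_emb
      (MeasurableEquiv.addRight v).measurableEmbedding (fun x => g x * Ψ (x + -v)) Ω'
    simpa [hΩ', preimage_preimage] using this
  have e2 : ∫ x in Ω', g x * Ψ (x + -v) =
      (∫ x in Ω', g x * (Ψ (x + -v) - Ψ x)) + ∫ x in Ω', g x * Ψ x := by
    rw [← integral_add (integrable_mul_of_sqInt (hg.mono hΩ'S) hdiff)
      (integrable_mul_of_sqInt (hg.mono hΩ'S) (hΨS.mono hΩ'S))]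
    exact integral_congr_ae (.of_forall fun x => by ring)
  have hi : IntegrableOn (fun x => g x * Ψ x) S := integrable_mul_of_sqInt hg hΨS
  have e3 := integral_inter_add_sdiff hopen.measurableSet (hi.mono_set hΩ'S)
  have e4 := integral_inter_add_sdiff hΩ'o.measurableSet (hi.mono_set hΩS)
  rw [inter_comm] at e4
  have e5 : ∫ x in Ω, (g (x + v) - g x) * Ψ x =
      (∫ x in Ω, g (x + v) * Ψ x) - ∫ x in Ω, g x * Ψ x := by
    rw [← integral_sub (integrable_mul_of_sqInt hgv (hΨS.mono hΩS))
      (integrable_mul_of_sqInt (hg.mono hΩS) (hΨS.mono hΩS))]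
    exact integral_congr_ae (.of_forall fun x => by ring)
  have hlayer : ∀ T ⊆ L, |∫ x in T, g x * Ψ x| ≤ nrm L g * nrm L Ψ := fun T hT =>
    (abs_integral_mul_le (hg.mono (hT.trans hLS)) (hΨS.mono (hT.trans hLS))).trans
      (mul_le_mul (nrm_mono (hg.mono hLS) hT) (nrm_mono (hΨS.mono hLS) hT) (nrm_nonneg _ _)
        (nrm_nonneg _ _))
  have b1 : |∫ x in Ω', g x * (Ψ (x + -v) - Ψ x)| ≤ nrm S g * (t * nrm D (vec G)) := by
    refine (abs_integral_mul_le (hg.mono hΩ'S) hdiff).trans (mul_le_mul (nrm_mono hg hΩ'S) ?_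
      (nrm_nonneg _ _) (nrm_nonneg _ _))
    refine (hΨ.nrm_translate_sub_le hΩ'o (-v) fun s hs x hx => ?_).trans
      (mul_le_mul_of_nonneg_right (by simpa using hv.le) (nrm_nonneg _ _))
    refine Metric.mem_thickening_iff.2 ⟨_, hx, ?_⟩
    rw [dist_eq_norm, show x + s • -v - (x + -v) = (1 - s) • v by module, norm_smul,
      Real.norm_of_nonneg (by linarith [hs.2])]
    have := mul_le_mul_of_nonneg_right (by linarith [hs.1] : 1 - s ≤ 1) (norm_nonneg v)
    linarith
  have b2 := hlayer _ h1
  have b3 := hlayer _ h2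
  rw [e5, e1, e2, ← e3, ← e4]
  rw [abs_le] at *
  constructor <;> linarith [b1.1, b1.2, b2.1, b2.2, b3.1, b3.2]

theorem abs_integral_translate_sub_mul_le {Ω : Set (E n)} {t : ℝ} {v : E n} (hv : ‖v‖ < t)
    {g ψ : E n → ℝ} (hg : SqInt (Metric.thickening t Ω) g) (hψ : SqInt Ω ψ) :
    |∫ x in Ω, (g (x + v) - g x) * ψ x| ≤ 2 * nrm (Metric.thickening t Ω) g * nrm Ω ψ := by
  have ht : 0 < t := (norm_nonneg v).trans_lt hv
  have hmem : ∀ x ∈ Ω, x + v ∈ Metric.thickening t Ω := fun x hx =>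
    Metric.mem_thickening_iff.2 ⟨x, hx, by rw [dist_eq_norm]; simpa using hv⟩
  have hΩS : Ω ⊆ Metric.thickening t Ω := Metric.self_subset_thickening ht Ω
  refine (abs_integral_mul_le ((hg.translate hmem).sub (hg.mono hΩS)) hψ).trans
    (mul_le_mul_of_nonneg_right ?_ (nrm_nonneg _ _))
  refine (nrm_sub_le (hg.translate hmem) (hg.mono hΩS)).trans ?_
  linarith [nrm_translate_le hg hmem, nrm_mono hg hΩS]

theorem add_layer_le {a b t s α β γ C₀ C₁ p q : ℝ} (ha : 0 ≤ a) (hb : 0 ≤ b) (ht : 0 ≤ t)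
    (hs : 0 ≤ s) (hC₀ : 0 ≤ C₀) (hC₁ : 0 ≤ C₁) (hp : 0 ≤ p) (hq : 0 ≤ q)
    (hγ : γ ≤ C₁ * s * (α + β)) (hα : α ≤ C₀ * p) (hβ : β ≤ C₀ * p) :
    a * (t * β) + 2 * (b * γ) ≤ (C₀ + 4 * C₁ * C₀ + q) * (t * a + s * b) * p := by
  have h3 : γ ≤ C₁ * s * (2 * (C₀ * p)) :=
    hγ.trans (mul_le_mul_of_nonneg_left (by linarith) (by positivity))
  have h4 : a * (t * β) ≤ a * (t * (C₀ * p)) := by gcongr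
  have h5 : b * γ ≤ b * (C₁ * s * (2 * (C₀ * p))) := by gcongr
  have h6 : 0 ≤ (C₀ * (s * b) + 4 * C₁ * C₀ * (t * a) + q * (t * a + s * b)) * p := by
    positivity
  linarith

set_option maxHeartbeats 2000000 in
/-- A translation by at most `t` changes a function `g` by `O(t)‖g‖`, in the dual of `H¹(Ω)`, up to
a boundary layer of width `t` which contributes `O(√t)‖g‖`. -/
theorem exists_translate_dual_le {Ω : Set (E n)} (hopen : IsOpen Ω) (hne : Ω.Nonempty)
    (hb : Bornology.IsBounded Ω) (hL : HasLipschitzBoundary Ω) :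
    ∃ C : ℝ, 0 ≤ C ∧ ∀ (t : ℝ) (v : E n) (g : E n → ℝ) (ψ : H1 Ω ℝ), ‖v‖ < t →
      SqInt (Metric.thickening t Ω) g →
      |∫ x in Ω, (g (x + v) - g x) * fn ψ x| ≤ C * (t * nrm (Metric.thickening t Ω) g +
        √t * nrm (Metric.thickening t (frontier Ω)) g) * ‖ψ‖ := by
  obtain ⟨r, C₀, P₀, hr, hC₀, hP₀⟩ := exists_local_extension hopen hne hb hL
  obtain ⟨C₁, hC₁, hlay⟩ := exists_layer_le hopen hb hL hr
  refine ⟨C₀ + 4 * C₁ * C₀ + 2 / r, by positivity, fun t v g ψ hv hg => ?_⟩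
  have ht : 0 < t := (norm_nonneg v).trans_lt hv
  have hS0 := nrm_nonneg (Metric.thickening t Ω) g
  have hL0 := nrm_nonneg (Metric.thickening t (frontier Ω)) g
  have hψ0 := norm_nonneg ψ
  have hst := Real.sqrt_nonneg t
  generalize hSg : nrm (Metric.thickening t Ω) g = a at *
  generalize hLg : nrm (Metric.thickening t (frontier Ω)) g = b at *
  -- Beyond the width r of the local extension nothing has to be gained: the increment is at most
  -- 2‖g‖ in `L²`, and 1 ≤ t/r.
  rcases le_or_gt t r with htr | htr
  · have hΨ := sobolevOn_H1 (P₀ ψ)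
    have e : ∫ x in Ω, (g (x + v) - g x) * fn ψ x =
        ∫ x in Ω, (g (x + v) - g x) * fn (P₀ ψ) x := by
      refine integral_congr_ae ?_
      filter_upwards [(hP₀ ψ).1] with x hx
      rw [hx]
    have hu : nrm (Metric.thickening r Ω) (fn (P₀ ψ)) ≤ C₀ * ‖ψ‖ :=
      (norm_fn_eq_nrm (P₀ ψ)).symm.trans_le ((hP₀ ψ).2.1.trans
        (mul_le_mul_of_nonneg_left (norm_fn_le ψ) hC₀))
    have hG : nrm (Metric.thickening r Ω) (vec fun i => grad (P₀ ψ) i) ≤ C₀ * ‖ψ‖ :=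
      (hP₀ ψ).2.2.1.trans (mul_le_mul_of_nonneg_left
        ((gradNorm_self ψ).symm.trans_le (gradNorm_le_norm ψ)) hC₀)
    have h1 := abs_integral_translate_mul_le hopen htr hv hg hΨ
    have h2 := hlay t _ _ ht htr hΨ
    rw [e]
    rw [hSg, hLg] at h1
    exact h1.trans (add_layer_le hS0 hL0 ht.le hst hC₀ hC₁ hψ0 (by positivity) h2 hu hG)
  · have h1 := abs_integral_translate_sub_mul_le hv hg (sobolevOn_H1 ψ).sqInt
    have h2 : nrm Ω (fn ψ) ≤ ‖ψ‖ := (norm_fn_eq_nrm ψ).symm.trans_le (norm_fn_le ψ)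
    rw [hSg] at h1
    have h3 : 2 * a * nrm Ω (fn ψ) ≤ 2 * a * ‖ψ‖ := by gcongr
    have h4 : 2 * a * ‖ψ‖ ≤ 2 / r * (t * a) * ‖ψ‖ := by
      have : 1 ≤ t / r := (one_le_div hr).2 htr.le
      have h5 : a * ‖ψ‖ * 1 ≤ a * ‖ψ‖ * (t / r) := by gcongr
      calc 2 * a * ‖ψ‖ = 2 * (a * ‖ψ‖ * 1) := by ring
        _ ≤ 2 * (a * ‖ψ‖ * (t / r)) := by linarith
        _ = _ := by ring
    have h6 : 0 ≤ ((C₀ + 4 * C₁ * C₀) * (t * a + √t * b) + 2 / r * (√t * b)) * ‖ψ‖ := by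
      positivity
    linarith

/-- The remainder is controlled by the increments of v·∇u along the segments sv, 0 ≤ s ≤ 1, to which
the dual translation bound applies; this adds a factor ‖v‖. -/
theorem SobolevOn.abs_integral_taylor_dual_le {Ω : Set (E n)} (hopen : IsOpen Ω) {C t : ℝ}
    (hC : ∀ (v : E n) (g : E n → ℝ) (ψ : H1 Ω ℝ), ‖v‖ < t → SqInt (Metric.thickening t Ω) g →
      |∫ x in Ω, (g (x + v) - g x) * fn ψ x| ≤ C * (t * nrm (Metric.thickening t Ω) g +
        √t * nrm (Metric.thickening t (frontier Ω)) g) * ‖ψ‖) (hC0 : 0 ≤ C)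
    {u : E n → ℝ} {G : Fin n → E n → ℝ} (h : SobolevOn (Metric.thickening t Ω) u G)
    {v : E n} (hv : ‖v‖ < t) (ψ : H1 Ω ℝ) :
    |∫ x in Ω, (u (x + v) - u x - inner ℝ v (Unfolding.vec G x)) * fn ψ x| ≤
      C * ‖v‖ * (t * nrm (Metric.thickening t Ω) (Unfolding.vec G) +
        √t * nrm (Metric.thickening t (_root_.frontier Ω)) (Unfolding.vec G)) * ‖ψ‖ := by
  have ht : 0 < t := (norm_nonneg v).trans_lt hv
  have hsv : ∀ s ∈ Icc (0 : ℝ) 1, ‖s • v‖ < t := fun s hs => by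
    rw [norm_smul, Real.norm_of_nonneg hs.1]
    exact (mul_le_of_le_one_left (norm_nonneg v) hs.2).trans_lt hv
  have hLS : Metric.thickening t (_root_.frontier Ω) ⊆ Metric.thickening t Ω := by
    rw [← Metric.thickening_closure (s := Ω)]
    exact Metric.thickening_subset_of_subset t frontier_subset_closure
  have key := h.abs_integral_taylor_le hopen v (fun s hs x hx => Metric.mem_thickening_iff.2
    ⟨x, hx, by rw [dist_eq_norm]; simpa using hsv s hs⟩) (sobolevOn_H1 ψ).sqInt
    (B := C * ‖v‖ * (t * nrm (Metric.thickening t Ω) (Unfolding.vec G) +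
        √t * nrm (Metric.thickening t (_root_.frontier Ω)) (Unfolding.vec G)) * ‖ψ‖) fun s hs => ?_
  · simpa only [mul_comm] using key
  · have h1 := hC (s • v) (fun x => inner ℝ v (Unfolding.vec G x)) ψ (hsv s hs)
      (sqInt_inner h.vec v)
    have e : ∫ x in Ω, fn ψ x * (inner ℝ v (Unfolding.vec G (x + s • v)) -
        inner ℝ v (Unfolding.vec G x)) = ∫ x in Ω, (inner ℝ v (Unfolding.vec G (x + s • v)) -
        inner ℝ v (Unfolding.vec G x)) * fn ψ x :=
      integral_congr_ae (.of_forall fun x => mul_comm _ _)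
    rw [e]
    refine h1.trans ?_
    have h2 := nrm_inner_le h.vec v
    have h3 := nrm_inner_le (h.vec.mono hLS) v
    rw [mul_assoc C ‖v‖]
    gcongr
    have h4 := mul_le_mul_of_nonneg_left h2 ht.le
    have h5 := mul_le_mul_of_nonneg_left h3 (Real.sqrt_nonneg t)
    linarith

end

section

open Filter Topology
open scoped ENNReal NNReal

variable {n : ℕ}

/-! ### Cells -/

theorem norm_le_sqrt_mul {x : E n} {c : ℝ} (hc : 0 ≤ c) (h : ∀ i, |x i| ≤ c) :
    ‖x‖ ≤ √n * c := by
  rw [EuclideanSpace.norm_eq, ← Real.sqrt_sq hc, ← Real.sqrt_mul (Nat.cast_nonneg n)]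
  refine Real.sqrt_le_sqrt ?_
  calc ∑ i, ‖x i‖ ^ 2 ≤ ∑ _i : Fin n, c ^ 2 := Finset.sum_le_sum fun i _ => by
        rw [Real.norm_eq_abs]; gcongr; exact h i
    _ = n * c ^ 2 := by simp

theorem norm_lt_sqrt_mul (hn : 0 < n) {x : E n} {c : ℝ} (h : ∀ i, |x i| < c) :
    ‖x‖ < √n * c := by
  have : Nonempty (Fin n) := ⟨⟨0, hn⟩⟩
  have hc : 0 < c := (abs_nonneg _).trans_lt (h ⟨0, hn⟩)
  obtain ⟨j, -, hj⟩ := Finset.exists_max_image Finset.univ (fun i => |x i|) Finset.univ_nonempty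
  refine (norm_le_sqrt_mul (abs_nonneg _) fun i => hj i (Finset.mem_univ i)).trans_lt ?_
  have : 0 < √(n : ℝ) := by positivity
  gcongr
  exact h j

/-- The lattice point with integer coordinates `m`. -/
def latt (m : Fin n → ℤ) : E n := WithLp.toLp 2 fun i => (m i : ℝ)

@[simp] theorem latt_apply (m : Fin n → ℤ) (i : Fin n) : latt m i = m i := rfl

/-- The integer part of a point, as a multi-index. -/
def flr (x : E n) : Fin n → ℤ := fun i => ⌊x i⌋

theorem measurable_flr : Measurable (flr : E n → Fin n → ℤ) :=
  measurable_pi_lambda _ fun i => Int.measurable_floor.comp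
    (by fun_prop : Continuous fun x : E n => x i).measurable

theorem volume_coord_eq (i : Fin n) (c : ℝ) : volume {x : E n | x i = c} = 0 := by
  have h := (EuclideanSpace.volume_preserving_symm_measurableEquiv_toLp (Fin n)).symm
  have hm : MeasurableSet {x : Fin n → ℝ | x i = c} :=
    measurableSet_eq_fun (measurable_pi_apply i) measurable_const
  have := (EuclideanSpace.volume_preserving_symm_measurableEquiv_toLp (Fin n)).measure_preimage
    hm.nullMeasurableSet
  have e : volume {x : Fin n → ℝ | x i = c} = 0 := by
    rw [volume_pi]
    exact Measure.pi_hyperplane (α := fun _ : Fin n => ℝ) (fun _ => volume) i c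
  rw [e] at this
  exact this

theorem ae_coord_ne_intCast : ∀ᵐ x : E n, ∀ i, ∀ k : ℤ, x i ≠ k := by
  rw [ae_all_iff]; intro i
  rw [ae_all_iff]; intro k
  exact measure_eq_zero_iff_ae_notMem.1 (volume_coord_eq i k)

theorem isOpen_cell : IsOpen (cell n) := by
  have : cell n = ⋂ i, {y : E n | 0 < y i ∧ y i < 1} := by ext; simp [cell]
  rw [this]
  refine isOpen_iInter_of_finite fun i => ?_
  have h : Continuous fun y : E n => y i := by fun_prop
  exact (isOpen_lt continuous_const h).inter (isOpen_lt h continuous_const)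

theorem ae_fractVec_mem_cell : ∀ᵐ x : E n, fractVec x ∈ cell n := by
  filter_upwards [ae_coord_ne_intCast] with x hx i
  have e : fractVec x i = Int.fract (x i) := rfl
  rw [e]
  exact ⟨(Int.fract_nonneg _).lt_of_ne' fun h => hx i ⌊x i⌋ (by
    rw [Int.fract] at h; linarith), Int.fract_lt_one _⟩

theorem flr_add_latt (x : E n) (m : Fin n → ℤ) : flr (x + latt m) = flr x + m := by
  funext i
  simp [flr]

theorem flr_of_mem_cell {y : E n} (hy : y ∈ cell n) : flr y = 0 := by
  funext i
  exact Int.floor_eq_iff.2 ⟨by simpa using (hy i).1.le, by simpa using (hy i).2⟩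

/-- The open cell `ε(m + Y)`. -/
def openCell (ε : ℝ) (m : Fin n → ℤ) : Set (E n) := (fun x => ε⁻¹ • x - latt m) ⁻¹' cell n

theorem isOpen_openCell (ε : ℝ) (m : Fin n → ℤ) : IsOpen (openCell ε m) :=
  isOpen_cell.preimage (by fun_prop)

theorem convex_cell : Convex ℝ (cell n) := by
  intro x hx y hy a b ha hb hab i
  have h1 := hx i
  have h2 := hy i
  have e : (a • x + b • y) i = a * x i + b * y i := by simp
  rw [e]
  rcases ha.eq_or_lt with rfl | ha
  · obtain rfl : b = 1 := by linarith
    simpa using h2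
  · constructor <;> nlinarith

theorem convex_openCell (ε : ℝ) (m : Fin n → ℤ) : Convex ℝ (openCell ε m) := by
  intro x hx y hy a b ha hb hab
  have e : ε⁻¹ • (a • x + b • y) - latt m = a • (ε⁻¹ • x - latt m) + b • (ε⁻¹ • y - latt m) := by
    obtain rfl : b = 1 - a := by linarith
    module
  change ε⁻¹ • (a • x + b • y) - latt m ∈ cell n
  rw [e]
  exact convex_cell hx hy ha hb hab

theorem openCell_norm_sub_le {ε : ℝ} (hε : 0 < ε) {m : Fin n → ℤ} {x y : E n}
    (hx : ∀ i, (m i : ℝ) ≤ ε⁻¹ * x i ∧ ε⁻¹ * x i ≤ m i + 1)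
    (hy : ∀ i, (m i : ℝ) ≤ ε⁻¹ * y i ∧ ε⁻¹ * y i ≤ m i + 1) : ‖y - x‖ ≤ √n * ε := by
  refine norm_le_sqrt_mul hε.le fun i => ?_
  have e : (y - x) i = ε * (ε⁻¹ * y i - ε⁻¹ * x i) := by
    rw [PiLp.sub_apply]; field_simp
  rw [e, abs_mul, abs_of_pos hε]
  refine mul_le_of_le_one_right hε.le (abs_le.2 ⟨?_, ?_⟩) <;> linarith [(hx i).1, (hx i).2, (hy i).1, (hy i).2]

theorem mem_openCell_bounds {ε : ℝ} {m : Fin n → ℤ} {x : E n} (hx : x ∈ openCell ε m) (i : Fin n) :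
    (m i : ℝ) ≤ ε⁻¹ * x i ∧ ε⁻¹ * x i ≤ m i + 1 := by
  have := hx i
  simp only [PiLp.sub_apply, PiLp.smul_apply, smul_eq_mul, latt_apply] at this
  constructor <;> linarith [this.1, this.2]

theorem flr_bounds {ε : ℝ} {m : Fin n → ℤ} {x : E n} (hx : flr (ε⁻¹ • x) = m) (i : Fin n) :
    (m i : ℝ) ≤ ε⁻¹ * x i ∧ ε⁻¹ * x i ≤ m i + 1 := by
  subst hx
  exact ⟨Int.floor_le _, (Int.lt_floor_add_one _).le⟩

theorem preimage_openCell {ε : ℝ} (hε : 0 < ε) (m : Fin n → ℤ) :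
    (fun y : E n => ε • latt m + ε • y) ⁻¹' openCell ε m = cell n := by
  ext y
  simp only [openCell, mem_preimage]
  rw [← smul_add, inv_smul_smul₀ hε.ne', add_sub_cancel_left]

theorem flr_of_mem_openCell {ε : ℝ} {m : Fin n → ℤ} {x : E n} (hx : x ∈ openCell ε m) :
    flr (ε⁻¹ • x) = m := by
  have := flr_of_mem_cell hx
  have h2 := flr_add_latt (ε⁻¹ • x - latt m) m
  rwa [sub_add_cancel, this, zero_add] at h2

theorem openCell_ae_eq {ε : ℝ} (hε : 0 < ε) (m : Fin n → ℤ) :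
    ((fun x : E n => flr (ε⁻¹ • x)) ⁻¹' {m} : Set (E n)) =ᵐ[volume] openCell ε m := by
  have h : ∀ᵐ x : E n, ∀ i, ∀ k : ℤ, x i ≠ ε * k := by
    rw [ae_all_iff]; intro i
    rw [ae_all_iff]; intro k
    exact measure_eq_zero_iff_ae_notMem.1 (volume_coord_eq i _)
  refine (?_ : ∀ᵐ x, (x ∈ (fun x : E n => flr (ε⁻¹ • x)) ⁻¹' {m}) = (x ∈ openCell ε m))
  filter_upwards [h] with x hx
  refine propext ⟨fun h i => ?_, flr_of_mem_openCell⟩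
  have hb := flr_bounds h i
  simp only [PiLp.sub_apply, PiLp.smul_apply, smul_eq_mul, latt_apply]
  have h1 : ε⁻¹ * x i ≠ m i := fun h => hx i (m i) (by rw [← h]; field_simp)
  have h2 : ε⁻¹ * x i ≠ m i + 1 := fun h => hx i (m i + 1) (by push_cast; rw [← h]; field_simp)
  have h3 := lt_of_le_of_ne hb.1 h1.symm
  have h4 := lt_of_le_of_ne hb.2 h2
  constructor <;> linarith

/-! ### Estimates of unfolded functions -/

theorem unfold_eq (ε : ℝ) (w : E n → ℝ) (x y : E n) :
    unfold ε w x y = w (ε • latt (flr (ε⁻¹ • x)) + ε • y) := rfl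

theorem measurable_unfoldPoint (ε : ℝ) :
    Measurable fun p : E n × E n => ε • latt (flr (ε⁻¹ • p.2)) + ε • p.1 := by
  have h1 : Measurable fun m : Fin n → ℤ => ε • latt m := measurable_of_countable _
  have h2 : Measurable fun p : E n × E n => flr (ε⁻¹ • p.2) :=
    measurable_flr.comp (by fun_prop : Continuous fun p : E n × E n => ε⁻¹ • p.2).measurable
  exact (h1.comp h2).add (by fun_prop : Continuous fun p : E n × E n => ε • p.1).measurable

/-- While x runs through one cell the integer part of x/ε is constant, so a = ε([x/ε] + y) runs
through the same cell as x, independently of x. The integral becomes ε⁻ⁿ times a sum over cells of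
integrals of F over cell × cell. A cell meeting S has diameter at most √n ε and is contained in S'.
-/
theorem lintegral_lintegral_unfold_le {ε : ℝ} (hε : 0 < ε) {S S' : Set (E n)}
    (hS : MeasurableSet S) (hSS' : ∀ x ∈ S, ∀ a, ‖a - x‖ ≤ √n * ε → a ∈ S')
    {F : E n → E n → ℝ≥0∞} (hF : Measurable (Function.uncurry F)) {g : E n → ℝ≥0∞} {c : ℝ≥0∞}
    (hg : ∀ m : Fin n → ℤ, openCell ε m ⊆ S' →
      ∫⁻ a in openCell ε m, ∫⁻ x in openCell ε m, F x a ≤ c * ∫⁻ a in openCell ε m, g a) :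
    ∫⁻ y in cell n, ∫⁻ x in S, F x (ε • latt (flr (ε⁻¹ • x)) + ε • y) ≤
      ENNReal.ofReal ((ε ^ n)⁻¹) * c * ∫⁻ a in S', g a := by
  classical
  let Q : (Fin n → ℤ) → Set (E n) := fun m => (fun x : E n => flr (ε⁻¹ • x)) ⁻¹' {m}
  have hfl : Measurable fun x : E n => flr (ε⁻¹ • x) :=
    measurable_flr.comp (by fun_prop : Continuous fun x : E n => ε⁻¹ • x).measurable
  have hQm : ∀ m, MeasurableSet (Q m) := fun m => hfl (measurableSet_singleton m)
  have hQd : Pairwise (Function.onFun Disjoint fun m => S ∩ Q m) := fun m m' h =>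
    Set.disjoint_left.2 fun x hx hx' => h (hx.2.symm.trans hx'.2)
  have hSU : S = ⋃ m, S ∩ Q m := by
    ext x
    simp only [mem_iUnion, mem_inter_iff]
    exact ⟨fun h => ⟨_, h, rfl⟩, fun ⟨_, h, _⟩ => h⟩
  have hOd : Pairwise (Function.onFun Disjoint fun m : Fin n → ℤ => openCell ε m) := fun m m' h =>
    Set.disjoint_left.2 fun x hx hx' =>
      h ((flr_of_mem_openCell hx).symm.trans (flr_of_mem_openCell hx'))
  have hFm : ∀ m : Fin n → ℤ, Measurable fun p : E n × E n =>
      F p.2 (ε • latt m + ε • p.1) := fun m =>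
    hF.comp (by fun_prop : Continuous fun p : E n × E n =>
      (p.2, ε • latt m + ε • p.1)).measurable
  let s : Set (Fin n → ℤ) := {m | openCell ε m ⊆ S'}
  have step : ∀ y, ∫⁻ x in S, F x (ε • latt (flr (ε⁻¹ • x)) + ε • y) ≤
      ∑' m : s, ∫⁻ x in openCell ε m, F x (ε • latt (m : Fin n → ℤ) + ε • y) := by
    intro y
    conv_lhs => rw [hSU]
    rw [lintegral_iUnion (fun m => hS.inter (hQm m)) hQd,
      tsum_subtype s (fun m => ∫⁻ x in openCell ε m, F x (ε • latt (m : Fin n → ℤ) + ε • y))]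
    refine ENNReal.tsum_le_tsum fun m => ?_
    have e : ∫⁻ x in S ∩ Q m, F x (ε • latt (flr (ε⁻¹ • x)) + ε • y) =
        ∫⁻ x in S ∩ Q m, F x (ε • latt m + ε • y) :=
      setLIntegral_congr_fun (hS.inter (hQm m)) fun x hx => by
        have : flr (ε⁻¹ • x) = m := hx.2
        simp only [this]
    rw [e]
    rcases (S ∩ Q m).eq_empty_or_nonempty with h0 | ⟨x, hxS, hx⟩
    · rw [h0]; simp
    · have hm : m ∈ s := fun a ha => hSS' x hxS a
        (openCell_norm_sub_le hε (flr_bounds hx) (mem_openCell_bounds ha))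
      rw [indicator_of_mem hm]
      refine (lintegral_mono_set inter_subset_right).trans (le_of_eq ?_)
      rw [Measure.restrict_congr_set (openCell_ae_eq hε m)]
  calc ∫⁻ y in cell n, ∫⁻ x in S, F x (ε • latt (flr (ε⁻¹ • x)) + ε • y)
      ≤ ∫⁻ y in cell n, ∑' m : s, ∫⁻ x in openCell ε m, F x (ε • latt (m : Fin n → ℤ) + ε • y) :=
        lintegral_mono step
    _ = ∑' m : s, ∫⁻ y in cell n, ∫⁻ x in openCell ε m, F x (ε • latt (m : Fin n → ℤ) + ε • y) :=
        lintegral_tsum fun m => (hFm m).lintegral_prod_right'.aemeasurable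
    _ ≤ ∑' m : s, ENNReal.ofReal ((ε ^ n)⁻¹) * c * ∫⁻ a in openCell ε (m : Fin n → ℤ), g a := by
        refine ENNReal.tsum_le_tsum fun m => ?_
        have := setLIntegral_affine (ε • latt (m : Fin n → ℤ)) hε (openCell ε (m : Fin n → ℤ))
          fun a => ∫⁻ x in openCell ε (m : Fin n → ℤ), F x a
        rw [preimage_openCell hε] at this
        rw [this, mul_assoc]
        gcongr
        exact hg m m.2
    _ = ENNReal.ofReal ((ε ^ n)⁻¹) * c * ∫⁻ a in ⋃ m : s, openCell ε (m : Fin n → ℤ), g a := by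
        rw [ENNReal.tsum_mul_left, lintegral_iUnion
          (s := fun m : s => openCell ε (m : Fin n → ℤ))
          (fun m => (isOpen_openCell ε _).measurableSet)
          (fun m m' h => hOd fun h' => h (Subtype.ext h')) g]
    _ ≤ _ := by
        gcongr
        exact iUnion_subset fun m => m.2

theorem volume_openCell {ε : ℝ} (hε : 0 < ε) (m : Fin n → ℤ) :
    ENNReal.ofReal ((ε ^ n)⁻¹) * volume (openCell ε m) ≤ 1 := by
  have h := setLIntegral_affine (ε • latt m) hε (openCell ε m) fun _ => 1
  rw [preimage_openCell hε, setLIntegral_one, setLIntegral_one] at h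
  rw [← h]
  have e : cell n ⊆ (MeasurableEquiv.toLp 2 (Fin n → ℝ)).symm ⁻¹' (Set.pi univ fun _ => Ioo 0 1) :=
    fun y hy i _ => hy i
  refine (measure_mono e).trans ?_
  rw [(EuclideanSpace.volume_preserving_symm_measurableEquiv_toLp (Fin n)).measure_preimage
    (MeasurableSet.univ_pi fun _ => measurableSet_Ioo).nullMeasurableSet, Real.volume_pi_Ioo]
  simp

theorem lintegral_sq_unfold_le {ε : ℝ} (hε : 0 < ε) {S S' : Set (E n)}
    (hS : MeasurableSet S) (hSS' : ∀ x ∈ S, ∀ a, ‖a - x‖ ≤ √n * ε → a ∈ S')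
    {w : E n → ℝ} (hw : Measurable w) :
    ∫⁻ y in cell n, sq S (fun x => unfold ε w x y) ≤ sq S' w := by
  have hwm : Measurable fun a => ‖w a‖ₑ ^ 2 := hw.enorm.pow_const 2
  have h := lintegral_lintegral_unfold_le hε hS hSS' (F := fun _ a => ‖w a‖ₑ ^ 2)
    (hwm.comp measurable_snd) (g := fun a => ‖w a‖ₑ ^ 2) (c := volume (openCell ε (0 : Fin n → ℤ)))
    fun m _ => by
      have e : volume (openCell ε m) = volume (openCell ε (0 : Fin n → ℤ)) := by
        have : openCell ε m = (fun x => x + -(ε • latt m)) ⁻¹' openCell ε (0 : Fin n → ℤ) := by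
          ext x
          simp only [openCell, mem_preimage, smul_add, smul_neg, inv_smul_smul₀ hε.ne']
          have : latt (0 : Fin n → ℤ) = 0 := by ext i; simp
          rw [this, sub_zero, sub_eq_add_neg]
        rw [this, measure_preimage_add_right]
      simp only [lintegral_const, Measure.restrict_apply MeasurableSet.univ, univ_inter]
      rw [lintegral_mul_const _ hwm, e, mul_comm]
  refine h.trans ?_
  exact (mul_le_mul_left (volume_openCell hε 0) _).trans (one_mul _).le

/-- The constant of the Poincaré–Wirtinger inequality used on the cells. -/
def cellConst (n : ℕ) : ℝ≥0∞ := ENNReal.ofReal (n * √n ^ n) * volume (Metric.ball (0 : E n) 1)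

/-- The double integral over a cell of |u(a) − u(x)|² is exactly the quantity bounded by the convex
Poincaré inequality, so no means over cells are needed. -/
theorem lintegral_sq_unfold_sub_le {ε : ℝ} (hε : 0 < ε) {S S' : Set (E n)}
    (hS : MeasurableSet S) (hSS' : ∀ x ∈ S, ∀ a, ‖a - x‖ ≤ √n * ε → a ∈ S')
    {u : E n → ℝ} (hum : Measurable u) {G : Fin n → E n → ℝ} (hu : SobolevOn S' u G) :
    ∫⁻ y in cell n, sq S (fun x => unfold ε u x y - u x) ≤
      ENNReal.ofReal (ε ^ 2) * cellConst n * sq S' (vec G) := by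
  have hm : Measurable fun p : E n × E n => ‖u p.2 - u p.1‖ₑ ^ 2 :=
    ((hum.comp measurable_snd).sub (hum.comp measurable_fst)).enorm.pow_const 2
  refine (lintegral_lintegral_unfold_le hε hS hSS' (F := fun x a => ‖u a - u x‖ₑ ^ 2) hm
    (g := fun a => ‖vec G a‖ₑ ^ 2) (c := ENNReal.ofReal ((√n * ε) ^ 2) *
      volume (Metric.closedBall (0 : E n) (√n * ε))) fun m hmS => ?_).trans ?_
  · have h := (hu.mono hmS).lintegral_lintegral_sub_le hum (isOpen_openCell ε m)
      (convex_openCell ε m) fun x hx y hy =>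
        openCell_norm_sub_le hε (mem_openCell_bounds hx) (mem_openCell_bounds hy)
    refine le_trans (le_of_eq ?_) h
    refine lintegral_congr fun a => lintegral_congr fun b => ?_
    rw [← enorm_neg, neg_sub]
  · change _ ≤ _ * ∫⁻ a in S', ‖vec G a‖ₑ ^ 2
    refine mul_le_mul_left (le_of_eq ?_) _
    have h1 : 0 ≤ √(n : ℝ) * ε := by positivity
    rw [Measure.addHaar_closedBall _ _ h1, cellConst, ← mul_assoc, ← mul_assoc, ← mul_assoc,
      ← ENNReal.ofReal_mul (by positivity), ← ENNReal.ofReal_mul (by positivity),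
      ← ENNReal.ofReal_mul (by positivity), finrank_euclideanSpace_fin]
    congr 2
    rw [mul_pow, mul_pow, Real.sq_sqrt (Nat.cast_nonneg n)]
    field_simp

end

section

open Filter Topology
open scoped ENNReal NNReal

variable {n : ℕ}

/-! ### A partition of unity by integer translates -/

/-- A bump function on the line whose integer translates sum up to one. -/
def unitBump (t : ℝ) : ℝ := Real.smoothTransition (1 + t) - Real.smoothTransition t

theorem unitBump_nonneg (t : ℝ) : 0 ≤ unitBump t :=
  sub_nonneg.2 (Real.smoothTransition.monotone (by linarith))

theorem unitBump_eq_zero {t : ℝ} (h : 1 ≤ |t|) : unitBump t = 0 := by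
  rcases le_abs.1 h with h | h
  · rw [unitBump, Real.smoothTransition.one_of_one_le (by linarith),
      Real.smoothTransition.one_of_one_le h, sub_self]
  · rw [unitBump, Real.smoothTransition.zero_of_nonpos (by linarith),
      Real.smoothTransition.zero_of_nonpos (by linarith), sub_self]

theorem unitBump_add {t : ℝ} (h0 : 0 ≤ t) (h1 : t ≤ 1) : unitBump t + unitBump (t - 1) = 1 := by
  rw [unitBump, unitBump, Real.smoothTransition.one_of_one_le (by linarith : 1 ≤ 1 + t),
    Real.smoothTransition.zero_of_nonpos (by linarith : t - 1 ≤ 0)]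
  ring_nf

theorem contDiff_unitBump : ContDiff ℝ ∞ unitBump :=
  (Real.smoothTransition.contDiff.comp (contDiff_const.add contDiff_id)).sub
    Real.smoothTransition.contDiff

/-- A bump function on `ℝⁿ` whose integer translates sum up to one. -/
def bump (y : E n) : ℝ := ∏ i, unitBump (y i)

theorem bump_nonneg (y : E n) : 0 ≤ bump y := Finset.prod_nonneg fun _ _ => unitBump_nonneg _

theorem bump_eq_zero {y : E n} {i : Fin n} (h : 1 ≤ |y i|) : bump y = 0 :=
  Finset.prod_eq_zero (Finset.mem_univ i) (unitBump_eq_zero h)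

theorem contDiff_bump : ContDiff ℝ ∞ (bump : E n → ℝ) := by
  refine contDiff_prod fun i _ => contDiff_unitBump.comp ?_
  exact (EuclideanSpace.proj (𝕜 := ℝ) i).contDiff

/-- The cube `]-2,2[ⁿ`. -/
def cube (n : ℕ) : Set (E n) := {y | ∀ i, |y i| < 2}

theorem isOpen_cube : IsOpen (cube n) := by
  have : cube n = ⋂ i, {y : E n | |y i| < 2} := by ext; simp [cube]
  rw [this]
  refine isOpen_iInter_of_finite fun i => ?_
  have h : Continuous fun y : E n => y i := by fun_prop
  exact isOpen_lt h.abs continuous_const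

theorem isBounded_cube : Bornology.IsBounded (cube n) :=
  Metric.isBounded_closedBall.subset fun _ hy =>
    mem_closedBall_zero_iff.2 (norm_le_sqrt_mul zero_le_two fun i => (hy i).le)

theorem isTest_bump : IsTest (cube n) bump := by
  have hsub : tsupport (bump : E n → ℝ) ⊆ {y | ∀ i, |y i| ≤ 1} := by
    refine closure_minimal (fun y hy i => ?_) ?_
    · by_contra hc
      exact hy (bump_eq_zero (not_le.1 hc).le)
    · rw [Set.ofPred_forall]
      refine isClosed_iInter fun i => ?_
      have h : Continuous fun y : E n => y i := by fun_prop
      exact isClosed_le h.abs continuous_const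
  have hsub' : tsupport (bump : E n → ℝ) ⊆ cube n := fun y hy i =>
    (hsub hy i).trans_lt one_lt_two
  exact ⟨contDiff_bump, Metric.isCompact_of_isClosed_isBounded (isClosed_tsupport _)
    (isBounded_cube.subset hsub'), hsub'⟩

/-- Such points are minima of a nonnegative function. This covers the faces |yⱼ| = 1 as well as the
exterior, as the periodization of the gradient requires. -/
theorem pderiv_bump_eq_zero {y : E n} {j : Fin n} (h : 1 ≤ |y j|) (i : Fin n) :
    pderiv i bump y = 0 := by
  have : IsLocalMin bump y := .of_forall fun z => by
    rw [bump_eq_zero h]; exact bump_nonneg z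
  rw [pderiv, this.fderiv_eq_zero]
  rfl

/-- The vertices of the unit cube. -/
def vertices (n : ℕ) : Finset (Fin n → ℤ) := Fintype.piFinset fun _ => {0, 1}

theorem mem_vertices {k : Fin n → ℤ} : k ∈ vertices n ↔ ∀ i, k i = 0 ∨ k i = 1 := by
  simp [vertices]

theorem sum_bump {y : E n} (hy : ∀ i, 0 ≤ y i ∧ y i ≤ 1) :
    ∑ k ∈ vertices n, bump (y - latt k) = 1 := by
  have h := Finset.prod_univ_sum (fun _ : Fin n => ({0, 1} : Finset ℤ))
    fun i k => unitBump (y i - k)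
  have e : ∀ i, ∑ k ∈ ({0, 1} : Finset ℤ), unitBump (y i - k) = 1 := fun i => by
    rw [Finset.sum_pair (by norm_num)]
    simpa using unitBump_add (hy i).1 (hy i).2
  simp only [e, Finset.prod_const_one] at h
  exact h.symm

theorem pderiv_comp_sub (i : Fin n) (η : E n → ℝ) (a y : E n) :
    pderiv i (fun z => η (z - a)) y = pderiv i η (y - a) := by
  rw [pderiv, fderiv_comp_sub, pderiv]

theorem sum_pderiv_bump {y : E n} (hy : y ∈ cell n) (i : Fin n) :
    ∑ k ∈ vertices n, pderiv i bump (y - latt k) = 0 := by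
  have hd : ∀ k ∈ vertices n, DifferentiableAt ℝ (fun z : E n => bump (z - latt k)) y := fun k _ =>
    ((contDiff_bump.comp (contDiff_id.sub contDiff_const)).differentiable (by simp)) y
  have h1 : fderiv ℝ (fun z : E n => ∑ k ∈ vertices n, bump (z - latt k)) y = 0 := by
    have : (fun z : E n => ∑ k ∈ vertices n, bump (z - latt k)) =ᶠ[𝓝 y] fun _ => 1 := by
      filter_upwards [isOpen_cell.mem_nhds hy] with z hz
      exact sum_bump fun i => ⟨(hz i).1.le, (hz i).2.le⟩
    rw [this.fderiv_eq, fderiv_const_apply]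
  rw [fderiv_fun_sum hd] at h1
  have h2 := congrArg (fun T : E n →L[ℝ] ℝ => T (EuclideanSpace.single i 1)) h1
  simp only [sum_apply, zero_apply] at h2
  rw [← h2]
  exact Finset.sum_congr rfl fun k _ => (pderiv_comp_sub i bump (latt k) y).symm

/-! ### Periodization -/

section

variable {X : Type*} [NormedAddCommGroup X]

theorem fractVec_eq (y : E n) : fractVec y = y - latt (flr y) := rfl

/-- Only the translates l with l − [y] in {0,1}ⁿ can be nonzero at y. The sum over the lattice thus
reduces to a sum over the vertices evaluated at the fractional part, which expresses its
periodicity. -/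
theorem sum_translates_eq {w : E n → X} (hw : ∀ y i, 1 ≤ |y i| → w y = 0)
    {Λ : Finset (Fin n → ℤ)} {y : E n} (hΛ : ∀ k ∈ vertices n, flr y + k ∈ Λ) :
    ∑ l ∈ Λ, w (y - latt l) = ∑ k ∈ vertices n, w (fractVec y - latt k) := by
  classical
  have e : ∀ k, fractVec y - latt k = y - latt (flr y + k) := fun k => by
    have : latt (flr y + k) = latt (flr y) + latt k := by ext i; simp
    rw [this, fractVec_eq]; abel
  have h1 : ∑ k ∈ vertices n, w (fractVec y - latt k) =
      ∑ l ∈ (vertices n).image (flr y + ·), w (y - latt l) := by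
    rw [Finset.sum_image fun a _ b _ h => add_left_cancel h]
    simp only [e]
  rw [h1]
  refine (Finset.sum_subset (fun l hl => ?_) fun l _ hl => ?_).symm
  · obtain ⟨k, hk, rfl⟩ := Finset.mem_image.1 hl
    exact hΛ k hk
  · obtain ⟨i, hi⟩ : ∃ i, ¬ (l i - flr y i = 0 ∨ l i - flr y i = 1) := by
      by_contra! hc
      exact hl (Finset.mem_image.2 ⟨l - flr y, mem_vertices.2 hc, by simp⟩)
    refine hw _ i ?_
    have hfl := Int.floor_le (y i)
    have hfl' := Int.lt_floor_add_one (y i)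
    change 1 ≤ |y i - l i|
    simp only [flr, not_or] at hi
    rcases lt_or_gt_of_ne hi.1 with h | h
    · have : (l i : ℝ) ≤ ⌊y i⌋ - 1 := by exact_mod_cast (by omega : l i ≤ ⌊y i⌋ - 1)
      rw [le_abs]; left; linarith
    · have : (⌊y i⌋ : ℝ) + 2 ≤ l i := by exact_mod_cast (by omega : ⌊y i⌋ + 2 ≤ l i)
      rw [le_abs]; right; linarith

theorem ae_fractVec {p : E n → Prop} (h : ∀ᵐ z ∂(volume.restrict (cell n)), p z) :
    ∀ᵐ y : E n, p (fractVec y) := by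
  rw [ae_restrict_iff' isOpen_cell.measurableSet] at h
  have h1 : ∀ᵐ y : E n, ∀ m : Fin n → ℤ, y - latt m ∈ cell n → p (y - latt m) :=
    ae_all_iff.2 fun m => (measurePreserving_sub_right volume (latt m)).quasiMeasurePreserving.ae h
  filter_upwards [h1, ae_fractVec_mem_cell] with y hy hc
  exact hy (flr y) hc

variable [NormedSpace ℝ X]

theorem SobolevOn.comp_sub {f : E n → X} {F : Fin n → E n → X} (h : SobolevOn univ f F) (a : E n) :
    SobolevOn univ (fun y => f (y - a)) (fun i y => F i (y - a)) := by
  have hs : ∀ w : E n → X, SqInt univ w → SqInt univ fun y => w (y - a) := fun w hw => by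
    simpa [sub_eq_add_neg] using hw.translate (A := univ) (z := -a) fun x _ => mem_univ _
  refine ⟨hs _ h.sqInt, fun i => hs _ (h.sqInt_grad i), fun η h1 h2 h3 i => ?_⟩
  have hη : IsTest univ fun y => η (y - -a) :=
    (⟨h1, h2, h3⟩ : IsTest univ η).translate fun x _ => mem_univ _
  have := h.weak _ hη.1 hη.2 hη.3 i
  simp only [pderiv_comp_sub] at this
  simp only [Measure.restrict_univ, sub_neg_eq_add] at this ⊢
  rw [← integral_add_right_eq_self _ a, ← integral_add_right_eq_self (fun y => η y • F i (y - a)) a]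
  simpa using this

/-- The sum of the integer translates of a function supported in the cube `]-1,1[ⁿ` is a periodic
function on the reference cell. -/
theorem SobolevOn.exists_periodic {f : E n → X} {F : Fin n → E n → X} (h : SobolevOn univ f F)
    (hf : ∀ y i, 1 ≤ |y i| → f y = 0) (hF : ∀ j y i, 1 ≤ |y i| → F j y = 0) :
    ∃ w : H1 (cell n) X, IsPeriodic w ∧
      fn w =ᵐ[volume.restrict (cell n)] (fun y => ∑ k ∈ vertices n, f (y - latt k)) ∧
      ∀ i, grad w i =ᵐ[volume.restrict (cell n)] fun y => ∑ k ∈ vertices n, F i (y - latt k) := by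
  have hsum : ∀ Λ : Finset (Fin n → ℤ), SobolevOn univ (fun y => ∑ l ∈ Λ, f (y - latt l))
      (fun i y => ∑ l ∈ Λ, F i (y - latt l)) := fun Λ =>
    SobolevOn.sum Λ fun l _ => h.comp_sub (latt l)
  obtain ⟨w, hw, hwG⟩ := ((hsum (vertices n)).mono (subset_univ (cell n))).exists_H1
  refine ⟨w, fun η h1 h2 h3 i => ?_, hw, hwG⟩
  obtain ⟨R, hR⟩ := h2.isCompact.isBounded.subset_closedBall 0
  -- A box containing all the lattice points that matter on the support of η: against this test the
  -- periodic extension is a finite sum of translates, whose weak gradient is known.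
  set Λ : Finset (Fin n → ℤ) := Fintype.piFinset fun _ => Finset.Icc (-⌈R⌉ - 1) (⌈R⌉ + 1) with hΛ
  have hΛ' : ∀ y ∈ tsupport η, ∀ k ∈ vertices n, flr y + k ∈ Λ := fun y hy k hk => by
    rw [hΛ, Fintype.mem_piFinset]
    intro j
    have hyR : |y j| ≤ R := (PiLp.norm_apply_le y j).trans (mem_closedBall_zero_iff.1 (hR hy))
    have hc := Int.le_ceil R
    have h1 : -⌈R⌉ ≤ ⌊y j⌋ := Int.le_floor.2 (by push_cast; linarith [(abs_le.1 hyR).1])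
    have h2 : ⌊y j⌋ ≤ ⌈R⌉ := by
      have : (⌊y j⌋ : ℝ) ≤ ⌈R⌉ := by linarith [Int.floor_le (y j), (abs_le.1 hyR).2]
      exact_mod_cast this
    have hkj := mem_vertices.1 hk j
    simp only [Pi.add_apply, flr, Finset.mem_Icc]
    omega
  have hz : ∀ y ∉ tsupport η, η y = 0 := fun y hy => image_eq_zero_of_notMem_tsupport hy
  have hz' : ∀ y ∉ tsupport η, Unfolding.pderiv i η y = 0 := fun y hy => by
    have : fderiv ℝ η y = 0 :=
      image_eq_zero_of_notMem_tsupport fun h' => hy (tsupport_fderiv_subset ℝ h')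
    simp [Unfolding.pderiv, this]
  have key := (hsum Λ).weak η h1 h2 h3 i
  have e1 : ∫ y in univ, Unfolding.pderiv i η y • fn w (fractVec y) =
      ∫ y in univ, Unfolding.pderiv i η y • ∑ l ∈ Λ, f (y - latt l) := by
    rw [Measure.restrict_univ]
    refine integral_congr_ae ?_
    filter_upwards [ae_fractVec hw] with y hy
    by_cases hys : y ∈ tsupport η
    · rw [hy, sum_translates_eq hf (hΛ' y hys)]
    · rw [hz' y hys, zero_smul, zero_smul]
  have e2 : ∫ y in univ, η y • grad w i (fractVec y) =
      ∫ y in univ, η y • ∑ l ∈ Λ, F i (y - latt l) := by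
    rw [Measure.restrict_univ]
    refine integral_congr_ae ?_
    filter_upwards [ae_fractVec (hwG i)] with y hy
    by_cases hys : y ∈ tsupport η
    · rw [hy, sum_translates_eq (hF i) (hΛ' y hys)]
    · rw [hz y hys, zero_smul, zero_smul]
  rw [e1, e2]
  exact key

end

end

section

open Filter Topology
open scoped ENNReal NNReal

variable {n : ℕ}

/-! ### Slices of unfolded functions -/

theorem finite_image_flr {Ω : Set (E n)} (hΩ : Bornology.IsBounded Ω) (ε : ℝ) :
    ((fun x : E n => flr (ε⁻¹ • x)) '' Ω).Finite := by
  obtain ⟨R, hR⟩ := hΩ.subset_closedBall 0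
  refine (Set.Finite.pi' (t := fun _ : Fin n => Icc (-⌈|ε⁻¹| * R⌉ - 1) (⌈|ε⁻¹| * R⌉))
    (fun _ => Set.finite_Icc _ _)).subset ?_
  rintro _ ⟨x, hx, rfl⟩ i
  have h1 : |x i| ≤ R := (PiLp.norm_apply_le x i).trans (mem_closedBall_zero_iff.1 (hR hx))
  have h2 : |(ε⁻¹ • x) i| ≤ |ε⁻¹| * R := by
    simp only [PiLp.smul_apply, smul_eq_mul, abs_mul]
    exact mul_le_mul_of_nonneg_left h1 (abs_nonneg _)
  have h3 := abs_le.1 (h2.trans (Int.le_ceil _))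
  refine ⟨?_, ?_⟩
  · refine (sub_le_self _ zero_le_one).trans (Int.le_floor.2 ?_)
    push_cast
    exact h3.1
  · exact Int.cast_le.1 ((Int.floor_le _).trans h3.2)

/-- A bounded set meets finitely many cells, and on each of them the unfolded function does not
depend on x; the eₘ are the indicators of the cells. Measurability and weak differentiability in y
thus become statements about finitely many scalar coefficients. -/
theorem exists_unfoldSlice_eq_sum {Ω : Set (E n)} (hopen : IsOpen Ω) (hΩ : Bornology.IsBounded Ω)
    (ε : ℝ) :
    ∃ (M : Finset (Fin n → ℤ)) (e : (Fin n → ℤ) → L2 Ω ℝ),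
      (∀ m ∈ M, ∃ x ∈ Ω, flr (ε⁻¹ • x) = m) ∧
      ∀ w y, unfoldSlice hΩ ε w y = ∑ m ∈ M, w (ε • latt m + ε • y) • e m := by
  classical
  have hfl : Measurable fun x : E n => flr (ε⁻¹ • x) :=
    measurable_flr.comp (by fun_prop : Continuous fun x : E n => ε⁻¹ • x).measurable
  have hQ : ∀ m, MeasurableSet ((fun x : E n => flr (ε⁻¹ • x)) ⁻¹' {m}) := fun m =>
    hfl (measurableSet_singleton m)
  have hfin : ∀ S, (volume.restrict Ω) S ≠ ⊤ := fun S =>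
    ((measure_mono (subset_univ S)).trans_lt
      (by rw [Measure.restrict_apply_univ]; exact hΩ.measure_lt_top)).ne
  let e : (Fin n → ℤ) → L2 Ω ℝ := fun m => indicatorConstLp 2 (hQ m) (hfin _) (1 : ℝ)
  refine ⟨(finite_image_flr hΩ ε).toFinset, e, fun m hm => ?_, fun w y => Lp.ext ?_⟩
  · simpa using hm
  · have h1 : ∀ᵐ x ∂(volume.restrict Ω), ∀ m ∈ (finite_image_flr hΩ ε).toFinset,
        (w (ε • latt m + ε • y) • e m : L2 Ω ℝ) x = w (ε • latt m + ε • y) *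
          ((fun x : E n => flr (ε⁻¹ • x)) ⁻¹' {m}).indicator (fun _ => (1 : ℝ)) x := by
      refine (Filter.eventually_all_finset _).2 fun m _ => ?_
      filter_upwards [Lp.coeFn_smul (w (ε • latt m + ε • y)) (e m),
        indicatorConstLp_coeFn (p := 2) (hs := hQ m) (hμs := hfin _) (c := (1 : ℝ))] with x h1 h2
      rw [h1, Pi.smul_apply, smul_eq_mul]
      exact congrArg _ h2
    filter_upwards [(unfold_memLp hΩ ε w y).coeFn_toLp, Lp.coeFn_fun_finsetSum
      (finite_image_flr hΩ ε).toFinset fun m => (w (ε • latt m + ε • y) • e m : L2 Ω ℝ), h1,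
      ae_restrict_mem hopen.measurableSet] with x h1 h2 h3 hx
    refine h1.trans (Eq.symm ?_)
    rw [h2, Finset.sum_congr rfl h3, Finset.sum_eq_single (flr (ε⁻¹ • x))]
    · rw [indicator_of_mem (by simp), mul_one, unfold_eq]
    · intro m _ hm
      have hxm : x ∉ (fun x : E n => flr (ε⁻¹ • x)) ⁻¹' {m} := fun h => hm (Eq.symm h)
      rw [indicator_of_notMem hxm, mul_zero]
    · intro h
      exact absurd ((finite_image_flr hΩ ε).mem_toFinset.2 ⟨x, hx, rfl⟩) h

theorem stronglyMeasurable_unfoldSlice {Ω : Set (E n)} (hopen : IsOpen Ω)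
    (hΩ : Bornology.IsBounded Ω) (ε : ℝ) {w : E n → ℝ} (hw : Measurable w) :
    StronglyMeasurable fun y => unfoldSlice hΩ ε w y := by
  obtain ⟨M, e, -, h⟩ := exists_unfoldSlice_eq_sum hopen hΩ ε
  simp only [h]
  refine Finset.stronglyMeasurable_fun_sum M fun m _ => ?_
  exact (hw.comp (by fun_prop : Continuous fun y : E n =>
    ε • latt m + ε • y).measurable).stronglyMeasurable.smul_const (e m)

/-- The data to which the unfolding operator is applied: a function `φ` of `H¹(Ω)`, and an extension
`u` of `φ`, with weak gradient `U`, to the neighbourhood of width `3√n ε` of `Ω`. -/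
structure UnfoldingData (Ω : Set (E n)) (ε : ℝ) (φ : H1 Ω ℝ) (u : E n → ℝ)
    (U : Fin n → E n → ℝ) : Prop where
  dim_pos : 0 < n
  isOpen : IsOpen Ω
  ε_pos : 0 < ε
  sobolevOn : SobolevOn (nbhd Ω ε 3) u U
  measurable_fn : Measurable u
  measurable_grad : ∀ i, Measurable (U i)
  fn_eq : fn φ =ᵐ[volume.restrict Ω] u
  grad_eq : ∀ i, grad φ i =ᵐ[volume.restrict Ω] U i

/-- The rescaled difference between the unfolded function and the function, corrected by an affine
function. -/
def oscillation {Ω : Set (E n)} (hΩ : Bornology.IsBounded Ω) (ε : ℝ) (φ : H1 Ω ℝ) (u : E n → ℝ)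
    (y : E n) : L2 Ω ℝ :=
  ε⁻¹ • (unfoldSlice hΩ ε u y - fn φ) - ∑ j, y j • grad φ j

/-- The corrector, before periodization. -/
def corrector {Ω : Set (E n)} (hΩ : Bornology.IsBounded Ω) (ε : ℝ) (φ : H1 Ω ℝ) (u : E n → ℝ)
    (y : E n) : L2 Ω ℝ :=
  bump y • oscillation hΩ ε φ u y

/-- The gradient of the corrector. -/
def correctorGrad {Ω : Set (E n)} (hΩ : Bornology.IsBounded Ω) (ε : ℝ) (φ : H1 Ω ℝ) (u : E n → ℝ)
    (U : Fin n → E n → ℝ) (i : Fin n) (y : E n) : L2 Ω ℝ :=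
  pderiv i bump y • oscillation hΩ ε φ u y + bump y • (unfoldSlice hΩ ε (U i) y - grad φ i)

section

variable {Ω : Set (E n)} {ε : ℝ} {φ : H1 Ω ℝ} {u : E n → ℝ} {U : Fin n → E n → ℝ}

/-- This accounts for the width 3√n ε: the coordinates of y are less than 2 in modulus and those of
x/ε − m lie in [0,1[, so those of the difference are less than 3. The strict norm bound needs n > 0.
-/
theorem cube_subset_preimage_nbhd (hn : 0 < n) (hε : 0 < ε) {m : Fin n → ℤ} {x : E n} (hx : x ∈ Ω)
    (hm : flr (ε⁻¹ • x) = m) :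
    cube n ⊆ (fun y : E n => ε • latt m + ε • y) ⁻¹' nbhd Ω ε 3 := by
  intro y hy
  rw [mem_preimage, nbhd_three]
  refine Metric.mem_thickening_iff.2 ⟨x, hx, ?_⟩
  have e : ε • latt m + ε • y - x = ε • (latt m + y - ε⁻¹ • x) := by
    rw [smul_sub, smul_inv_smul₀ hε.ne', smul_add]
  rw [dist_eq_norm, e, norm_smul, Real.norm_of_nonneg hε.le]
  have h : ‖latt m + y - ε⁻¹ • x‖ < √n * 3 := by
    refine norm_lt_sqrt_mul hn fun i => ?_
    have h1 := abs_lt.1 (hy i)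
    have h2 : (m i : ℝ) ≤ (ε⁻¹ • x) i := by rw [← hm]; exact Int.floor_le _
    have h3 : (ε⁻¹ • x) i < m i + 1 := by rw [← hm]; exact Int.lt_floor_add_one _
    rw [PiLp.sub_apply, PiLp.add_apply, latt_apply, abs_lt]
    constructor <;> linarith
  nlinarith

theorem pderiv_coord (i j : Fin n) (y : E n) :
    pderiv i (fun z : E n => z j) y = if i = j then 1 else 0 := by
  have : fderiv ℝ (fun z : E n => z j) y = EuclideanSpace.proj j :=
    (EuclideanSpace.proj (𝕜 := ℝ) j).fderiv
  rw [pderiv, this]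
  simp [eq_comm]

/-- On each cell index the coefficient y ↦ u(εm + εy) has gradient ε∇u(εm + εy), whose factor ε
cancels ε⁻¹; the affine term contributes −∇φ. Multiplication by the bump makes everything a Sobolev
function on the whole space. -/
theorem UnfoldingData.sobolevOn_corrector (h : UnfoldingData Ω ε φ u U)
    (hΩ : Bornology.IsBounded Ω) :
    SobolevOn univ (corrector hΩ ε φ u) (correctorGrad hΩ ε φ u U) := by
  obtain ⟨M, e, hM, hsl⟩ := exists_unfoldSlice_eq_sum h.isOpen hΩ ε
  have hα : ∀ m ∈ M, SobolevOn univ (fun y : E n => bump y * u (ε • latt m + ε • y))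
      (fun i y => pderiv i bump y * u (ε • latt m + ε • y) +
        bump y * (ε * U i (ε • latt m + ε • y))) := fun m hm => by
    obtain ⟨x, hx, hxm⟩ := hM m hm
    exact (h.sobolevOn.comp_affine (ε • latt m) h.ε_pos).mul_test
      (Metric.isOpen_thickening.preimage (by fun_prop))
      (isTest_bump.mono (cube_subset_preimage_nbhd h.dim_pos h.ε_pos hx hxm))
  have hβ := (sobolevOn_of_contDiff (contDiff_const (c := (1 : ℝ))) isBounded_cube).mul_test
    isOpen_cube (isTest_bump (n := n))
  have hγ : ∀ j : Fin n, SobolevOn univ (fun y : E n => bump y * y j)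
      (fun i y => pderiv i bump y * y j + bump y * pderiv i (fun z : E n => z j) y) := fun j =>
    (sobolevOn_of_contDiff (EuclideanSpace.proj (𝕜 := ℝ) j).contDiff isBounded_cube).mul_test
      isOpen_cube (isTest_bump (n := n))
  have key := (((SobolevOn.sum M fun m hm => (hα m hm).smul_vec (e m)).sub
    (hβ.smul_vec (fn φ))).const_smul ε⁻¹).sub
    (SobolevOn.sum Finset.univ fun j _ => (hγ j).smul_vec (grad φ j))
  refine key.congr (.of_forall fun y => ?_) fun i => .of_forall fun y => ?_
  · simp only [corrector, oscillation, hsl, smul_sub, Finset.smul_sum, smul_smul, mul_one]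
    congr 2
    · exact Finset.sum_congr rfl fun m _ => by congr 1; ring
    · congr 1; ring
  · have hp : ∀ z : E n, pderiv i (fun _ : E n => (1 : ℝ)) z = 0 := fun z => by simp [pderiv]
    have h1 : ∑ j, (pderiv i bump y * y j + bump y * pderiv i (fun z : E n => z j) y) • grad φ j =
        pderiv i bump y • (∑ j, y j • grad φ j) + bump y • grad φ i := by
      simp only [pderiv_coord, add_smul, Finset.sum_add_distrib, Finset.smul_sum, smul_smul,
        mul_ite, mul_one, mul_zero, ite_smul, zero_smul, Finset.sum_ite_eq, Finset.mem_univ,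
        if_true]
    have h2 : ε⁻¹ • ∑ m ∈ M, (pderiv i bump y * u (ε • latt m + ε • y) +
        bump y * (ε * U i (ε • latt m + ε • y))) • e m =
        pderiv i bump y • ε⁻¹ • unfoldSlice hΩ ε u y + bump y • unfoldSlice hΩ ε (U i) y := by
      simp only [hsl, Finset.smul_sum, smul_smul, ← Finset.sum_add_distrib, ← add_smul]
      refine Finset.sum_congr rfl fun m _ => ?_
      congr 1
      have := h.ε_pos.ne'
      field_simp
    beta_reduce
    rw [h1, smul_sub, h2, hp]
    simp only [correctorGrad, oscillation]
    module

theorem corrector_eq_zero (hΩ : Bornology.IsBounded Ω) {y : E n} {i : Fin n} (hy : 1 ≤ |y i|) :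
    corrector hΩ ε φ u y = 0 := by
  rw [corrector, bump_eq_zero hy, zero_smul]

theorem correctorGrad_eq_zero (hΩ : Bornology.IsBounded Ω) (j : Fin n) {y : E n} {i : Fin n}
    (hy : 1 ≤ |y i|) : correctorGrad hΩ ε φ u U j y = 0 := by
  rw [correctorGrad, bump_eq_zero hy, pderiv_bump_eq_zero hy, zero_smul, zero_smul, add_zero]

/-- The algebraic core. As the bumps sum to 1 and their derivatives to 0, T_ε(∇u) − ∇φ can be
distributed over the vertices and the oscillation at y subtracted freely. Only differences between y
and y − k remain, and these measure the lack of periodicity. -/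
theorem sum_correctorGrad (hΩ : Bornology.IsBounded Ω) {y : E n} (hy : y ∈ cell n) (i : Fin n) :
    unfoldSlice hΩ ε (U i) y - grad φ i - ∑ k ∈ vertices n, correctorGrad hΩ ε φ u U i (y - latt k) =
      (∑ k ∈ vertices n, bump (y - latt k) •
        (unfoldSlice hΩ ε (U i) y - unfoldSlice hΩ ε (U i) (y - latt k))) -
      ∑ k ∈ vertices n, pderiv i bump (y - latt k) •
        (ε⁻¹ • (unfoldSlice hΩ ε u (y - latt k) - unfoldSlice hΩ ε u y) +
          ∑ j, (k j : ℝ) • grad φ j) := by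
  have h1 : unfoldSlice hΩ ε (U i) y - grad φ i =
      ∑ k ∈ vertices n, bump (y - latt k) • (unfoldSlice hΩ ε (U i) y - grad φ i) := by
    rw [← Finset.sum_smul, sum_bump fun i => ⟨(hy i).1.le, (hy i).2.le⟩, one_smul]
  have h2 : ∑ k ∈ vertices n, pderiv i bump (y - latt k) • oscillation hΩ ε φ u y = 0 := by
    rw [← Finset.sum_smul, sum_pderiv_bump hy, zero_smul]
  have h3 : ∀ k, oscillation hΩ ε φ u (y - latt k) - oscillation hΩ ε φ u y =
      ε⁻¹ • (unfoldSlice hΩ ε u (y - latt k) - unfoldSlice hΩ ε u y) +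
          ∑ j, (k j : ℝ) • grad φ j := fun k => by
    simp only [oscillation, PiLp.sub_apply, latt_apply, sub_smul, Finset.sum_sub_distrib]
    module
  simp only [← h3]
  rw [h1, ← Finset.sum_sub_distrib, ← sub_eq_zero, ← Finset.sum_sub_distrib,
    ← Finset.sum_sub_distrib, ← neg_zero, ← h2, ← Finset.sum_neg_distrib]
  refine Finset.sum_congr rfl fun k _ => ?_
  simp only [correctorGrad]
  module

end

end

section

open Filter Topology
open scoped ENNReal NNReal

variable {n : ℕ}

/-! ### The size of the unfolded functions -/

theorem volume_cell_le : volume (cell n) ≤ 1 := by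
  have h := volume_openCell one_pos (0 : Fin n → ℤ)
  have e : openCell 1 (0 : Fin n → ℤ) = cell n := by
    have : latt (0 : Fin n → ℤ) = 0 := by ext i; simp
    simp [openCell, this]
  rw [e] at h
  simpa using h

theorem measurable_nrm {H : E n → E n → ℝ} (hH : Measurable (Function.uncurry H)) (S : Set (E n)) :
    Measurable fun y => nrm S (H y) := by
  have e : (fun y => nrm S (H y)) = fun y => √(sq S (H y)).toReal := by
    funext y
    rw [← nrm_sq, Real.sqrt_sq (nrm_nonneg _ _)]
  rw [e]
  have h : Measurable fun y => sq S (H y) :=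
    Measurable.lintegral_prod_right' (f := fun p : E n × E n => ‖H p.1 p.2‖ₑ ^ 2)
      (hH.enorm.pow_const 2)
  exact h.ennreal_toReal.sqrt

theorem sqInt_nrm_and_le {H : E n → E n → ℝ} (hH : Measurable (Function.uncurry H))
    {S Y : Set (E n)} (hS : ∀ y, SqInt S (H y)) {c : ℝ} (hc : 0 ≤ c)
    (h : ∫⁻ y in Y, sq S (H y) ≤ ENNReal.ofReal (c ^ 2)) :
    SqInt Y (fun y => nrm S (H y)) ∧ nrm Y (fun y => nrm S (H y)) ≤ c := by
  have e : sq Y (fun y => nrm S (H y)) = ∫⁻ y in Y, sq S (H y) := by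
    refine lintegral_congr fun y => ?_
    rw [sq_eq_ofReal (hS y), Real.enorm_eq_ofReal (nrm_nonneg _ _),
      ENNReal.ofReal_pow (nrm_nonneg _ _)]
  rw [← e] at h
  exact ⟨sqInt_of_sq_lt_top (measurable_nrm hH S).aestronglyMeasurable
    (h.trans_lt ENNReal.ofReal_lt_top), nrm_le_of_sq_le hc h⟩

/-- The `L²(S)` size of the unfolded gradient and of the oscillation of the unfolded function. -/
def unfoldSize (ε : ℝ) (u : E n → ℝ) (U : Fin n → E n → ℝ) (S : Set (E n)) (y : E n) : ℝ :=
  ∑ i, nrm S (fun x => unfold ε (U i) x y) + ε⁻¹ * nrm S (fun x => unfold ε u x y - u x) +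
    nrm S (vec U)

theorem unfoldSize_nonneg {ε : ℝ} (hε : 0 < ε) (u : E n → ℝ) (U : Fin n → E n → ℝ) (S : Set (E n))
    (y : E n) : 0 ≤ unfoldSize ε u U S y :=
  add_nonneg (add_nonneg (Finset.sum_nonneg fun _ _ => nrm_nonneg _ _)
    (mul_nonneg (inv_nonneg.2 hε.le) (nrm_nonneg _ _))) (nrm_nonneg _ _)

theorem measurable_unfold {w : E n → ℝ} (hw : Measurable w) (ε : ℝ) :
    Measurable (Function.uncurry fun y x : E n => unfold ε w x y) := by
  simp only [Function.uncurry_def, unfold_eq]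
  exact hw.comp (measurable_unfoldPoint ε)

/-- The constant in the `L²` estimate of the unfolded functions. -/
def sizeConst (n : ℕ) : ℝ := n + √(cellConst n).toReal + 1

theorem sizeConst_nonneg (n : ℕ) : 0 ≤ sizeConst n := by
  unfold sizeConst; positivity

/-- The cellwise bounds are integrated in y: the unfolded gradient is no larger than the gradient,
and the difference between the unfolded function and u gains a factor ε, which cancels ε⁻¹. -/
theorem nrm_unfoldSize_le {ε : ℝ} (hε : 0 < ε) {S S' : Set (E n)} (hSb : Bornology.IsBounded S)
    (hS : MeasurableSet S) (hSS' : ∀ x ∈ S, ∀ a, ‖a - x‖ ≤ √n * ε → a ∈ S') {u : E n → ℝ}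
    {U : Fin n → E n → ℝ} (hum : Measurable u) (hUm : ∀ i, Measurable (U i))
    (hu : SobolevOn S' u U) :
    SqInt (cell n) (unfoldSize ε u U S) ∧
      nrm (cell n) (unfoldSize ε u U S) ≤ sizeConst n * nrm S' (vec U) := by
  set a := nrm S' (vec U) with ha
  have ha0 : 0 ≤ a := nrm_nonneg _ _
  have hSsub : S ⊆ S' := fun x hx => hSS' x hx x (by simpa using by positivity)
  have hsq : sq S' (vec U) = ENNReal.ofReal (a ^ 2) := sq_eq_ofReal hu.vec
  have h1 : ∀ i, SqInt (cell n) (fun y => nrm S (fun x => unfold ε (U i) x y)) ∧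
      nrm (cell n) (fun y => nrm S (fun x => unfold ε (U i) x y)) ≤ a := fun i => by
    refine sqInt_nrm_and_le (measurable_unfold (hUm i) ε) (fun y => unfold_memLp hSb ε (U i) y) ha0
      ((lintegral_sq_unfold_le hε hS hSS' (hUm i)).trans ?_)
    rw [sq_eq_ofReal (hu.sqInt_grad i)]
    exact ENNReal.ofReal_le_ofReal (pow_le_pow_left₀ (nrm_nonneg _ _)
      (nrm_grad_le hu.sqInt_grad i) 2)
  have hcell : cellConst n ≠ ⊤ := ENNReal.mul_ne_top ENNReal.ofReal_ne_top measure_ball_lt_top.ne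
  have h2 : SqInt (cell n) (fun y => nrm S (fun x => unfold ε u x y - u x)) ∧
      nrm (cell n) (fun y => nrm S (fun x => unfold ε u x y - u x)) ≤
        ε * √(cellConst n).toReal * a := by
    refine sqInt_nrm_and_le ((measurable_unfold hum ε).sub (hum.comp measurable_snd))
      (fun y => (unfold_memLp hSb ε u y).sub (hu.sqInt.mono hSsub)) (by positivity)
      ((lintegral_sq_unfold_sub_le hε hS hSS' hum hu).trans (le_of_eq ?_))
    rw [hsq, mul_pow, mul_pow, Real.sq_sqrt ENNReal.toReal_nonneg,
      ENNReal.ofReal_mul (by positivity), ENNReal.ofReal_mul (by positivity),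
      ENNReal.ofReal_toReal hcell]
  have hfin : volume (cell n) ≠ ⊤ := (volume_cell_le.trans_lt ENNReal.one_lt_top).ne
  have h3 : SqInt (cell n) (fun _ : E n => nrm S (vec U)) := sqInt_const hfin _
  have h3' : nrm (cell n) (fun _ : E n => nrm S (vec U)) ≤ a := by
    rw [nrm_const, abs_of_nonneg (nrm_nonneg _ _)]
    have hv : √(volume (cell n)).toReal ≤ 1 := by
      refine Real.sqrt_le_one.2 ?_
      exact ENNReal.toReal_le_of_le_ofReal zero_le_one (by simpa using volume_cell_le)
    exact (mul_le_of_le_one_right (nrm_nonneg _ _) hv).trans (nrm_mono hu.vec hSsub)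
  have h4 : SqInt (cell n) (fun y => ∑ i, nrm S (fun x => unfold ε (U i) x y)) :=
    memLp_finsetSum _ fun i _ => (h1 i).1
  have h5 : SqInt (cell n) (fun y => ε⁻¹ • nrm S (fun x => unfold ε u x y - u x)) :=
    h2.1.const_smul ε⁻¹
  refine ⟨(h4.add h5).add h3, ?_⟩
  have h6 := nrm_add_le (show SqInt (cell n) fun y => ∑ i, nrm S (fun x => unfold ε (U i) x y) +
    ε⁻¹ • nrm S (fun x => unfold ε u x y - u x) from h4.add h5) h3
  have h7 := nrm_add_le h4 h5
  have h8 := nrm_sum_le Finset.univ fun i (_ : i ∈ Finset.univ) => (h1 i).1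
  have h9 : ∑ i, nrm (cell n) (fun y => nrm S (fun x => unfold ε (U i) x y)) ≤ n * a :=
    (Finset.sum_le_sum fun i _ => (h1 i).2).trans_eq (by simp)
  have h10 : nrm (cell n) (fun y => ε⁻¹ • nrm S (fun x => unfold ε u x y - u x)) ≤
      √(cellConst n).toReal * a := by
    rw [nrm_const_smul, abs_of_pos (inv_pos.2 hε)]
    refine (mul_le_mul_of_nonneg_left h2.2 (inv_pos.2 hε).le).trans (le_of_eq ?_)
    field_simp
  have e : nrm (cell n) (unfoldSize ε u U S) = nrm (cell n) fun y =>
    ∑ i, nrm S (fun x => unfold ε (U i) x y) +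
    ε⁻¹ • nrm S (fun x => unfold ε u x y - u x) + nrm S (vec U) := rfl
  rw [e, sizeConst]
  linarith

/-- A lattice shift in y is a translation in x. This identity turns the failure of periodicity into
increments of length O(ε), accessible to the dual estimate. -/
theorem unfold_sub_latt {ε : ℝ} (hε : 0 < ε) (w : E n → ℝ) (x y : E n) (k : Fin n → ℤ) :
    unfold ε w x (y - latt k) = unfold ε w (x + -(ε • latt k)) y := by
  rw [unfold_eq, unfold_eq]
  have h : flr (ε⁻¹ • (x + -(ε • latt k))) = flr (ε⁻¹ • x) - k := by
    have := flr_add_latt (ε⁻¹ • (x + -(ε • latt k))) k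
    rw [smul_add, smul_neg, inv_smul_smul₀ hε.ne', neg_add_cancel_right] at this
    rw [smul_add, smul_neg, inv_smul_smul₀ hε.ne', this, add_sub_cancel_right]
  rw [h]
  have : latt (flr (ε⁻¹ • x) - k) = latt (flr (ε⁻¹ • x)) - latt k := by ext i; simp
  rw [this]
  congr 1
  module

theorem norm_latt_le {k : Fin n → ℤ} (hk : k ∈ vertices n) : ‖latt k‖ ≤ √n := by
  have := norm_le_sqrt_mul (x := latt k) zero_le_one fun i => by
    rcases mem_vertices.1 hk i with h | h <;> simp [h]
  simpa using this

section

variable {Ω : Set (E n)} {ε t : ℝ} {φ : H1 Ω ℝ} {u : E n → ℝ} {U : Fin n → E n → ℝ}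

theorem norm_neg_smul_latt_lt (hε : 0 < ε) (ht : √n * ε < t) {k : Fin n → ℤ} (hk : k ∈ vertices n) :
    ‖-(ε • latt k)‖ < t := by
  rw [norm_neg, norm_smul, Real.norm_of_nonneg hε.le, mul_comm]
  exact (mul_le_mul_of_nonneg_right (norm_latt_le hk) hε.le).trans_lt ht

theorem thickening_frontier_subset (Ω : Set (E n)) (t : ℝ) :
    Metric.thickening t (frontier Ω) ⊆ Metric.thickening t Ω := by
  rw [← Metric.thickening_closure (s := Ω)]
  exact Metric.thickening_subset_of_subset t frontier_subset_closure

theorem UnfoldingData.thickening_subset (h : UnfoldingData Ω ε φ u U)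
    (ht' : t ≤ 2 * √n * ε) : Metric.thickening t Ω ⊆ nbhd Ω ε 3 := by
  rw [nbhd_three]
  refine Metric.thickening_mono (ht'.trans ?_) Ω
  have := h.ε_pos
  gcongr
  norm_num

theorem unfoldSlice_coe (hΩ : Bornology.IsBounded Ω) (ε : ℝ) (w : E n → ℝ) (y : E n) :
    unfoldSlice hΩ ε w y =ᵐ[volume.restrict Ω] fun x => unfold ε w x y :=
  (unfold_memLp hΩ ε w y).coeFn_toLp

theorem norm_toLp_sub_le {f g : L2 Ω ℝ} {f' g' : E n → ℝ} (hf : f =ᵐ[volume.restrict Ω] f')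
    (hg : g =ᵐ[volume.restrict Ω] g') : ‖f - g‖ = nrm Ω fun x => f' x - g' x := by
  rw [norm_eq_nrm]
  refine nrm_congr ?_
  filter_upwards [Lp.coeFn_sub f g, hf, hg] with x h1 h2 h3
  rw [h1, Pi.sub_apply, h2, h3]

theorem nrm_unfold_grad_le_size (hε : 0 < ε) (S : Set (E n)) (y : E n) (i : Fin n) :
    nrm S (fun x => unfold ε (U i) x y) + nrm S (vec U) ≤ unfoldSize ε u U S y := by
  have h1 := Finset.single_le_sum (f := fun i => nrm S (fun x => unfold ε (U i) x y))
    (fun i _ => nrm_nonneg _ _) (Finset.mem_univ i)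
  have h2 : 0 ≤ ε⁻¹ * nrm S (fun x => unfold ε u x y - u x) :=
    mul_nonneg (inv_pos.2 hε).le (nrm_nonneg _ _)
  rw [unfoldSize]
  linarith

theorem nrm_unfold_sub_le_size (S : Set (E n)) (y : E n) :
    ε⁻¹ * nrm S (fun x => unfold ε u x y - u x) + nrm S (vec U) ≤ unfoldSize ε u U S y := by
  have h1 : 0 ≤ ∑ i, nrm S (fun x => unfold ε (U i) x y) :=
    Finset.sum_nonneg fun i _ => nrm_nonneg _ _
  rw [unfoldSize]
  linarith

theorem UnfoldingData.norm_slice_grad_le (h : UnfoldingData Ω ε φ u U) (hΩ : Bornology.IsBounded Ω)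
    (ht : √n * ε < t) (ht' : t ≤ 2 * √n * ε) {k : Fin n → ℤ} (hk : k ∈ vertices n) (y : E n)
    (i : Fin n) :
    ‖unfoldSlice hΩ ε (U i) (y - latt k) - grad φ i‖ ≤
      unfoldSize ε u U (Metric.thickening t Ω) y := by
  have hv := norm_neg_smul_latt_lt h.ε_pos ht hk
  have ht0 : 0 < t := (norm_nonneg _).trans_lt hv
  have hΩS : Ω ⊆ Metric.thickening t Ω := Metric.self_subset_thickening ht0 Ω
  have hmem : ∀ x ∈ Ω, x + -(ε • latt k) ∈ Metric.thickening t Ω := fun x hx =>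
    Metric.mem_thickening_iff.2 ⟨x, hx, by rw [dist_eq_norm]; simpa using hv⟩
  rw [norm_toLp_sub_le (unfoldSlice_coe hΩ ε (U i) _) (h.grad_eq i)]
  simp only [unfold_sub_latt h.ε_pos]
  have hw := unfold_memLp (hΩ.thickening (δ := t)) ε (U i) y
  have hU := h.sobolevOn.mono (h.thickening_subset ht')
  refine (nrm_sub_le (SqInt.translate hw hmem) ((hU.sqInt_grad i).mono hΩS)).trans ?_
  have h1 := nrm_translate_le hw hmem
  have h2 := (nrm_mono (hU.sqInt_grad i) hΩS).trans (nrm_grad_le hU.sqInt_grad i)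
  exact (add_le_add h1 h2).trans (nrm_unfold_grad_le_size h.ε_pos _ y i)

theorem UnfoldingData.norm_slice_fn_le (h : UnfoldingData Ω ε φ u U) (hΩ : Bornology.IsBounded Ω)
    (ht : √n * ε < t) (ht' : t ≤ 2 * √n * ε) {k : Fin n → ℤ} (hk : k ∈ vertices n) (y : E n) :
    ε⁻¹ * ‖unfoldSlice hΩ ε u (y - latt k) - fn φ‖ ≤
      (1 + √n) * unfoldSize ε u U (Metric.thickening t Ω) y := by
  have hε := h.ε_pos
  have hv := norm_neg_smul_latt_lt h.ε_pos ht hk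
  have ht0 : 0 < t := (norm_nonneg _).trans_lt hv
  have hΩS : Ω ⊆ Metric.thickening t Ω := Metric.self_subset_thickening ht0 Ω
  have hmem : ∀ s ∈ Icc (0 : ℝ) 1, ∀ x ∈ Ω, x + s • -(ε • latt k) ∈ Metric.thickening t Ω :=
    fun s hs x hx => Metric.mem_thickening_iff.2 ⟨x, hx, by
      rw [dist_eq_norm, add_sub_cancel_left, norm_smul, Real.norm_of_nonneg hs.1]
      exact (mul_le_of_le_one_left (norm_nonneg _) hs.2).trans_lt hv⟩
  have hmem1 : ∀ x ∈ Ω, x + -(ε • latt k) ∈ Metric.thickening t Ω := fun x hx => by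
    simpa using hmem 1 (by simp) x hx
  have hU := h.sobolevOn.mono (h.thickening_subset ht')
  have hw : SqInt (Metric.thickening t Ω) fun x => unfold ε u x y - u x :=
    (unfold_memLp (hΩ.thickening (δ := t)) ε u y).sub hU.sqInt
  rw [norm_toLp_sub_le (unfoldSlice_coe hΩ ε u _) h.fn_eq]
  simp only [unfold_sub_latt h.ε_pos]
  -- The translate of T_ε(u) − u plus an increment of u: both are of order ε times the gradient.
  have e : (fun x => unfold ε u (x + -(ε • latt k)) y - u x) = fun x =>
      (unfold ε u (x + -(ε • latt k)) y - u (x + -(ε • latt k))) +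
        (u (x + -(ε • latt k)) - u x) := by
    funext x; ring
  rw [e]
  have h1 := nrm_translate_le hw hmem1
  have h2 := hU.nrm_translate_sub_le h.isOpen _ hmem
  have h3 := nrm_add_le (hw.translate hmem1)
    (show SqInt Ω fun x => u (x + -(ε • latt k)) - u x from
      (hU.sqInt.translate hmem1).sub (hU.sqInt.mono hΩS))
  have h4 : ‖-(ε • latt k)‖ ≤ √n * ε := by
    rw [norm_neg, norm_smul, Real.norm_of_nonneg hε.le, mul_comm]
    exact mul_le_mul_of_nonneg_right (norm_latt_le hk) hε.le
  have h5 := nrm_unfold_sub_le_size (ε := ε) (u := u) (U := U) (Metric.thickening t Ω) y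
  have h6 := mul_le_mul_of_nonneg_right h4 (nrm_nonneg (Metric.thickening t Ω) (vec U))
  have h7 := mul_le_mul_of_nonneg_left (h3.trans (add_le_add h1 (h2.trans h6))) (inv_pos.2 hε).le
  refine h7.trans ?_
  have h8 : ε⁻¹ * (√n * ε * nrm (Metric.thickening t Ω) (vec U)) =
      √n * nrm (Metric.thickening t Ω) (vec U) := by field_simp
  have h9 : nrm (Metric.thickening t Ω) (vec U) ≤ unfoldSize ε u U (Metric.thickening t Ω) y := by
    have := mul_nonneg (inv_pos.2 hε).le
      (nrm_nonneg (Metric.thickening t Ω) fun x => unfold ε u x y - u x)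
    linarith
  have h10 := mul_le_mul_of_nonneg_left h9 (Real.sqrt_nonneg n)
  rw [mul_add, h8]
  linarith [nrm_nonneg (Metric.thickening t Ω) (vec U)]

end

end

section

open Filter Topology
open scoped ENNReal NNReal

variable {n : ℕ}

/-! ### Estimates in the dual of `H¹(Ω)` -/

/-- The norm of `f` in the dual of `H¹(Ω)` is at most `B`. -/
def DualLe {Ω : Set (E n)} (f : L2 Ω ℝ) (B : ℝ) : Prop :=
  ∀ ψ : H1 Ω ℝ, |inner ℝ f (fn ψ)| ≤ B * ‖ψ‖

theorem dualLe_of_integral {Ω : Set (E n)} {f : L2 Ω ℝ} {g : E n → ℝ}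
    (hfg : f =ᵐ[volume.restrict Ω] g) {B : ℝ}
    (h : ∀ ψ : H1 Ω ℝ, |∫ x in Ω, g x * fn ψ x| ≤ B * ‖ψ‖) : DualLe f B := by
  intro ψ
  have e : inner ℝ f (fn ψ) = ∫ x in Ω, g x * fn ψ x := by
    rw [L2.inner_def]
    refine integral_congr_ae ?_
    filter_upwards [hfg] with x hx
    rw [← hx]
    simp [mul_comm]
  rw [e]
  exact h ψ

theorem DualLe.sub {Ω : Set (E n)} {f g : L2 Ω ℝ} {A B : ℝ} (hf : DualLe f A) (hg : DualLe g B) :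
    DualLe (f - g) (A + B) := fun ψ => by
  rw [inner_sub_left, add_mul]
  exact (abs_sub _ _).trans (add_le_add (hf ψ) (hg ψ))

theorem DualLe.sum_smul {Ω : Set (E n)} {ι : Type*} {s : Finset ι} {c : ι → ℝ} {f : ι → L2 Ω ℝ}
    {M A : ℝ} (hc : ∀ k ∈ s, |c k| ≤ M) (hf : ∀ k ∈ s, DualLe (f k) A) :
    DualLe (∑ k ∈ s, c k • f k) (s.card * (M * A)) := fun ψ => by
  rw [sum_inner]
  refine (Finset.abs_sum_le_sum_abs _ _).trans ?_
  have : ∀ k ∈ s, |inner ℝ (c k • f k) (fn ψ)| ≤ M * A * ‖ψ‖ := fun k hk => by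
    rw [real_inner_smul_left, abs_mul, mul_assoc]
    exact mul_le_mul (hc k hk) (hf k hk ψ) (abs_nonneg _) ((abs_nonneg _).trans (hc k hk))
  refine (Finset.sum_le_sum this).trans (le_of_eq ?_)
  rw [Finset.sum_const, nsmul_eq_mul, ← mul_assoc]

/-- The map f ↦ ⟨f, T·⟩ into the dual is continuous, which gives measurability, and B dominates each
component. The factor n comes from bounding the Euclidean norm of the components by their sum. -/
theorem memLp_inner_comp {V H α : Type*} [NormedAddCommGroup V] [NormedSpace ℝ V]
    [NormedAddCommGroup H] [InnerProductSpace ℝ H] [MeasurableSpace α] {μ : Measure α}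
    (T : V →L[ℝ] H) {g : Fin n → α → H} (hg : ∀ i, AEStronglyMeasurable (g i) μ) {B : α → ℝ}
    (hB0 : ∀ y, 0 ≤ B y) (hB : MemLp B 2 μ)
    (hb : ∀ᵐ y ∂μ, ∀ i ψ, |inner ℝ (g i y) (T ψ)| ≤ B y * ‖ψ‖) :
    MemLp (fun y => (WithLp.toLp 2 fun i => (innerSL ℝ (g i y)).comp T :
      PiLp 2 fun _ : Fin n => StrongDual ℝ V)) 2 μ ∧
    eLpNorm (fun y => (WithLp.toLp 2 fun i => (innerSL ℝ (g i y)).comp T :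
      PiLp 2 fun _ : Fin n => StrongDual ℝ V)) 2 μ ≤ ENNReal.ofReal n * eLpNorm B 2 μ := by
  have hn : ∀ᵐ y ∂μ, ∀ i, ‖(innerSL ℝ (g i y)).comp T‖ ≤ B y := by
    filter_upwards [hb] with y hy i
    exact ContinuousLinearMap.opNorm_le_bound _ (hB0 y) (hy i)
  have hmem : MemLp (fun y => (WithLp.toLp 2 fun i => (innerSL ℝ (g i y)).comp T :
      PiLp 2 fun _ : Fin n => StrongDual ℝ V)) 2 μ := by
    refine MemLp.of_eval_piLp fun i => ?_
    have hc : Continuous fun f : H => (innerSL ℝ f).comp T :=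
      ((ContinuousLinearMap.compL ℝ V H ℝ).flip T).continuous.comp (innerSL ℝ).continuous
    refine hB.of_le (hc.comp_aestronglyMeasurable (hg i)) ?_
    filter_upwards [hn] with y hy
    exact (hy i).trans (le_abs_self _)
  have hle : ∀ᵐ y ∂μ, ‖(WithLp.toLp 2 fun i => (innerSL ℝ (g i y)).comp T :
      PiLp 2 fun _ : Fin n => StrongDual ℝ V)‖ ≤ n * ‖B y‖ := by
    filter_upwards [hn] with y h1
    rw [PiLp.norm_eq_of_L2, Real.norm_of_nonneg (hB0 y)]
    refine Real.sqrt_le_iff.2 ⟨mul_nonneg n.cast_nonneg (hB0 y), ?_⟩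
    refine (Finset.sum_sq_le_sq_sum_of_nonneg fun i _ => norm_nonneg _).trans ?_
    refine pow_le_pow_left₀ (Finset.sum_nonneg fun i _ => norm_nonneg _) ?_ 2
    exact (Finset.sum_le_sum fun i _ => h1 i).trans_eq (by simp)
  exact ⟨hmem, eLpNorm_le_mul_eLpNorm_of_ae_le_mul hle 2⟩

/-- Translations by less than `t` change functions by at most the quantity below, in the dual of
`H¹(Ω)`. -/
def IsTranslateBound (Ω : Set (E n)) (C t : ℝ) : Prop :=
  ∀ (v : E n) (g : E n → ℝ) (ψ : H1 Ω ℝ), ‖v‖ < t → SqInt (Metric.thickening t Ω) g →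
    |∫ x in Ω, (g (x + v) - g x) * fn ψ x| ≤ C * (t * nrm (Metric.thickening t Ω) g +
      √t * nrm (Metric.thickening t (frontier Ω)) g) * ‖ψ‖

/-- The bound of the defect, in terms of the size of the unfolded functions. -/
def dualSize (Ω : Set (E n)) (ε t : ℝ) (u : E n → ℝ) (U : Fin n → E n → ℝ) (y : E n) : ℝ :=
  t * unfoldSize ε u U (Metric.thickening t Ω) y +
    √t * unfoldSize ε u U (Metric.thickening t (frontier Ω)) y

theorem osc_arith {ε t r s C p v a a' A b b' B : ℝ} (hε : 0 < ε) (ht : 0 ≤ t) (hr : 0 ≤ r)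
    (hs : 0 ≤ s) (hC : 0 ≤ C) (hp : 0 ≤ p) (hv : v ≤ s * ε) (a1 : ε⁻¹ * a ≤ A) (a2 : a' ≤ A)
    (b1 : ε⁻¹ * b ≤ B) (b2 : b' ≤ B) (ha : 0 ≤ a') (hb : 0 ≤ b') :
    ε⁻¹ * (C * (t * a + r * b) * p + C * v * (t * a' + r * b') * p) ≤
      (1 + s) * (C * (t * A + r * B)) * p := by
  have h1 : C * (t * (ε⁻¹ * a) + r * (ε⁻¹ * b)) * p ≤ C * (t * A + r * B) * p := by gcongr
  have h2 : C * v * (t * a' + r * b') * p ≤ C * (s * ε) * (t * A + r * B) * p := by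
    have : 0 ≤ t * a' + r * b' := by positivity
    gcongr
  have h3 := mul_le_mul_of_nonneg_left h2 (inv_pos.2 hε).le
  have h4 : ε⁻¹ * (C * (s * ε) * (t * A + r * B) * p) = s * (C * (t * A + r * B) * p) := by
    field_simp
  rw [h4] at h3
  linarith

section

variable {Ω : Set (E n)} {ε t C : ℝ} {φ : H1 Ω ℝ} {u : E n → ℝ} {U : Fin n → E n → ℝ}

theorem dualSize_nonneg (hε : 0 < ε) (ht : 0 ≤ t) (y : E n) : 0 ≤ dualSize Ω ε t u U y :=
  add_nonneg (mul_nonneg ht (unfoldSize_nonneg hε u U _ y))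
    (mul_nonneg (Real.sqrt_nonneg t) (unfoldSize_nonneg hε u U _ y))

theorem UnfoldingData.dualLe_slice (h : UnfoldingData Ω ε φ u U)
    (hΩ : Bornology.IsBounded Ω) (hC : IsTranslateBound Ω C t) (hC0 : 0 ≤ C) (ht : √n * ε < t)
    {k : Fin n → ℤ} (hk : k ∈ vertices n) (y : E n) (i : Fin n) :
    DualLe (unfoldSlice hΩ ε (U i) y - unfoldSlice hΩ ε (U i) (y - latt k))
      (C * dualSize Ω ε t u U y) := by
  have hv := norm_neg_smul_latt_lt h.ε_pos ht hk
  have ht0 : 0 < t := (norm_nonneg _).trans_lt hv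
  have hae : (unfoldSlice hΩ ε (U i) y - unfoldSlice hΩ ε (U i) (y - latt k) : L2 Ω ℝ)
      =ᵐ[volume.restrict Ω] fun x => unfold ε (U i) x y - unfold ε (U i) (x + -(ε • latt k)) y := by
    filter_upwards [Lp.coeFn_sub (unfoldSlice hΩ ε (U i) y) (unfoldSlice hΩ ε (U i) (y - latt k)),
      unfoldSlice_coe hΩ ε (U i) y, unfoldSlice_coe hΩ ε (U i) (y - latt k)] with x h1 h2 h3
    rw [h1, Pi.sub_apply, h2, h3, unfold_sub_latt h.ε_pos]
  refine dualLe_of_integral hae fun ψ => ?_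
  have h1 := hC _ (fun x => unfold ε (U i) x y) ψ hv (unfold_memLp hΩ.thickening ε (U i) y)
  have e : ∫ x in Ω, (unfold ε (U i) x y - unfold ε (U i) (x + -(ε • latt k)) y) * fn ψ x =
      -∫ x in Ω, (unfold ε (U i) (x + -(ε • latt k)) y - unfold ε (U i) x y) * fn ψ x := by
    rw [← integral_neg]
    exact integral_congr_ae (.of_forall fun x => by ring)
  rw [e, abs_neg]
  refine h1.trans (mul_le_mul_of_nonneg_right (mul_le_mul_of_nonneg_left ?_ hC0) (norm_nonneg ψ))
  have h2 : ∀ S, nrm S (fun x => unfold ε (U i) x y) ≤ unfoldSize ε u U S y := fun S =>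
    (le_add_of_nonneg_right (nrm_nonneg _ _)).trans (nrm_unfold_grad_le_size h.ε_pos S y i)
  exact add_le_add (mul_le_mul_of_nonneg_left (h2 _) ht0.le)
    (mul_le_mul_of_nonneg_left (h2 _) (Real.sqrt_nonneg t))

/-- With v = −εk, the term Σkⱼ∂ⱼφ equals −ε⁻¹v·∇u on Ω; adding and subtracting u isolates an
increment of T_ε(u) − u and a Taylor remainder of u. -/
theorem UnfoldingData.osc_ae_eq (h : UnfoldingData Ω ε φ u U) (hΩ : Bornology.IsBounded Ω)
    (k : Fin n → ℤ) (y : E n) :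
    (ε⁻¹ • (unfoldSlice hΩ ε u (y - latt k) - unfoldSlice hΩ ε u y) +
      ∑ j, (k j : ℝ) • grad φ j : L2 Ω ℝ) =ᵐ[volume.restrict Ω] fun x =>
      ε⁻¹ * (((unfold ε u (x + -(ε • latt k)) y - u (x + -(ε • latt k))) -
        (unfold ε u x y - u x)) + (u (x + -(ε • latt k)) - u x -
          inner ℝ (-(ε • latt k)) (vec U x))) := by
  have hε := h.ε_pos.ne'
  have h0 : ∀ᵐ x ∂(volume.restrict Ω), ∀ j, ((k j : ℝ) • grad φ j : L2 Ω ℝ) x = k j * U j x := by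
    rw [ae_all_iff]
    intro j
    filter_upwards [Lp.coeFn_smul (k j : ℝ) (grad φ j), h.grad_eq j] with x h1 h2
    rw [h1, Pi.smul_apply, h2, smul_eq_mul]
  filter_upwards [Lp.coeFn_add (ε⁻¹ • (unfoldSlice hΩ ε u (y - latt k) - unfoldSlice hΩ ε u y))
      (∑ j, (k j : ℝ) • grad φ j),
    Lp.coeFn_smul ε⁻¹ (unfoldSlice hΩ ε u (y - latt k) - unfoldSlice hΩ ε u y),
    Lp.coeFn_sub (unfoldSlice hΩ ε u (y - latt k)) (unfoldSlice hΩ ε u y),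
    unfoldSlice_coe hΩ ε u y, unfoldSlice_coe hΩ ε u (y - latt k),
    Lp.coeFn_fun_finsetSum Finset.univ fun j => ((k j : ℝ) • grad φ j : L2 Ω ℝ), h0]
    with x h1 h2 h3 h4 h5 h6 h7
  rw [h1, Pi.add_apply, h2, Pi.smul_apply, h3, Pi.sub_apply, h4, h5, h6,
    Finset.sum_congr rfl fun j _ => h7 j, unfold_sub_latt h.ε_pos, inner_vec, smul_eq_mul]
  have e : ∑ i, (-(ε • latt k)) i * U i x = -(ε * ∑ j, (k j : ℝ) * U j x) := by
    rw [Finset.mul_sum, ← Finset.sum_neg_distrib]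
    refine Finset.sum_congr rfl fun j _ => ?_
    rw [PiLp.neg_apply, PiLp.smul_apply, latt_apply, smul_eq_mul]
    ring
  rw [e]
  field_simp
  ring

/-- The factor ε⁻¹ is compensated in both terms: in the increment by its inclusion in `unfoldSize`,
the size of T_ε(u) − u being O(ε), and in the Taylor remainder by ‖v‖ ≤ √n ε. -/
theorem UnfoldingData.dualLe_osc (h : UnfoldingData Ω ε φ u U)
    (hΩ : Bornology.IsBounded Ω) (hC : IsTranslateBound Ω C t) (hC0 : 0 ≤ C) (ht : √n * ε < t)
    (ht' : t ≤ 2 * √n * ε) {k : Fin n → ℤ} (hk : k ∈ vertices n) (y : E n) :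
    DualLe (ε⁻¹ • (unfoldSlice hΩ ε u (y - latt k) - unfoldSlice hΩ ε u y) +
      ∑ j, (k j : ℝ) • grad φ j : L2 Ω ℝ) ((1 + √n) * (C * dualSize Ω ε t u U y)) := by
  have hε := h.ε_pos
  have hv := norm_neg_smul_latt_lt h.ε_pos ht hk
  have ht0 : 0 < t := (norm_nonneg _).trans_lt hv
  have hΩS : Ω ⊆ Metric.thickening t Ω := Metric.self_subset_thickening ht0 Ω
  have hmem : ∀ x ∈ Ω, x + -(ε • latt k) ∈ Metric.thickening t Ω := fun x hx =>
    Metric.mem_thickening_iff.2 ⟨x, hx, by rw [dist_eq_norm]; simpa using hv⟩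
  have hU := h.sobolevOn.mono (h.thickening_subset ht')
  have hw : SqInt (Metric.thickening t Ω) fun x => unfold ε u x y - u x :=
    (unfold_memLp (hΩ.thickening (δ := t)) ε u y).sub hU.sqInt
  refine dualLe_of_integral (h.osc_ae_eq hΩ k y) fun ψ => ?_
  have hv' : ‖-(ε • latt k)‖ ≤ √n * ε := by
    rw [norm_neg, norm_smul, Real.norm_of_nonneg hε.le, mul_comm]
    exact mul_le_mul_of_nonneg_right (norm_latt_le hk) hε.le
  have h1 := hC _ _ ψ hv hw
  have h2 := hU.abs_integral_taylor_dual_le h.isOpen hC hC0 hv ψ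
  have hψ := (sobolevOn_H1 ψ).sqInt
  generalize -(ε • latt k) = v at *
  have e : ∫ x in Ω, ε⁻¹ * (((unfold ε u (x + v) y - u (x + v)) - (unfold ε u x y - u x)) +
      (u (x + v) - u x - inner ℝ v (vec U x))) * fn ψ x =
      ε⁻¹ * ((∫ x in Ω, ((unfold ε u (x + v) y - u (x + v)) - (unfold ε u x y - u x)) * fn ψ x) +
        ∫ x in Ω, (u (x + v) - u x - inner ℝ v (vec U x)) * fn ψ x) := by
    have hs1 : SqInt Ω fun x => (unfold ε u (x + v) y - u (x + v)) - (unfold ε u x y - u x) :=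
      (hw.translate hmem).sub (hw.mono hΩS)
    have hs2 : SqInt Ω fun x => u (x + v) - u x - inner ℝ v (vec U x) :=
      ((hU.sqInt.translate hmem).sub (hU.sqInt.mono hΩS)).sub ((sqInt_inner hU.vec v).mono hΩS)
    rw [← integral_add (integrable_mul_of_sqInt hs1 hψ) (integrable_mul_of_sqInt hs2 hψ),
      ← integral_const_mul]
    exact integral_congr_ae (.of_forall fun x => by ring)
  rw [e, abs_mul, abs_of_pos (inv_pos.2 hε)]
  have h3 := mul_le_mul_of_nonneg_left ((abs_add_le _ _).trans (add_le_add h1 h2)) (inv_pos.2 hε).le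
  refine h3.trans ?_
  have hS : ∀ S, ε⁻¹ * nrm S (fun x => unfold ε u x y - u x) ≤ unfoldSize ε u U S y ∧
      nrm S (vec U) ≤ unfoldSize ε u U S y := fun S => by
    have h4 := nrm_unfold_sub_le_size (ε := ε) (u := u) (U := U) S y
    have h5 := mul_nonneg (inv_pos.2 hε).le (nrm_nonneg S fun x => unfold ε u x y - u x)
    have h6 := nrm_nonneg S (vec U)
    exact ⟨by linarith, by linarith⟩
  have hp := norm_nonneg ψ
  have hst := Real.sqrt_nonneg t
  have hsn := Real.sqrt_nonneg (n : ℝ)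
  unfold dualSize
  obtain ⟨a1, a2⟩ := hS (Metric.thickening t Ω)
  obtain ⟨b1, b2⟩ := hS (Metric.thickening t (_root_.frontier Ω))
  have c1 := nrm_nonneg (Metric.thickening t Ω) (vec U)
  have c2 := nrm_nonneg (Metric.thickening t (_root_.frontier Ω)) (vec U)
  exact osc_arith hε ht0.le hst hsn hC0 hp hv' a1 a2 b1 b2 c1 c2

end

end

section

open Filter Topology
open scoped ENNReal NNReal

variable {n : ℕ}

/-! ### The corrector and the defect -/

theorem exists_bump_bound (n : ℕ) :
    ∃ M : ℝ, 0 ≤ M ∧ ∀ y : E n, |bump y| ≤ M ∧ ∀ i, |pderiv i bump y| ≤ M := by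
  obtain ⟨M₀, h0, hM₀⟩ := (isTest_bump (n := n)).exists_bound
  choose M h1 hM using fun i => ((isTest_bump (n := n)).pderiv i).exists_bound
  have hs : ∀ i, M i ≤ ∑ i, M i := fun i =>
    Finset.single_le_sum (f := M) (fun i _ => h1 i) (Finset.mem_univ i)
  have hs0 : 0 ≤ ∑ i, M i := Finset.sum_nonneg fun i _ => h1 i
  exact ⟨M₀ + ∑ i, M i, by positivity, fun y => ⟨by linarith [hM₀ y], fun i => by
    linarith [hM i y, hs i]⟩⟩

theorem norm_H1_le_sum {D : Set (E n)} {X : Type*} [NormedAddCommGroup X] [NormedSpace ℝ X]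
    (w : H1 D X) : ‖w‖ ≤ ‖fn w‖ + ∑ i, ‖grad w i‖ := by
  have h0 : 0 ≤ ∑ i, ‖grad w i‖ := Finset.sum_nonneg fun i _ => norm_nonneg _
  refine le_of_sq_le_sq ?_ (add_nonneg (norm_nonneg _) h0)
  have h1 := Finset.sum_sq_le_sq_sum_of_nonneg (s := Finset.univ) (f := fun i => ‖grad w i‖)
    fun i _ => norm_nonneg _
  rw [norm_sq_H1]
  nlinarith [mul_nonneg (norm_nonneg (fn w)) h0]

theorem norm_H1_le_mul {D : Set (E n)} {X : Type*} [NormedAddCommGroup X] [NormedSpace ℝ X]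
    {w : H1 D X} {c : ℝ} (h0 : ‖fn w‖ ≤ c) (h1 : ∀ i, ‖grad w i‖ ≤ c) : ‖w‖ ≤ (n + 1) * c := by
  refine (norm_H1_le_sum w).trans ((add_le_add h0 (Finset.sum_le_sum fun i _ => h1 i)).trans
    (le_of_eq ?_))
  rw [Finset.sum_const, Finset.card_univ, Fintype.card_fin, nsmul_eq_mul]
  ring

section

variable {Ω : Set (E n)} {ε t C M : ℝ} {φ : H1 Ω ℝ} {u : E n → ℝ} {U : Fin n → E n → ℝ}

theorem UnfoldingData.dualLe_defect (h : UnfoldingData Ω ε φ u U)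
    (hΩ : Bornology.IsBounded Ω) (hC : IsTranslateBound Ω C t) (hC0 : 0 ≤ C) (ht : √n * ε < t)
    (ht' : t ≤ 2 * √n * ε) (hM : ∀ y : E n, |bump y| ≤ M ∧ ∀ i, |pderiv i bump y| ≤ M)
    {y : E n} (hy : y ∈ cell n) (i : Fin n) :
    DualLe (unfoldSlice hΩ ε (U i) y - grad φ i -
      ∑ k ∈ vertices n, correctorGrad hΩ ε φ u U i (y - latt k))
      ((vertices n).card * (M * (2 + √n) * C) * dualSize Ω ε t u U y) := by
  rw [sum_correctorGrad hΩ hy i]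
  have h1 : DualLe (∑ k ∈ vertices n, bump (y - latt k) •
      (unfoldSlice hΩ ε (U i) y - unfoldSlice hΩ ε (U i) (y - latt k)))
      ((vertices n).card * (M * (C * dualSize Ω ε t u U y))) :=
    DualLe.sum_smul (fun k _ => (hM _).1) fun k hk => h.dualLe_slice hΩ hC hC0 ht hk y i
  have h2 : DualLe (∑ k ∈ vertices n, pderiv i bump (y - latt k) •
      (ε⁻¹ • (unfoldSlice hΩ ε u (y - latt k) - unfoldSlice hΩ ε u y) +
          ∑ j, (k j : ℝ) • grad φ j : L2 Ω ℝ))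
      ((vertices n).card * (M * ((1 + √n) * (C * dualSize Ω ε t u U y)))) :=
    DualLe.sum_smul (fun k _ => (hM _).2 i) fun k hk => h.dualLe_osc hΩ hC hC0 ht ht' hk y
  intro ψ
  refine ((h1.sub h2) ψ).trans (le_of_eq ?_)
  ring

theorem UnfoldingData.norm_oscillation_le (h : UnfoldingData Ω ε φ u U)
    (hΩ : Bornology.IsBounded Ω) (ht : √n * ε < t) (ht' : t ≤ 2 * √n * ε) {k : Fin n → ℤ}
    (hk : k ∈ vertices n) {y : E n} (hy : y ∈ cell n) :
    ‖oscillation hΩ ε φ u (y - latt k)‖ ≤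
      (1 + √n + n) * unfoldSize ε u U (Metric.thickening t Ω) y := by
  have hε := h.ε_pos
  have ht0 : 0 < t := (norm_nonneg _).trans_lt (norm_neg_smul_latt_lt hε ht hk)
  have h1 := h.norm_slice_fn_le hΩ ht ht' hk y
  have hU := h.sobolevOn.mono (h.thickening_subset ht')
  have hg : ∀ j, ‖(y - latt k) j • grad φ j‖ ≤ unfoldSize ε u U (Metric.thickening t Ω) y :=
    fun j => by
      have e1 : ‖(y - latt k) j‖ ≤ 1 := by
        rw [PiLp.sub_apply, latt_apply, Real.norm_eq_abs, abs_le]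
        rcases mem_vertices.1 hk j with h0 | h0 <;> rw [h0] <;> push_cast <;>
          constructor <;> linarith [(hy j).1, (hy j).2]
      have e2 : ‖grad φ j‖ ≤ nrm (Metric.thickening t Ω) (vec U) := by
        rw [norm_eq_nrm, nrm_congr (h.grad_eq j)]
        exact (nrm_mono (hU.sqInt_grad j) (Metric.self_subset_thickening ht0 Ω)).trans
          (nrm_grad_le hU.sqInt_grad j)
      have e3 := nrm_unfold_grad_le_size (u := u) (U := U) hε (Metric.thickening t Ω) y j
      have e4 := nrm_nonneg (Metric.thickening t Ω) fun x => unfold ε (U j) x y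
      rw [norm_smul]
      have e5 := mul_le_of_le_one_left (norm_nonneg (grad φ j)) e1
      linarith
  have h2 : ‖∑ j, (y - latt k) j • grad φ j‖ ≤
      n * unfoldSize ε u U (Metric.thickening t Ω) y :=
    (norm_sum_le _ _).trans ((Finset.sum_le_sum fun j _ => hg j).trans_eq (by simp))
  have h3 : ‖ε⁻¹ • (unfoldSlice hΩ ε u (y - latt k) - fn φ)‖ =
      ε⁻¹ * ‖unfoldSlice hΩ ε u (y - latt k) - fn φ‖ := by
    rw [norm_smul, Real.norm_of_nonneg (inv_pos.2 hε).le]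
  refine (norm_sub_le _ _).trans ?_
  rw [h3]
  linarith

theorem UnfoldingData.norm_corrector_le (h : UnfoldingData Ω ε φ u U)
    (hΩ : Bornology.IsBounded Ω) (ht : √n * ε < t) (ht' : t ≤ 2 * √n * ε)
    (hM : ∀ y : E n, |bump y| ≤ M ∧ ∀ i, |pderiv i bump y| ≤ M) (hM0 : 0 ≤ M) {k : Fin n → ℤ}
    (hk : k ∈ vertices n) {y : E n} (hy : y ∈ cell n) :
    ‖corrector hΩ ε φ u (y - latt k)‖ ≤
      M * (2 + √n + n) * unfoldSize ε u U (Metric.thickening t Ω) y ∧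
    ∀ i, ‖correctorGrad hΩ ε φ u U i (y - latt k)‖ ≤
      M * (2 + √n + n) * unfoldSize ε u U (Metric.thickening t Ω) y := by
  have h1 := h.norm_oscillation_le hΩ ht ht' hk hy
  have h0 := unfoldSize_nonneg h.ε_pos u U (Metric.thickening t Ω) y
  have hb : ∀ c : ℝ, |c| ≤ M → ‖c • oscillation hΩ ε φ u (y - latt k)‖ ≤
      M * ((1 + √n + n) * unfoldSize ε u U (Metric.thickening t Ω) y) := fun c hc => by
    rw [norm_smul, Real.norm_eq_abs]
    exact mul_le_mul hc h1 (norm_nonneg _) hM0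
  have h2 := mul_nonneg hM0 h0
  refine ⟨(hb _ (hM _).1).trans (by linarith), fun i => ?_⟩
  have h3 : ‖bump (y - latt k) • (unfoldSlice hΩ ε (U i) (y - latt k) - grad φ i)‖ ≤
      M * unfoldSize ε u U (Metric.thickening t Ω) y := by
    rw [norm_smul, Real.norm_eq_abs]
    exact mul_le_mul (hM _).1 (h.norm_slice_grad_le hΩ ht ht' hk y i) (norm_nonneg _) hM0
  exact (norm_add_le _ _).trans ((add_le_add (hb _ ((hM _).2 i)) h3).trans (le_of_eq (by ring)))

theorem norm_sum_translates_le {s : E n → ℝ} {c : ℝ} {X : Type*} [NormedAddCommGroup X]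
    {f : E n → X} {v : L2 (cell n) X}
    (hv : v =ᵐ[volume.restrict (cell n)] fun y => ∑ k ∈ vertices n, f (y - latt k))
    (hs : SqInt (cell n) s) (h0 : ∀ y, 0 ≤ s y) (hc : 0 ≤ c)
    (hf : ∀ y ∈ cell n, ∀ k ∈ vertices n, ‖f (y - latt k)‖ ≤ c * s y) :
    ‖v‖ ≤ (vertices n).card * c * nrm (cell n) s := by
  rw [norm_eq_nrm]
  refine nrm_le_of_bound (by positivity) hs ?_
  filter_upwards [hv, ae_restrict_mem isOpen_cell.measurableSet] with y h1 h2
  rw [h1, Real.norm_of_nonneg (h0 y)]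
  refine (norm_sum_le _ _).trans ((Finset.sum_le_sum (hf y h2)).trans (le_of_eq ?_))
  rw [Finset.sum_const, nsmul_eq_mul]
  ring

/-- There is a periodic function on the reference cell, of norm at most `N`, whose gradient is the sum
of the translates of `F`. -/
def HasPeriodization {X : Type*} [NormedAddCommGroup X] [NormedSpace ℝ X] (F : Fin n → E n → X)
    (N : ℝ) : Prop :=
  ∃ w : H1 (cell n) X, IsPeriodic w ∧ ‖w‖ ≤ N ∧
    ∀ i, grad w i =ᵐ[volume.restrict (cell n)] fun y => ∑ k ∈ vertices n, F i (y - latt k)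

theorem SobolevOn.hasPeriodization {X : Type*} [NormedAddCommGroup X] [NormedSpace ℝ X]
    {f : E n → X} {F : Fin n → E n → X} {s : E n → ℝ} {c : ℝ} (h : SobolevOn univ f F)
    (hf : ∀ y i, 1 ≤ |y i| → f y = 0) (hF : ∀ j y i, 1 ≤ |y i| → F j y = 0)
    (hs : SqInt (cell n) s) (h0 : ∀ y, 0 ≤ s y) (hc : 0 ≤ c)
    (hb : ∀ y ∈ cell n, ∀ k ∈ vertices n, ‖f (y - latt k)‖ ≤ c * s y ∧
      ∀ i, ‖F i (y - latt k)‖ ≤ c * s y) :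
    HasPeriodization F ((n + 1) * ((vertices n).card * c * nrm (cell n) s)) := by
  obtain ⟨w, hp, hw, hwG⟩ := h.exists_periodic hf hF
  exact ⟨w, hp, norm_H1_le_mul
    (norm_sum_translates_le hw hs h0 hc fun y hy k hk => (hb y hy k hk).1)
    fun i => norm_sum_translates_le (hwG i) hs h0 hc fun y hy k hk => (hb y hy k hk).2 i, hwG⟩

theorem UnfoldingData.hasPeriodization (h : UnfoldingData Ω ε φ u U)
    (hΩ : Bornology.IsBounded Ω) (ht : √n * ε < t) (ht' : t ≤ 2 * √n * ε)
    (hM : ∀ y : E n, |bump y| ≤ M ∧ ∀ i, |pderiv i bump y| ≤ M) (hM0 : 0 ≤ M)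
    (hsz : SqInt (cell n) (unfoldSize ε u U (Metric.thickening t Ω))) :
    HasPeriodization (correctorGrad hΩ ε φ u U)
      ((n + 1) * ((vertices n).card * (M * (2 + √n + n)) *
        nrm (cell n) (unfoldSize ε u U (Metric.thickening t Ω)))) :=
  (h.sobolevOn_corrector hΩ).hasPeriodization (fun _ _ hy => corrector_eq_zero hΩ hy)
    (fun j _ _ hy => correctorGrad_eq_zero hΩ j hy) hsz (unfoldSize_nonneg h.ε_pos u U _)
    (by positivity) fun _ hy _ hk => h.norm_corrector_le hΩ ht ht' hM hM0 hk hy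

theorem mem_thickening_of_norm_sub_le {A : Set (E n)} {s : ℝ} {x a : E n}
    (hx : x ∈ Metric.thickening t A) (ha : ‖a - x‖ ≤ s) : a ∈ Metric.thickening (t + s) A := by
  obtain ⟨z, hz, hxz⟩ := Metric.mem_thickening_iff.1 hx
  refine Metric.mem_thickening_iff.2 ⟨z, hz, ?_⟩
  have := dist_triangle a x z
  rw [dist_eq_norm a x] at this
  linarith

/-- Unfolding on a neighbourhood of width t reads values one cell diameter further, and t + √n ε ≤
3√n ε. The same holds for the layer, which produces the boundary term of the theorem. -/
theorem UnfoldingData.nrm_size_le (h : UnfoldingData Ω ε φ u U)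
    (hΩ : Bornology.IsBounded Ω) (ht' : t ≤ 2 * √n * ε) :
    (SqInt (cell n) (unfoldSize ε u U (Metric.thickening t Ω)) ∧
      nrm (cell n) (unfoldSize ε u U (Metric.thickening t Ω)) ≤
        sizeConst n * nrm (nbhd Ω ε 3) (vec U)) ∧
    SqInt (cell n) (unfoldSize ε u U (Metric.thickening t (frontier Ω))) ∧
      nrm (cell n) (unfoldSize ε u U (Metric.thickening t (frontier Ω))) ≤
        sizeConst n * nrm (bdryLayer Ω ε 3) (vec U) := by
  have hsub : t + √n * ε ≤ 3 * √n * ε := by linarith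
  have hfr : bdryLayer Ω ε 3 ⊆ nbhd Ω ε 3 := thickening_frontier_subset Ω _
  refine ⟨nrm_unfoldSize_le h.ε_pos hΩ.thickening Metric.isOpen_thickening.measurableSet
    (fun x hx a ha => ?_) h.measurable_fn h.measurable_grad h.sobolevOn,
    nrm_unfoldSize_le h.ε_pos (hΩ.thickening.subset (thickening_frontier_subset Ω t))
    Metric.isOpen_thickening.measurableSet
    (fun x hx a ha => ?_) h.measurable_fn h.measurable_grad (h.sobolevOn.mono hfr)⟩
  · rw [nbhd_three]
    exact Metric.thickening_mono hsub _ (mem_thickening_of_norm_sub_le hx ha)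
  · rw [bdryLayer_three]
    exact Metric.thickening_mono hsub _ (mem_thickening_of_norm_sub_le hx ha)

theorem UnfoldingData.nrm_dualSize_le (h : UnfoldingData Ω ε φ u U)
    (hΩ : Bornology.IsBounded Ω) (ht0 : 0 ≤ t) (ht' : t ≤ 2 * √n * ε) :
    SqInt (cell n) (dualSize Ω ε t u U) ∧
      nrm (cell n) (dualSize Ω ε t u U) ≤ sizeConst n *
        (t * nrm (nbhd Ω ε 3) (vec U) + √t * nrm (bdryLayer Ω ε 3) (vec U)) := by
  obtain ⟨⟨a1, a2⟩, b1, b2⟩ := h.nrm_size_le hΩ ht'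
  have s1 := a1.const_smul t
  have s2 := b1.const_smul √t
  refine ⟨s1.add s2, (nrm_add_le s1 s2).trans ?_⟩
  have e1 := nrm_const_smul (S := cell n) t (unfoldSize ε u U (Metric.thickening t Ω))
  have e2 := nrm_const_smul (S := cell n) √t (unfoldSize ε u U (Metric.thickening t (frontier Ω)))
  rw [abs_of_nonneg ht0] at e1
  rw [abs_of_nonneg (Real.sqrt_nonneg t)] at e2
  have c1 := mul_le_mul_of_nonneg_left a2 ht0
  have c2 := mul_le_mul_of_nonneg_left b2 (Real.sqrt_nonneg t)
  refine (add_le_add (e1.trans_le c1) (e2.trans_le c2)).trans (le_of_eq ?_)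
  ring

end

end

/-! ### From dual bounds at each y to the error estimate, and the final constants. -/

section

open Filter Topology
open scoped ENNReal NNReal

variable {n : ℕ}

theorem IsExtension.unfoldingData {Ω : Set (E n)} {ε K : ℝ} (hn : 0 < n) (hopen : IsOpen Ω)
    (hε : 0 < ε) {P : H1 Ω ℝ →L[ℝ] H1 (nbhd Ω ε 3) ℝ} (hP : IsExtension Ω ε K P) (φ : H1 Ω ℝ) :
    UnfoldingData Ω ε φ (fn (P φ)) (fun i => grad (P φ) i) := by
  have hΩ : Ω ⊆ nbhd Ω ε 3 := by
    rw [nbhd_three]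
    exact Metric.self_subset_thickening (by positivity) Ω
  refine ⟨hn, hopen, hε, sobolevOn_H1 (P φ), (Lp.stronglyMeasurable _).measurable,
    fun i => (Lp.stronglyMeasurable _).measurable, (hP.eq_on φ).symm, fun i => ?_⟩
  filter_upwards [(sobolevOn_H1 (P φ)).grad_ae_eq hopen hΩ (hP.eq_on φ)] with x hx
  exact (congrArg (fun v : E n => v i) hx).symm

theorem aestronglyMeasurable_defect {Ω : Set (E n)} (hopen : IsOpen Ω)
    (hΩ : Bornology.IsBounded Ω) (ε : ℝ) (φ : H1 Ω ℝ) {U : E n → ℝ} (hU : Measurable U)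
    (w : H1 (cell n) (L2 Ω ℝ)) (i : Fin n) :
    AEStronglyMeasurable (fun y => unfoldSlice hΩ ε U y - grad φ i - grad w i y)
      (volume.restrict (cell n)) :=
  ((stronglyMeasurable_unfoldSlice hopen hΩ ε hU).aestronglyMeasurable.sub
    aestronglyMeasurable_const).sub (Lp.aestronglyMeasurable _)

theorem UnfoldingData.dualLe_grad {Ω : Set (E n)} {ε t C M : ℝ} {φ : H1 Ω ℝ}
    {u : E n → ℝ} {U : Fin n → E n → ℝ} (h : UnfoldingData Ω ε φ u U)
    (hΩ : Bornology.IsBounded Ω) (hC : IsTranslateBound Ω C t) (hC0 : 0 ≤ C) (ht : √n * ε < t)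
    (ht' : t ≤ 2 * √n * ε) (hM : ∀ y : E n, |bump y| ≤ M ∧ ∀ i, |pderiv i bump y| ≤ M)
    {G : Fin n → E n → L2 Ω ℝ} (hG : ∀ i, G i =ᵐ[volume.restrict (cell n)] fun y =>
      ∑ k ∈ vertices n, correctorGrad hΩ ε φ u U i (y - latt k)) :
    ∀ᵐ y ∂(volume.restrict (cell n)), ∀ i,
      DualLe (unfoldSlice hΩ ε (U i) y - grad φ i - G i y)
        ((vertices n).card * (M * (2 + √n) * C) * dualSize Ω ε t u U y) := by
  filter_upwards [ae_all_iff.2 hG, ae_restrict_mem isOpen_cell.measurableSet] with y h1 h2 i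
  rw [h1 i]
  exact h.dualLe_defect hΩ hC hC0 ht ht' hM h2 i

/-- There is a periodic `w` of norm at most `N` whose gradient corrects `T_ε(U) - ∇φ` up to an error
`D` in the dual norm. -/
def HasPeriodicCorrector {Ω : Set (E n)} (hΩ : Bornology.IsBounded Ω) (ε : ℝ) (φ : H1 Ω ℝ)
    (U : Fin n → E n → ℝ) (N : ℝ) (D : E n → ℝ) : Prop :=
  ∃ w : H1 (cell n) (L2 Ω ℝ), IsPeriodic w ∧ ‖w‖ ≤ N ∧
    ∀ᵐ y ∂(volume.restrict (cell n)), ∀ i,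
      DualLe (unfoldSlice hΩ ε (U i) y - grad φ i - grad w i y) (D y)

theorem UnfoldingData.hasPeriodicCorrector {Ω : Set (E n)} {ε t C M : ℝ} {φ : H1 Ω ℝ}
    {u : E n → ℝ} {U : Fin n → E n → ℝ} (h : UnfoldingData Ω ε φ u U)
    (hΩ : Bornology.IsBounded Ω) (hC : IsTranslateBound Ω C t) (hC0 : 0 ≤ C) (ht : √n * ε < t)
    (ht' : t ≤ 2 * √n * ε) (hM : ∀ y : E n, |bump y| ≤ M ∧ ∀ i, |pderiv i bump y| ≤ M)
    (hM0 : 0 ≤ M) :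
    HasPeriodicCorrector hΩ ε φ U ((n + 1) * ((vertices n).card * (M * (2 + √n + n)) *
        (sizeConst n * nrm (nbhd Ω ε 3) (vec U))))
      fun y => (vertices n).card * (M * (2 + √n) * C) * dualSize Ω ε t u U y :=
  (h.hasPeriodization hΩ ht ht' hM hM0 (h.nrm_size_le hΩ ht').1.1).imp fun _ hw =>
    ⟨hw.1, hw.2.1.trans (mul_le_mul_of_nonneg_left (mul_le_mul_of_nonneg_left
      (h.nrm_size_le hΩ ht').1.2 (by positivity)) (by positivity)),
      h.dualLe_grad hΩ hC hC0 ht ht' hM hw.2.2⟩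

theorem memLp_toDual {Ω : Set (E n)} {g : Fin n → E n → L2 Ω ℝ} {B : E n → ℝ}
    (hg : ∀ i, AEStronglyMeasurable (g i) (volume.restrict (cell n)))
    (hB0 : ∀ y, 0 ≤ B y) (hB : MemLp B 2 (volume.restrict (cell n)))
    (hb : ∀ᵐ y ∂(volume.restrict (cell n)), ∀ i, DualLe (g i y) (B y)) :
    MemLp (fun y => (WithLp.toLp 2 fun i => toDual (g i y) :
      PiLp 2 fun _ : Fin n => StrongDual ℝ (H1 Ω ℝ))) 2 (volume.restrict (cell n)) ∧
    eLpNorm (fun y => (WithLp.toLp 2 fun i => toDual (g i y) :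
      PiLp 2 fun _ : Fin n => StrongDual ℝ (H1 Ω ℝ))) 2 (volume.restrict (cell n)) ≤
      ENNReal.ofReal n * eLpNorm B 2 (volume.restrict (cell n)) :=
  memLp_inner_comp (fnL Ω ℝ) hg hB0 hB hb

theorem eLpNorm_eq_ofReal_nrm {X : Type*} [NormedAddCommGroup X] {S : Set (E n)} {w : E n → X}
    (h : SqInt S w) : eLpNorm w 2 (volume.restrict S) = ENNReal.ofReal (nrm S w) :=
  (ENNReal.ofReal_toReal h.2.ne).symm

theorem UnfoldingData.eLpNorm_dualSize_le {Ω : Set (E n)} {ε t A : ℝ} {φ : H1 Ω ℝ} {u : E n → ℝ}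
    {U : Fin n → E n → ℝ} (h : UnfoldingData Ω ε φ u U) (hΩ : Bornology.IsBounded Ω)
    (hA : 0 ≤ A) (ht0 : 0 ≤ t) (ht' : t ≤ 2 * √n * ε) :
    MemLp (fun y => A * dualSize Ω ε t u U y) 2 (volume.restrict (cell n)) ∧
    ENNReal.ofReal n *
        eLpNorm (fun y => A * dualSize Ω ε t u U y) 2 (volume.restrict (cell n)) ≤
      ENNReal.ofReal (n * (A * (sizeConst n *
        (t * nrm (nbhd Ω ε 3) (vec U) + √t * nrm (bdryLayer Ω ε 3) (vec U))))) := by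
  obtain ⟨s1, s2⟩ := h.nrm_dualSize_le hΩ ht0 ht'
  have s3 := s1.const_smul A
  have e3 := nrm_const_smul (S := cell n) A (dualSize Ω ε t u U)
  rw [abs_of_nonneg hA] at e3
  have e4 : eLpNorm (fun y => A * dualSize Ω ε t u U y) 2 (volume.restrict (cell n)) =
      ENNReal.ofReal (A * nrm (cell n) (dualSize Ω ε t u U)) :=
    (eLpNorm_eq_ofReal_nrm s3).trans (congrArg _ e3)
  refine ⟨s3, ?_⟩
  rw [e4, ← ENNReal.ofReal_mul n.cast_nonneg]
  exact ENNReal.ofReal_le_ofReal (mul_le_mul_of_nonneg_left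
    (mul_le_mul_of_nonneg_left s2 hA) n.cast_nonneg)

/-- There is a periodic corrector of norm at most `N`, with an unfolding error at most `B`. -/
def HasCorrector {Ω : Set (E n)} (hΩ : Bornology.IsBounded Ω) (ε : ℝ) (φ : H1 Ω ℝ)
    (φ' : H1 (nbhd Ω ε 3) ℝ) (N B : ℝ) : Prop :=
  ∃ w : H1 (cell n) (L2 Ω ℝ), IsPeriodic w ∧ ‖w‖ ≤ N ∧
    MemLp (gradDefect hΩ ε φ φ' w) 2 (volume.restrict (cell n)) ∧
    eLpNorm (gradDefect hΩ ε φ φ' w) 2 (volume.restrict (cell n)) ≤ ENNReal.ofReal B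

theorem HasCorrector.mono {Ω : Set (E n)} {hΩ : Bornology.IsBounded Ω} {ε : ℝ} {φ : H1 Ω ℝ}
    {φ' : H1 (nbhd Ω ε 3) ℝ} {N B N' B' : ℝ} (h : HasCorrector hΩ ε φ φ' N B) (hN : N ≤ N')
    (hB : B ≤ B') : HasCorrector hΩ ε φ φ' N' B' :=
  h.imp fun _ h => ⟨h.1, h.2.1.trans hN, h.2.2.1, h.2.2.2.trans (ENNReal.ofReal_le_ofReal hB)⟩

theorem HasPeriodicCorrector.hasCorrector {Ω : Set (E n)} {ε t A N : ℝ} {φ : H1 Ω ℝ}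
    {φ' : H1 (nbhd Ω ε 3) ℝ} {hΩ : Bornology.IsBounded Ω}
    (h : UnfoldingData Ω ε φ (fn φ') (fun i => grad φ' i))
    (hA : 0 ≤ A) (ht0 : 0 ≤ t) (ht' : t ≤ 2 * √n * ε)
    (hw : HasPeriodicCorrector hΩ ε φ (fun i => grad φ' i) N
      fun y => A * dualSize Ω ε t (fn φ') (fun i => grad φ' i) y) :
    HasCorrector hΩ ε φ φ' N (n * (A * (sizeConst n *
      (t * nrm (nbhd Ω ε 3) (vec fun i => grad φ' i) +
        √t * nrm (bdryLayer Ω ε 3) (vec fun i => grad φ' i))))) :=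
  Exists.imp (fun w hw => And.imp_right (And.imp_right fun hw =>
    (memLp_toDual
      (fun i => aestronglyMeasurable_defect h.isOpen hΩ ε φ (h.measurable_grad i) w i)
      (fun y => mul_nonneg hA (dualSize_nonneg h.ε_pos ht0 y))
      (h.eLpNorm_dualSize_le hΩ hA ht0 ht').1 hw).imp_right
      fun k => k.trans (h.eLpNorm_dualSize_le hΩ hA ht0 ht').2) hw) hw

/-- The constant in the error estimate. -/
def errorConst (n : ℕ) (M C : ℝ) : ℝ :=
  n * ((vertices n).card * (M * (2 + √n) * C) * (sizeConst n * (3 / 2 * √n + √(3 / 2 * √n))))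

/-- The constant in the estimate of the corrector. -/
def correctorConst (n : ℕ) (M : ℝ) : ℝ :=
  (n + 1) * ((vertices n).card * (M * (2 + √n + n))) * sizeConst n

theorem error_arith {m A s τ ε a b r q : ℝ} (hm : 0 ≤ m) (hA : 0 ≤ A) (hs : 0 ≤ s) (hτ : 0 ≤ τ)
    (hε : 0 ≤ ε) (ha : 0 ≤ a) (hb : 0 ≤ b) (hr : 0 ≤ r) (hq : 0 ≤ q) :
    m * (A * (s * (τ * ε * a + r * q * b))) ≤ m * (A * (s * (τ + r))) * (ε * a + q * b) := by
  have h1 : τ * ε * a + r * q * b ≤ (τ + r) * (ε * a + q * b) := by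
    have h2 : 0 ≤ τ * (q * b) + r * (ε * a) := by positivity
    linarith
  calc m * (A * (s * (τ * ε * a + r * q * b)))
      ≤ m * (A * (s * ((τ + r) * (ε * a + q * b)))) := by gcongr
    _ = _ := by ring

/-- The width t = (3/2)√n ε exceeds the length √n ε of the largest lattice shift and stays below 2√n
ε, which leaves one cell diameter inside the prescribed neighbourhood. The dual bound t‖·‖ +
√t‖·‖_layer thereby becomes a constant times ε‖·‖ + √ε‖·‖_layer. -/
theorem hasCorrector_of_bounds {Ω : Set (E n)} {ε C M : ℝ} {φ : H1 Ω ℝ}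
    {φ' : H1 (nbhd Ω ε 3) ℝ} (h : UnfoldingData Ω ε φ (fn φ') (fun i => grad φ' i))
    (hb : Bornology.IsBounded Ω) (hC : IsTranslateBound Ω C (3 / 2 * √n * ε)) (hC0 : 0 ≤ C)
    (hM : ∀ y : E n, |bump y| ≤ M ∧ ∀ i, |pderiv i bump y| ≤ M) (hM0 : 0 ≤ M) :
    HasCorrector hb ε φ φ'
      (correctorConst n M * nrm (nbhd Ω ε 3) (vec fun i => grad φ' i))
      (errorConst n M C * (ε * nrm (nbhd Ω ε 3) (vec fun i => grad φ' i) +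
          √ε * nrm (bdryLayer Ω ε 3) (vec fun i => grad φ' i))) := by
  have hs := sizeConst_nonneg n
  have hε := h.ε_pos
  have hn := h.dim_pos
  have hsn : 0 < √(n : ℝ) := by positivity
  have hsε := mul_pos hsn hε
  have hA : 0 ≤ (vertices n).card * (M * (2 + √n) * C) := by positivity
  have ht : 3 / 2 * √n * ε ≤ 2 * √n * ε := by linarith
  have ht0 : 0 ≤ 3 / 2 * √n * ε := by positivity
  refine ((h.hasPeriodicCorrector hb hC hC0 (by linarith) ht hM hM0).hasCorrector h hA
    ht0 ht).mono (le_of_eq (by unfold correctorConst; ring)) ?_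
  rw [Real.sqrt_mul (by positivity) ε]
  exact error_arith n.cast_nonneg hA hs (by positivity) hε.le (nrm_nonneg _ _) (nrm_nonneg _ _)
    (Real.sqrt_nonneg _) (Real.sqrt_nonneg _)

theorem extension_arith {C₁ C₂ K ε q a b g : ℝ} (h1 : 0 ≤ C₁) (h2 : 0 ≤ C₂) (hε : 0 ≤ ε)
    (hq : 0 ≤ q) (hb : 0 ≤ b) (hg : 0 ≤ g) (ha : a ≤ K * g) :
    C₁ * a ≤ (C₁ * |K| + C₂ * |K| + C₂) * g ∧
      C₂ * (ε * a + q * b) ≤ (C₁ * |K| + C₂ * |K| + C₂) * ε * g +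
        (C₁ * |K| + C₂ * |K| + C₂) * q * b := by
  have ha' : a ≤ |K| * g := ha.trans (mul_le_mul_of_nonneg_right (le_abs_self K) hg)
  have hK := abs_nonneg K
  constructor
  · have : 0 ≤ (C₂ * |K| + C₂) * g := by positivity
    nlinarith [mul_le_mul_of_nonneg_left ha' h1]
  · have e1 := mul_le_mul_of_nonneg_left ha' (mul_nonneg h2 hε)
    have e2 : 0 ≤ (C₁ * |K| + C₂) * ε * g := by positivity
    have e3 : 0 ≤ (C₁ * |K| + C₂ * |K|) * q * b := by positivity
    nlinarith

theorem gradNorm_bdryLayer {Ω : Set (E n)} {ε : ℝ} (u : H1 (nbhd Ω ε 3) ℝ) :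
    gradNorm u (bdryLayer Ω ε 3) = nrm (bdryLayer Ω ε 3) (vec fun i => grad u i) := by
  have e : nbhd Ω ε 3 ∩ bdryLayer Ω ε 3 = bdryLayer Ω ε 3 :=
    inter_eq_right.2 (thickening_frontier_subset Ω _)
  rw [gradNorm_eq, e]

/-- The constant in the unfolding theorem, for extension operators with constant `K`. -/
def unfoldingConst (n : ℕ) (M C K : ℝ) : ℝ :=
  correctorConst n M * |K| + errorConst n M C * |K| + errorConst n M C

theorem IsExtension.hasCorrector {Ω : Set (E n)} {ε C M K : ℝ} (hn : 0 < n) (hopen : IsOpen Ω)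
    (hb : Bornology.IsBounded Ω) (hC : IsTranslateBound Ω C (3 / 2 * √n * ε)) (hC0 : 0 ≤ C)
    (hM : ∀ y : E n, |bump y| ≤ M ∧ ∀ i, |pderiv i bump y| ≤ M) (hM0 : 0 ≤ M)
    (hε : 0 < ε) {P : H1 Ω ℝ →L[ℝ] H1 (nbhd Ω ε 3) ℝ} (hP : IsExtension Ω ε K P) (φ : H1 Ω ℝ) :
    HasCorrector hb ε φ (P φ) (unfoldingConst n M C K * gradNorm φ Ω)
      (unfoldingConst n M C K * ε * gradNorm φ Ω +
        unfoldingConst n M C K * √ε * gradNorm (P φ) (bdryLayer Ω ε 3)) := by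
  have hs := sizeConst_nonneg n
  have h1 : 0 ≤ correctorConst n M := by unfold correctorConst; positivity
  have h2 : 0 ≤ errorConst n M C := by unfold errorConst; positivity
  have hg := hP.grad_le φ
  rw [gradNorm_self (P φ)] at hg
  have key := extension_arith h1 h2 hε.le (Real.sqrt_nonneg ε)
    (nrm_nonneg (bdryLayer Ω ε 3) (vec fun i => grad (P φ) i)) (gradNorm_nonneg φ Ω) hg
  rw [gradNorm_bdryLayer]
  exact (hasCorrector_of_bounds (hP.unfoldingData hn hopen hε φ) hb hC hC0 hM hM0).mono
    key.1 key.2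

theorem exists_hasCorrector {Ω : Set (E n)} (hn : 0 < n) (hopen : IsOpen Ω)
    (hne : Ω.Nonempty) (hb : Bornology.IsBounded Ω) (hL : HasLipschitzBoundary Ω) (K : ℝ) :
    ∃ C : ℝ, ∀ ε : ℝ, 0 < ε → ∀ P : H1 Ω ℝ →L[ℝ] H1 (nbhd Ω ε 3) ℝ, IsExtension Ω ε K P →
      ∀ φ : H1 Ω ℝ, HasCorrector hb ε φ (P φ) (C * gradNorm φ Ω)
        (C * ε * gradNorm φ Ω + C * √ε * gradNorm (P φ) (bdryLayer Ω ε 3)) :=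
  (exists_bump_bound n).elim fun M hM => (exists_translate_dual_le hopen hne hb hL).elim
    fun C hC => ⟨unfoldingConst n M C K, fun ε hε _ hP φ =>
      hP.hasCorrector hn hopen hb (hC.2 (3 / 2 * √n * ε)) hC.1 hM.2 hM.1 hε φ⟩

end

end Unfolding

end

theorem theorem2p3 (n : ℕ) (hn : 0 < n) (Ω : Set (Unfolding.E n))
    (hopen : IsOpen Ω) (hconn : IsConnected Ω) (hbdd : Bornology.IsBounded Ω)
    (hLip : Unfolding.HasLipschitzBoundary Ω) :
    (∃ K : ℝ, ∀ ε : ℝ, 0 < ε →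
      ∃ P : Unfolding.H1 Ω ℝ →L[ℝ] Unfolding.H1 (Unfolding.nbhd Ω ε 3) ℝ,
        Unfolding.IsExtension Ω ε K P) ∧
    (∀ K : ℝ, ∃ C : ℝ, ∀ ε : ℝ, 0 < ε →
      ∀ P : Unfolding.H1 Ω ℝ →L[ℝ] Unfolding.H1 (Unfolding.nbhd Ω ε 3) ℝ,
        Unfolding.IsExtension Ω ε K P →
      ∀ φ : Unfolding.H1 Ω ℝ,
      ∃ φhat : Unfolding.H1 (Unfolding.cell n) (Unfolding.L2 Ω ℝ),
        Unfolding.IsPeriodic φhat ∧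
        ‖φhat‖ ≤ C * Unfolding.gradNorm φ Ω ∧
        MemLp (Unfolding.gradDefect hbdd ε φ (P φ) φhat) 2
          (volume.restrict (Unfolding.cell n)) ∧
        eLpNorm (Unfolding.gradDefect hbdd ε φ (P φ) φhat) 2
            (volume.restrict (Unfolding.cell n)) ≤
          ENNReal.ofReal (C * ε * Unfolding.gradNorm φ Ω +
            C * Real.sqrt ε *
              Unfolding.gradNorm (P φ) (Unfolding.bdryLayer Ω ε 3))) :=
  ⟨Unfolding.exists_isExtension hn hopen hconn hbdd hLip,
    Unfolding.exists_hasCorrector hn hopen hconn.nonempty hbdd hLip⟩
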